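/- Let $K$ be a global field, that is, a number field or a finite extension of $\mathbb{F}_p(T)$ for some prime $p$; let $M_K$ be its set of primes (equivalence classes of nontrivial absolute values), and for a non-archimedean $v\in M_K$ let $\mathbb{C}_v$ be the completion of an algebraic closure of the completion $K_v$, with ring of integers $\mathcal{O}_v$ and residue field $k_v$. A rational function over $\mathbb{C}_v$, written $[x,y]\mapsto[f(x,y),g(x,y)]$ with relatively prime homogeneous $f,g\in\mathcal{O}_v[x,y]$ of the same degree, at least one coefficient of which has absolute value $1$, has good reduction if the reductions $\bar f,\bar g$ have no common zero in $k_v\times k_v$ besides $(0,0)$; it has potentially good reduction if some conjugate of it by an element of $\mathrm{PGL}(2,\mathbb{C}_v)$ has good reduction. A prime of $K$ is bad for $\phi\in K[z]$ if it is archimedean, or if it is non-archimedean and $\phi$ does not have potentially good reduction there. Let $\phi\in K[z]$ be a polynomial of degree $d\ge 2$, let $s_\infty\geq 0$ be the number of archimedean primes of $K$, and let $s\ge s_\infty$ be the number of bad primes of $\phi$ (which is finite). If $K$ is a function field, let $q$ be the size of the smallest residue field of $K$ at a prime of $K$. If $K$ is a number field, let $D=[K:\mathbb{Q}]$, and let $\sigma=7$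 if $d=2$ and $$\sigma=\frac{2\cdot 33^{(d-1)(d-2)}}{(d-1)(d-2)}\quad\text{if } d\ge 3.$$ Set $$t=\begin{cases} s-s_\infty & \text{if $K$ is a number field and } s\le\sigma D,\\ s+\dfrac{D\log d}{2\log 2} & \text{if $K$ is a number field and } s>\sigma D,\\ s & \text{if $K$ is a function field,}\end{cases}$$ $$\beta=\begin{cases} 9 & \text{if $K$ is a number field, } s\le\sigma D \text{ and } d=2,\\ \max\{11,2d\} & \text{if $K$ is a number field, } s\le\sigma D \text{ and } d\ge3,\\ 1 & \text{otherwise.}\end{cases}$$ Then $\phi$ has at most $M+1$ preperiodic points in $\mathbb{P}^1(K)$, where (the first applicable case being used, and $\beta^D=1$ for function fields) $$M=\begin{cases} q & \text{if $K$ is a function field and } s=0,\\ \beta^D & \text{if $K$ is a number field and } s=s_\infty,\\ \beta^D(d^2-2d+2)(t\log_d t+3t) & \text{if } 0<t<d,\\ \beta^D(d^2-2d+2)(t\log_d t+t\log_d\log_d t+3t) & \text{otherwise.}\end{cases}$$ In particular, for fixed $K$ and $d$ there is a constant $C$ such that every polynomial $\phi\in K[z]$ of degree $d$ with $s\ge 2$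 bad primes has at most $C\,s\log s$ preperiodic points in $\mathbb{P}^1(K)$. -/

import Mathlib

open Polynomial

noncomputable section

/-- A global field: a number field, or a finite extension of `𝔽_p(T)` for some prime `p`. -/
def IsGlobalField (K : Type*) [Field K] : Prop :=
  NumberField K ∨
    ∃ (p : ℕ) (_ : Fact p.Prime) (_ : Algebra (RatFunc (ZMod p)) K),
      FunctionField (ZMod p) K

/-! ### Non-archimedean absolute values and the fields `ℂ_v` -/

/-- A nontrivial non-archimedean absolute value on `K`. -/
structure NonarchAbs (K : Type*) [Field K] where
  abs : AbsoluteValue K ℝ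
  nontrivial : abs.IsNontrivial
  nonarch : IsNonarchimedean abs

namespace NonarchAbs

variable {K : Type*} [Field K] (v : NonarchAbs K)

instance : IsUltrametricDist (WithAbs v.abs) :=
  IsUltrametricDist.isUltrametricDist_of_forall_norm_add_le_max_norm
    fun x y => v.nonarch x.ofAbs y.ofAbs

/-- The completion `K_v`. -/
abbrev Kv : Type _ := v.abs.Completion

instance : IsUltrametricDist v.Kv :=
  IsUltrametricDist.of_normedAlgebra (WithAbs v.abs)

instance : NontriviallyNormedField v.Kv :=
  NontriviallyNormedField.ofNormNeOne (by
    obtain ⟨x, hx0, hx1⟩ := v.nontrivial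
    refine ⟨((WithAbs.toAbs v.abs x : WithAbs v.abs) : v.Kv), ?_, ?_⟩
    · rw [← norm_ne_zero_iff, UniformSpace.Completion.norm_coe]
      exact v.abs.ne_zero hx0
    · rw [UniformSpace.Completion.norm_coe]
      exact hx1)

/-- An algebraic closure of `K_v`, with the unique extension of the absolute value. -/
abbrev KvBar : Type _ := AlgebraicClosure v.Kv

instance : NormedField v.KvBar := spectralNorm.normedField v.Kv v.KvBar

instance : IsUltrametricDist v.KvBar :=
  IsUltrametricDist.isUltrametricDist_of_forall_norm_add_le_max_norm
    (isNonarchimedean_spectralNorm (K := v.Kv) (L := v.KvBar))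

/-- `ℂ_v`, the completion of an algebraic closure of `K_v`. -/
abbrev Cv : Type _ := UniformSpace.Completion v.KvBar

instance : IsUltrametricDist v.Cv :=
  IsUltrametricDist.of_normedAlgebra v.KvBar

/-- The embedding `K → ℂ_v`. -/
def toCv : K →+* v.Cv :=
  (algebraMap v.KvBar v.Cv).comp
    ((algebraMap v.Kv v.KvBar).comp
      ((algebraMap (WithAbs v.abs) v.Kv).comp (WithAbs.equiv v.abs).symm.toRingHom))

/-- The number of elements of the residue field of `K` at `v`. -/
def residueCard : ℕ :=
  Nat.card (IsLocalRing.ResidueField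
    (NormedField.valuation (K := WithAbs v.abs)).valuationSubring)

end NonarchAbs

/-! ### Good and potentially good reduction -/

section Reduction

variable {C : Type*} [NormedField C]

/-- A rational map `[x, y] ↦ [f(x, y), g(x, y)]` is presented by a pair of binary forms of the
same degree without common factor. The polynomial map of `φ = ∑ aᵢ zⁱ`, of degree `d`, is presented
by `f = ∑ aᵢ xⁱ y^(d-i)` and `g = y^d`. -/
def homogeneousPresentation (φ : C[X]) : Fin 2 → MvPolynomial (Fin 2) C :=
  ![∑ i ∈ Finset.range (φ.natDegree + 1),
      MvPolynomial.C (φ.coeff i) * MvPolynomial.X 0 ^ i * MvPolynomial.X 1 ^ (φ.natDegree - i),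
    MvPolynomial.X 1 ^ φ.natDegree]

/-- The presentation of `h⁻¹ ∘ F ∘ h`, where `h` is the linear fractional transformation with
matrix `A`. -/
def conjPresentation (A : GL (Fin 2) C) (F : Fin 2 → MvPolynomial (Fin 2) C) :
    Fin 2 → MvPolynomial (Fin 2) C :=
  fun i => ∑ j, MvPolynomial.C ((A⁻¹ : GL (Fin 2) C) i j) *
    MvPolynomial.aeval (fun k => ∑ l, MvPolynomial.C (A k l) * MvPolynomial.X l) (F j)

/-- Good reduction of the rational map presented by `F`: some multiple `G` of `F` by a nonzero
scalar has coefficients in the ring of integers `𝒪`, at least one of them of absolute value `1`,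
and the reductions of the two forms of `G` have no common zero over the residue field but
`(0, 0)`. -/
def GoodReduction [IsUltrametricDist C] (F : Fin 2 → MvPolynomial (Fin 2) C) : Prop :=
  ∃ c : C, c ≠ 0 ∧
    ∃ G : Fin 2 → MvPolynomial (Fin 2) (NormedField.valuation (K := C)).valuationSubring,
      (∀ i, (G i).map (algebraMap _ C) = MvPolynomial.C c * F i) ∧
      (∃ i m, ‖algebraMap _ C ((G i).coeff m)‖ = 1) ∧
      ∀ z : Fin 2 → IsLocalRing.ResidueField (NormedField.valuation (K := C)).valuationSubring,
        (∀ i, MvPolynomial.eval z ((G i).map (IsLocalRing.residue _)) = 0) → z = 0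

/-- Potentially good reduction of a polynomial: some conjugate under `PGL(2, C)` has good
reduction. -/
def PotentiallyGoodReduction [IsUltrametricDist C] (φ : C[X]) : Prop :=
  ∃ A : GL (Fin 2) C, GoodReduction (conjPresentation A (homogeneousPresentation φ))

end Reduction

/-! ### Primes of a global field, bad primes, preperiodic points -/

section Global

variable {K : Type*} [Field K]

/-- The set `M_K` of standard absolute values (primes) of the global field `K`: one for each
class of equivalent nontrivial absolute values. The archimedean ones are normalized by `|n| = n`
for natural numbers `n`, the non-archimedean ones by `|π| = 1 / #k` for a uniformizer `π`, where
`k` is the residue field. -/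
def standardAbs (K : Type*) [Field K] : Set (AbsoluteValue K ℝ) :=
  {v | (∀ n : ℕ, v n = n) ∨
    ∃ w : NonarchAbs K, w.abs = v ∧
      IsGreatest {r : ℝ | ∃ x : K, v x = r ∧ r < 1} (1 / (w.residueCard : ℝ))}

/-- The archimedean primes of `K`. -/
def archPrimes (K : Type*) [Field K] : Set (AbsoluteValue K ℝ) :=
  {v ∈ standardAbs K | ¬ IsNonarchimedean v}

/-- The primes of `K` at which `φ` has bad, that is, not potentially good, reduction.
Every archimedean prime is bad. -/
def badPrimes (φ : K[X]) : Set (AbsoluteValue K ℝ) :=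
  {v ∈ standardAbs K |
    ¬ ∃ w : NonarchAbs K, w.abs = v ∧ PotentiallyGoodReduction (φ.map w.toCv)}

/-- The size of the smallest residue field of a prime of `K` (for a function field `K`). -/
def minResidueCard (K : Type*) [Field K] : ℕ :=
  sInf {q : ℕ | ∃ w : NonarchAbs K, w.abs ∈ standardAbs K ∧ w.residueCard = q}

/-- The map of `ℙ¹(K) = K ∪ {∞}` to itself given by a nonconstant polynomial. -/
def polyMap (φ : K[X]) : OnePoint K → OnePoint K :=
  OnePoint.map fun x => φ.eval x

/-- The `K`-rational preperiodic points of `φ` in `ℙ¹(K)`. -/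
def preperiodicPts (φ : K[X]) : Set (OnePoint K) :=
  {x | ∃ m : ℕ, (polyMap φ)^[m] x ∈ Function.periodicPts (polyMap φ)}

/-! ### The bound -/

open Classical in
/-- `[K : ℚ]` for a number field `K` (and `0` for a function field). -/
def degQ (K : Type*) [Field K] : ℕ :=
  if _h : NumberField K then Module.finrank ℚ K else 0

/-- The constant `σ`. -/
def sigmaConst (d : ℕ) : ℝ :=
  if d = 2 then 7
  else 2 * 33 ^ ((d - 1) * (d - 2)) / (((d : ℝ) - 1) * ((d : ℝ) - 2))

open Classical in
/-- The parameter `t`, for polynomials of degree `d` with `s` bad primes. -/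
def tParam (K : Type*) [Field K] (d s : ℕ) : ℝ :=
  if NumberField K then
    if (s : ℝ) ≤ sigmaConst d * degQ K then (s : ℝ) - (archPrimes K).ncard
    else s + degQ K * Real.log d / (2 * Real.log 2)
  else s

open Classical in
/-- The parameter `β`. -/
def betaParam (K : Type*) [Field K] (d s : ℕ) : ℝ :=
  if NumberField K ∧ (s : ℝ) ≤ sigmaConst d * degQ K then
    if d = 2 then 9 else max 11 (2 * d)
  else 1

open Classical in
/-- The bound `M` on the number of finite preperiodic points. -/
def boundM (K : Type*) [Field K] (d s : ℕ) : ℝ :=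
  let t := tParam K d s
  let β := betaParam K d s
  if ¬ NumberField K ∧ s = 0 then minResidueCard K
  else if NumberField K ∧ s = (archPrimes K).ncard then β ^ degQ K
  else if 0 < t ∧ t < d then
    β ^ degQ K * ((d : ℝ) ^ 2 - 2 * d + 2) * (t * Real.logb d t + 3 * t)
  else
    β ^ degQ K * ((d : ℝ) ^ 2 - 2 * d + 2) *
      (t * Real.logb d t + t * Real.logb d (Real.logb d t) + 3 * t)

end Global

end

/-! Apart from infinity, the preperiodic points are the points of `K` with finite forward orbit.
Given N of them, the product of their differences is a nonzero element of `K`, so its absolute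
values multiply to 1 over all places. The same holds for the leading coefficient, so at each place
the distances may be rescaled to those of a monic conjugate of φ. At a place of potentially good
reduction the rescaled distances are at most 1 (`norm_sub_pow_mul_le_one`), hence the logarithms
summed over the bad places are nonnegative (`ProductFormula.sum_normPairLog_nonneg`). Upper bounds
at the bad places contradict this once N is large.

The product of the mutual distances is a Vandermonde determinant, and its columns may be replaced by
values of monic polynomials of degrees 0, …, N - 1. Small polynomials come from iterates: ψ^k - c₀
has degree d^k, yet on the filled Julia set it is bounded by a diameter δ. Writing n in base d
yields a monic polynomial of degree n bounded by δ to the digit sum of n, and the digit sums of 0,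
…, N - 1 add up to at most (d - 1)/2 · N log_d N (`two_mul_sum_mixedDigitSum_le`). At a bad place
whose filled Julia set is large, that set moreover splits into two parts, containing m and d - m of
the preimages of every relevant point, at distance at least r from each other. On one part, deleting
the roots that belong to the other one gains a term (d - m)/m · N (N - m) log r, quadratic in N
(`Splitting.pairLog_le`).

The splitting is used only at the place where log r is largest. All other bad places are compared
with it, which gives N ≤ m + κ t log_d N with t roughly the number of bad places. Solving this
bounds each part, and the two values of κ add up to at most d² - 2d + 2 (`ncard_le_of_placeSplit`).

Archimedean places cost extra: Hadamard's inequality contributes N log N, and the parts are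
separated by less than the diameter. If s > σD, counting primes produces a bad place with a large
residue field, hence a large radius; the dominant place then splits, and the archimedean loss is
absorbed into t (`ProductFormula.ncard_finiteOrbitPts_le_of_large`). If s ≤ σD, the points are
divided into β^D classes of small diameter at every archimedean place, so that only the
non-archimedean bad places matter within a class (`ProductFormula.exists_coloring`,
`ProductFormula.ncard_finiteOrbitPts_le`). Without non-archimedean bad places such a class has at
most one point. Over a function field with s = 0, all differences have the same size at each place,
and the points inject into the smallest residue field.

The product formula itself comes from the known one for number fields, and from counting zeros and
poles of an element with separable extension for function fields. -/

open Polynomial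

noncomputable section

/-! ### Mixed radix digit sums -/

/-- The digit sum of `n` in the mixed radix system with radices `m, d, d, d, …`. -/
def mixedDigitSum (d m n : ℕ) : ℕ := n % m + (Nat.digits d (n / m)).sum

/-- Concavity of the logarithm: on [1, d] its graph lies above the chord from (1, 0) to (d, log d).
Bernoulli's inequality with exponent (a - 1)/(d - 1) is the exponentiated form. -/
theorem sub_one_mul_log_le {a d : ℝ} (ha : 1 ≤ a) (had : a ≤ d) (hd : 1 < d) :
    (a - 1) * Real.log d ≤ (d - 1) * Real.log a := by
  have h2 := rpow_one_add_le_one_add_mul_self (s := d - 1) (by linarith)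
    (p := (a - 1) / (d - 1)) (by apply div_nonneg <;> linarith)
    (by rw [div_le_one] <;> linarith)
  have h3 : 1 + (a - 1) / (d - 1) * (d - 1) = a := by
    rw [div_mul_cancel₀] <;> linarith
  rw [h3, show 1 + (d - 1) = d by ring] at h2
  have h4 := Real.log_le_log (Real.rpow_pos_of_pos (by linarith) _) h2
  rw [Real.log_rpow (by linarith)] at h4
  have h5 : (0 : ℝ) < d - 1 := by linarith
  calc (a - 1) * Real.log d = (d - 1) * ((a - 1) / (d - 1) * Real.log d) := by field_simp
    _ ≤ _ := by gcongr

/-- Interpolation between `x = 0` and `x = 1` for the concave function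
`(a + x) log (a + x) - x log x`. -/
theorem interpolate_mul_log {a x : ℝ} (ha : 0 < a) (hx : 0 < x) (hx1 : x ≤ 1) :
    (1 - x) * (a * Real.log a) + x * ((a + 1) * Real.log (a + 1)) ≤
      (a + x) * Real.log (a + x) - x * Real.log x := by
  -- The inequality log y ≥ 1 - 1/y at three ratios. With weights x, (1 - x)a and xa the logarithms
  -- add up to the difference of the two sides, and the rational parts to a x (1 - x)/(a + x).
  have e1 := Real.one_sub_inv_le_log_of_pos (x := (a + x) / (x * (a + 1))) (by positivity)
  have e2 := Real.one_sub_inv_le_log_of_pos (x := (a + x) / a) (by positivity)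
  have e3 := Real.one_sub_inv_le_log_of_pos (x := (a + x) / (a + 1)) (by positivity)
  rw [Real.log_div (by positivity) (by positivity)] at e1 e2 e3
  rw [Real.log_mul (by positivity) (by positivity)] at e1
  rw [inv_div] at e1 e2 e3
  have f1 := mul_le_mul_of_nonneg_left e1 hx.le
  have f2 := mul_le_mul_of_nonneg_left e2 (mul_nonneg (sub_nonneg.2 hx1) ha.le)
  have f3 := mul_le_mul_of_nonneg_left e3 (mul_nonneg hx.le ha.le)
  have key : 0 ≤ x * (1 - x * (a + 1) / (a + x)) + (1 - x) * a * (1 - a / (a + x)) +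
      x * a * (1 - (a + 1) / (a + x)) := by
    have : x * (1 - x * (a + 1) / (a + x)) + (1 - x) * a * (1 - a / (a + x)) +
      x * a * (1 - (a + 1) / (a + x)) = a * x * (1 - x) / (a + x) := by
      field_simp
      ring
    rw [this]
    have := sub_nonneg.2 hx1
    positivity
  nlinarith

/-- No carry occurs when i times the place value m d^j is added to a number below that place value:
the digit i is merely prepended. -/
theorem mixedDigitSum_block {d m j i n : ℕ} (hd : 2 ≤ d) (hm : 0 < m) (hi : i < d)
    (hn : n < m * d ^ j) :
    mixedDigitSum d m (i * (m * d ^ j) + n) = i + mixedDigitSum d m n := by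
  have hdig : ∀ j q : ℕ, q < d ^ j →
      (Nat.digits d (i * d ^ j + q)).sum = i + (Nat.digits d q).sum := by
    intro j
    induction j with
    | zero =>
      intro q hq
      obtain rfl : q = 0 := by simpa using hq
      rcases Nat.eq_zero_or_pos i with rfl | h0
      · simp
      · simp [Nat.digits_of_lt d i h0.ne' hi]
    | succ j ih =>
      intro q hq
      have hq' : q / d < d ^ j := Nat.div_lt_of_lt_mul (by rwa [pow_succ'] at hq)
      have h1 : ∀ q : ℕ, (Nat.digits d q).sum = q % d + (Nat.digits d (q / d)).sum := by
        intro q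
        rcases Nat.eq_zero_or_pos q with rfl | h0
        · simp
        · rw [Nat.digits_eq_cons_digits_div (by omega) h0.ne', List.sum_cons]
      have h2 : i * d ^ (j + 1) + q = q + d * (i * d ^ j) := by ring
      rw [h1, h1 q, h2, Nat.add_mul_mod_self_left, Nat.add_mul_div_left _ _ (by omega),
        add_comm (q / d), ih _ hq']
      ring
  have h1 : i * (m * d ^ j) + n = n + m * (i * d ^ j) := by ring
  have h2 : n / m < d ^ j := Nat.div_lt_of_lt_mul hn
  rw [mixedDigitSum, mixedDigitSum, h1, Nat.add_mul_mod_self_left, Nat.add_mul_div_left _ _ hm,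
    add_comm (n / m), hdig _ _ h2]
  ring

/-- The range consists of a full blocks and a partial one. The leading digit is constant on each
block, which yields 0 + 1 + ⋯ + (a - 1) block lengths and a further a for each of the last n
numbers. -/
theorem sum_mixedDigitSum_block {d m j : ℕ} (hd : 2 ≤ d) (hm : 0 < m) (a : ℕ) (ha : a < d)
    (n : ℕ) (hn : n ≤ m * d ^ j) :
    2 * ∑ k ∈ Finset.range (a * (m * d ^ j) + n), (mixedDigitSum d m k : ℝ) =
      a * (2 * ∑ k ∈ Finset.range (m * d ^ j), (mixedDigitSum d m k : ℝ)) +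
        a * (a - 1) * (m * d ^ j) + 2 * a * n +
        2 * ∑ k ∈ Finset.range n, (mixedDigitSum d m k : ℝ) := by
  have h1 : ∀ a < d, ∀ n ≤ m * d ^ j, 
      ∑ k ∈ Finset.range (a * (m * d ^ j) + n), (mixedDigitSum d m k : ℝ) =
      ∑ k ∈ Finset.range (a * (m * d ^ j)), (mixedDigitSum d m k : ℝ) + (a * n +
        ∑ k ∈ Finset.range n, (mixedDigitSum d m k : ℝ)) := by
    intro a ha n hn
    rw [Finset.sum_range_add]
    congr 1
    rw [Finset.sum_congr rfl fun k hk => by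
      rw [mixedDigitSum_block hd hm ha ((Finset.mem_range.1 hk).trans_le hn)]]
    push_cast
    rw [Finset.sum_add_distrib]
    simp [mul_comm]
  have h2 : ∀ a < d, 2 * ∑ k ∈ Finset.range (a * (m * d ^ j)), (mixedDigitSum d m k : ℝ) =
      a * (2 * ∑ k ∈ Finset.range (m * d ^ j), (mixedDigitSum d m k : ℝ)) +
        a * (a - 1) * (m * d ^ j) := by
    intro a
    induction a with
    | zero => simp
    | succ a ih =>
      intro ha
      rw [show (a + 1) * (m * d ^ j) = a * (m * d ^ j) + m * d ^ j by ring,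
        h1 a (by omega) _ le_rfl, mul_add, ih (by omega)]
      push_cast
      ring
  rw [h1 a ha n hn, mul_add, h2 a ha]
  ring

theorem mixedDigitSum_of_lt {d m n : ℕ} (hn : n < m) : mixedDigitSum d m n = n := by
  simp [mixedDigitSum, Nat.mod_eq_of_lt hn, Nat.div_eq_of_lt hn]

theorem two_mul_sum_range_cast (N : ℕ) :
    2 * ∑ k ∈ Finset.range N, (k : ℝ) = N * (N - 1) := by
  induction N with
  | zero => simp
  | succ n ih => rw [Finset.sum_range_succ, mul_add, ih]; push_cast; ring

/-- Over a full block the digits are uniformly distributed, with average (m - 1)/2 for the lowest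
and (d - 1)/2 for each of the other j. -/
theorem sum_mixedDigitSum_full {d m : ℕ} (hd : 2 ≤ d) (hm : 0 < m) (j : ℕ) :
    2 * ∑ k ∈ Finset.range (m * d ^ j), (mixedDigitSum d m k : ℝ) =
      m * d ^ j * ((m - 1) + j * (d - 1)) := by
  induction j with
  | zero =>
    rw [pow_zero, mul_one, Finset.sum_congr rfl fun k hk => by
      rw [mixedDigitSum_of_lt (Finset.mem_range.1 hk)], two_mul_sum_range_cast]
    simp
  | succ j ih =>
    obtain ⟨e, rfl⟩ : ∃ e, d = e + 1 := ⟨d - 1, by omega⟩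
    have := sum_mixedDigitSum_block hd hm e (by omega) (m * (e + 1) ^ j) le_rfl
    rw [show e * (m * (e + 1) ^ j) + m * (e + 1) ^ j = m * (e + 1) ^ (j + 1) by ring] at this
    rw [this, ih]
    push_cast
    ring

/-- Induction on the number of digits. For N = aB + n and x = n/B the multiples of log B are handled
by the chord inequality for m. What remains compares a(a - 1) + 2ax, linear in x, with the concave
function (a + x) log (a + x) - x log x; by interpolation only the endpoints x = 0 and x = 1 matter,
and there it is the chord inequality for a and a + 1. -/
theorem two_mul_sum_mixedDigitSum_le_aux {d m : ℕ} (hd : 2 ≤ d) (hm : 0 < m) (hmd : m ≤ d)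
    (j : ℕ) : ∀ N ≤ m * d ^ j,
    (2 * ∑ k ∈ Finset.range N, (mixedDigitSum d m k : ℝ)) * Real.log d ≤
      (d - 1) * (N * Real.log N) := by
  have hd1 : (1 : ℝ) < d := by exact_mod_cast hd
  induction j with
  | zero =>
    intro N hN
    rw [pow_zero, mul_one] at hN
    rw [Finset.sum_congr rfl fun k hk => by
      rw [mixedDigitSum_of_lt ((Finset.mem_range.1 hk).trans_le hN)], two_mul_sum_range_cast]
    rcases Nat.eq_zero_or_pos N with rfl | h0
    · simp
    have := sub_one_mul_log_le (a := N) (d := d) (by exact_mod_cast h0)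
      (by exact_mod_cast hN.trans hmd) hd1
    have h3 := mul_le_mul_of_nonneg_left this (Nat.cast_nonneg (α := ℝ) N)
    linarith
  | succ j ih =>
    intro N hN
    rcases Nat.eq_zero_or_pos N with rfl | h0
    · simp
    set B := m * d ^ j with hB
    have hBpos : 0 < B := by positivity
    -- The last block is taken nonempty, 0 < n ≤ B, so that x = n/B is positive and log x makes
    -- sense.
    obtain ⟨a, n, ha, hn0, hn, rfl⟩ : ∃ a n, a < d ∧ 0 < n ∧ n ≤ B ∧ N = a * B + n := by
      have hlt : (N - 1) % B < B := Nat.mod_lt _ hBpos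
      refine ⟨(N - 1) / B, (N - 1) % B + 1, ?_, by omega, by omega, ?_⟩
      · rw [Nat.div_lt_iff_lt_mul hBpos]
        have : d * B = m * d ^ (j + 1) := by rw [hB]; ring
        omega
      · have := Nat.div_add_mod' (N - 1) B
        omega
    have hih := ih n hn
    rw [hB, sum_mixedDigitSum_block hd hm a ha n hn, sum_mixedDigitSum_full hd hm j]
    rcases Nat.eq_zero_or_pos a with rfl | ha0
    · simpa using hih
    have hBr : ((B : ℕ) : ℝ) = m * d ^ j := by rw [hB]; push_cast; ring
    have hBp : (0 : ℝ) < B := by exact_mod_cast hBpos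
    have hlogB : Real.log B = Real.log m + j * Real.log d := by
      rw [hBr, Real.log_mul (by positivity) (by positivity), Real.log_pow]
    have hlm := sub_one_mul_log_le (a := m) (d := d) (by exact_mod_cast hm)
      (by exact_mod_cast hmd) hd1
    set x : ℝ := n / B with hx
    have hxp : 0 < x := by positivity
    have hx1 : x ≤ 1 := by rw [hx, div_le_one hBp]; exact_mod_cast hn
    have hnx : (n : ℝ) = x * B := by rw [hx]; field_simp
    have ha0r : (0 : ℝ) < a := by exact_mod_cast ha0
    have hint := interpolate_mul_log ha0r hxp hx1
    have hl1 := sub_one_mul_log_le (a := a) (d := d) (by exact_mod_cast ha0)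
      (by exact_mod_cast ha.le) hd1
    have hl2 := sub_one_mul_log_le (a := a + 1) (d := d) (by linarith)
      (by exact_mod_cast ha) hd1
    rw [← hB]
    push_cast
    rw [← hBr]
    have hlogN : Real.log (a * B + n) = Real.log (a + x) + Real.log B := by
      rw [hnx, ← add_mul, Real.log_mul (by positivity) (by positivity)]
    have hlogn : Real.log n = Real.log x + Real.log B := by
      rw [hnx, Real.log_mul (by positivity) (by positivity)]
    rw [hlogN]
    rw [hlogn] at hih
    set G := 2 * ∑ k ∈ Finset.range n, (mixedDigitSum d m k : ℝ)
    set lB := Real.log B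
    have k1 : ((m - 1) + j * (d - 1)) * Real.log d ≤ (d - 1) * lB := by rw [hlogB]; linarith
    have k2 : (a * (a - 1) + 2 * a * x) * Real.log d ≤
        (d - 1) * ((a + x) * Real.log (a + x) - x * Real.log x) := by
      have hd0 : (0 : ℝ) < d - 1 := by linarith
      have c1 := mul_le_mul_of_nonneg_left hint hd0.le
      have c2 := mul_le_mul_of_nonneg_left hl1 (mul_nonneg (sub_nonneg.2 hx1) ha0r.le)
      have c3 := mul_le_mul_of_nonneg_left hl2 (mul_nonneg hxp.le (by linarith : (0:ℝ) ≤ a + 1))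
      linarith
    have k3 := mul_le_mul_of_nonneg_left k1 (mul_nonneg ha0r.le hBp.le)
    have k4 := mul_le_mul_of_nonneg_left k2 hBp.le
    rw [hnx] at hih ⊢
    nlinarith

/-- The sum of the mixed radix digit sums of `0, …, N - 1`. -/
theorem two_mul_sum_mixedDigitSum_le {d m : ℕ} (hd : 2 ≤ d) (hm : 0 < m) (hmd : m ≤ d) (N : ℕ) :
    2 * ∑ k ∈ Finset.range N, (mixedDigitSum d m k : ℝ) ≤ (d - 1) * (N * Real.logb d N) := by
  have hlog : 0 < Real.log d := Real.log_pos (by exact_mod_cast hd)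
  have h := two_mul_sum_mixedDigitSum_le_aux hd hm hmd N N
    ((Nat.lt_pow_self hd).le.trans (Nat.le_mul_of_pos_left _ hm))
  rw [Real.logb, ← mul_div_assoc, ← mul_div_assoc, le_div_iff₀ hlog]
  exact h

theorem two_mul_sum_mod_le {m : ℕ} (hm : 0 < m) (N : ℕ) :
    2 * ∑ k ∈ Finset.range N, ((k % m : ℕ) : ℝ) ≤ N * (m - 1) := by
  have hfull : ∀ Q : ℕ, 2 * ∑ k ∈ Finset.range (m * Q), ((k % m : ℕ) : ℝ) =
      m * Q * (m - 1) := by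
    intro Q
    induction Q with
    | zero => simp
    | succ Q ih =>
      rw [Nat.mul_succ, Finset.sum_range_add, mul_add, ih]
      rw [Finset.sum_congr rfl fun k hk => by
        rw [Nat.mul_add_mod, Nat.mod_eq_of_lt (Finset.mem_range.1 hk)], two_mul_sum_range_cast]
      push_cast
      ring
  have hN := Nat.div_add_mod N m
  have hlt := Nat.mod_lt N hm
  set Q := N / m
  set R := N % m
  rw [← hN, Finset.sum_range_add, mul_add, hfull]
  rw [Finset.sum_congr rfl fun k hk => by
        rw [Nat.mul_add_mod, Nat.mod_eq_of_lt ((Finset.mem_range.1 hk).trans hlt)],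
    two_mul_sum_range_cast]
  push_cast
  have h1 : (R : ℝ) * (R - 1) ≤ R * (m - 1) := by
    have : (R : ℝ) ≤ m := by exact_mod_cast hlt.le
    gcongr
  linarith

/-! ### Solving the inequality `N ≤ m + κ t log_d N` -/

/-- The coefficient `m (d - 1) / (d - m)`. -/
def kappa (d m : ℕ) : ℝ := m * (d - 1) / (d - m)

theorem kappa_pos {d m : ℕ} (hm : 0 < m) (hmd : m < d) : 0 < kappa d m := by
  have h1 : (0 : ℝ) < m := by exact_mod_cast hm
  have h2 : (m : ℝ) + 1 ≤ d := by exact_mod_cast hmd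
  have h3 : (0 : ℝ) < d - m := by linarith
  have h4 : (0 : ℝ) < d - 1 := by linarith
  unfold kappa
  positivity

/-- Cleared of denominators, the difference of the two sides is d² (m - 1)(d - m - 1). Equality
holds for the most uneven splittings m = 1 and m = d - 1. -/
theorem kappa_add_kappa_le {d m : ℕ} (hm : 0 < m) (hmd : m < d) :
    kappa d m + kappa d (d - m) ≤ (d : ℝ) ^ 2 - 2 * d + 2 := by
  have h1 : (1 : ℝ) ≤ m := by exact_mod_cast hm
  have h2 : (m : ℝ) + 1 ≤ d := by exact_mod_cast hmd
  have h3 : (0 : ℝ) < d - m := by linarith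
  have h5 : (0 : ℝ) < m := by linarith
  unfold kappa
  rw [Nat.cast_sub hmd.le, show (d : ℝ) - (d - m) = m by ring, div_add_div _ _ h3.ne' h5.ne',
    div_le_iff₀ (by positivity)]
  have h6 : 0 ≤ (m - 1 : ℝ) * (d - m - 1) := mul_nonneg (by linarith) (by linarith)
  nlinarith [mul_nonneg h6 (by positivity : (0 : ℝ) ≤ (d : ℝ) ^ 2)]

/-- The additive term m is absorbed into the logarithm. With j = d - m, division by κ turns m into
j/(d - 1) ≤ log_d (1 + j), and it remains to see that (1 + j) κ^t ≤ c^t. Since κ j ≤ (d - 1)², this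
follows from 1 + j ≤ 2j for t = 1 and from 1 + j ≤ (3j/2)² for t ≥ 2, which explains the two values
of c. -/
theorem le_mul_logb_of_le {d m N : ℕ} {t c : ℝ} (hm : 0 < m) (hmd : m < d) (hN0 : 0 < N)
    (htc : t = 1 ∧ c = 2 * ((d : ℝ) - 1) ^ 2 ∨ 2 ≤ t ∧ c = 3 / 2 * ((d : ℝ) - 1) ^ 2)
    (hN : (N : ℝ) ≤ m + kappa d m * t * Real.logb d N) :
    N / kappa d m ≤ t * Real.logb d (c * (N / kappa d m)) := by
  have h1 : (1 : ℝ) ≤ m := by exact_mod_cast hm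
  have h2 : (m : ℝ) + 1 ≤ d := by exact_mod_cast hmd
  have hNr : (0 : ℝ) < N := by exact_mod_cast hN0
  have hk := kappa_pos hm hmd
  set j : ℝ := d - m with hj
  have hj1 : 1 ≤ j := by linarith
  have hd1 : (0 : ℝ) < d - 1 := by linarith
  have hld : 0 < Real.log d := Real.log_pos (by linarith)
  have hkj : kappa d m = (d - j) * (d - 1) / j := by rw [kappa, hj]; ring
  have hmk : m / kappa d m = j / (d - 1) := by
    rw [kappa, ← hj]
    have : j ≠ 0 := by positivity
    have : (m : ℝ) ≠ 0 := by positivity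
    field_simp
  have hb : j / (d - 1) ≤ Real.logb d (1 + j) := by
    have := sub_one_mul_log_le (a := 1 + j) (d := d) (by linarith) (by linarith) (by linarith)
    rw [Real.logb, div_le_div_iff₀ hd1 hld]
    linarith
  have hc0 : 0 < c := by rcases htc with ⟨_, rfl⟩ | ⟨_, rfl⟩ <;> positivity
  have ht1 : 1 ≤ t := by rcases htc with ⟨h, _⟩ | ⟨h, _⟩ <;> linarith
  have hT : N / kappa d m ≤ j / (d - 1) + t * Real.logb d N := by
    rw [← hmk, ← sub_nonneg]
    have : m / kappa d m + t * Real.logb d N - N / kappa d m =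
      (m + kappa d m * t * Real.logb d N - N) / kappa d m := by field_simp
    rw [this]
    exact div_nonneg (by linarith) hk.le
  have hNk : Real.logb d N = Real.logb d (kappa d m) + Real.logb d (N / kappa d m) := by
    rw [← Real.logb_mul hk.ne' (by positivity)]
    congr 1
    field_simp
  rw [Real.logb_mul hc0.ne' (by positivity)]
  suffices h : Real.logb d (1 + j) + t * Real.logb d (kappa d m) ≤ t * Real.logb d c by
    rw [hNk] at hT
    linarith
  have hkle : kappa d m * j ≤ (d - 1) ^ 2 := by
    rw [hkj, div_mul_cancel₀ _ (by positivity)]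
    nlinarith
  have hb1 : (1 : ℝ) < d := by linarith
  rcases htc with ⟨rfl, rfl⟩ | ⟨ht, rfl⟩
  · rw [one_mul, one_mul, ← Real.logb_mul (by positivity) hk.ne']
    apply Real.logb_le_logb_of_le hb1 (by positivity)
    nlinarith
  · have e1 : Real.logb d (1 + j) + 2 * Real.logb d (kappa d m) ≤
        2 * Real.logb d (3 / 2 * ((d : ℝ) - 1) ^ 2) := by
      have e2 : ∀ y : ℝ, 2 * Real.logb d y = Real.logb d (y ^ 2) := fun y => by
        rw [Real.logb_pow]; norm_num
      rw [e2, e2, ← Real.logb_mul (by positivity) (by positivity)]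
      apply Real.logb_le_logb_of_le hb1 (by positivity)
      have e3 : (kappa d m * j) ^ 2 ≤ ((d - 1) ^ 2) ^ 2 := by gcongr
      have e4 : (1 + j) ≤ 9 / 4 * j ^ 2 := by nlinarith
      have e5 : (1 + j) * kappa d m ^ 2 ≤ 9 / 4 * j ^ 2 * kappa d m ^ 2 := by gcongr
      nlinarith
    -- From exponent 2 to exponent t: the case t = 2 is multiplied by t/2 ≥ 1, which only enlarges
    -- the nonnegative term log_d (1 + j).
    have e6 : 0 ≤ Real.logb d (1 + j) := Real.logb_nonneg hb1 (by linarith)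
    nlinarith

/-- Beyond T₀ the function t log_d (cT) has slope at most t/(T₀ log d) < 1, because T₀ ≥ 3t and log
d > 1/3. Once it has fallen below the diagonal at T₀ it cannot meet it again. -/
theorem le_of_le_mul_logb {d : ℕ} {t c T T₀ : ℝ} (hd : 2 ≤ d) (ht : 0 < t) (hc : 0 < c)
    (hT : 0 < T) (h : T ≤ t * Real.logb d (c * T)) (h3 : 3 * t ≤ T₀)
    (h0 : t * Real.logb d (c * T₀) ≤ T₀) : T ≤ T₀ := by
  by_contra! hlt
  have hT0 : 0 < T₀ := by linarith
  have hl2 : Real.log 2 ≤ Real.log d := Real.log_le_log (by norm_num) (by exact_mod_cast hd)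
  have hld : 1 / 3 < Real.log d := by linarith [Real.log_two_gt_d9]
  have h1 : Real.logb d (c * T) = Real.logb d (c * T₀) + Real.logb d (T / T₀) := by
    rw [← Real.logb_mul (by positivity) (by positivity)]
    congr 1
    field_simp
  have h2 : Real.logb d (T / T₀) ≤ (T / T₀ - 1) / Real.log d := by
    rw [Real.logb]
    gcongr
    exact Real.log_le_sub_one_of_pos (by positivity)
  have h4 : T ≤ T₀ + t * ((T / T₀ - 1) / Real.log d) := by
    rw [h1] at h
    nlinarith [mul_le_mul_of_nonneg_left h2 ht.le]
  have h5 : t * ((T / T₀ - 1) / Real.log d) = (T - T₀) * (t / (T₀ * Real.log d)) := by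
    field_simp
  have h6 : t / (T₀ * Real.log d) < 1 := by
    rw [div_lt_one (by positivity)]
    nlinarith
  nlinarith

/-- The difference is (d - 2)³ + 2. This is the source of the summand 3t in the bound, as 3 = log_d
d³. -/
theorem six_mul_sq_le_cube {d : ℕ} (hd : 2 ≤ d) : 6 * ((d : ℝ) - 1) ^ 2 ≤ (d : ℝ) ^ 3 := by
  have : (2 : ℝ) ≤ d := by exact_mod_cast hd
  nlinarith [pow_nonneg (sub_nonneg.2 this) 3]

/-- The quantity bounding the number of points per unit of `kappa`. -/
def pointBound (d : ℕ) (t : ℝ) : ℝ :=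
  if t < d then t * Real.logb d t + 3 * t
  else t * Real.logb d t + t * Real.logb d (Real.logb d t) + 3 * t

/-- It has to be checked that T₀ = `pointBound d t` lies above t log_d (c T₀). The bracket in T₀/t
equals 3 for t = 1, is less than 4 for t < d, and is at most 4 log_d t for t ≥ d; in each case c
times this factor is covered by 6(d - 1)² ≤ d³. -/
theorem le_kappa_mul_pointBound {d m N : ℕ} {t : ℝ} (hm : 0 < m) (hmd : m < d)
    (ht : t = 1 ∨ 2 ≤ t)
    (hN : (N : ℝ) ≤ m + kappa d m * t * Real.logb d N) :
    (N : ℝ) ≤ kappa d m * pointBound d t := by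
  have hd : 2 ≤ d := by omega
  have hdr : (2 : ℝ) ≤ d := by exact_mod_cast hd
  have hk := kappa_pos hm hmd
  have ht1 : 1 ≤ t := by rcases ht with h | h <;> linarith
  have hb1 : (1 : ℝ) < d := by linarith
  have hL0 : 0 ≤ Real.logb d t := Real.logb_nonneg hb1 ht1
  have hl2 : Real.log 2 ≤ Real.log d := Real.log_le_log (by norm_num) hdr
  have hld : 1 / 3 < Real.log d := by linarith [Real.log_two_gt_d9]
  have h6 := six_mul_sq_le_cube hd
  have hd10 : (0 : ℝ) < d - 1 := by linarith
  have hld3 : Real.logb d ((d : ℝ) ^ 3) = 3 := by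
    rw [Real.logb_pow, Real.logb_self_eq_one hb1]; norm_num
  have hLL : ¬ t < d → 1 ≤ Real.logb d t := fun h => by
    rw [← Real.logb_self_eq_one hb1]
    exact Real.logb_le_logb_of_le hb1 (by linarith) (not_lt.1 h)
  have h3t : 3 * t ≤ pointBound d t := by
    unfold pointBound
    split_ifs with h
    · nlinarith
    · have : 0 ≤ Real.logb d (Real.logb d t) := Real.logb_nonneg hb1 (hLL h)
      have := mul_nonneg (by linarith : 0 ≤ t) this
      nlinarith
  rcases Nat.eq_zero_or_pos N with rfl | hN0
  · rw [Nat.cast_zero]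
    exact mul_nonneg hk.le (by linarith)
  have key : ∀ c : ℝ, (t = 1 ∧ c = 2 * ((d : ℝ) - 1) ^ 2 ∨ 2 ≤ t ∧ c = 3 / 2 * ((d : ℝ) - 1) ^ 2) →
      N ≤ kappa d m * pointBound d t := by
    intro c htc
    have h := le_mul_logb_of_le hm hmd hN0 htc hN
    have hc0 : 0 < c := by rcases htc with ⟨_, rfl⟩ | ⟨_, rfl⟩ <;> positivity
    have := le_of_le_mul_logb hd (by linarith) hc0 (by positivity) h h3t ?_
    · rw [div_le_iff₀ hk] at this
      linarith
    have hp0 : 0 < pointBound d t := by linarith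
    by_cases htd : t < d
    · have hpb : pointBound d t = t * (Real.logb d t + 3) := by
        rw [pointBound, if_pos htd]; ring
      have hL1 : Real.logb d t < 1 := by
        rw [← Real.logb_self_eq_one hb1]
        exact Real.logb_lt_logb hb1 (by linarith) htd
      rw [hpb] at hp0 ⊢
      apply mul_le_mul_of_nonneg_left _ (by linarith)
      have e1 : Real.logb d t + 3 = Real.logb d (t * d ^ 3) := by
        rw [Real.logb_mul (by positivity) (by positivity), hld3]
      nth_rw 2 [e1]
      apply Real.logb_le_logb_of_le hb1 (by positivity)
      rcases htc with ⟨rfl, rfl⟩ | ⟨h2, rfl⟩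
      · rw [Real.logb_one]; linarith
      · have : 3 / 2 * ((d : ℝ) - 1) ^ 2 * (t * (Real.logb d t + 3)) ≤
          3 / 2 * ((d : ℝ) - 1) ^ 2 * (t * (1 + 3)) := by gcongr
        nlinarith
    · have hpb : pointBound d t = t * (Real.logb d t + Real.logb d (Real.logb d t) + 3) := by
        rw [pointBound, if_neg htd]; ring
      have hL1 := hLL htd
      set Lt := Real.logb d t with hLt
      have hlogL : Real.logb d Lt ≤ 3 * (Lt - 1) := by
        rw [Real.logb, div_le_iff₀ (by linarith)]
        have := Real.log_le_sub_one_of_pos (x := Lt) (by linarith)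
        nlinarith
      rw [hpb] at hp0 ⊢
      apply mul_le_mul_of_nonneg_left _ (by linarith)
      have hc : c ≤ 3 / 2 * ((d : ℝ) - 1) ^ 2 := by
        rcases htc with ⟨rfl, rfl⟩ | ⟨h2, rfl⟩
        · linarith
        · exact le_rfl
      have e1 : Lt + Real.logb d Lt + 3 = Real.logb d (t * Lt * d ^ 3) := by
        rw [Real.logb_mul (by positivity) (by positivity),
          Real.logb_mul (by positivity) (by positivity), hld3]
      nth_rw 2 [e1]
      apply Real.logb_le_logb_of_le hb1 (by positivity)
      have e2 : c * (t * (Lt + Real.logb d Lt + 3)) ≤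
          3 / 2 * ((d : ℝ) - 1) ^ 2 * (t * (4 * Lt)) := by
        gcongr
        linarith
      have : 0 ≤ t * Lt := by positivity
      nlinarith
  rcases ht with h | h
  · exact key _ (Or.inl ⟨h, rfl⟩)
  · exact key _ (Or.inr ⟨h, rfl⟩)

noncomputable section

/-! ### Monic polynomials that are small on pieces of filled Julia sets -/

section Splitting

variable {L : Type*} [NormedField L]

open Classical in
/-- Data showing that the roots of all the polynomials `ψ - c`, `c ∈ U`, outside `W` stay at
distance at least `r` from a set `S`; exactly `m` of the roots of each `ψ - c` lie in `W`. -/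
structure Splitting (ψ : L[X]) (d m : ℕ) (r δ : ℝ) (S : Set L) where
  /-- a backward invariant set -/
  U : Set L
  /-- the base point -/
  c₀ : L
  /-- one of the two parts of the preimage of `U` -/
  W : Set L
  backward : ∀ z, ψ.eval z ∈ U → z ∈ U
  base_mem : c₀ ∈ U
  card_roots : ∀ c ∈ U, ((ψ - C c).roots.filter (· ∈ W)).card = m
  far : ∀ x ∈ S, ∀ β, ψ.eval β ∈ U → β ∉ W → r ≤ ‖x - β‖
  near : ∀ x ∈ S, ∀ k : ℕ, ‖(fun z => ψ.eval z)^[k] x - c₀‖ ≤ δ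

theorem eval_sub_eq_prod_roots [IsAlgClosed L] {ψ : L[X]} (hψ : ψ.Monic) (hd : 0 < ψ.natDegree)
    (c z : L) : ψ.eval z - c = ((ψ - C c).roots.map fun α => z - α).prod := by
  have hm : (ψ - C c).Monic := by
    apply hψ.sub_of_left
    exact (degree_C_le).trans_lt (natDegree_pos_iff_degree_pos.1 hd)
  have h := (IsAlgClosed.splits (ψ - C c)).eq_prod_roots_of_monic hm
  have h2 := congrArg (eval z) h
  rw [eval_multiset_prod, Multiset.map_map] at h2
  simpa using h2

theorem card_roots_sub_C_eq [IsAlgClosed L] {ψ : L[X]} (c : L) :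
    (ψ - C c).roots.card = ψ.natDegree := by
  rw [IsAlgClosed.card_roots_eq_natDegree, natDegree_sub_C]

/-- The `k`-fold preimages of a point, with multiplicity. -/
def iteratedPreimages (ψ : L[X]) (c₀ : L) : ℕ → Multiset L
  | 0 => {c₀}
  | k + 1 => (iteratedPreimages ψ c₀ k).bind fun β => (ψ - C β).roots

theorem iterate_sub_eq_prod [IsAlgClosed L] {ψ : L[X]} (hψ : ψ.Monic) (hd : 0 < ψ.natDegree)
    (c₀ : L) (k : ℕ) (z : L) :
    (fun z => ψ.eval z)^[k] z - c₀ = ((iteratedPreimages ψ c₀ k).map fun α => z - α).prod := by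
  induction k generalizing z with
  | zero => simp [iteratedPreimages]
  | succ k ih =>
    rw [Function.iterate_succ_apply, ih, iteratedPreimages, Multiset.map_bind,
      Multiset.prod_bind]
    congr 1
    exact Multiset.map_congr rfl fun β _ => eval_sub_eq_prod_roots hψ hd β z

theorem card_iteratedPreimages [IsAlgClosed L] (ψ : L[X]) (c₀ : L) (k : ℕ) :
    (iteratedPreimages ψ c₀ k).card = ψ.natDegree ^ k := by
  induction k with
  | zero => simp [iteratedPreimages]
  | succ k ih =>
    rw [iteratedPreimages, Multiset.card_bind, Multiset.map_congr rfl (g := fun _ => ψ.natDegree)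
      fun β _ => by exact card_roots_sub_C_eq β]
    simp [ih, pow_succ]

theorem mem_of_mem_iteratedPreimages {ψ : L[X]} {c₀ : L} {U : Set L}
    (hU : ∀ z, ψ.eval z ∈ U → z ∈ U) (hc : c₀ ∈ U) (k : ℕ) :
    ∀ β ∈ iteratedPreimages ψ c₀ k, β ∈ U := by
  induction k with
  | zero => simp [iteratedPreimages, hc]
  | succ k ih =>
    intro β hβ
    rw [iteratedPreimages, Multiset.mem_bind] at hβ
    obtain ⟨γ, hγ, hβ⟩ := hβ
    apply hU
    have := isRoot_of_mem_roots hβ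
    rw [IsRoot, eval_sub, eval_C, sub_eq_zero] at this
    rw [this]
    exact ih γ hγ

theorem Multiset.le_prod_map_of_forall_le {α : Type*} (s : Multiset α) {f : α → ℝ} {r : ℝ}
    (hr : 0 ≤ r) (h : ∀ a ∈ s, r ≤ f a) : r ^ s.card ≤ (s.map f).prod := by
  induction s using Multiset.induction_on with
  | empty => simp
  | cons a s ih =>
    rw [Multiset.card_cons, pow_succ', Multiset.map_cons, Multiset.prod_cons]
    have h1 := h a (Multiset.mem_cons_self _ _)
    exact mul_le_mul h1 (ih fun b hb => h b (Multiset.mem_cons_of_mem hb)) (by positivity)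
      (hr.trans h1)

theorem norm_multiset_prod {s : Multiset L} : ‖s.prod‖ = (s.map fun x => ‖x‖).prod :=
  map_multiset_prod (normHom : L →*₀ ℝ) s

namespace Splitting

variable {ψ : L[X]} {d m : ℕ} {r δ : ℝ} {S : Set L}

/-- The polynomial has as roots those (k+1)-fold preimages of c₀ that lie in W. The product over all
preimages is ψ^(k+1)(x) - c₀, of norm at most δ on S, and each of the (d - m) d^k discarded factors
is at least r there. -/
theorem exists_monic_level [IsAlgClosed L] (h : Splitting ψ d m r δ S) (hψ : ψ.Monic)
    (hd : ψ.natDegree = d) (hd0 : 0 < d) (hr : 0 < r) (k : ℕ) :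
    ∃ P : L[X], P.Monic ∧ P.natDegree = m * d ^ k ∧
      ∀ x ∈ S, ‖P.eval x‖ ≤ δ / r ^ ((d - m) * d ^ k) := by
  classical
  set B := iteratedPreimages ψ h.c₀ k with hB
  have hBU := mem_of_mem_iteratedPreimages h.backward h.base_mem k
  have hBc : B.card = d ^ k := hd ▸ card_iteratedPreimages ψ h.c₀ k
  let Q : Multiset L := B.bind fun β => (ψ - C β).roots.filter (· ∈ h.W)
  let Q' : Multiset L := B.bind fun β => (ψ - C β).roots.filter (· ∉ h.W)
  have hQc : Q.card = m * d ^ k := by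
    rw [Multiset.card_bind, Multiset.map_congr rfl (g := fun _ => m) fun β hβ => by
      simpa using h.card_roots β (hBU β hβ)]
    simp [hBc, mul_comm]
  have hcomp : ∀ β ∈ B, ((ψ - C β).roots.filter (· ∉ h.W)).card = d - m := fun β hβ => by
    have h1 := congrArg Multiset.card (Multiset.filter_add_not (· ∈ h.W) (ψ - C β).roots)
    have h2 := h.card_roots β (hBU β hβ)
    rw [Multiset.card_add, card_roots_sub_C_eq, hd] at h1
    have h3 : (Multiset.filter (· ∈ h.W) (ψ - C β).roots).card = m := by simpa using h2
    omega
  have hQ'c : Q'.card = (d - m) * d ^ k := by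
    rw [Multiset.card_bind, Multiset.map_congr rfl (g := fun _ => d - m) fun β hβ => by exact hcomp β hβ]
    simp [hBc, mul_comm]
  have hdeg : 0 < ψ.natDegree := hd ▸ hd0
  refine ⟨(Q.map fun α => X - C α).prod, monic_multiset_prod_of_monic _ _ fun α _ =>
    monic_X_sub_C α, ?_, fun x hx => ?_⟩
  · rw [natDegree_multiset_prod_X_sub_C_eq_card, hQc]
  · have e1 : (fun z => ψ.eval z)^[k + 1] x - h.c₀ =
        (Q.map fun α => x - α).prod * (Q'.map fun α => x - α).prod := by
      rw [iterate_sub_eq_prod hψ hdeg, iteratedPreimages, ← Multiset.prod_add, ← Multiset.map_add]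
      congr 2
      rw [← Multiset.bind_add]
      exact Multiset.bind_congr fun β _ => (Multiset.filter_add_not _ _).symm
    have e2 : r ^ ((d - m) * d ^ k) ≤ ‖(Q'.map fun α => x - α).prod‖ := by
      rw [norm_multiset_prod, Multiset.map_map, ← hQ'c]
      refine Multiset.le_prod_map_of_forall_le _ hr.le fun β hβ => ?_
      obtain ⟨γ, hγ, hβ⟩ := Multiset.mem_bind.1 hβ
      obtain ⟨hβ, hβW⟩ := Multiset.mem_filter.1 hβ
      refine h.far x hx β ?_ hβW
      have := isRoot_of_mem_roots hβ
      rw [IsRoot, eval_sub, eval_C, sub_eq_zero] at this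
      rw [this]
      exact hBU γ hγ
    have e3 := h.near x hx (k + 1)
    rw [e1, norm_mul] at e3
    rw [eval_multiset_prod, Multiset.map_map, le_div_iff₀ (by positivity)]
    have e4 : ((fun p => eval x p) ∘ fun α => X - C α) = fun α => x - α := by
      ext α; simp
    change ‖(Multiset.map ((fun p => eval x p) ∘ fun α => X - C α) Q).prod‖ * _ ≤ δ
    rw [e4]
    exact (mul_le_mul_of_nonneg_left e2 (norm_nonneg _)).trans e3

/-- The polynomial for q is a product of level polynomials, the one of level k + i occurring as
often as the i-th base d digit of q says. Each factor costs one δ, whence the digit sum; the powers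
of r depend only on the total degree. -/
theorem exists_monic_mul [IsAlgClosed L] (h : Splitting ψ d m r δ S) (hψ : ψ.Monic)
    (hd : ψ.natDegree = d) (hd0 : 2 ≤ d) (hr : 0 < r) (hδ : 0 < δ) (q k : ℕ) :
    ∃ P : L[X], P.Monic ∧ P.natDegree = m * d ^ k * q ∧
      ∀ x ∈ S, ‖P.eval x‖ ≤ δ ^ (Nat.digits d q).sum / r ^ ((d - m) * d ^ k * q) := by
  induction q using Nat.strong_induction_on generalizing k with
  | _ q ih =>
  rcases Nat.eq_zero_or_pos q with rfl | hq
  · exact ⟨1, monic_one, by simp, by simp⟩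
  obtain ⟨P, hP, hPd, hPs⟩ := ih (q / d) (Nat.div_lt_self hq hd0) (k + 1)
  obtain ⟨R, hR, hRd, hRs⟩ := h.exists_monic_level hψ hd (by omega) hr k
  have hq' : q = q % d + d * (q / d) := (Nat.mod_add_div q d).symm
  refine ⟨R ^ (q % d) * P, (hR.pow _).mul hP, ?_, fun x hx => ?_⟩
  · rw [(hR.pow _).natDegree_mul hP, hR.natDegree_pow, hRd, hPd]
    nth_rw 3 [hq']
    ring
  · rw [eval_mul, eval_pow, norm_mul, norm_pow, Nat.digits_eq_cons_digits_div hd0 hq.ne',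
      List.sum_cons]
    have e1 := pow_le_pow_left₀ (norm_nonneg _) (hRs x hx) (q % d)
    refine (mul_le_mul e1 (hPs x hx) (norm_nonneg _) (by positivity)).trans_eq ?_
    have e2 : (d - m) * d ^ k * q = (d - m) * d ^ k * (q % d) + (d - m) * d ^ (k + 1) * (q / d) := by
      nth_rw 1 [hq']
      ring
    rw [div_pow, div_mul_div_comm, ← pow_add, ← pow_mul, ← pow_add, e2]

/-- Degrees not divisible by m are reached with factors X - c₀, each of norm at most δ on S. This is
why the lowest radix is m. -/
theorem exists_monic [IsAlgClosed L] (h : Splitting ψ d m r δ S) (hψ : ψ.Monic)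
    (hd : ψ.natDegree = d) (hd0 : 2 ≤ d) (hr : 0 < r) (hδ : 0 < δ) (n : ℕ) :
    ∃ P : L[X], P.Monic ∧ P.natDegree = n ∧
      ∀ x ∈ S, ‖P.eval x‖ ≤ δ ^ mixedDigitSum d m n / r ^ ((d - m) * (n / m)) := by
  obtain ⟨P, hP, hPd, hPs⟩ := h.exists_monic_mul hψ hd hd0 hr hδ (n / m) 0
  rw [pow_zero, mul_one] at hPd
  simp only [pow_zero, mul_one] at hPs
  refine ⟨(X - C h.c₀) ^ (n % m) * P, ((monic_X_sub_C _).pow _).mul hP, ?_, fun x hx => ?_⟩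
  · rw [((monic_X_sub_C _).pow _).natDegree_mul hP, (monic_X_sub_C _).natDegree_pow,
      natDegree_X_sub_C, hPd, mul_one, Nat.mod_add_div]
  · rw [eval_mul, eval_pow, norm_mul, norm_pow, mixedDigitSum, pow_add, mul_div_assoc]
    have e0 := h.near x hx 0
    refine mul_le_mul (pow_le_pow_left₀ (norm_nonneg _) ?_ _) (hPs x hx) (norm_nonneg _)
      (by positivity)
    simpa using e0

end Splitting

/-! ### Vandermonde determinants -/

/-- The sum of the logarithms of the mutual distances of a tuple of points. -/
def pairLog {N : ℕ} (x : Fin N → L) : ℝ :=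
  ∑ i, ∑ j ∈ Finset.Ioi i, Real.log ‖x j - x i‖

/-- Column operations turn a Vandermonde matrix into the matrix of values of any monic polynomials
of degrees 0, …, N - 1 without changing its determinant. The factor H leaves room for Hadamard's
inequality. -/
theorem pairLog_le_of_norm_det_le {N : ℕ} {x : Fin N → L} (hx : Function.Injective x)
    {p : ℕ → L[X]} {ρ : ℕ → ℝ} {H : ℝ} (hp : ∀ n, (p n).Monic) (hpd : ∀ n, (p n).natDegree = n)
    (hH : 0 < H) (hρ : ∀ n, 0 < ρ n)
    (hdet : ‖(Matrix.of fun i j : Fin N => (p j).eval (x i)).det‖ ≤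
      H * ∏ n ∈ Finset.range N, ρ n) :
    pairLog x ≤ Real.log H + ∑ n ∈ Finset.range N, Real.log (ρ n) := by
  rw [← Matrix.det_eval_matrixOfPolynomials_eq_det_vandermonde x (fun j => p j)
    (fun i => hpd i) (fun i => hp i), Matrix.det_vandermonde, norm_prod] at hdet
  have hne : ∀ i : Fin N, ∀ j ∈ Finset.Ioi i, ‖x j - x i‖ ≠ 0 := fun i j hj => by
    rw [norm_ne_zero_iff, sub_ne_zero]
    exact fun h => (Finset.mem_Ioi.1 hj).ne' (hx h)
  have h1 : pairLog x = Real.log (∏ i : Fin N, ‖∏ j ∈ Finset.Ioi i, (x j - x i)‖) := by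
    rw [Real.log_prod fun i _ => by
      rw [norm_prod]; exact Finset.prod_ne_zero_iff.2 (hne i)]
    refine Finset.sum_congr rfl fun i _ => ?_
    rw [norm_prod, Real.log_prod (hne i)]
  rw [h1, ← Real.log_prod fun n _ => (hρ n).ne', ← Real.log_mul hH.ne'
    (Finset.prod_ne_zero_iff.2 fun n _ => (hρ n).ne')]
  refine Real.log_le_log (Finset.prod_pos fun i _ => ?_) hdet
  rw [norm_prod]
  exact Finset.prod_pos fun j hj => lt_of_le_of_ne (norm_nonneg _) (hne i j hj).symm

theorem norm_det_le_of_ultrametric [IsUltrametricDist L] {N : ℕ} {M : Matrix (Fin N) (Fin N) L}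
    {ρ : ℕ → ℝ} (hρ : ∀ n, 0 < ρ n) (hM : ∀ i j, ‖M i j‖ ≤ ρ j) :
    ‖M.det‖ ≤ 1 * ∏ n ∈ Finset.range N, ρ n := by
  rw [one_mul, Matrix.det_apply]
  refine IsUltrametricDist.norm_sum_le_of_forall_le_of_nonneg
    (Finset.prod_nonneg fun n _ => (hρ n).le) fun σ _ => ?_
  have h1 : ‖Equiv.Perm.sign σ • ∏ i, M (σ i) i‖ = ‖∏ i, M (σ i) i‖ := by
    rcases Int.units_eq_one_or (Equiv.Perm.sign σ) with h | h <;> simp [h]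
  rw [h1, norm_prod, ← Fin.prod_univ_eq_prod_range]
  exact Finset.prod_le_prod (fun _ _ => norm_nonneg _) fun i _ => hM _ _

end Splitting

open scoped ComplexOrder in
/-- Hadamard's inequality. -/
theorem norm_det_le_of_complex {N : ℕ} {M : Matrix (Fin N) (Fin N) ℂ}
    {ρ : ℕ → ℝ} (hρ : ∀ n, 0 < ρ n) (hM : ∀ i j, ‖M i j‖ ≤ ρ j) :
    ‖M.det‖ ≤ Real.sqrt ((N : ℝ) ^ N) * ∏ n ∈ Finset.range N, ρ n := by
  -- Dividing column j by ρ j leaves a matrix with entries of norm at most 1.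
  set A : Matrix (Fin N) (Fin N) ℂ := Matrix.of fun i j => ((ρ j : ℝ) : ℂ)⁻¹ * M i j with hA
  have hAb : ∀ i j, ‖A i j‖ ≤ 1 := fun i j => by
    rw [hA, Matrix.of_apply, norm_mul, norm_inv, Complex.norm_real, Real.norm_of_nonneg (hρ j).le,
      inv_mul_le_one₀ (hρ j)]
    exact hM i j
  have hMA : M.det = (∏ n ∈ Finset.range N, ((ρ n : ℝ) : ℂ)) * A.det := by
    rw [hA, Matrix.det_mul_row, ← mul_assoc, Finset.prod_inv_distrib,
      Fin.prod_univ_eq_prod_range (fun n => ((ρ n : ℝ) : ℂ)), mul_inv_cancel₀, one_mul]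
    exact Finset.prod_ne_zero_iff.2 fun n _ => by exact_mod_cast (hρ n).ne'
  have hdetA : ‖A.det‖ ^ 2 ≤ (N : ℝ) ^ N := by
    -- |det A|² is the product of the nonnegative eigenvalues of G. Their sum is the trace, at most
    -- N², so the inequality of the arithmetic and geometric means bounds the product by N^N.
    set G := A * A.conjTranspose with hG
    have hps : G.PosSemidef := Matrix.posSemidef_self_mul_conjTranspose A
    have hh : G.IsHermitian := hps.isHermitian
    have hev : ∀ i, 0 ≤ hh.eigenvalues i := hps.eigenvalues_nonneg
    have h1 : ((‖A.det‖ ^ 2 : ℝ) : ℂ) = ∏ i, (hh.eigenvalues i : ℂ) := by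
      refine Eq.trans ?_ hh.det_eq_prod_eigenvalues
      rw [hG, Matrix.det_mul, Matrix.det_conjTranspose]
      push_cast
      exact (Complex.mul_conj' A.det).symm
    have h2 : ‖A.det‖ ^ 2 = ∏ i, hh.eigenvalues i := by exact_mod_cast h1
    have h3 : ∑ i, hh.eigenvalues i ≤ N * N := by
      have e1 := hh.trace_eq_sum_eigenvalues
      have e2 : ((∑ i, hh.eigenvalues i : ℝ) : ℂ) = ((∑ i, ∑ j, ‖A i j‖ ^ 2 : ℝ) : ℂ) := by
        push_cast
        refine e1.symm.trans ?_
        rw [hG, Matrix.trace]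
        refine Finset.sum_congr rfl fun i _ => ?_
        rw [Matrix.diag_apply, Matrix.mul_apply]
        refine Finset.sum_congr rfl fun j _ => ?_
        rw [Matrix.conjTranspose_apply]
        exact Complex.mul_conj' _
      have e3 : ∑ i, hh.eigenvalues i = ∑ i, ∑ j, ‖A i j‖ ^ 2 := by exact_mod_cast e2
      rw [e3]
      calc ∑ i, ∑ j, ‖A i j‖ ^ 2 ≤ ∑ _i : Fin N, ∑ _j : Fin N, (1 : ℝ) :=
            Finset.sum_le_sum fun i _ => Finset.sum_le_sum fun j _ =>
              pow_le_one₀ (norm_nonneg _) (hAb i j)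
        _ = N * N := by simp
    rcases Nat.eq_zero_or_pos N with rfl | hN
    · simp
    have hNr : (0 : ℝ) < N := by exact_mod_cast hN
    have h5 := Real.geom_mean_le_arith_mean_weighted Finset.univ (fun _ : Fin N => (1 : ℝ) / N)
      hh.eigenvalues (fun _ _ => by positivity) (by simp [hNr.ne'])
      (fun i _ => hev i)
    rw [← Finset.mul_sum] at h5
    have h6 : (∏ i, hh.eigenvalues i ^ ((1 : ℝ) / N)) ≤ N := by
      refine h5.trans ?_
      rw [div_mul_eq_mul_div, one_mul, div_le_iff₀ hNr]
      exact h3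
    have h7 := pow_le_pow_left₀ (Finset.prod_nonneg fun i _ =>
      Real.rpow_nonneg (hev i) _) h6 N
    rw [← Finset.prod_pow] at h7
    rw [h2]
    refine le_of_eq_of_le (Finset.prod_congr rfl fun i _ => ?_) h7
    rw [← Real.rpow_natCast, ← Real.rpow_mul (hev i), one_div,
      inv_mul_cancel₀ hNr.ne', Real.rpow_one]
  rw [hMA, norm_mul, mul_comm, norm_prod]
  have h8 : ‖A.det‖ ≤ Real.sqrt ((N : ℝ) ^ N) := Real.le_sqrt_of_sq_le hdetA
  have h9 : ∏ n ∈ Finset.range N, ‖((ρ n : ℝ) : ℂ)‖ = ∏ n ∈ Finset.range N, ρ n :=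
    Finset.prod_congr rfl fun n _ => by rw [Complex.norm_real, Real.norm_of_nonneg (hρ n).le]
  rw [h9]
  exact mul_le_mul_of_nonneg_right h8 (Finset.prod_nonneg fun n _ => (hρ n).le)

section

variable {L : Type*} [NormedField L] [IsAlgClosed L] {ψ : L[X]} {d m : ℕ} {r δ : ℝ} {S : Set L}

theorem two_mul_sum_div_ge {m : ℕ} (hm : 0 < m) (N : ℕ) :
    (N : ℝ) * (N - m) / m ≤ 2 * ∑ n ∈ Finset.range N, ((n / m : ℕ) : ℝ) := by
  have hmr : (0 : ℝ) < m := by exact_mod_cast hm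
  have h1 : ∀ n : ℕ, (n : ℝ) = ((n % m : ℕ) : ℝ) + m * ((n / m : ℕ) : ℝ) := fun n => by
    exact_mod_cast (Nat.mod_add_div n m).symm
  have h2 := two_mul_sum_range_cast N
  rw [Finset.sum_congr rfl fun n _ => h1 n, Finset.sum_add_distrib, ← Finset.mul_sum] at h2
  have h3 := two_mul_sum_mod_le hm N
  rw [div_le_iff₀ hmr]
  nlinarith

/-- The basic upper bound for the product of the mutual distances of points in one part of a
filled Julia set. -/
theorem Splitting.pairLog_le (h : Splitting ψ d m r δ S) (hψ : ψ.Monic)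
    (hd : ψ.natDegree = d) (hd0 : 2 ≤ d) (hm : 0 < m) (hmd : m ≤ d) (hr : 1 ≤ r) (hδ : 1 ≤ δ)
    {N : ℕ} {x : Fin N → L} (hx : Function.Injective x) (hxS : ∀ i, x i ∈ S) {H : ℝ} (hH : 0 < H)
    (hdet : ∀ (M : Matrix (Fin N) (Fin N) L) (ρ : ℕ → ℝ), (∀ n, 0 < ρ n) →
      (∀ i j, ‖M i j‖ ≤ ρ j) → ‖M.det‖ ≤ H * ∏ n ∈ Finset.range N, ρ n) :
    2 * pairLog x ≤ 2 * Real.log H + Real.log δ * ((d - 1) * (N * Real.logb d N)) -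
      (d - m) / m * (N * (N - m)) * Real.log r := by
  -- The logarithm of the n-th bound has two parts, log δ times a mixed digit sum and -(d - m) log r
  -- times the integer part of n/m. They are summed separately over n < N.
  choose p hp hpd hps using h.exists_monic hψ hd hd0 (by linarith) (by linarith)
  have h1 := pairLog_le_of_norm_det_le hx (p := p)
    (ρ := fun n => δ ^ mixedDigitSum d m n / r ^ ((d - m) * (n / m))) hp hpd hH
    (fun n => by positivity) (hdet _ _ (fun n => by positivity) fun i j => hps j _ (hxS i))
  have h2 : ∀ n : ℕ, Real.log (δ ^ mixedDigitSum d m n / r ^ ((d - m) * (n / m))) =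
      mixedDigitSum d m n * Real.log δ - (d - m) * ((n / m : ℕ) : ℝ) * Real.log r := fun n => by
    rw [Real.log_div (by positivity) (by positivity), Real.log_pow, Real.log_pow]
    push_cast [Nat.cast_sub hmd]
    ring
  rw [Finset.sum_congr rfl fun n _ => h2 n, Finset.sum_sub_distrib, ← Finset.sum_mul,
    ← Finset.sum_mul, ← Finset.mul_sum] at h1
  have h3 := mul_le_mul_of_nonneg_right (two_mul_sum_mixedDigitSum_le hd0 hm hmd N)
    (Real.log_nonneg hδ)
  have hdm : (0 : ℝ) ≤ d - m := sub_nonneg.2 (by exact_mod_cast hmd)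
  have h4 := mul_le_mul_of_nonneg_right (mul_le_mul_of_nonneg_left (two_mul_sum_div_ge hm N) hdm)
    (Real.log_nonneg hr)
  have h5 : ((d : ℝ) - m) * (N * (N - m) / m) * Real.log r =
    (d - m) / m * (N * (N - m)) * Real.log r := by ring
  rw [h5] at h4
  linarith

end

noncomputable section

/-! ### Points with finite forward orbit -/

/-- The forward orbit of `x` under `f` is finite. -/
def FiniteOrbit {α : Type*} (f : α → α) (x : α) : Prop := (Set.range fun n : ℕ => f^[n] x).Finite

theorem FiniteOrbit.iterate {α : Type*} {f : α → α} {x : α} (h : FiniteOrbit f x) (k : ℕ) :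
    FiniteOrbit f (f^[k] x) := by
  refine Set.Finite.subset h ?_
  rintro _ ⟨n, rfl⟩
  exact ⟨n + k, Function.iterate_add_apply f n k x⟩

/-- The escape criterion: a region mapped into itself on which g strictly increases along orbits
contains no finite orbit. -/
theorem not_finiteOrbit_of_increasing {α : Type*} {f : α → α} {P : α → Prop} {g : α → ℝ}
    (h : ∀ z, P z → P (f z) ∧ g z < g (f z)) {z : α} (hz : P z) : ¬ FiniteOrbit f z := by
  have hP : ∀ n, P (f^[n] z) := fun n => by
    induction n with
    | zero => exact hz
    | succ n ih => rw [Function.iterate_succ_apply']; exact (h _ ih).1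
  have hmono : StrictMono fun n : ℕ => g (f^[n] z) := strictMono_nat_of_lt_succ fun n => by
    rw [Function.iterate_succ_apply']; exact (h _ (hP n)).2
  have hinj : Function.Injective fun n : ℕ => f^[n] z := fun a b hab =>
    hmono.injective (congrArg g hab)
  exact Set.infinite_range_of_injective hinj

theorem FiniteOrbit.map {α β : Type*} {f : α → α} {g : β → β} {x : α} {σ : α → β}
    (h : ∀ y, σ (f y) = g (σ y)) (hx : FiniteOrbit f x) : FiniteOrbit g (σ x) := by
  refine (Set.Finite.image σ hx).subset ?_
  rintro _ ⟨n, rfl⟩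
  refine ⟨f^[n] x, ⟨n, rfl⟩, ?_⟩
  exact (Function.Semiconj.iterate_right (f := σ) (ga := f) (gb := g) h n) x

/-! ### Affine conjugation -/

section Conj

variable {L : Type*} [Field L]

/-- The conjugate of `φ` by `z ↦ a z + x₀`. -/
def affineConj (φ : L[X]) (a x₀ : L) : L[X] :=
  C a⁻¹ * (φ.comp (C a * X + C x₀) - C x₀)

variable {φ : L[X]} {a x₀ : L}

theorem eval_affineConj (ha : a ≠ 0) (z : L) :
    a * (affineConj φ a x₀).eval z + x₀ = φ.eval (a * z + x₀) := by
  simp [affineConj, ha]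

theorem eval_affineConj_symm (ha : a ≠ 0) (x : L) :
    (φ.eval x - x₀) / a = (affineConj φ a x₀).eval ((x - x₀) / a) := by
  have := eval_affineConj (φ := φ) (x₀ := x₀) ha ((x - x₀) / a)
  rw [mul_div_cancel₀ _ ha, sub_add_cancel] at this
  rw [← this, add_sub_cancel_right, mul_div_cancel_left₀ _ ha]

theorem comp_affine_eq (φ : L[X]) (a x₀ : L) :
    φ.comp (C a * X + C x₀) = (taylor x₀ φ).comp (C a * X) := by
  rw [taylor_apply, comp_assoc]
  simp

theorem coeff_affineConj (ha : a ≠ 0) {i : ℕ} (hi : i ≠ 0) :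
    (affineConj φ a x₀).coeff i = a ^ (i - 1) * (taylor x₀ φ).coeff i := by
  rw [affineConj, coeff_C_mul, coeff_sub, coeff_C_of_ne_zero hi, sub_zero, comp_affine_eq,
    comp_C_mul_X_coeff]
  obtain ⟨j, rfl⟩ := Nat.exists_eq_succ_of_ne_zero hi
  rw [Nat.succ_sub_one, pow_succ]
  field_simp

theorem natDegree_affineConj (ha : a ≠ 0) :
    (affineConj φ a x₀).natDegree = φ.natDegree := by
  rw [affineConj, natDegree_C_mul (inv_ne_zero ha), natDegree_sub_C, natDegree_comp,
    natDegree_linear ha, mul_one]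

theorem monic_affineConj (ha : a ≠ 0) (hd : 0 < φ.natDegree)
    (h : a ^ (φ.natDegree - 1) * φ.leadingCoeff = 1) : (affineConj φ a x₀).Monic := by
  rw [Monic, leadingCoeff, natDegree_affineConj ha, coeff_affineConj ha hd.ne',
    coeff_taylor_natDegree, h]

theorem finiteOrbit_affineConj (ha : a ≠ 0) {x : L} (h : FiniteOrbit (fun z => φ.eval z) x) :
    FiniteOrbit (fun z => (affineConj φ a x₀).eval z) ((x - x₀) / a) :=
  h.map (σ := fun x => (x - x₀) / a) fun y => eval_affineConj_symm ha y

end Conj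

/-! ### Non-archimedean filled Julia sets -/

section Nonarch

variable {L : Type*} [NormedField L]

/-- Density of the value group: roots of u of high order have norm below 1 and arbitrarily close to
1. -/
theorem exists_norm_between [IsAlgClosed L] {u y : L} (hu0 : u ≠ 0) (hu1 : ‖u‖ < 1) (hy : y ≠ 0)
    {lo : ℝ} (hlo : lo < ‖y‖) : ∃ z : L, lo < ‖z‖ ∧ ‖z‖ < ‖y‖ := by
  have hy0 : 0 < ‖y‖ := norm_pos_iff.2 hy
  have hu : 0 < ‖u‖ := norm_pos_iff.2 hu0
  have hq : max (lo / ‖y‖) 0 < 1 := max_lt (by rwa [div_lt_one hy0]) one_pos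
  obtain ⟨n, hn⟩ := exists_pow_lt_of_lt_one hu hq
  obtain ⟨w, hw⟩ := IsAlgClosed.exists_pow_nat_eq u (n := n + 1) (by omega)
  have hw' : ‖w‖ ^ (n + 1) = ‖u‖ := by rw [← norm_pow, hw]
  have hw1 : ‖w‖ < 1 := by
    by_contra! h
    have := one_le_pow₀ (n := n + 1) h
    linarith
  have hw2 : max (lo / ‖y‖) 0 < ‖w‖ := by
    by_contra! h
    have h1 := pow_le_pow_left₀ (norm_nonneg _) h (n + 1)
    have h2 : max (lo / ‖y‖) 0 ^ (n + 1) ≤ max (lo / ‖y‖) 0 ^ n :=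
      pow_le_pow_of_le_one (le_max_right _ _) hq.le (by omega)
    linarith
  refine ⟨w * y, ?_, ?_⟩
  · rw [norm_mul, ← div_lt_iff₀ hy0]
    exact (le_max_left _ _).trans_lt hw2
  · rw [norm_mul]
    exact mul_lt_of_lt_one_left hy0 hw1

theorem exists_lt_forall_norm_le (s : Multiset L) (r : ℝ) :
    ∃ lo < r, ∀ β ∈ s, ‖β‖ < r → ‖β‖ ≤ lo := by
  induction s using Multiset.induction_on with
  | empty => exact ⟨r - 1, by linarith, by simp⟩
  | cons a s ih =>
    obtain ⟨lo, hlo, h⟩ := ih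
    by_cases ha : ‖a‖ < r
    · refine ⟨max lo ‖a‖, max_lt hlo ha, fun β hβ hβr => ?_⟩
      rcases Multiset.mem_cons.1 hβ with rfl | hβ
      · exact le_max_right _ _
      · exact (h β hβ hβr).trans (le_max_left _ _)
    · refine ⟨lo, hlo, fun β hβ hβr => ?_⟩
      rcases Multiset.mem_cons.1 hβ with rfl | hβ
      · exact absurd hβr ha
      · exact h β hβ hβr

variable [IsUltrametricDist L]

/-- Outside the disk of radius r the leading term strictly dominates all others. For the constant
term it is enough that it is at most |z|, since |z| < |z|^d. -/
theorem norm_eval_eq_pow {ψ : L[X]} {d : ℕ} (hψ : ψ.Monic) (hd : ψ.natDegree = d) (hd2 : 2 ≤ d)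
    {r : ℝ} (hr : 1 ≤ r) (hb : ∀ i, 1 ≤ i → i < d → ‖ψ.coeff i‖ ≤ r ^ (d - i)) {z : L}
    (hz : r < ‖z‖) (h0 : ‖ψ.coeff 0‖ ≤ ‖z‖) : ‖ψ.eval z‖ = ‖z‖ ^ d := by
  have hz1 : 1 < ‖z‖ := hr.trans_lt hz
  have hlead : ψ.coeff d = 1 := by rw [← hd]; exact hψ
  rw [eval_eq_sum_range, hd, Finset.sum_range_succ, hlead, one_mul]
  have hlt : ‖∑ i ∈ Finset.range d, ψ.coeff i * z ^ i‖ < ‖z ^ d‖ := by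
    have hne : (Finset.range d).Nonempty := ⟨0, Finset.mem_range.2 (by omega)⟩
    obtain ⟨i, hi, hle⟩ := IsUltrametricDist.exists_norm_finsetSum_le_of_nonempty hne
      (fun i => ψ.coeff i * z ^ i)
    refine hle.trans_lt ?_
    rw [norm_mul, norm_pow, norm_pow]
    have hid := Finset.mem_range.1 hi
    rcases Nat.eq_zero_or_pos i with rfl | hi0
    · rw [pow_zero, mul_one]
      refine h0.trans_lt ?_
      exact lt_self_pow₀ hz1 (by omega)
    · calc ‖ψ.coeff i‖ * ‖z‖ ^ i ≤ r ^ (d - i) * ‖z‖ ^ i := by gcongr; exact hb i hi0 hid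
        _ < ‖z‖ ^ (d - i) * ‖z‖ ^ i := by
            gcongr
            omega
        _ = ‖z‖ ^ d := by rw [← pow_add]; congr 1; omega
  rw [IsUltrametricDist.norm_add_eq_max_of_norm_ne_norm hlt.ne, max_eq_right hlt.le, norm_pow]

theorem not_finiteOrbit_of_lt_norm {ψ : L[X]} {d : ℕ} (hψ : ψ.Monic) (hd : ψ.natDegree = d)
    (hd2 : 2 ≤ d) {r : ℝ} (hr : 1 ≤ r) (hb : ∀ i, 1 ≤ i → i < d → ‖ψ.coeff i‖ ≤ r ^ (d - i)) {z : L}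
    (hz : r < ‖z‖) (h0 : ‖ψ.coeff 0‖ ≤ ‖z‖) : ¬ FiniteOrbit (fun z => ψ.eval z) z := by
  refine not_finiteOrbit_of_increasing (P := fun z => r < ‖z‖ ∧ ‖ψ.coeff 0‖ ≤ ‖z‖)
    (g := fun z => ‖z‖) (fun z hz => ?_) ⟨hz, h0⟩
  have h1 := norm_eval_eq_pow hψ hd hd2 hr hb hz.1 hz.2
  have h2 : ‖z‖ < ‖z‖ ^ d := lt_self_pow₀ (hr.trans_lt hz.1) (by omega)
  rw [h1]
  exact ⟨⟨hz.1.trans h2, hz.2.trans h2.le⟩, h2⟩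

/-- Otherwise the constant coefficient ψ(0), a point of the orbit of 0, lies in the escape region.
Moving a point of finite orbit to 0 therefore controls the one coefficient that the choice of r does
not. -/
theorem norm_coeff_zero_le_of_finiteOrbit {ψ : L[X]} {d : ℕ} (hψ : ψ.Monic)
    (hd : ψ.natDegree = d) (hd2 : 2 ≤ d) {r : ℝ} (hr : 1 ≤ r)
    (hb : ∀ i, 1 ≤ i → i < d → ‖ψ.coeff i‖ ≤ r ^ (d - i))
    (h0 : FiniteOrbit (fun z => ψ.eval z) 0) : ‖ψ.coeff 0‖ ≤ r := by
  by_contra! h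
  have h1 := h0.iterate 1
  rw [Function.iterate_one] at h1
  have h2 : ψ.eval 0 = ψ.coeff 0 := by rw [coeff_zero_eq_eval_zero]
  exact not_finiteOrbit_of_lt_norm hψ hd hd2 hr hb (z := ψ.eval 0) (by rwa [h2]) (by rw [h2]) h1

theorem norm_sub_of_norm_lt {x y : L} (h : ‖x‖ < ‖y‖) : ‖x - y‖ = ‖y‖ := by
  have h1 : ‖x‖ ≠ ‖-y‖ := by rw [norm_neg]; exact h.ne
  rw [sub_eq_add_neg, IsUltrametricDist.norm_add_eq_max_of_norm_ne_norm h1, norm_neg,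
    max_eq_right h.le]

/-- Just inside the circle of radius r the point z dominates every root in the open disk, while
every root on the circle dominates z. The norm of the product thus records the number of inner
roots. -/
theorem norm_prod_sub_eq {r : ℝ} [DecidablePred fun β : L => β ∈ Metric.ball (0 : L) r] {s : Multiset L}
    (hs : ∀ β ∈ s, ‖β‖ ≤ r) {z : L} (hzr : ‖z‖ < r) (hz : ∀ β ∈ s, ‖β‖ < r → ‖β‖ < ‖z‖) :
    ‖(s.map fun β => z - β).prod‖ =
      ‖z‖ ^ (s.filter (· ∈ Metric.ball (0 : L) r)).card *
        r ^ (s.card - (s.filter (· ∈ Metric.ball (0 : L) r)).card) := by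
  induction s using Multiset.induction_on with
  | empty => simp
  | cons a s ih =>
    have ih' := ih (fun β hβ => hs β (Multiset.mem_cons_of_mem hβ))
      (fun β hβ => hz β (Multiset.mem_cons_of_mem hβ))
    have hle := Multiset.card_le_card (Multiset.filter_le (· ∈ Metric.ball (0 : L) r) s)
    rw [Multiset.map_cons, Multiset.prod_cons, norm_mul, ih']
    by_cases ha : ‖a‖ < r
    · have hmem : a ∈ Metric.ball (0 : L) r := by simpa using ha
      rw [Multiset.filter_cons_of_pos _ hmem, Multiset.card_cons, Multiset.card_cons,
        norm_sub_rev, norm_sub_of_norm_lt (hz a (Multiset.mem_cons_self _ _) ha),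
        Nat.add_sub_add_right]
      ring
    · have hmem : a ∉ Metric.ball (0 : L) r := by simpa using ha
      have har : ‖a‖ = r := le_antisymm (hs a (Multiset.mem_cons_self _ _)) (not_lt.1 ha)
      rw [Multiset.filter_cons_of_neg _ hmem, Multiset.card_cons,
        norm_sub_of_norm_lt (by rwa [har]), har, Nat.sub_add_comm hle]
      ring

theorem norm_coeff_prod_X_sub_C_le {s : Multiset L} {ρ : ℝ} (hρ : 0 ≤ ρ)
    (hs : ∀ β ∈ s, ‖β‖ ≤ ρ) (i : ℕ) (hi : i ≤ s.card) :
    ‖((s.map fun β => X - C β).prod).coeff i‖ ≤ ρ ^ (s.card - i) := by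
  induction s using Multiset.induction_on generalizing i with
  | empty =>
    obtain rfl : i = 0 := by simpa using hi
    simp
  | cons a s ih =>
    have ih' := ih (fun β hβ => hs β (Multiset.mem_cons_of_mem hβ))
    have ha := hs a (Multiset.mem_cons_self _ _)
    rw [Multiset.map_cons, Multiset.prod_cons, sub_mul, coeff_sub, Multiset.card_cons]
    rw [Multiset.card_cons] at hi
    have h2 : ∀ i, i ≤ s.card → ‖(C a * (s.map fun β => X - C β).prod).coeff i‖ ≤
        ρ ^ (s.card + 1 - i) := fun i hi => by
      rw [coeff_C_mul, norm_mul, Nat.sub_add_comm hi, pow_succ']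
      exact mul_le_mul ha (ih' i hi) (norm_nonneg _) hρ
    rcases i with _ | i
    · rw [coeff_X_mul_zero, zero_sub, norm_neg]
      exact h2 0 (Nat.zero_le _)
    · rw [coeff_X_mul]
      have h3 := ih' i (by omega)
      rw [show s.card + 1 - (i + 1) = s.card - i by omega]
      rw [sub_eq_add_neg]
      refine (IsUltrametricDist.norm_add_le_max _ _).trans (max_le h3 ?_)
      rw [norm_neg]
      rcases (show i + 1 ≤ s.card ∨ i = s.card by omega) with h | h
      · have := h2 (i + 1) h
        rwa [show s.card + 1 - (i + 1) = s.card - i by omega] at this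
      · rw [coeff_eq_zero_of_natDegree_lt, norm_zero]
        · positivity
        · refine (natDegree_C_mul_le _ _).trans_lt ?_
          rw [natDegree_multiset_prod_X_sub_C_eq_card]
          omega

/-- The normalized coefficients of a monic polynomial with bad reduction for which `0` has finite
orbit: `r` is the radius of the smallest disk containing the filled Julia set. -/
structure BadRadius (ψ : L[X]) (d : ℕ) (r : ℝ) : Prop where
  monic : ψ.Monic
  natDegree_eq : ψ.natDegree = d
  two_le : 2 ≤ d
  one_lt : 1 < r
  coeff_le : ∀ i, 1 ≤ i → i < d → ‖ψ.coeff i‖ ≤ r ^ (d - i)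
  exists_eq : ∃ i, 1 ≤ i ∧ i < d ∧ ‖ψ.coeff i‖ = r ^ (d - i)
  coeff_zero_le : ‖ψ.coeff 0‖ ≤ r

namespace BadRadius

variable {ψ : L[X]} {d : ℕ} {r : ℝ}

theorem norm_le_of_finiteOrbit (h : BadRadius ψ d r) {z : L}
    (hz : FiniteOrbit (fun z => ψ.eval z) z) : ‖z‖ ≤ r := by
  by_contra! hlt
  exact not_finiteOrbit_of_lt_norm h.monic h.natDegree_eq h.two_le h.one_lt.le h.coeff_le hlt
    (h.coeff_zero_le.trans hlt.le) hz

theorem backward (h : BadRadius ψ d r) {z : L} (hz : ‖ψ.eval z‖ ≤ r) : ‖z‖ ≤ r := by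
  by_contra! hlt
  rw [norm_eval_eq_pow h.monic h.natDegree_eq h.two_le h.one_lt.le h.coeff_le hlt
    (h.coeff_zero_le.trans hlt.le)] at hz
  have : ‖z‖ < ‖z‖ ^ d := lt_self_pow₀ (h.one_lt.trans hlt) (by linarith [h.two_le])
  linarith

theorem norm_root_le (h : BadRadius ψ d r) {c : L} (hc : ‖c‖ ≤ r) {β : L}
    (hβ : β ∈ (ψ - C c).roots) : ‖β‖ ≤ r := by
  have := isRoot_of_mem_roots hβ
  rw [IsRoot, eval_sub, eval_C, sub_eq_zero] at this
  exact h.backward (by rwa [this])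

theorem near (h : BadRadius ψ d r) {z : L} (hz : FiniteOrbit (fun z => ψ.eval z) z) (k : ℕ) :
    ‖(fun z => ψ.eval z)^[k] z - 0‖ ≤ r := by
  rw [sub_zero]
  exact h.norm_le_of_finiteOrbit (hz.iterate k)

open Classical in
/-- The number of zeros of `ψ` in the open disk of radius `r`. -/
def innerCard (ψ : L[X]) (r : ℝ) : ℕ := (ψ.roots.filter (· ∈ Metric.ball (0 : L) r)).card

variable [IsAlgClosed L]

-- On a circle slightly inside radius r one has |ψ(z) - c| ≥ |z|^d > r ≥ |c|, so |ψ(z)| does not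
-- feel c. Evaluating it through the roots of ψ - c and through those of ψ gives two monomials in
-- |z|/r < 1 that must have the same exponent.
open Classical in
theorem card_roots_inner (h : BadRadius ψ d r) {u : L} (hu0 : u ≠ 0) (hu1 : ‖u‖ < 1) {c : L}
    (hc : ‖c‖ ≤ r) :
    ((ψ - C c).roots.filter (· ∈ Metric.ball (0 : L) r)).card = innerCard ψ r := by
  have hr0 : 0 < r := one_pos.trans h.one_lt
  have hd2 := h.two_le
  obtain ⟨i, hi1, hid, hi⟩ := h.exists_eq
  obtain ⟨y, hy⟩ := IsAlgClosed.exists_pow_nat_eq (ψ.coeff i) (n := d - i) (by omega)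
  have hyr : ‖y‖ = r := by
    rw [← hy, norm_pow] at hi
    exact (pow_left_inj₀ (norm_nonneg _) hr0.le (by omega)).1 hi
  have hy0 : y ≠ 0 := by rw [← norm_pos_iff, hyr]; exact hr0
  obtain ⟨l₁, hl₁, h₁⟩ := exists_lt_forall_norm_le (ψ - C c).roots r
  obtain ⟨l₂, hl₂, h₂⟩ := exists_lt_forall_norm_le (ψ - C 0).roots r
  -- Choosing |z| above r^(1/d) ensures |z|^d > r.
  have hl₃ : r ^ ((d : ℝ)⁻¹) < r := by
    nth_rw 2 [← Real.rpow_one r]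
    apply Real.rpow_lt_rpow_of_exponent_lt h.one_lt
    apply inv_lt_one_of_one_lt₀
    exact_mod_cast hd2
  obtain ⟨z, hz1, hz2⟩ := exists_norm_between hu0 hu1 hy0 (lo := max (max l₁ l₂) (r ^ ((d : ℝ)⁻¹)))
    (by rw [hyr]; exact max_lt (max_lt hl₁ hl₂) hl₃)
  rw [hyr] at hz2
  have hz3 : r < ‖z‖ ^ d := by
    have e1 : r ^ ((d : ℝ)⁻¹) < ‖z‖ := (le_max_right _ _).trans_lt hz1
    have e2 := pow_lt_pow_left₀ e1 (by positivity) (n := d) (by omega)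
    rwa [Real.rpow_inv_natCast_pow hr0.le (by omega)] at e2
  have hz0 : 0 < ‖z‖ := lt_of_le_of_lt (by positivity) ((le_max_right _ _).trans_lt hz1)
  have hdeg : 0 < ψ.natDegree := by rw [h.natDegree_eq]; omega
  have key : ∀ c : L, ‖c‖ ≤ r → (∀ β ∈ (ψ - C c).roots, ‖β‖ < r → ‖β‖ < ‖z‖) →
      ‖ψ.eval z‖ = ‖z‖ ^ ((ψ - C c).roots.filter (· ∈ Metric.ball (0 : L) r)).card *
        r ^ (d - ((ψ - C c).roots.filter (· ∈ Metric.ball (0 : L) r)).card) ∧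
      ((ψ - C c).roots.filter (· ∈ Metric.ball (0 : L) r)).card ≤ d := by
    intro c hc hroots
    have e1 := norm_prod_sub_eq (fun β hβ => h.norm_root_le hc hβ) hz2 hroots
    rw [← eval_sub_eq_prod_roots h.monic hdeg, card_roots_sub_C_eq, h.natDegree_eq] at e1
    have e2 := Multiset.card_le_card
      (Multiset.filter_le (· ∈ Metric.ball (0 : L) r) (ψ - C c).roots)
    rw [card_roots_sub_C_eq, h.natDegree_eq] at e2
    refine ⟨?_, e2⟩
    rw [← e1]
    have e3 : ‖c‖ < ‖ψ.eval z - c‖ := by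
      rw [e1]
      refine hc.trans_lt (hz3.trans_le ?_)
      calc ‖z‖ ^ d = ‖z‖ ^ ((ψ - C c).roots.filter (· ∈ Metric.ball (0 : L) r)).card *
            ‖z‖ ^ (d - ((ψ - C c).roots.filter (· ∈ Metric.ball (0 : L) r)).card) := by
            rw [← pow_add]; congr 1; omega
        _ ≤ _ := by gcongr
    have e4 := IsUltrametricDist.norm_add_eq_max_of_norm_ne_norm e3.ne'
    rw [sub_add_cancel, max_eq_left e3.le] at e4
    exact e4
  have k1 := key c hc fun β hβ hβr => (h₁ β hβ hβr).trans_lt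
    (((le_max_left _ _).trans (le_max_left _ _)).trans_lt hz1)
  have k2 := key 0 (by simpa using hr0.le) fun β hβ hβr => (h₂ β hβ hβr).trans_lt
    (((le_max_right _ _).trans (le_max_left _ _)).trans_lt hz1)
  have hinner : innerCard ψ r = ((ψ - C 0).roots.filter (· ∈ Metric.ball (0 : L) r)).card := by
    rw [innerCard, C_0, sub_zero]
  rw [hinner]
  set m₁ := ((ψ - C c).roots.filter (· ∈ Metric.ball (0 : L) r)).card
  set m₂ := ((ψ - C 0).roots.filter (· ∈ Metric.ball (0 : L) r)).card
  have hq0 : 0 < ‖z‖ / r := by positivity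
  have hq1 : ‖z‖ / r < 1 := by rwa [div_lt_one hr0]
  have e5 : ∀ m ≤ d, ‖z‖ ^ m * r ^ (d - m) = (‖z‖ / r) ^ m * r ^ d := fun m hm => by
    rw [div_pow]
    have : r ^ d = r ^ m * r ^ (d - m) := by rw [← pow_add]; congr 1; omega
    rw [this]
    field_simp
  have e6 : (‖z‖ / r) ^ m₁ = (‖z‖ / r) ^ m₂ := by
    have := k1.1.symm.trans k2.1
    rw [e5 _ k1.2, e5 _ k2.2] at this
    exact mul_right_cancel₀ (by positivity) this
  exact pow_right_injective₀ hq0 hq1.ne e6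

/-- If all d zeros had norm at least r, the constant coefficient would have norm at least r^d > r.
-/
theorem innerCard_pos (h : BadRadius ψ d r) : 0 < innerCard ψ r := by
  classical
  rw [Nat.pos_iff_ne_zero]
  intro h0
  have h1 : ∀ β ∈ ψ.roots, r ≤ ‖β‖ := fun β hβ => by
    by_contra! hlt
    have : β ∈ ψ.roots.filter (· ∈ Metric.ball (0 : L) r) :=
      Multiset.mem_filter.2 ⟨hβ, by simpa using hlt⟩
    have h2 := Multiset.card_pos_iff_exists_mem.2 ⟨β, this⟩
    rw [innerCard] at h0
    refine h2.ne' ?_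
    convert h0
  have hd2 := h.two_le
  have hr1 := h.one_lt
  have h2 := eval_sub_eq_prod_roots h.monic (by rw [h.natDegree_eq]; omega) 0 0
  rw [C_0, sub_zero, sub_zero, ← coeff_zero_eq_eval_zero] at h2
  have h3 := Multiset.le_prod_map_of_forall_le ψ.roots (f := fun β => ‖0 - β‖) (r := r)
    (by linarith) (fun β hβ => by simpa using h1 β hβ)
  have h4 : ‖ψ.coeff 0‖ = (ψ.roots.map fun β => ‖0 - β‖).prod := by
    rw [h2, norm_multiset_prod, Multiset.map_map]
    rfl
  rw [← h4, IsAlgClosed.card_roots_eq_natDegree, h.natDegree_eq] at h3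
  have : r < r ^ d := lt_self_pow₀ hr1 (by omega)
  linarith [h.coeff_zero_le]

/-- If all zeros had norm below r, the elementary symmetric functions would be too small for any
coefficient to attain the bound r^(d - i). -/
theorem innerCard_lt (h : BadRadius ψ d r) : innerCard ψ r < d := by
  classical
  have hr1 := h.one_lt
  by_contra! hge
  have hcard : ψ.roots.card = d := by
    rw [IsAlgClosed.card_roots_eq_natDegree, h.natDegree_eq]
  have h1 : ψ.roots.filter (· ∈ Metric.ball (0 : L) r) = ψ.roots := by
    apply Multiset.eq_of_le_of_card_le (Multiset.filter_le _ _)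
    rw [hcard]
    refine hge.trans_eq ?_
    rw [innerCard]
  obtain ⟨lo, hlo, hlo'⟩ := exists_lt_forall_norm_le ψ.roots r
  have h2 : ∀ β ∈ ψ.roots, ‖β‖ ≤ max lo 0 := fun β hβ => by
    rw [← h1, Multiset.mem_filter] at hβ
    exact (hlo' β hβ.1 (by simpa using hβ.2)).trans (le_max_left _ _)
  obtain ⟨i, hi1, hid, hi⟩ := h.exists_eq
  have h3 := norm_coeff_prod_X_sub_C_le (le_max_right _ _) h2 i (by rw [hcard]; exact hid.le)
  rw [← (IsAlgClosed.splits ψ).eq_prod_roots_of_monic h.monic, hi, hcard] at h3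
  have h4 : max lo 0 ^ (d - i) < r ^ (d - i) :=
    pow_lt_pow_left₀ (max_lt hlo (by linarith)) (le_max_right _ _) (by omega)
  linarith

/-- The trivial splitting, with a single part. -/
def whole (h : BadRadius ψ d r) :
    Splitting ψ d d r r {z | FiniteOrbit (fun z => ψ.eval z) z} where
  U := Metric.closedBall 0 r
  c₀ := 0
  W := Set.univ
  backward z hz := by simpa using h.backward (by simpa using hz)
  base_mem := by simpa using (one_pos.trans h.one_lt).le
  card_roots c hc := by
    rw [← h.natDegree_eq, ← card_roots_sub_C_eq c]
    congr 1
    exact @Multiset.filter_eq_self L _ (fun _ => Classical.propDecidable _) _ |>.2 (by simp)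
  far x hx β hβ hβW := absurd (Set.mem_univ β) hβW
  near x hx k := h.near hx k

/-- The part of the filled Julia set in the open disk of radius `r`. -/
def inner (h : BadRadius ψ d r) {u : L} (hu0 : u ≠ 0) (hu1 : ‖u‖ < 1) :
    Splitting ψ d (innerCard ψ r) r r {z | FiniteOrbit (fun z => ψ.eval z) z ∧ ‖z‖ < r} where
  U := Metric.closedBall 0 r
  c₀ := 0
  W := Metric.ball 0 r
  backward z hz := by simpa using h.backward (by simpa using hz)
  base_mem := by simpa using (one_pos.trans h.one_lt).le
  card_roots c hc := h.card_roots_inner hu0 hu1 (by simpa using hc)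
  far x hx β hβ hβW := by
    have h1 : ‖β‖ ≤ r := h.backward (by simpa using hβ)
    have h2 : r ≤ ‖β‖ := by simpa using hβW
    rw [norm_sub_of_norm_lt (hx.2.trans_le h2)]
    exact h2
  near x hx k := h.near hx.1 k

/-- The part of the filled Julia set outside the open disk of radius `r`. -/
def outer (h : BadRadius ψ d r) {u : L} (hu0 : u ≠ 0) (hu1 : ‖u‖ < 1) :
    Splitting ψ d (d - innerCard ψ r) r r
      {z | FiniteOrbit (fun z => ψ.eval z) z ∧ ¬ ‖z‖ < r} where
  U := Metric.closedBall 0 r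
  c₀ := 0
  W := (Metric.ball 0 r)ᶜ
  backward z hz := by simpa using h.backward (by simpa using hz)
  base_mem := by simpa using (one_pos.trans h.one_lt).le
  card_roots c hc := by
    classical
    have h1 := congrArg Multiset.card
      (Multiset.filter_add_not (· ∈ Metric.ball (0 : L) r) (ψ - C c).roots)
    have h2 := h.card_roots_inner hu0 hu1 (c := c) (by simpa using hc)
    have h3 : (Multiset.filter (· ∈ Metric.ball (0 : L) r) (ψ - C c).roots).card =
      innerCard ψ r := by convert h2
    rw [Multiset.card_add, card_roots_sub_C_eq, h.natDegree_eq, h3] at h1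
    have h4 : (Multiset.filter (· ∈ (Metric.ball (0 : L) r)ᶜ) (ψ - C c).roots).card =
      (Multiset.filter (¬ · ∈ Metric.ball (0 : L) r) (ψ - C c).roots).card := by
      congr 1
    refine Eq.trans ?_ (h4.trans (Nat.eq_sub_of_add_eq' h1))
    congr!
  far x hx β hβ hβW := by
    have h1 : ‖β‖ < r := by simpa using hβW
    have h2 : r ≤ ‖x‖ := not_lt.1 hx.2
    rw [norm_sub_rev, norm_sub_of_norm_lt (h1.trans_le h2)]
    exact h2
  near x hx k := h.near hx.1 k

end BadRadius

/-- The radius is the maximum of |a_i|^(1/(d - i)) over 0 < i < d. Were it at most 1, the finite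
orbit of 0 would make the constant coefficient integral too, and with it the whole polynomial. -/
theorem exists_badRadius {φ : L[X]} {d : ℕ} (hφ : φ.natDegree = d) (hd : 2 ≤ d) {x₀ a : L}
    (hx₀ : FiniteOrbit (fun z => φ.eval z) x₀) (ha : a ^ (d - 1) * φ.leadingCoeff = 1)
    (hbad : ¬ ∀ i, ‖(affineConj φ a x₀).coeff i‖ ≤ 1) : ∃ r, BadRadius (affineConj φ a x₀) d r := by
  have ha0 : a ≠ 0 := by
    rintro rfl
    rw [zero_pow (by omega), zero_mul] at ha
    exact zero_ne_one ha
  set ψ := affineConj φ a x₀ with hψ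
  have hm : ψ.Monic := monic_affineConj ha0 (by omega) (by rwa [hφ])
  have hψd : ψ.natDegree = d := by rw [hψ, natDegree_affineConj ha0, hφ]
  have h0 : FiniteOrbit (fun z => ψ.eval z) 0 := by
    have := finiteOrbit_affineConj (x₀ := x₀) ha0 hx₀
    rwa [sub_self, zero_div] at this
  obtain ⟨j, hj, hmax⟩ := Finset.exists_max_image (Finset.Ico 1 d)
    (fun i => ‖ψ.coeff i‖ ^ (((d - i : ℕ) : ℝ)⁻¹)) ⟨1, Finset.mem_Ico.2 (by omega)⟩
  rw [Finset.mem_Ico] at hj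
  set r := ‖ψ.coeff j‖ ^ (((d - j : ℕ) : ℝ)⁻¹) with hr
  have hr0 : 0 ≤ r := by positivity
  have hle : ∀ i, 1 ≤ i → i < d → ‖ψ.coeff i‖ ≤ r ^ (d - i) := fun i h1 h2 => by
    have := pow_le_pow_left₀ (by positivity) (hmax i (Finset.mem_Ico.2 ⟨h1, h2⟩)) (d - i)
    rwa [Real.rpow_inv_natCast_pow (norm_nonneg _) (by omega)] at this
  have hr1 : 1 < r := by
    by_contra! hle1
    have hb : ∀ i, 1 ≤ i → i < d → ‖ψ.coeff i‖ ≤ 1 ^ (d - i) := fun i h1 h2 =>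
      (hle i h1 h2).trans (pow_le_pow_left₀ hr0 hle1 _)
    refine hbad fun i => ?_
    rcases Nat.eq_zero_or_pos i with rfl | hi0
    · exact norm_coeff_zero_le_of_finiteOrbit hm hψd hd le_rfl hb h0
    · rcases lt_trichotomy i d with hid | rfl | hid
      · simpa using hb i hi0 hid
      · have : ψ.coeff i = 1 := by rw [← hψd]; exact hm
        rw [this, norm_one]
      · rw [coeff_eq_zero_of_natDegree_lt (by omega), norm_zero]
        exact zero_le_one
  exact ⟨r, hm, hψd, hd, hr1, hle,
    ⟨j, hj.1, hj.2, by rw [hr, Real.rpow_inv_natCast_pow (norm_nonneg _) (by omega)]⟩,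
    norm_coeff_zero_le_of_finiteOrbit hm hψd hd hr1.le hle h0⟩

end Nonarch

/-- The sum of the logarithms of the normalized mutual distances of a tuple of points: each
distance, measured by `v`, is multiplied by `exp A`. -/
def normPairLog {K : Type*} [Sub K] (v : K → ℝ) (A : ℝ) {N : ℕ} (x : Fin N → K) : ℝ :=
  ∑ i, ∑ j ∈ Finset.Ioi i, (Real.log (v (x j - x i)) + A)

/-- From a^(d - 1) lc = 1 one gets log |lc|/(d - 1) = -log |a|. The shift thus passes to a
coordinate in which the polynomial is monic, but is expressed by the leading coefficient alone, so
that the product formula cancels it globally even where a is not in `K`. -/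
theorem normPairLog_eq_pairLog {L : Type*} [NormedField L] {a x₀ lc : L} {d : ℕ} (hd : 2 ≤ d)
    (ha : a ^ (d - 1) * lc = 1) {N : ℕ} {x : Fin N → L} (hx : Function.Injective x) :
    normPairLog (fun z : L => ‖z‖) (Real.log ‖lc‖ / (d - 1)) x =
      pairLog fun i => (x i - x₀) / a := by
  have ha0 : a ≠ 0 := by
    rintro rfl
    rw [zero_pow (by omega), zero_mul] at ha
    exact zero_ne_one ha
  have hlc : lc ≠ 0 := by rintro rfl; simp at ha
  have h1 : Real.log ‖lc‖ / (d - 1) = - Real.log ‖a‖ := by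
    have h2 := congrArg (fun z => Real.log ‖z‖) ha
    simp only [norm_mul, norm_pow, norm_one, Real.log_one] at h2
    rw [Real.log_mul (pow_ne_zero _ (norm_ne_zero_iff.2 ha0)) (norm_ne_zero_iff.2 hlc),
      Real.log_pow, Nat.cast_sub (by omega), Nat.cast_one] at h2
    have : (0 : ℝ) < d - 1 := by
      have : (2 : ℝ) ≤ d := by exact_mod_cast hd
      linarith
    rw [div_eq_iff this.ne']
    linarith
  rw [normPairLog, pairLog, h1]
  refine Finset.sum_congr rfl fun i _ => Finset.sum_congr rfl fun j hj => ?_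
  have hne : x j - x i ≠ 0 := sub_ne_zero.2 fun h => (Finset.mem_Ioi.1 hj).ne' (hx h)
  rw [← sub_div, sub_sub_sub_cancel_right, norm_div,
    Real.log_div (norm_ne_zero_iff.2 hne) (norm_ne_zero_iff.2 ha0)]
  ring

/-- The bound at a non-archimedean place of bad reduction: on the whole filled Julia set, and on
each of the two parts into which it splits. -/
theorem nonarch_bad_bound {L : Type*} [NormedField L] [IsUltrametricDist L] [IsAlgClosed L]
    (hL : ∃ u : L, u ≠ 0 ∧ ‖u‖ < 1) {φ : L[X]} {d : ℕ} (hφ : φ.natDegree = d) (hd : 2 ≤ d) {x₀ : L}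
    (hx₀ : FiniteOrbit (fun z => φ.eval z) x₀)
    (hbad : ∀ a : L, a ^ (d - 1) * φ.leadingCoeff = 1 →
      ¬ ∀ i, ‖(affineConj φ a x₀).coeff i‖ ≤ 1) :
    ∃ r : ℝ, 1 < r ∧
      (∃ i, 1 ≤ i ∧ i < d ∧
        r ^ ((d - 1) * (d - i)) * ‖φ.leadingCoeff‖ ^ (i - 1) = ‖(taylor x₀ φ).coeff i‖ ^ (d - 1)) ∧
      ∃ (m : ℕ) (W : Set L), 0 < m ∧ m < d ∧ ∀ {N : ℕ} (x : Fin N → L), Function.Injective x →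
        (∀ i, FiniteOrbit (fun z => φ.eval z) (x i)) →
        2 * normPairLog (fun z : L => ‖z‖) (Real.log ‖φ.leadingCoeff‖ / (d - 1)) x ≤
          Real.log r * ((d - 1) * (N * Real.logb d N)) ∧
        ((∀ i, x i ∈ W) →
          2 * normPairLog (fun z : L => ‖z‖) (Real.log ‖φ.leadingCoeff‖ / (d - 1)) x ≤
          Real.log r * ((d - 1) * (N * Real.logb d N)) -
            (d - m) / m * (N * (N - m)) * Real.log r) ∧
        ((∀ i, x i ∉ W) →
          2 * normPairLog (fun z : L => ‖z‖) (Real.log ‖φ.leadingCoeff‖ / (d - 1)) x ≤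
          Real.log r * ((d - 1) * (N * Real.logb d N)) -
            (d - (d - m : ℕ)) / (d - m : ℕ) * (N * (N - (d - m : ℕ))) * Real.log r) := by
  have hlc : φ.leadingCoeff ≠ 0 := by
    rw [Ne, leadingCoeff_eq_zero]
    rintro rfl
    rw [natDegree_zero] at hφ
    omega
  obtain ⟨u, hu0, hu1⟩ := hL
  obtain ⟨a, ha⟩ := IsAlgClosed.exists_pow_nat_eq (φ.leadingCoeff)⁻¹ (n := d - 1) (by omega)
  have ha' : a ^ (d - 1) * φ.leadingCoeff = 1 := by rw [ha, inv_mul_cancel₀ hlc]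
  have ha0 : a ≠ 0 := by
    rintro rfl
    rw [zero_pow (by omega), zero_mul] at ha'
    exact zero_ne_one ha'
  obtain ⟨r, hr⟩ := exists_badRadius hφ hd hx₀ ha' (hbad a ha')
  set ψ := affineConj φ a x₀ with hψ
  refine ⟨r, hr.one_lt, ?_, BadRadius.innerCard ψ r, {x | ‖(x - x₀) / a‖ < r}, hr.innerCard_pos,
    hr.innerCard_lt, fun {N} x hx hfin => ?_⟩
  -- Raising to the power d - 1 eliminates a. The relation ties r to absolute values of Taylor
  -- coefficients; over `K` it later shows that a large residue field forces a large radius.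
  · obtain ⟨i, hi1, hid, hi⟩ := hr.exists_eq
    refine ⟨i, hi1, hid, ?_⟩
    rw [hψ, coeff_affineConj ha0 (by omega), norm_mul, norm_pow] at hi
    have h1 : ‖a‖ ^ (d - 1) * ‖φ.leadingCoeff‖ = 1 := by rw [← norm_pow, ← norm_mul, ha', norm_one]
    calc r ^ ((d - 1) * (d - i)) * ‖φ.leadingCoeff‖ ^ (i - 1)
        = (r ^ (d - i)) ^ (d - 1) * ‖φ.leadingCoeff‖ ^ (i - 1) := by
          rw [← pow_mul, mul_comm (d - 1)]
      _ = ‖(taylor x₀ φ).coeff i‖ ^ (d - 1) *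
            (‖a‖ ^ (d - 1) * ‖φ.leadingCoeff‖) ^ (i - 1) := by rw [← hi]; ring
      _ = _ := by rw [h1, one_pow, mul_one]
  · have hz : Function.Injective fun i => (x i - x₀) / a := fun i j hij => by
      apply hx
      have := (div_left_inj' ha0).1 hij
      exact sub_left_inj.1 this
    have hzf : ∀ i, FiniteOrbit (fun z => ψ.eval z) ((x i - x₀) / a) := fun i =>
      finiteOrbit_affineConj ha0 (hfin i)
    rw [normPairLog_eq_pairLog (x₀ := x₀) hd ha' hx]
    have hdet : ∀ (M : Matrix (Fin N) (Fin N) L) (ρ : ℕ → ℝ), (∀ n, 0 < ρ n) →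
      (∀ i j, ‖M i j‖ ≤ ρ j) → ‖M.det‖ ≤ 1 * ∏ n ∈ Finset.range N, ρ n :=
      fun M ρ hρ hM => norm_det_le_of_ultrametric hρ hM
    have hr1 := hr.one_lt.le
    refine ⟨?_, fun hW => ?_, fun hW => ?_⟩
    · have := hr.whole.pairLog_le hr.monic hr.natDegree_eq hd (by omega) le_rfl hr1 hr1 hz hzf
        one_pos hdet
      simpa using this
    · have := (hr.inner hu0 hu1).pairLog_le hr.monic hr.natDegree_eq hd hr.innerCard_pos
        hr.innerCard_lt.le hr1 hr1 hz (fun i => ⟨hzf i, hW i⟩) one_pos hdet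
      rwa [Real.log_one, mul_zero, zero_add] at this
    · have := (hr.outer hu0 hu1).pairLog_le hr.monic hr.natDegree_eq hd
        (Nat.sub_pos_of_lt hr.innerCard_lt) (Nat.sub_le _ _) hr1 hr1 hz
        (fun i => ⟨hzf i, hW i⟩) one_pos hdet
      rwa [Real.log_one, mul_zero, zero_add] at this

noncomputable section

/-! ### Good reduction -/

section Reduction

theorem eval_map_comp {R S σ : Type*} [CommSemiring R] [CommSemiring S] (f : R →+* S) (z : σ → R)
    (p : MvPolynomial σ R) :
    MvPolynomial.eval (fun i => f (z i)) (p.map f) = f (MvPolynomial.eval z p) := by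
  have h : (MvPolynomial.eval fun i => f (z i)).comp (MvPolynomial.map f) =
      f.comp (MvPolynomial.eval z) := MvPolynomial.ringHom_ext (by simp) (by simp)
  exact RingHom.congr_fun h p

theorem eval_map_homogenization {R S : Type*} [CommSemiring R] [CommSemiring S] (f : R →+* S)
    (b : ℕ → R) (d : ℕ) (z : Fin 2 → S) :
    MvPolynomial.eval z (MvPolynomial.map f (∑ i ∈ Finset.range (d + 1),
      MvPolynomial.C (b i) * MvPolynomial.X 0 ^ i * MvPolynomial.X 1 ^ (d - i) :
        MvPolynomial (Fin 2) R)) =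
      ∑ i ∈ Finset.range (d + 1), f (b i) * z 0 ^ i * z 1 ^ (d - i) := by
  simp

variable {C : Type*} [NormedField C]

/-- The homogeneous lift to the affine plane of a polynomial map. -/
def planeLift (φ : C[X]) (w : Fin 2 → C) : Fin 2 → C :=
  ![∑ i ∈ Finset.range (φ.natDegree + 1), φ.coeff i * w 0 ^ i * w 1 ^ (φ.natDegree - i),
    w 1 ^ φ.natDegree]

theorem eval_homogeneousPresentation (φ : C[X]) (w : Fin 2 → C) (i : Fin 2) :
    MvPolynomial.eval w (homogeneousPresentation φ i) = planeLift φ w i := by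
  fin_cases i <;> simp [homogeneousPresentation, planeLift]

theorem eval_conjPresentation (A : GL (Fin 2) C) (φ : C[X]) (w : Fin 2 → C) :
    (fun i => MvPolynomial.eval w (conjPresentation A (homogeneousPresentation φ) i)) =
      ((A⁻¹ : GL (Fin 2) C) : Matrix (Fin 2) (Fin 2) C).mulVec
        (planeLift φ ((A : Matrix (Fin 2) (Fin 2) C).mulVec w)) := by
  ext i
  rw [conjPresentation, map_sum, Matrix.mulVec, dotProduct]
  refine Finset.sum_congr rfl fun j _ => ?_
  rw [map_mul, MvPolynomial.eval_C]
  congr 1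
  rw [← eval_homogeneousPresentation]
  have h : (MvPolynomial.eval w).comp (MvPolynomial.aeval (R := C) fun k =>
      ∑ l, MvPolynomial.C (A k l) * MvPolynomial.X l).toRingHom =
      MvPolynomial.eval ((A : Matrix (Fin 2) (Fin 2) C).mulVec w) := by
    apply MvPolynomial.ringHom_ext
    · intro r
      simp
    · intro k
      fin_cases k <;> simp
  exact RingHom.congr_fun h _

theorem planeLift_smul (φ : C[X]) (t : C) (w : Fin 2 → C) :
    planeLift φ (t • w) = t ^ φ.natDegree • planeLift φ w := by
  ext i
  fin_cases i
  · simp only [planeLift, Fin.zero_eta, Matrix.cons_val_zero, Pi.smul_apply, smul_eq_mul,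
      Finset.mul_sum]
    refine Finset.sum_congr rfl fun i hi => ?_
    have : t ^ φ.natDegree = t ^ i * t ^ (φ.natDegree - i) := by
      rw [← pow_add]; congr 1; have := Finset.mem_range.1 hi; omega
    rw [this]
    ring
  · simp [planeLift, mul_pow]

theorem planeLift_one (φ : C[X]) (x : C) : planeLift φ ![x, 1] = ![φ.eval x, 1] := by
  ext i
  fin_cases i
  · simp [planeLift, eval_eq_sum_range]
  · simp [planeLift]

theorem planeLift_infty (φ : C[X]) (hd : 0 < φ.natDegree) :
    planeLift φ ![1, 0] = φ.leadingCoeff • ![1, 0] := by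
  ext i
  fin_cases i
  · simp only [planeLift, Fin.zero_eta, Matrix.cons_val_zero, Finset.sum_range_succ]
    rw [Finset.sum_eq_zero fun i hi => ?_]
    · simp
    · have := Finset.mem_range.1 hi
      simp [zero_pow (Nat.sub_ne_zero_of_lt this)]
  · simp [planeLift, hd.ne']

/-- The sup norm on the plane. -/
theorem norm_fin_two (w : Fin 2 → C) : ‖w‖ = max ‖w 0‖ ‖w 1‖ := by
  apply le_antisymm
  · rw [pi_norm_le_iff_of_nonneg (le_max_of_le_left (norm_nonneg _))]
    intro i
    fin_cases i
    · exact le_max_left _ _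
    · exact le_max_right _ _
  · exact max_le (norm_le_pi_norm w 0) (norm_le_pi_norm w 1)

theorem planeLift_eq {φ : C[X]} (w : Fin 2 → C) (hw : w 1 ≠ 0) :
    planeLift φ w 0 = w 1 ^ φ.natDegree * φ.eval (w 0 / w 1) := by
  have h1 : w = w 1 • ![w 0 / w 1, 1] := by
    ext i; fin_cases i
    · simp [mul_div_cancel₀ _ hw]
    · simp
  conv_lhs => rw [h1]
  rw [planeLift_smul, planeLift_one]
  simp

/-- Polynomials over an infinite field are determined by their values. Off the line w 1 = 0 the
claim is the affine conjugation identity, on that line a comparison of leading coefficients. -/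
theorem conjPresentation_eq [Infinite C] {φ : C[X]} (hd : 0 < φ.natDegree) {a x₀ : C} (ha : a ≠ 0)
    {A : GL (Fin 2) C} (hA : (A : Matrix (Fin 2) (Fin 2) C) = !![a, x₀; 0, 1])
    (hA' : ((A⁻¹ : GL (Fin 2) C) : Matrix (Fin 2) (Fin 2) C) = !![a⁻¹, -(a⁻¹ * x₀); 0, 1]) :
    conjPresentation A (homogeneousPresentation φ) =
      homogeneousPresentation (affineConj φ a x₀) := by
  have hdeg : (affineConj φ a x₀).natDegree = φ.natDegree := natDegree_affineConj ha
  ext1 i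
  apply MvPolynomial.funext
  intro w
  rw [congrFun (eval_conjPresentation A φ w) i, eval_homogeneousPresentation, hA, hA']
  have hw : Matrix.mulVec !![a, x₀; 0, 1] w = ![a * w 0 + x₀ * w 1, w 1] := by
    ext j; fin_cases j <;> simp [Matrix.mulVec, dotProduct, Fin.sum_univ_two]
  rw [hw]
  have h1 : ∀ v : Fin 2 → C, planeLift φ v 1 = v 1 ^ φ.natDegree := fun v => by simp [planeLift]
  fin_cases i
  · change a⁻¹ * _ + (-(a⁻¹ * x₀) * _ + 0) = planeLift (affineConj φ a x₀) w 0
    change a⁻¹ * planeLift φ ![a * w 0 + x₀ * w 1, w 1] 0 + (-(a⁻¹ * x₀) *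
      planeLift φ ![a * w 0 + x₀ * w 1, w 1] 1 + 0) = planeLift (affineConj φ a x₀) w 0
    rw [h1]
    by_cases hw1 : w 1 = 0
    · have h2 : ∀ (ψ : C[X]) (t : C), 0 < ψ.natDegree →
          planeLift ψ ![t, 0] 0 = ψ.leadingCoeff * t ^ ψ.natDegree := fun ψ t hψ => by
        have : ![t, (0 : C)] = t • ![1, 0] := by ext i; fin_cases i <;> simp
        rw [this, planeLift_smul, planeLift_infty ψ hψ]
        simp [mul_comm]
      have h3 : w = ![w 0, 0] := by ext i; fin_cases i <;> simp [hw1]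
      have h4 : planeLift (affineConj φ a x₀) w 0 =
          (affineConj φ a x₀).leadingCoeff * w 0 ^ φ.natDegree := by
        conv_lhs => rw [h3]
        rw [h2 _ _ (by rwa [hdeg]), hdeg]
      rw [h4, hw1, mul_zero, add_zero, h2 _ _ hd]
      have h5 : (affineConj φ a x₀).leadingCoeff = a ^ (φ.natDegree - 1) * φ.leadingCoeff := by
        rw [leadingCoeff, hdeg, coeff_affineConj ha hd.ne', coeff_taylor_natDegree]
      rw [h5]
      have h6 : a ^ φ.natDegree = a ^ (φ.natDegree - 1) * a := by
        rw [← pow_succ]; congr 1; omega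
      simp only [Matrix.cons_val_one, Matrix.cons_val_fin_one, zero_pow hd.ne', mul_pow, h6]
      field_simp
      ring
    · rw [planeLift_eq _ (by simpa using hw1), planeLift_eq _ hw1, hdeg]
      have h2 : (a * w 0 + x₀ * w 1) / w 1 = a * (w 0 / w 1) + x₀ := by field_simp
      simp only [Matrix.cons_val_zero, Matrix.cons_val_one, Matrix.cons_val_fin_one]
      rw [h2, ← eval_affineConj ha]
      field_simp
      ring
  · change (0 : C) * _ + (1 * planeLift φ ![a * w 0 + x₀ * w 1, w 1] 1 + 0) =
      planeLift (affineConj φ a x₀) w 1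
    rw [h1]
    simp [planeLift, hdeg]

variable [IsUltrametricDist C]

theorem mem_valuationSubring_iff_norm_le_one {F : Type*} [NormedField F] [IsUltrametricDist F]
    {x : F} : x ∈ (NormedField.valuation (K := F)).valuationSubring ↔ ‖x‖ ≤ 1 := by
  rw [Valuation.mem_valuationSubring_iff, NormedField.valuation_apply, ← NNReal.coe_le_coe,
    coe_nnnorm, NNReal.coe_one]

theorem residue_eq_zero_iff_norm_lt_one {F : Type*} [NormedField F] [IsUltrametricDist F]
    (x : (NormedField.valuation (K := F)).valuationSubring) :
    IsLocalRing.residue _ x = 0 ↔ ‖(x : F)‖ < 1 := by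
  rw [IsLocalRing.residue_eq_zero_iff, IsLocalRing.mem_maximalIdeal, mem_nonunits_iff]
  have hx : ‖(x : F)‖ ≤ 1 := mem_valuationSubring_iff_norm_le_one.1 x.2
  constructor
  · intro h
    refine lt_of_le_of_ne hx fun h1 => h ?_
    have hx0 : (x : F) ≠ 0 := by rw [← norm_ne_zero_iff, h1]; exact one_ne_zero
    refine IsUnit.of_mul_eq_one ⟨(x : F)⁻¹, mem_valuationSubring_iff_norm_le_one.2 ?_⟩ ?_
    · rw [norm_inv, h1, inv_one]
    · exact Subtype.ext (mul_inv_cancel₀ hx0)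
  · rintro h hu
    obtain ⟨y, hy⟩ := hu.exists_right_inv
    have h1 : ‖(x : F)‖ * ‖(y : F)‖ = 1 := by
      rw [← norm_mul]
      have := congrArg (fun z : (NormedField.valuation (K := F)).valuationSubring => ‖(z : F)‖) hy
      simpa using this
    have h2 : ‖(y : F)‖ ≤ 1 := mem_valuationSubring_iff_norm_le_one.1 y.2
    nlinarith [norm_nonneg (x : F)]

/-- A vector of norm 1 has nonzero reduction, which the reduced forms do not send to 0; so its
image, scaled by c, has norm exactly 1. Homogeneity extends this to all vectors. -/
theorem exists_norm_eq_pow_of_goodReduction {φ : C[X]} (hd : 0 < φ.natDegree) {A : GL (Fin 2) C}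
    (h : GoodReduction (conjPresentation A (homogeneousPresentation φ))) :
    ∃ c : C, c ≠ 0 ∧ ∀ w : Fin 2 → C,
      ‖c‖ * ‖((A⁻¹ : GL (Fin 2) C) : Matrix (Fin 2) (Fin 2) C).mulVec
        (planeLift φ ((A : Matrix (Fin 2) (Fin 2) C).mulVec w))‖ = ‖w‖ ^ φ.natDegree := by
  obtain ⟨c, hc, G, hG, -, hz⟩ := h
  refine ⟨c, hc, ?_⟩
  set E : (Fin 2 → C) → (Fin 2 → C) := fun w =>
    ((A⁻¹ : GL (Fin 2) C) : Matrix (Fin 2) (Fin 2) C).mulVec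
        (planeLift φ ((A : Matrix (Fin 2) (Fin 2) C).mulVec w)) with hE
  have hEs : ∀ (t : C) w, E (t • w) = t ^ φ.natDegree • E w := fun t w => by
    simp only [hE, Matrix.mulVec_smul, planeLift_smul]
  have key : ∀ w : Fin 2 → C, ‖w‖ = 1 → ‖c‖ * ‖E w‖ = 1 := by
    intro w hw
    let z : Fin 2 → (NormedField.valuation (K := C)).valuationSubring := fun i =>
      ⟨w i, mem_valuationSubring_iff_norm_le_one.2 (hw ▸ norm_le_pi_norm w i)⟩
    have h1 : ∀ i, algebraMap _ C (MvPolynomial.eval z (G i)) = c * E w i := fun i => by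
      have e1 : algebraMap _ C (MvPolynomial.eval z (G i)) =
          MvPolynomial.eval w ((G i).map (algebraMap _ C)) := by
        exact (eval_map_comp _ z (G i)).symm
      rw [e1, hG, map_mul, MvPolynomial.eval_C]
      exact congrArg (c * ·) (congrFun (eval_conjPresentation A φ w) i)
    have h2 : ∀ i, ‖c * E w i‖ ≤ 1 := fun i => by
      rw [← h1]
      exact mem_valuationSubring_iff_norm_le_one.1 (MvPolynomial.eval z (G i)).2
    have h3 : ∃ i, 1 ≤ ‖c * E w i‖ := by
      by_contra! hlt
      have h4 := hz (fun i => IsLocalRing.residue _ (z i)) fun i => by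
        have e2 : MvPolynomial.eval (fun i => IsLocalRing.residue _ (z i))
            ((G i).map (IsLocalRing.residue _)) =
            IsLocalRing.residue _ (MvPolynomial.eval z (G i)) := by
          exact eval_map_comp _ z (G i)
        rw [e2, residue_eq_zero_iff_norm_lt_one]
        have := hlt i
        rwa [← h1] at this
      have h5 : ∀ i, ‖w i‖ < 1 := fun i =>
        (residue_eq_zero_iff_norm_lt_one (z i)).1 (congrFun h4 i)
      have := norm_fin_two w
      rw [hw] at this
      exact absurd this (max_lt (h5 0) (h5 1)).ne'
    obtain ⟨i, hi⟩ := h3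
    have h6 : ‖c‖ * ‖E w‖ = ‖c • E w‖ := (norm_smul _ _).symm
    rw [h6]
    apply le_antisymm
    · rw [pi_norm_le_iff_of_nonneg zero_le_one]
      exact fun j => by simpa using h2 j
    · exact hi.trans (by simpa using norm_le_pi_norm (c • E w) i)
  intro w
  by_cases hw : w = 0
  · subst hw
    have := hEs 0 0
    rw [smul_zero, zero_pow hd.ne', zero_smul] at this
    change ‖c‖ * ‖E 0‖ = _
    rw [this, norm_zero, mul_zero, zero_pow hd.ne']
  · obtain ⟨i, hi⟩ : ∃ i, ‖w i‖ = ‖w‖ := by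
      have := norm_fin_two w
      rcases max_choice ‖w 0‖ ‖w 1‖ with h | h
      · exact ⟨0, by rw [this, h]⟩
      · exact ⟨1, by rw [this, h]⟩
    have hw0 : 0 < ‖w‖ := norm_pos_iff.2 hw
    have hwi : w i ≠ 0 := by rw [← norm_pos_iff, hi]; exact hw0
    have h1 := key ((w i)⁻¹ • w) (by rw [norm_smul, norm_inv, hi, inv_mul_cancel₀ hw0.ne'])
    have h2 : w = w i • ((w i)⁻¹ • w) := by rw [smul_smul, mul_inv_cancel₀ hwi, one_smul]
    change ‖c‖ * ‖E w‖ = _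
    have h3 : ‖E w‖ = ‖w‖ ^ φ.natDegree * ‖E ((w i)⁻¹ • w)‖ := by
      conv_lhs => rw [h2]
      rw [hEs, norm_smul, norm_pow, hi]
    rw [h3, mul_left_comm, h1, mul_one]

/-- Potentially good reduction bounds the mutual distances of points with finite orbits. -/
theorem norm_sub_pow_mul_le_one {φ : C[X]} {d : ℕ} (hφ : φ.natDegree = d) (hd : 2 ≤ d)
    (h : PotentiallyGoodReduction φ) {x y : C} (hx : FiniteOrbit (fun z => φ.eval z) x)
    (hy : FiniteOrbit (fun z => φ.eval z) y) :
    ‖x - y‖ ^ (d - 1) * ‖φ.leadingCoeff‖ ≤ 1 := by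
  obtain ⟨A, hA⟩ := h
  obtain ⟨c, hc, hE⟩ := exists_norm_eq_pow_of_goodReduction (by omega) hA
  rw [hφ] at hE
  have hc0 : 0 < ‖c‖ := norm_pos_iff.2 hc
  set B : Matrix (Fin 2) (Fin 2) C := ((A⁻¹ : GL (Fin 2) C) : Matrix (Fin 2) (Fin 2) C) with hB
  set A' : Matrix (Fin 2) (Fin 2) C := (A : Matrix (Fin 2) (Fin 2) C) with hA'
  have hAB : A' * B = 1 := by
    rw [hA', hB, ← Matrix.GeneralLinearGroup.coe_mul, mul_inv_cancel,
      Matrix.GeneralLinearGroup.coe_one]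
  have hABv : ∀ w, A'.mulVec (B.mulVec w) = w := fun w => by
    rw [Matrix.mulVec_mulVec, hAB, Matrix.one_mulVec]
  -- In the twisted norm h(w) = ‖B w‖ the homogeneous lift F of φ satisfies |c| h(F w) = h(w)^d.
  have hn : ∀ w, ‖c‖ * ‖B.mulVec (planeLift φ w)‖ = ‖B.mulVec w‖ ^ d := fun w => by
    have := hE (B.mulVec w)
    rwa [hABv] at this
  have hinj : ∀ w, w ≠ 0 → 0 < ‖B.mulVec w‖ := fun w hw => by
    rw [norm_pos_iff]
    intro h0
    have := hABv w
    rw [h0, Matrix.mulVec_zero] at this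
    exact hw this.symm
  have hdd : d = (d - 1) + 1 := by omega
  -- Infinity is fixed: F maps (1, 0) to its multiple by the leading coefficient.
  have he : ‖B.mulVec ![1, 0]‖ ^ (d - 1) = ‖c‖ * ‖φ.leadingCoeff‖ := by
    have h1 := hn ![1, 0]
    rw [planeLift_infty φ (by omega), Matrix.mulVec_smul, norm_smul, ← mul_assoc] at h1
    have h2 := hinj ![1, 0] (fun h => by simpa using congrFun h 0)
    rw [hdd, pow_succ] at h1
    exact (mul_right_cancel₀ h2.ne' h1).symm
  -- If h(x, 1)^(d - 1) exceeded |c|, then h would strictly increase along the orbit.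
  have horb : ∀ x : C, FiniteOrbit (fun z => φ.eval z) x →
      ‖B.mulVec ![x, 1]‖ ^ (d - 1) ≤ ‖c‖ := by
    intro x hx
    by_contra! hlt
    refine not_finiteOrbit_of_increasing (P := fun z => ‖c‖ < ‖B.mulVec ![z, 1]‖ ^ (d - 1))
      (g := fun z => ‖B.mulVec ![z, 1]‖) (fun z hz => ?_) hlt hx
    have h1 := hn ![z, 1]
    rw [planeLift_one] at h1
    have h2 := hinj ![z, 1] (fun h => by simpa using congrFun h 1)
    have h3 : ‖B.mulVec ![z, 1]‖ < ‖B.mulVec ![φ.eval z, 1]‖ := by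
      rw [hdd, pow_succ] at h1
      by_contra! hle
      have h4 : ‖c‖ * ‖B.mulVec ![φ.eval z, 1]‖ ≤ ‖c‖ * ‖B.mulVec ![z, 1]‖ := by gcongr
      have h5 : ‖c‖ * ‖B.mulVec ![z, 1]‖ < ‖B.mulVec ![z, 1]‖ ^ (d - 1) * ‖B.mulVec ![z, 1]‖ := by
        gcongr
      linarith
    exact ⟨hz.trans_le (pow_le_pow_left₀ h2.le h3.le _), h3⟩
  -- The ultrametric inequality for (x - y)(1, 0) = (x, 1) - (y, 1).
  have hsub : ‖x - y‖ * ‖B.mulVec ![1, 0]‖ ≤ max ‖B.mulVec ![x, 1]‖ ‖B.mulVec ![y, 1]‖ := by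
    rw [← norm_smul, ← Matrix.mulVec_smul]
    have h1 : (x - y) • ![(1 : C), 0] = ![x, 1] - ![y, 1] := by
      ext i; fin_cases i <;> simp
    rw [h1, Matrix.mulVec_sub]
    rw [pi_norm_le_iff_of_nonneg (le_max_of_le_left (norm_nonneg _))]
    intro i
    rw [Pi.sub_apply, sub_eq_add_neg]
    refine (IsUltrametricDist.norm_add_le_max _ _).trans ?_
    rw [norm_neg]
    exact max_le_max (norm_le_pi_norm _ i) (norm_le_pi_norm _ i)
  have h1 : (‖x - y‖ * ‖B.mulVec ![1, 0]‖) ^ (d - 1) ≤ ‖c‖ := by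
    refine (pow_le_pow_left₀ (by positivity) hsub _).trans ?_
    rcases max_choice ‖B.mulVec ![x, 1]‖ ‖B.mulVec ![y, 1]‖ with h | h <;> rw [h]
    · exact horb x hx
    · exact horb y hy
  rw [mul_pow, he] at h1
  have h2 : ‖c‖ * (‖x - y‖ ^ (d - 1) * ‖φ.leadingCoeff‖) ≤ ‖c‖ * 1 := by linarith
  exact le_of_mul_le_mul_left h2 hc0

theorem goodReduction_of_norm_coeff_le_one {ψ : C[X]} (hd : 0 < ψ.natDegree)
    (hc : ∀ i, ‖ψ.coeff i‖ ≤ 1) (hl : ‖ψ.leadingCoeff‖ = 1) :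
    GoodReduction (homogeneousPresentation ψ) := by
  let b : ℕ → (NormedField.valuation (K := C)).valuationSubring := fun i => ⟨ψ.coeff i, mem_valuationSubring_iff_norm_le_one.2 (hc i)⟩
  refine ⟨1, one_ne_zero, ![∑ i ∈ Finset.range (ψ.natDegree + 1),
      MvPolynomial.C (b i) * MvPolynomial.X 0 ^ i * MvPolynomial.X 1 ^ (ψ.natDegree - i),
    MvPolynomial.X 1 ^ ψ.natDegree], fun i => ?_, ⟨1, Finsupp.single 1 ψ.natDegree, ?_⟩,
    fun z hz => ?_⟩
  · rw [MvPolynomial.C_1, one_mul]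
    fin_cases i
    · simp [homogeneousPresentation, b]
    · simp [homogeneousPresentation]
  · simp [MvPolynomial.coeff_X_pow]
  · have h1 := hz 1
    have h0 := hz 0
    have hz1 : z 1 = 0 := by simpa [hd.ne'] using h1
    have hz0 : z 0 = 0 := by
      have h2 := (eval_map_homogenization (IsLocalRing.residue _) b ψ.natDegree z).symm.trans h0
      rw [hz1, Finset.sum_range_succ, Finset.sum_eq_zero fun i hi => by
        rw [zero_pow (Nat.sub_ne_zero_of_lt (Finset.mem_range.1 hi)), mul_zero], zero_add,
        Nat.sub_self, pow_zero, mul_one, mul_eq_zero] at h2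
      rcases h2 with h0 | h0
      · rw [residue_eq_zero_iff_norm_lt_one] at h0
        exact absurd hl h0.ne
      · exact pow_eq_zero_iff hd.ne' |>.1 h0
    ext i
    fin_cases i
    · exact hz0
    · exact hz1

/-- Used mainly in contrapositive form: at a bad prime no affine conjugate that is monic has
integral coefficients, which is the input for `exists_badRadius`. -/
theorem potentiallyGoodReduction_of_affineConj [Infinite C] {φ : C[X]} (hd : 0 < φ.natDegree)
    {a x₀ : C} (ha : a ≠ 0) (hc : ∀ i, ‖(affineConj φ a x₀).coeff i‖ ≤ 1)
    (hl : ‖(affineConj φ a x₀).leadingCoeff‖ = 1) : PotentiallyGoodReduction φ := by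
  let A : GL (Fin 2) C :=
    { val := !![a, x₀; 0, 1]
      inv := !![a⁻¹, -(a⁻¹ * x₀); 0, 1]
      val_inv := by
        ext i j
        fin_cases i <;> fin_cases j <;> simp [Matrix.mul_apply, Fin.sum_univ_two, ha]
      inv_val := by
        ext i j
        fin_cases i <;> fin_cases j <;> simp [Matrix.mul_apply, Fin.sum_univ_two, ha] }
  refine ⟨A, ?_⟩
  rw [conjPresentation_eq hd ha (A := A) rfl rfl]
  exact goodReduction_of_norm_coeff_le_one (by rwa [natDegree_affineConj ha]) hc hl

end Reduction

noncomputable section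

/-! ### Non-archimedean places -/

namespace NonarchAbs

variable {K : Type*} [Field K] (v : NonarchAbs K)

/-- The embedding of `K` into the algebraic closure of `K_v`. -/
def toKvBar : K →+* v.KvBar :=
  (algebraMap v.Kv v.KvBar).comp
    ((algebraMap (WithAbs v.abs) v.Kv).comp (WithAbs.equiv v.abs).symm.toRingHom)

theorem norm_toKvBar (x : K) : ‖v.toKvBar x‖ = v.abs x := by
  have h1 : ‖v.toKvBar x‖ = spectralNorm v.Kv v.KvBar (v.toKvBar x) := rfl
  rw [h1]
  have h2 : v.toKvBar x = algebraMap v.Kv v.KvBar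
      (algebraMap (WithAbs v.abs) v.Kv ((WithAbs.equiv v.abs).symm x)) := rfl
  rw [h2, spectralNorm_extends]
  exact UniformSpace.Completion.norm_coe _

theorem toCv_eq : v.toCv = (algebraMap v.KvBar v.Cv).comp v.toKvBar := rfl

theorem norm_algebraMap_Cv (x : v.KvBar) : ‖algebraMap v.KvBar v.Cv x‖ = ‖x‖ :=
  UniformSpace.Completion.norm_coe x

theorem norm_toCv (x : K) : ‖v.toCv x‖ = v.abs x := by
  rw [toCv_eq, RingHom.comp_apply, norm_algebraMap_Cv, norm_toKvBar]

theorem exists_small : ∃ u : v.KvBar, u ≠ 0 ∧ ‖u‖ < 1 := by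
  obtain ⟨x, hx0, hx1⟩ := v.nontrivial
  rcases lt_or_gt_of_ne hx1 with h | h
  · exact ⟨v.toKvBar x, (_root_.map_ne_zero _).2 hx0, by rwa [norm_toKvBar]⟩
  · exact ⟨v.toKvBar x⁻¹, (_root_.map_ne_zero _).2 (inv_ne_zero hx0), by
      rw [norm_toKvBar, map_inv₀]; exact inv_lt_one_of_one_lt₀ h⟩

theorem infinite_Cv : Infinite v.Cv :=
  Infinite.of_injective (algebraMap v.KvBar v.Cv) (algebraMap v.KvBar v.Cv).injective

end NonarchAbs

theorem affineConj_map {K L : Type*} [Field K] [Field L] (σ : K →+* L) (φ : K[X]) (a x₀ : K) :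
    (affineConj φ a x₀).map σ = affineConj (φ.map σ) (σ a) (σ x₀) := by
  simp [affineConj, Polynomial.map_comp]

theorem FiniteOrbit.map_ringHom {K L : Type*} [Field K] [Field L] (σ : K →+* L) {φ : K[X]} {x : K}
    (h : FiniteOrbit (fun z => φ.eval z) x) : FiniteOrbit (fun z => (φ.map σ).eval z) (σ x) :=
  h.map (σ := σ) fun y => by simp [eval_map, eval₂_at_apply]

theorem normPairLog_comp {K L : Type*} [Field K] [NormedField L] (σ : K →+* L) {v : K → ℝ}
    (hσ : ∀ x, ‖σ x‖ = v x) (A : ℝ) {N : ℕ} (x : Fin N → K) :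
    normPairLog (fun z : L => ‖z‖) A (fun i => σ (x i)) = normPairLog v A x := by
  simp only [normPairLog, ← map_sub, hσ]

section

variable {K : Type*} [Field K] (v : NonarchAbs K) {φ : K[X]} {d : ℕ}

theorem potentiallyGoodReduction_of_integral (hφ : 0 < φ.natDegree)
    (hc : ∀ i, v.abs (φ.coeff i) ≤ 1) (hl : v.abs φ.leadingCoeff = 1) :
    PotentiallyGoodReduction (φ.map v.toCv) := by
  have := v.infinite_Cv
  have h1 : affineConj (φ.map v.toCv) 1 0 = φ.map v.toCv := by simp [affineConj]
  refine potentiallyGoodReduction_of_affineConj (by rwa [natDegree_map]) one_ne_zero (x₀ := 0)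
    (fun i => ?_) ?_
  · rw [h1, coeff_map, v.norm_toCv]
    exact hc i
  · rw [h1, leadingCoeff_map, v.norm_toCv]
    exact hl

theorem nonarch_place_good (hφ : φ.natDegree = d) (hd : 2 ≤ d)
    (h : PotentiallyGoodReduction (φ.map v.toCv)) {x y : K}
    (hx : FiniteOrbit (fun z => φ.eval z) x) (hy : FiniteOrbit (fun z => φ.eval z) y) :
    v.abs (x - y) ^ (d - 1) * v.abs φ.leadingCoeff ≤ 1 := by
  have := norm_sub_pow_mul_le_one (by rwa [natDegree_map]) hd h (hx.map_ringHom v.toCv)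
    (hy.map_ringHom v.toCv)
  rwa [← map_sub, v.norm_toCv, leadingCoeff_map, v.norm_toCv] at this

/-- The estimates take place in the algebraic closure of `K_v`. The field `ℂ_v` enters only because
an integral monic conjugate over the closure would also be one over `ℂ_v`, contrary to bad
reduction. -/
theorem nonarch_place_bad (hφ : φ.natDegree = d) (hd : 2 ≤ d)
    (h : ¬ PotentiallyGoodReduction (φ.map v.toCv)) {x₀ : K}
    (hx₀ : FiniteOrbit (fun z => φ.eval z) x₀) :
    ∃ r : ℝ, 1 < r ∧
      (∃ i, 1 ≤ i ∧ i < d ∧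
        r ^ ((d - 1) * (d - i)) * v.abs φ.leadingCoeff ^ (i - 1) =
          v.abs ((taylor x₀ φ).coeff i) ^ (d - 1)) ∧
      ∃ (m : ℕ) (W : Set K), 0 < m ∧ m < d ∧ ∀ {N : ℕ} (x : Fin N → K), Function.Injective x →
        (∀ i, FiniteOrbit (fun z => φ.eval z) (x i)) →
        2 * normPairLog v.abs (Real.log (v.abs φ.leadingCoeff) / (d - 1)) x ≤
          Real.log r * ((d - 1) * (N * Real.logb d N)) ∧
        ((∀ i, x i ∈ W) →
          2 * normPairLog v.abs (Real.log (v.abs φ.leadingCoeff) / (d - 1)) x ≤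
          Real.log r * ((d - 1) * (N * Real.logb d N)) -
            (d - m) / m * (N * (N - m)) * Real.log r) ∧
        ((∀ i, x i ∉ W) →
          2 * normPairLog v.abs (Real.log (v.abs φ.leadingCoeff) / (d - 1)) x ≤
          Real.log r * ((d - 1) * (N * Real.logb d N)) -
            (d - (d - m : ℕ)) / (d - m : ℕ) * (N * (N - (d - m : ℕ))) * Real.log r) := by
  have hφ' : (φ.map v.toKvBar).natDegree = d := by rwa [natDegree_map]
  have hlc : ‖(φ.map v.toKvBar).leadingCoeff‖ = v.abs φ.leadingCoeff := by
    rw [leadingCoeff_map, v.norm_toKvBar]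
  have hbad : ∀ a : v.KvBar, a ^ (d - 1) * (φ.map v.toKvBar).leadingCoeff = 1 →
      ¬ ∀ i, ‖(affineConj (φ.map v.toKvBar) a (v.toKvBar x₀)).coeff i‖ ≤ 1 := by
    intro a ha hle
    apply h
    have ha0 : a ≠ 0 := by
      rintro rfl
      rw [zero_pow (by omega), zero_mul] at ha
      exact zero_ne_one ha
    have := v.infinite_Cv
    have hmap : affineConj (φ.map v.toCv) (algebraMap v.KvBar v.Cv a)
        (algebraMap v.KvBar v.Cv (v.toKvBar x₀)) =
        (affineConj (φ.map v.toKvBar) a (v.toKvBar x₀)).map (algebraMap v.KvBar v.Cv) := by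
      rw [affineConj_map, Polynomial.map_map, v.toCv_eq]
    refine potentiallyGoodReduction_of_affineConj (by rw [natDegree_map]; omega)
      ((_root_.map_ne_zero (algebraMap v.KvBar v.Cv)).2 ha0) (x₀ := algebraMap v.KvBar v.Cv (v.toKvBar x₀)) (fun i => ?_) ?_
    · rw [hmap, coeff_map, v.norm_algebraMap_Cv]
      exact hle i
    · have hm := monic_affineConj (x₀ := v.toKvBar x₀) ha0 (by rw [hφ']; omega) (by rwa [hφ'])
      rw [hmap, leadingCoeff_map, v.norm_algebraMap_Cv, hm.leadingCoeff, norm_one]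
  obtain ⟨r, hr, ⟨i, hi1, hid, hi⟩, m, W, hm0, hmd, hW⟩ := nonarch_bad_bound v.exists_small hφ' hd
    (hx₀.map_ringHom v.toKvBar) hbad
  refine ⟨r, hr, ⟨i, hi1, hid, ?_⟩, m, v.toKvBar ⁻¹' W, hm0, hmd, fun {N} x hx hfin => ?_⟩
  · rw [hlc] at hi
    rw [hi, ← v.norm_toKvBar, ← map_taylor, coeff_map]
  · have := hW (fun i => v.toKvBar (x i)) (v.toKvBar.injective.comp hx)
      fun i => (hfin i).map_ringHom _
    rw [hlc, normPairLog_comp v.toKvBar v.norm_toKvBar] at this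
    exact this

end

noncomputable section

/-! ### Continuity of the number of zeros in a region -/

theorem exists_fin_map_eq {α : Type*} {n : ℕ} (s : Multiset α) (hs : s.card = n) :
    ∃ f : Fin n → α, Finset.univ.val.map f = s := by
  induction s using Quotient.inductionOn with
  | _ l =>
  change l.length = n at hs
  subst hs
  exact ⟨l.get, by rw [Fin.univ_val_map, List.ofFn_get]; rfl⟩

theorem roots_eq_of_forall_eval_eq {ψ : ℂ[X]} {d : ℕ} {c : ℂ} {α : Fin d → ℂ}
    (h : ∀ z, ψ.eval z - c = ∏ i, (z - α i)) :
    (ψ - C c).roots = Finset.univ.val.map α := by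
  have : ψ - C c = ((Finset.univ.val.map α).map fun a => X - C a).prod := by
    apply Polynomial.funext
    intro z
    rw [eval_sub, eval_C, h, Multiset.map_map]
    change _ = eval z (∏ i, (X - C (α i)))
    rw [eval_prod]
    simp
  rw [this, roots_multiset_prod_X_sub_C]

theorem exists_forall_eval_eq {ψ : ℂ[X]} {d : ℕ} (hψ : ψ.Monic) (hd : ψ.natDegree = d)
    (hd0 : 0 < d) (c : ℂ) : ∃ α : Fin d → ℂ, ∀ z, ψ.eval z - c = ∏ i, (z - α i) := by
  obtain ⟨α, hα⟩ := exists_fin_map_eq (ψ - C c).roots (card_roots_sub_C_eq c)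
  subst hd
  refine ⟨α, fun z => ?_⟩
  rw [eval_sub_eq_prod_roots hψ hd0, ← hα, Multiset.map_map]
  rfl

theorem exists_norm_le_of_norm_eval_le {ψ : ℂ[X]} (hd : 0 < ψ.natDegree) (B : ℝ) :
    ∃ M : ℝ, ∀ z, ‖ψ.eval z‖ ≤ B → ‖z‖ ≤ M := by
  have h := ψ.tendsto_norm_atTop (natDegree_pos_iff_degree_pos.1 hd)
    (l := Filter.comap (fun z : ℂ => ‖z‖) Filter.atTop) (z := fun z => z) Filter.tendsto_comap
  have h1 := h.eventually (Filter.eventually_gt_atTop B)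
  rw [Filter.eventually_comap] at h1
  obtain ⟨M, hM⟩ := Filter.eventually_atTop.1 h1
  refine ⟨M, fun z hz => ?_⟩
  by_contra! hlt
  exact absurd (hM _ hlt.le z rfl) (not_lt.2 hz)

open Classical in
/-- If no preimage of a point of a compact connected set lies in a strip, then the number of
preimages on one side of the strip is constant. -/
theorem exists_card_roots_filter_eq {ψ : ℂ[X]} (hψ : ψ.Monic) (hd : 0 < ψ.natDegree) {D : Set ℂ}
    (hD : IsCompact D) (hDc : IsPreconnected D) {p : ℂ → ℝ} (hp : Continuous p) {a b : ℝ}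
    (hab : a < b) (hgap : ∀ z, ψ.eval z ∈ D → p z ≤ a ∨ b ≤ p z) :
    ∃ m, ∀ c ∈ D, ((ψ - C c).roots.filter (· ∈ {z | p z ≤ a})).card = m := by
  set d := ψ.natDegree with hdd
  obtain ⟨B, hB⟩ := hD.isBounded.exists_norm_le
  obtain ⟨M, hM⟩ := exists_norm_le_of_norm_eval_le hd B
  set n : ℂ → ℕ := fun c => ((ψ - C c).roots.filter (· ∈ {z | p z ≤ a})).card with hn
  let γ : (Fin d → ℂ) → ℂ := fun α => ψ.eval 0 - ∏ i, (0 - α i)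
  have hγ : Continuous γ := by fun_prop
  -- Ordered root tuples of ψ - c, c ∈ D, for which exactly the indices in I lie on the lower side
  -- of the strip. The map γ recovers c from the tuple, so the image of the compact set T I is
  -- closed.
  let T : Finset (Fin d) → Set (Fin d → ℂ) := fun I =>
    {α | γ α ∈ D ∧ (∀ z, ψ.eval z - γ α = ∏ i, (z - α i)) ∧ (∀ i ∈ I, p (α i) ≤ a) ∧
      ∀ i ∉ I, b ≤ p (α i)}
  have hTD : ∀ I, ∀ α ∈ T I, ∀ i, ψ.eval (α i) = γ α := fun I α hα i => by
    have := hα.2.1 (α i)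
    rw [Finset.prod_eq_zero (Finset.mem_univ i) (sub_self _)] at this
    exact sub_eq_zero.1 this
  have hTc : ∀ I, IsCompact (T I) := fun I => by
    refine Metric.isCompact_of_isClosed_isBounded ?_ ?_
    · have e : T I = γ ⁻¹' D ∩ ((⋂ z, {α | ψ.eval z - γ α = ∏ i, (z - α i)}) ∩
          ((⋂ i ∈ I, {α | p (α i) ≤ a}) ∩ ⋂ i ∈ (I : Set (Fin d))ᶜ, {α | b ≤ p (α i)})) := by
        ext α
        simp [T]
      rw [e]
      refine (hD.isClosed.preimage hγ).inter (IsClosed.inter ?_ (IsClosed.inter ?_ ?_))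
      · exact isClosed_iInter fun z => isClosed_eq (by fun_prop) (by fun_prop)
      · exact isClosed_iInter fun i => isClosed_iInter fun _ =>
          isClosed_le (by fun_prop) (by fun_prop)
      · exact isClosed_iInter fun i => isClosed_iInter fun _ =>
          isClosed_le (by fun_prop) (by fun_prop)
    · refine (Metric.isBounded_closedBall (x := (0 : Fin d → ℂ)) (r := max M 0)).subset
        fun α hα => ?_
      rw [mem_closedBall_zero_iff, pi_norm_le_iff_of_nonneg (le_max_right _ _)]
      intro i
      refine le_max_of_le_left (hM _ ?_)
      rw [hTD I α hα i]
      exact hB _ hα.1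
  have hncard : ∀ I, ∀ α ∈ T I, n (γ α) = I.card := fun I α hα => by
    rw [hn]
    simp only
    rw [roots_eq_of_forall_eval_eq hα.2.1, Multiset.filter_map, Multiset.card_map]
    change (Finset.univ.filter fun i => p (α i) ≤ a).card = _
    congr 1
    ext i
    simp only [Finset.mem_filter, Finset.mem_univ, true_and]
    refine ⟨fun h => ?_, fun h => hα.2.2.1 i h⟩
    by_contra hi
    linarith [hα.2.2.2 i hi]
  have hcover : ∀ c ∈ D, ∃ I, ∃ α ∈ T I, γ α = c := fun c hc => by
    obtain ⟨α, hα⟩ := exists_forall_eval_eq hψ hdd.symm hd c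
    have e : γ α = c := by rw [← sub_eq_zero]; change _ - _ - _ = _; rw [← hα 0]; ring
    refine ⟨Finset.univ.filter fun i => p (α i) ≤ a, α, ⟨e ▸ hc, fun z => e ▸ hα z, ?_, ?_⟩, e⟩
    · intro i hi
      exact (Finset.mem_filter.1 hi).2
    · intro i hi
      have h1 : ψ.eval (α i) = c := by
        have := hα (α i)
        rw [Finset.prod_eq_zero (Finset.mem_univ i) (sub_self _)] at this
        exact sub_eq_zero.1 this
      refine (hgap (α i) (h1 ▸ hc)).resolve_left fun h => hi ?_
      simpa using h
  have hcl : ∀ P : Finset (Fin d) → Prop, IsClosed (⋃ I ∈ {I | P I}, γ '' T I) := fun P =>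
    (Set.toFinite _).isClosed_biUnion fun I _ => ((hTc I).image hγ).isClosed
  rcases D.eq_empty_or_nonempty with rfl | ⟨c₁, hc₁⟩
  · exact ⟨0, by simp⟩
  refine ⟨n c₁, fun c hc => ?_⟩
  by_contra hne
  have hmem : ∀ P : Finset (Fin d) → Prop, ∀ c ∈ D, (∀ I : Finset (Fin d), n c = I.card → P I) →
      c ∈ ⋃ I ∈ {I | P I}, γ '' T I := fun P c hc h => by
    obtain ⟨I, α, hα, rfl⟩ := hcover c hc
    simp only [Set.mem_iUnion]
    exact ⟨I, h I (hncard I α hα), α, hα, rfl⟩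
  -- Finitely many closed images cover D. Those with the count at c₁ and those with another count
  -- would both be nonempty, so by connectedness they would meet, giving one value of c with two
  -- counts.
  obtain ⟨c', -, h1, h2⟩ := isPreconnected_closed_iff.1 hDc _ _ (hcl fun I => I.card = n c₁)
    (hcl fun I => I.card ≠ n c₁)
    (fun c hc => by
      by_cases h : n c = n c₁
      · exact Or.inl (hmem _ c hc fun I hI => hI ▸ h)
      · exact Or.inr (hmem _ c hc fun I hI => hI ▸ h))
    ⟨c₁, hc₁, hmem _ c₁ hc₁ fun I hI => hI.symm⟩
    ⟨c, hc, hmem _ c hc fun I hI => hI ▸ hne⟩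
  simp only [Set.mem_iUnion] at h1 h2
  obtain ⟨I, hI, α, hα, rfl⟩ := h1
  obtain ⟨I', hI', α', hα', he⟩ := h2
  have e1 := hncard I α hα
  have e2 := hncard I' α' hα'
  rw [he, e1] at e2
  exact hI' (e2.symm.trans hI)

/-! ### Filled Julia sets -/

/-- The filled Julia set of a complex polynomial. -/
def filledJulia (ψ : ℂ[X]) : Set ℂ :=
  {z | Bornology.IsBounded (Set.range fun n : ℕ => (fun z => ψ.eval z)^[n] z)}

section Julia

variable {ψ : ℂ[X]}

theorem mem_filledJulia {z : ℂ} : z ∈ filledJulia ψ ↔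
    Bornology.IsBounded (Set.range fun n : ℕ => (fun z => ψ.eval z)^[n] z) := Iff.rfl

theorem FiniteOrbit.mem_filledJulia {z : ℂ} (h : FiniteOrbit (fun z => ψ.eval z) z) :
    z ∈ filledJulia ψ := Set.Finite.isBounded h

theorem eval_mem_filledJulia {z : ℂ} (h : z ∈ filledJulia ψ) : ψ.eval z ∈ filledJulia ψ := by
  refine Bornology.IsBounded.subset (mem_filledJulia.1 h) ?_
  rintro _ ⟨n, rfl⟩
  exact ⟨n + 1, Function.iterate_succ_apply _ _ _⟩

theorem iterate_mem_filledJulia {z : ℂ} (h : z ∈ filledJulia ψ) (n : ℕ) :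
    (fun z => ψ.eval z)^[n] z ∈ filledJulia ψ := by
  induction n with
  | zero => exact h
  | succ n ih => rw [Function.iterate_succ_apply']; exact eval_mem_filledJulia ih

theorem mem_filledJulia_of_eval_mem {z : ℂ} (h : ψ.eval z ∈ filledJulia ψ) :
    z ∈ filledJulia ψ := by
  refine (Bornology.IsBounded.union (mem_filledJulia.1 h) (Bornology.isBounded_singleton (x := z))).subset ?_
  rintro _ ⟨n, rfl⟩
  cases n with
  | zero => right; rfl
  | succ n => left; exact ⟨n, (Function.iterate_succ_apply _ _ _).symm⟩

theorem exists_escape_radius (hd : 2 ≤ ψ.natDegree) :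
    ∃ R : ℝ, 0 < R ∧ ∀ z, R < ‖z‖ → 2 * ‖z‖ ≤ ‖ψ.eval z‖ := by
  have hdiv : 0 < ψ.divX.natDegree := by rw [natDegree_divX_eq_natDegree_tsub_one]; omega
  obtain ⟨M, hM⟩ := exists_norm_le_of_norm_eval_le hdiv 3
  refine ⟨max M (max ‖ψ.coeff 0‖ 1), by positivity, fun z hz => ?_⟩
  have h1 : M < ‖z‖ := (le_max_left _ _).trans_lt hz
  have h2 : ‖ψ.coeff 0‖ < ‖z‖ := ((le_max_left _ _).trans (le_max_right _ _)).trans_lt hz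
  have h3 : 3 < ‖ψ.divX.eval z‖ := by
    by_contra! h
    exact absurd (hM z h) (not_le.2 h1)
  have h4 : ψ.eval z = ψ.divX.eval z * z + ψ.coeff 0 := by
    nth_rw 1 [← divX_mul_X_add ψ]
    simp
  rw [h4]
  have h5 := norm_sub_le_norm_add (ψ.divX.eval z * z) (ψ.coeff 0)
  rw [norm_mul] at h5
  nlinarith [norm_nonneg z]

theorem isCompact_filledJulia (hd : 2 ≤ ψ.natDegree) : IsCompact (filledJulia ψ) := by
  obtain ⟨R, hR0, hR⟩ := exists_escape_radius hd
  have hle : ∀ z ∈ filledJulia ψ, ‖z‖ ≤ R := by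
    intro z hz
    by_contra! hlt
    have h1 : ∀ n : ℕ, 2 ^ n * R < ‖(fun z => ψ.eval z)^[n] z‖ := fun n => by
      induction n with
      | zero => simpa using hlt
      | succ n ih =>
        rw [Function.iterate_succ_apply', pow_succ]
        have h2 : R < ‖(fun z => ψ.eval z)^[n] z‖ :=
          lt_of_le_of_lt (by nlinarith [one_le_pow₀ (one_le_two (α := ℝ)) (n := n)]) ih
        have h3 : 2 * ‖(fun z => ψ.eval z)^[n] z‖ ≤ ‖ψ.eval ((fun z => ψ.eval z)^[n] z)‖ := hR _ h2
        linarith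
    obtain ⟨B, hB⟩ := Bornology.IsBounded.exists_norm_le (mem_filledJulia.1 hz)
    obtain ⟨n, hn⟩ := pow_unbounded_of_one_lt (B / R) (one_lt_two (α := ℝ))
    rw [div_lt_iff₀ hR0] at hn
    exact absurd (hB _ ⟨n, rfl⟩) (not_le.2 (hn.trans (h1 n)))
  -- An orbit that once leaves the disk of radius R tends to infinity, so bounded orbits are
  -- described by closed conditions on the single iterates.
  have heq : filledJulia ψ = ⋂ n : ℕ, {z | ‖(fun z => ψ.eval z)^[n] z‖ ≤ R} := by
    ext z
    simp only [Set.mem_iInter, Set.mem_ofPred_eq]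
    refine ⟨fun hz n => hle _ (iterate_mem_filledJulia hz n), fun h => ?_⟩
    refine (Metric.isBounded_closedBall (x := (0 : ℂ)) (r := R)).subset ?_
    rintro _ ⟨n, rfl⟩
    simpa using h n
  refine Metric.isCompact_of_isClosed_isBounded ?_ ?_
  · rw [heq]
    refine isClosed_iInter fun n => isClosed_le ?_ continuous_const
    exact (Continuous.iterate (by fun_prop) n).norm
  · exact (Metric.isBounded_closedBall (x := (0 : ℂ)) (r := R)).subset fun z hz => by
      simpa using hle z hz

end Julia
end

noncomputable section

/-! ### Splitting complex filled Julia sets -/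

/-- Pigeonhole: [lo, hi] contains d - 1 disjoint open intervals of equal length, but only d - 2 of
the numbers can lie inside them, since one is at most lo and another at least hi. -/
theorem exists_gap {d : ℕ} (hd : 2 ≤ d) (α : Fin d → ℝ) {lo hi : ℝ} (hlt : lo < hi)
    (h1 : ∃ i, α i ≤ lo) (h2 : ∃ i, hi ≤ α i) :
    ∃ u, lo ≤ u ∧ u + (hi - lo) / (d - 1) ≤ hi ∧
      ∀ i, α i ≤ u ∨ u + (hi - lo) / (d - 1) ≤ α i := by
  have hd1 : (0 : ℝ) < d - 1 := by
    have : (2 : ℝ) ≤ d := by exact_mod_cast hd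
    linarith
  set g := (hi - lo) / (d - 1) with hg
  have hg0 : 0 < g := div_pos (by linarith) hd1
  have hgd : (d - 1) * g = hi - lo := by rw [hg]; field_simp
  have hk : ∀ k : Fin (d - 1), (k : ℝ) + 1 ≤ d - 1 := fun k => by
    have : ((k : ℕ) : ℝ) + 1 ≤ ((d - 1 : ℕ) : ℝ) := by exact_mod_cast k.2
    rwa [Nat.cast_sub (by omega), Nat.cast_one] at this
  by_contra! hcon
  have hex : ∀ k : Fin (d - 1), ∃ i, lo + k * g < α i ∧ α i < lo + k * g + g := fun k =>
    hcon (lo + k * g) (by have : (0 : ℝ) ≤ k := by positivity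
                          nlinarith) (by nlinarith [hk k])
  choose f hf1 hf2 using hex
  have hinj : Function.Injective f := fun k l hkl => by
    by_contra hne
    have key : ∀ k l : Fin (d - 1), k < l → f k ≠ f l := fun k l hlt he => by
      have h3 := hf2 k
      have h4 := hf1 l
      rw [he] at h3
      have : (k : ℝ) + 1 ≤ l := by exact_mod_cast hlt
      nlinarith
    rcases lt_or_gt_of_ne hne with h | h
    · exact key k l h hkl
    · exact key l k h hkl.symm
  obtain ⟨i, hi1⟩ := h1
  obtain ⟨j, hj1⟩ := h2
  have hij : i ≠ j := by rintro rfl; linarith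
  have hsub : Finset.univ.image f ⊆ ({i, j} : Finset (Fin d))ᶜ := by
    intro l hl
    obtain ⟨k, -, rfl⟩ := Finset.mem_image.1 hl
    simp only [Finset.mem_compl, Finset.mem_insert, Finset.mem_singleton, not_or]
    have h0 : (0 : ℝ) ≤ k := by positivity
    constructor
    · rintro rfl
      nlinarith [hf1 k]
    · rintro rfl
      nlinarith [hf2 k, hk k]
  have hc := Finset.card_le_card hsub
  rw [Finset.card_image_of_injective _ hinj, Finset.card_compl, Finset.card_pair hij,
    Finset.card_fin, Fintype.card_fin] at hc
  omega

theorem exists_norm_sub_le {d : ℕ} (hd : 0 < d) {α : Fin d → ℂ} {z : ℂ} {q : ℝ} (hq : 0 < q)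
    (h : ∏ i, ‖z - α i‖ ≤ q ^ d) : ∃ i, ‖z - α i‖ ≤ q := by
  by_contra! hlt
  have hne : (Finset.univ : Finset (Fin d)).Nonempty := ⟨⟨0, hd⟩, Finset.mem_univ _⟩
  have := Finset.prod_lt_prod_of_nonempty (s := Finset.univ) (f := fun _ : Fin d => q)
    (g := fun i => ‖z - α i‖) (fun _ _ => hq) (fun i _ => hlt i) hne
  rw [Finset.prod_const, Finset.card_fin] at this
  linarith

theorem exists_pow_eq_of_pos {d : ℕ} (hd : 0 < d) {δ : ℝ} (hδ : 0 < δ) : ∃ q : ℝ, 0 < q ∧ q ^ d = δ :=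
  ⟨δ ^ ((1 : ℝ) / d), Real.rpow_pos_of_pos hδ _, by
    rw [← Real.rpow_natCast, ← Real.rpow_mul hδ.le, one_div,
      inv_mul_cancel₀ (by exact_mod_cast hd.ne'), Real.rpow_one]⟩

theorem cube_le_of_pow_eq {d : ℕ} (hd : 3 ≤ d) {δ q : ℝ} (hq : 0 < q) (h : q ^ d = δ)
    (hδ : 1 ≤ δ) : q ^ 3 ≤ δ := by
  have hq1 : 1 ≤ q := by
    by_contra! hlt
    have := pow_lt_one₀ hq.le hlt (n := d) (by omega)
    linarith
  rw [← h]
  exact pow_le_pow_right₀ hq1 hd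

/-- A gap of length (δ - 2q)/(d - 1) between roots shrinks by q on either side when each root is
replaced by a disk of radius q = δ^(1/d). The hypothesis δ² ≥ 32 d⁴ makes q ≤ 7δ/(18d), and then at
least δ/d² is left. -/
theorem splitting_width {d : ℕ} (hd : 3 ≤ d) {δ q : ℝ} (hq : 0 < q) (h : q ^ d = δ)
    (hδ : 32 * (d : ℝ) ^ 4 ≤ δ ^ 2) (hδ0 : 0 < δ) :
    δ / d ^ 2 ≤ (δ - q - q) / (d - 1) - 2 * q ∧ 2 * q < δ := by
  have hd' : (3 : ℝ) ≤ d := by exact_mod_cast hd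
  have hd4 : (1 : ℝ) ≤ (d : ℝ) ^ 4 := one_le_pow₀ (by linarith)
  have hδ1 : 1 ≤ δ := by nlinarith
  have hc := cube_le_of_pow_eq hd hq h hδ1
  have hq' : q * (18 * d) ≤ 7 * δ := by
    by_contra! hlt
    have h1 : (7 * δ) ^ 3 < (q * (18 * d)) ^ 3 := pow_lt_pow_left₀ hlt (by positivity) (by norm_num)
    have h2 : (q * (18 * d)) ^ 3 ≤ δ * (18 * d) ^ 3 := by
      rw [mul_pow]; exact mul_le_mul_of_nonneg_right hc (by positivity)
    have h3 : 343 * δ ^ 2 < 5832 * d ^ 3 := by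
      have h4 : δ * (343 * δ ^ 2) < δ * (5832 * d ^ 3) := by nlinarith
      exact lt_of_mul_lt_mul_left h4 hδ0.le
    have h5 : (3 : ℝ) * d ^ 3 ≤ d ^ 4 := by
      rw [pow_succ (d : ℝ) 3, mul_comm]
      exact mul_le_mul_of_nonneg_left hd' (by positivity)
    have h6 : (0 : ℝ) < (d : ℝ) ^ 3 := by positivity
    linarith
  refine ⟨?_, by nlinarith⟩
  have hd1 : (0 : ℝ) < d - 1 := by linarith
  rw [div_sub' hd1.ne', div_le_div_iff₀ (by positivity) hd1]
  have h7 : q * d ≤ 7 / 18 * δ := by linarith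
  have h8 : ((d : ℝ) - 1) ≤ 2 / 9 * d ^ 2 := by nlinarith
  have h9 : (q * d) * d ^ 2 ≤ 7 / 18 * δ * d ^ 2 := mul_le_mul_of_nonneg_right h7 (by positivity)
  have h10 : δ * (d - 1) ≤ δ * (2 / 9 * d ^ 2) := mul_le_mul_of_nonneg_left h8 hδ0.le
  nlinarith

open Classical in
theorem card_roots_filter_compl {ψ : ℂ[X]} {d m : ℕ} (hd : ψ.natDegree = d) {c : ℂ} {W : Set ℂ}
    (h : ((ψ - C c).roots.filter (· ∈ W)).card = m) :
    ((ψ - C c).roots.filter (· ∈ Wᶜ)).card = d - m := by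
  have h1 := congrArg Multiset.card (Multiset.filter_add_not (· ∈ W) (ψ - C c).roots)
  rw [Multiset.card_add, card_roots_sub_C_eq, hd, h] at h1
  have h2 : (ψ - C c).roots.filter (· ∈ Wᶜ) = (ψ - C c).roots.filter (fun z => ¬ z ∈ W) := by
    congr
  rw [h2]
  omega

/-- Two complementary splittings of a filled Julia set. -/
def SplitsComplex (ψ : ℂ[X]) (d : ℕ) (ρ δ : ℝ) : Prop :=
  ∃ (m : ℕ) (W : Set ℂ), 0 < m ∧ m < d ∧
    Nonempty (Splitting ψ d m ρ δ {z | FiniteOrbit (fun z => ψ.eval z) z ∧ z ∈ W}) ∧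
    Nonempty (Splitting ψ d (d - m) ρ δ {z | FiniteOrbit (fun z => ψ.eval z) z ∧ z ∉ W})

theorem nonempty_filledJulia {ψ : ℂ[X]} (hd : 2 ≤ ψ.natDegree) : (filledJulia ψ).Nonempty := by
  have hdeg : (ψ - X).degree ≠ 0 := by
    have h1 : (X : ℂ[X]).degree < ψ.degree := by
      rw [degree_X, degree_eq_natDegree (by rintro rfl; simp at hd)]
      exact_mod_cast hd
    rw [degree_sub_eq_left_of_degree_lt h1, degree_eq_natDegree (by rintro rfl; simp at hd)]
    exact_mod_cast (by omega : ψ.natDegree ≠ 0)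
  obtain ⟨z, hz⟩ := IsAlgClosed.exists_root _ hdeg
  have hz' : ψ.eval z = z := by simpa [IsRoot, sub_eq_zero] using hz
  refine ⟨z, FiniteOrbit.mem_filledJulia ((Set.finite_singleton z).subset ?_)⟩
  rintro _ ⟨n, rfl⟩
  exact Function.iterate_fixed (f := fun z => ψ.eval z) hz' n

theorem nonempty_splitting_whole {ψ : ℂ[X]} {d : ℕ} (hd : ψ.natDegree = d) (hd2 : 2 ≤ d)
    {δ : ℝ} (hδ : Metric.diam (filledJulia ψ) ≤ δ) :
    Nonempty (Splitting ψ d d 1 δ {z | FiniteOrbit (fun z => ψ.eval z) z}) := by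
  obtain ⟨c, hc⟩ := nonempty_filledJulia (ψ := ψ) (by omega)
  refine ⟨⟨filledJulia ψ, c, Set.univ, fun z => mem_filledJulia_of_eval_mem, hc, fun c _ => ?_,
    fun x _ β _ h => absurd (Set.mem_univ β) h, fun x hx k => ?_⟩⟩
  · simp [card_roots_sub_C_eq, hd]
  · refine le_trans ?_ hδ
    rw [← dist_eq_norm]
    exact Metric.dist_le_diam_of_mem (isCompact_filledJulia (by omega)).isBounded
      (iterate_mem_filledJulia hx.mem_filledJulia k) hc

/-- Let A and B realize the diameter δ. Each preimage of a point of the disk of radius δ about A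
lies within q = δ^(1/d) of a root of ψ - A. Projected to the line AB, the d roots have one within q
of A and one within q of B, hence leave a gap; a slightly narrower strip perpendicular to AB
contains no such preimage and separates the two parts. -/
theorem splitsComplex_of_three_le {ψ : ℂ[X]} {d : ℕ} (hψ : ψ.Monic) (hd : ψ.natDegree = d)
    (hd3 : 3 ≤ d) {δ : ℝ} (hδ : Metric.diam (filledJulia ψ) = δ) (hδ0 : 0 < δ)
    (hδd : 32 * (d : ℝ) ^ 4 ≤ δ ^ 2) : SplitsComplex ψ d (δ / d ^ 2) δ := by
  classical
  have hJc := isCompact_filledJulia (ψ := ψ) (by omega)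
  have hJn := nonempty_filledJulia (ψ := ψ) (by omega)
  obtain ⟨A, hA, B, hB, hAB⟩ : ∃ A ∈ filledJulia ψ, ∃ B ∈ filledJulia ψ, ‖B - A‖ = δ := by
    obtain ⟨⟨A, B⟩, ⟨hA, hB⟩, hmax⟩ := (hJc.prod hJc).exists_isMaxOn (hJn.prod hJn)
      (f := fun p => dist p.2 p.1) (by fun_prop)
    have hA : A ∈ filledJulia ψ := hA
    have hB : B ∈ filledJulia ψ := hB
    refine ⟨A, hA, B, hB, le_antisymm ?_ ?_⟩
    · rw [← hδ, ← dist_eq_norm]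
      exact Metric.dist_le_diam_of_mem hJc.isBounded hB hA
    · rw [← hδ, ← dist_eq_norm]
      refine Metric.diam_le_of_forall_dist_le dist_nonneg fun x hx y hy => ?_
      have := hmax (show (y, x) ∈ filledJulia ψ ×ˢ filledJulia ψ from ⟨hy, hx⟩)
      exact this
  obtain ⟨q, hq, hqd⟩ := exists_pow_eq_of_pos (d := d) (by omega) hδ0
  obtain ⟨hw, h2q⟩ := splitting_width hd3 hq hqd hδd hδ0
  obtain ⟨α, hα⟩ := exists_forall_eval_eq hψ hd (by omega) A
  have hnear : ∀ z, ‖ψ.eval z - A‖ ≤ δ → ∃ i, ‖z - α i‖ ≤ q := fun z hz => by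
    rw [hα, norm_prod, ← hqd] at hz
    exact exists_norm_sub_le (by omega) hq hz
  have hJd : ∀ z ∈ filledJulia ψ, ‖z - A‖ ≤ δ := fun z hz => by
    rw [← hδ, ← dist_eq_norm]
    exact Metric.dist_le_diam_of_mem hJc.isBounded hz hA
  let p : ℂ → ℝ := fun z => ((z - A) * (starRingEnd ℂ) (B - A)).re / δ
  have hpc : Continuous p := by
    have : Continuous fun z : ℂ => ((z - A) * (starRingEnd ℂ) (B - A)).re :=
      Complex.continuous_re.comp (by fun_prop)
    exact this.div_const _
  have hpA : p A = 0 := by simp [p]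
  have hpB : p B = δ := by
    have : ((B - A) * (starRingEnd ℂ) (B - A)).re = δ ^ 2 := by
      rw [Complex.mul_conj', ← hAB]
      exact_mod_cast Complex.ofReal_re _
    simp only [p]
    rw [this]
    field_simp
  have hpl : ∀ z w, p z - p w ≤ ‖z - w‖ := fun z w => by
    have h1 : p z - p w = ((z - w) * (starRingEnd ℂ) (B - A)).re / δ := by
      simp only [p]
      rw [← sub_div, ← Complex.sub_re, ← sub_mul, sub_sub_sub_cancel_right]
    rw [h1, div_le_iff₀ hδ0]
    refine (Complex.re_le_norm _).trans ?_
    rw [norm_mul, Complex.norm_conj, hAB]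
  obtain ⟨iA, hiA⟩ := hnear A (hJd _ (eval_mem_filledJulia hA))
  obtain ⟨iB, hiB⟩ := hnear B (hJd _ (eval_mem_filledJulia hB))
  obtain ⟨u, hu1, hu2, hu⟩ := exists_gap (by omega) (fun i => p (α i)) (lo := q) (hi := δ - q)
    (by linarith)
    ⟨iA, by have := hpl (α iA) A; rw [norm_sub_rev] at this; linarith⟩
    ⟨iB, by have := hpl B (α iB); linarith⟩
  set g := (δ - q - q) / (d - 1) with hg
  have hd0 : (0 : ℝ) < d := by exact_mod_cast (by omega : 0 < d)
  have hρ : 0 < δ / (d : ℝ) ^ 2 := by positivity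
  have hab : u + q < u + g - q := by linarith
  have hgap : ∀ z, ψ.eval z ∈ Metric.closedBall A δ → p z ≤ u + q ∨ u + g - q ≤ p z := by
    intro z hz
    rw [Metric.mem_closedBall, dist_eq_norm] at hz
    obtain ⟨i, hi⟩ := hnear z hz
    have h1 := hpl z (α i)
    have h2 := hpl (α i) z
    rw [norm_sub_rev] at h2
    rcases hu i with h | h
    · left; linarith
    · right; linarith
  -- Constancy of the count is applied to the disk because it is connected; the filled Julia set
  -- need not be.
  obtain ⟨m, hm⟩ := exists_card_roots_filter_eq hψ (by omega) (isCompact_closedBall A δ)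
    (convex_closedBall A δ).isPreconnected hpc hab hgap
  set W : Set ℂ := {z | p z ≤ u + q} with hW
  have hJball : ∀ z ∈ filledJulia ψ, z ∈ Metric.closedBall A δ := fun z hz => by
    rw [Metric.mem_closedBall, dist_eq_norm]; exact hJd z hz
  have hroots := roots_eq_of_forall_eval_eq hα
  have hmA := hm A (hJball A hA)
  have hmemroot : ∀ i, α i ∈ (ψ - C A).roots := fun i => by
    rw [hroots]; exact Multiset.mem_map_of_mem _ (Finset.mem_univ i)
  have hm0 : 0 < m := by
    rw [← hmA, Multiset.card_pos_iff_exists_mem]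
    refine ⟨α iA, Multiset.mem_filter.2 ⟨hmemroot iA, ?_⟩⟩
    have := hpl (α iA) A
    rw [norm_sub_rev] at this
    change p (α iA) ≤ u + q
    linarith
  have hmc := card_roots_filter_compl hd hmA
  have hmd : m < d := by
    have : 0 < d - m := by
      rw [← hmc, Multiset.card_pos_iff_exists_mem]
      refine ⟨α iB, Multiset.mem_filter.2 ⟨hmemroot iB, ?_⟩⟩
      have := hpl B (α iB)
      change ¬ p (α iB) ≤ u + q
      linarith
    omega
  have hside : ∀ z, ψ.eval z ∈ filledJulia ψ → z ∉ W → u + g - q ≤ p z := fun z hz hzW =>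
    (hgap z (hJball _ hz)).resolve_left hzW
  have hnr : ∀ z, FiniteOrbit (fun z => ψ.eval z) z → ∀ k,
      ‖(fun z => ψ.eval z)^[k] z - A‖ ≤ δ := fun z hz k =>
    hJd _ (iterate_mem_filledJulia hz.mem_filledJulia k)
  refine ⟨m, W, hm0, hmd,
    ⟨⟨filledJulia ψ, A, W, fun z => mem_filledJulia_of_eval_mem, hA,
      fun c hc => hm c (hJball c hc), fun x hx β hβ hβW => ?_, fun x hx k => hnr x hx.1 k⟩⟩,
    ⟨⟨filledJulia ψ, A, Wᶜ, fun z => mem_filledJulia_of_eval_mem, hA,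
      fun c hc => by convert card_roots_filter_compl hd (hm c (hJball c hc)),
      fun x hx β hβ hβW => ?_, fun x hx k => hnr x hx.1 k⟩⟩⟩
  · have h1 := hside β hβ hβW
    have h2 : p x ≤ u + q := hx.2
    have h3 := hpl β x
    rw [norm_sub_rev] at h3
    linarith
  · have h1 := hside x (eval_mem_filledJulia hx.1.mem_filledJulia) hx.2
    have h2 : p β ≤ u + q := not_not.1 hβW
    have h3 := hpl x β
    linarith

/-- The radius of a disk containing the filled Julia set of `z ^ 2 + c`. -/
def quadraticRadius (c : ℂ) : ℝ := (1 + Real.sqrt (1 + 4 * ‖c‖)) / 2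

theorem quadraticRadius_sq (c : ℂ) : quadraticRadius c ^ 2 = quadraticRadius c + ‖c‖ := by
  have h := Real.sq_sqrt (show (0 : ℝ) ≤ 1 + 4 * ‖c‖ by positivity)
  rw [quadraticRadius]
  nlinarith

theorem one_le_quadraticRadius (c : ℂ) : 1 ≤ quadraticRadius c := by
  have h : 1 ≤ Real.sqrt (1 + 4 * ‖c‖) := Real.one_le_sqrt.2 (by linarith [norm_nonneg c])
  rw [quadraticRadius]
  linarith

theorem lt_norm_sq_add {c z : ℂ} (hz : quadraticRadius c < ‖z‖) : ‖z‖ < ‖z ^ 2 + c‖ := by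
  have h1 := norm_sub_le_norm_add (z ^ 2) c
  rw [norm_pow] at h1
  nlinarith [quadraticRadius_sq c, one_le_quadraticRadius c]

theorem norm_le_quadraticRadius {c z : ℂ} (h : ‖z ^ 2 + c‖ ≤ quadraticRadius c) :
    ‖z‖ ≤ quadraticRadius c := by
  by_contra! hlt
  linarith [lt_norm_sq_add hlt]

theorem FiniteOrbit.norm_le_quadraticRadius {c z : ℂ}
    (h : FiniteOrbit (fun z => (X ^ 2 + C c : ℂ[X]).eval z) z) : ‖z‖ ≤ quadraticRadius c := by
  by_contra! hlt
  refine not_finiteOrbit_of_increasing (P := fun z => quadraticRadius c < ‖z‖)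
    (g := fun z => ‖z‖) (fun z hz => ?_) hlt h
  have := lt_norm_sq_add hz
  simp only [eval_add, eval_pow, eval_X, eval_C]
  exact ⟨hz.trans this, this⟩

theorem natDegree_X_sq_add_C (c : ℂ) : (X ^ 2 + C c : ℂ[X]).natDegree = 2 := by compute_degree!

theorem nonempty_splitting_whole_quadratic (c : ℂ) :
    Nonempty (Splitting (X ^ 2 + C c) 2 2 1 (quadraticRadius c)
      {z | FiniteOrbit (fun z => (X ^ 2 + C c : ℂ[X]).eval z) z}) := by
  refine ⟨⟨Metric.closedBall 0 (quadraticRadius c), 0, Set.univ, fun z hz => ?_, ?_, fun c' _ => ?_,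
    fun x _ β _ h => absurd (Set.mem_univ β) h, fun x hx k => ?_⟩⟩
  · simp only [eval_add, eval_pow, eval_X, eval_C, mem_closedBall_zero_iff] at hz ⊢
    exact norm_le_quadraticRadius hz
  · simpa using zero_le_one.trans (one_le_quadraticRadius c)
  · simp [card_roots_sub_C_eq]
  · rw [sub_zero]
    exact (FiniteOrbit.iterate hx k).norm_le_quadraticRadius

theorem one_sub_le_re_sq {w : ℂ} {ε : ℝ} (h : ‖w ^ 2 - 1‖ ≤ ε) : 1 - ε ≤ w.re ^ 2 := by
  have h1 := (Complex.abs_re_le_norm (w ^ 2 - 1)).trans h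
  have h2 : (w ^ 2 - 1).re = w.re ^ 2 - w.im ^ 2 - 1 := by
    simp [pow_two]
  rw [h2, abs_le] at h1
  nlinarith [sq_nonneg w.im]

/-- With α² = -c and b² = b + |c|, a preimage z of the disk of radius b satisfies |(z/α)² - 1| ≤
1/(b - 1). Hence z/α has real part at least b/(2|α|) in absolute value, and the two half planes are
separated by the full radius b. No loss between diameter and separation occurs, which is why
`archConst 2` is 1. -/
theorem splitsComplex_quadratic {c : ℂ} (hc : 4 ≤ quadraticRadius c) :
    SplitsComplex (X ^ 2 + C c) 2 (quadraticRadius c) (quadraticRadius c) := by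
  classical
  set b := quadraticRadius c with hb
  have hbc : ‖c‖ = b * (b - 1) := by nlinarith [quadraticRadius_sq c]
  have hc0 : c ≠ 0 := by
    rw [← norm_pos_iff, hbc]
    nlinarith
  obtain ⟨α, hα⟩ := IsAlgClosed.exists_pow_nat_eq (-c) (n := 2) (by norm_num)
  have hα0 : α ≠ 0 := by
    rintro rfl
    rw [zero_pow two_ne_zero, eq_comm, neg_eq_zero] at hα
    exact hc0 hα
  have hαn : ‖α‖ ^ 2 = b * (b - 1) := by rw [← norm_pow, hα, norm_neg, hbc]
  have hαp : 0 < ‖α‖ := norm_pos_iff.2 hα0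
  let p : ℂ → ℝ := fun z => (z / α).re
  have hpl : ∀ z w, ‖α‖ * (p z - p w) ≤ ‖z - w‖ := fun z w => by
    have h1 : p z - p w = ((z - w) / α).re := by simp only [p]; rw [sub_div, Complex.sub_re]
    rw [h1]
    calc ‖α‖ * ((z - w) / α).re ≤ ‖α‖ * ‖(z - w) / α‖ :=
          mul_le_mul_of_nonneg_left (Complex.re_le_norm _) hαp.le
      _ = ‖z - w‖ := by rw [norm_div]; field_simp
  have hkey : ∀ z, ‖z ^ 2 + c‖ ≤ b → b ^ 2 ≤ 4 * (‖α‖ ^ 2 * p z ^ 2) := fun z hz => by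
    have h1 : (z / α) ^ 2 - 1 = (z ^ 2 + c) / α ^ 2 := by
      rw [div_pow, hα]
      field_simp
      ring
    have h2 : ‖(z / α) ^ 2 - 1‖ ≤ 1 / (b - 1) := by
      rw [h1, norm_div, norm_pow, hαn, div_le_div_iff₀ (by nlinarith) (by linarith)]
      nlinarith
    have h3 := one_sub_le_re_sq h2
    have h4 : ‖α‖ ^ 2 * (1 - 1 / (b - 1)) ≤ ‖α‖ ^ 2 * p z ^ 2 :=
      mul_le_mul_of_nonneg_left h3 (by positivity)
    have hb1 : b - 1 ≠ 0 := by linarith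
    have h5 : ‖α‖ ^ 2 * (1 - 1 / (b - 1)) = b * (b - 2) := by
      rw [hαn]
      field_simp
      ring
    nlinarith
  have hpos : ∀ z, ‖z ^ 2 + c‖ ≤ b → 0 < p z → b ≤ 2 * (‖α‖ * p z) := fun z hz hp => by
    have := hkey z hz
    refine le_of_sq_le_sq ?_ (by positivity)
    nlinarith
  have hneg : ∀ z, ‖z ^ 2 + c‖ ≤ b → ¬ 0 < p z → b ≤ 2 * (‖α‖ * -p z) := fun z hz hp => by
    have := hkey z hz
    have h0 : 0 ≤ -p z := by linarith
    refine le_of_sq_le_sq ?_ (by positivity)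
    nlinarith
  set W : Set ℂ := {z | 0 < p z} with hW
  have hpn : ∀ z, p (-z) = -p z := fun z => by simp [p, neg_div]
  have hcount : ∀ c' ∈ Metric.closedBall (0 : ℂ) b,
      (((X ^ 2 + C c : ℂ[X]) - C c').roots.filter (· ∈ W)).card = 1 := by
    intro c' hc'
    rw [mem_closedBall_zero_iff] at hc'
    obtain ⟨w, hw⟩ := IsAlgClosed.exists_pow_nat_eq (c' - c) (n := 2) (by norm_num)
    have hroots : ((X ^ 2 + C c : ℂ[X]) - C c').roots = {w, -w} := by
      have : (X ^ 2 + C c : ℂ[X]) - C c' = (({w, -w} : Multiset ℂ).map fun a => X - C a).prod := by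
        have hCw : (C w : ℂ[X]) ^ 2 = C c' - C c := by rw [← C_pow, hw, C_sub]
        simp only [Multiset.insert_eq_cons, Multiset.map_cons, Multiset.map_singleton,
          Multiset.prod_cons, Multiset.prod_singleton, C_neg]
        linear_combination hCw
      rw [this, roots_multiset_prod_X_sub_C]
    have hwb : ‖w ^ 2 + c‖ ≤ b := by rwa [hw, sub_add_cancel]
    rw [hroots, Multiset.insert_eq_cons]
    by_cases h : 0 < p w
    · rw [Multiset.filter_cons_of_pos (p := (· ∈ W)) _ h, Multiset.filter_singleton, if_neg]
      · simp
      · change ¬ 0 < p (-w)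
        rw [hpn]; linarith
    · have h2 := hneg w hwb h
      have h3 : 0 < p (-w) := by
        rw [hpn]
        by_contra! h4
        nlinarith
      rw [Multiset.filter_cons_of_neg (p := (· ∈ W)) _ h, Multiset.filter_singleton, if_pos (show -w ∈ W from h3)]
      simp
  have hback : ∀ z, (X ^ 2 + C c : ℂ[X]).eval z ∈ Metric.closedBall (0 : ℂ) b →
      z ∈ Metric.closedBall (0 : ℂ) b := fun z hz => by
    simp only [eval_add, eval_pow, eval_X, eval_C, mem_closedBall_zero_iff] at hz ⊢
    exact norm_le_quadraticRadius hz
  have hev : ∀ z, (X ^ 2 + C c : ℂ[X]).eval z ∈ Metric.closedBall (0 : ℂ) b →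
      ‖z ^ 2 + c‖ ≤ b := fun z hz => by
    simpa only [eval_add, eval_pow, eval_X, eval_C, mem_closedBall_zero_iff] using hz
  have hnr : ∀ z, FiniteOrbit (fun z => (X ^ 2 + C c : ℂ[X]).eval z) z → ∀ k,
      ‖(fun z => (X ^ 2 + C c : ℂ[X]).eval z)^[k] z - 0‖ ≤ b := fun z hz k => by
    rw [sub_zero]
    exact (hz.iterate k).norm_le_quadraticRadius
  have hfe : ∀ z, FiniteOrbit (fun z => (X ^ 2 + C c : ℂ[X]).eval z) z → ‖z ^ 2 + c‖ ≤ b :=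
    fun z hz => by simpa using hnr z hz 1
  have hz0 : (0 : ℂ) ∈ Metric.closedBall (0 : ℂ) b := by simpa using (by linarith : 0 ≤ b)
  refine ⟨1, W, one_pos, one_lt_two,
    ⟨⟨Metric.closedBall 0 b, 0, W, hback, hz0, hcount, fun x hx β hβ hβW => ?_,
      fun x hx k => hnr x hx.1 k⟩⟩,
    ⟨⟨Metric.closedBall 0 b, 0, Wᶜ, hback, hz0, fun c' hc' => by
      convert card_roots_filter_compl (natDegree_X_sq_add_C c) (hcount c' hc'),
      fun x hx β hβ hβW => ?_, fun x hx k => hnr x hx.1 k⟩⟩⟩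
  · have h1 := hpos x (hfe x hx.1) hx.2
    have h2 := hneg β (hev β hβ) hβW
    have h3 := hpl x β
    linarith
  · have h1 := hneg x (hfe x hx.1) hx.2
    have h2 := hpos β (hev β hβ) (not_not.1 hβW)
    have h3 := hpl β x
    rw [norm_sub_rev] at h3
    linarith

/-! ### Bounds at archimedean places -/

/-- The constant relating diameter and separation of filled Julia sets. -/
def archConst (d : ℕ) : ℝ := if d = 2 then 1 else (d : ℝ) ^ 2

/-- The size from which on filled Julia sets can be split. -/
def splitThreshold (d : ℕ) : ℝ := if d = 2 then 16 else 32

/-- Completing the square: x₀ is the critical point of φ. -/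
theorem affineConj_eq_X_sq_add_C {L : Type*} [Field L] (h2 : (2 : L) ≠ 0) {φ : L[X]}
    (hφ : φ.natDegree = 2) {a x₀ : L} (ha : a * φ.leadingCoeff = 1)
    (hx₀ : x₀ = -φ.coeff 1 / (2 * φ.leadingCoeff)) :
    affineConj φ a x₀ = X ^ 2 + C ((affineConj φ a x₀).coeff 0) := by
  have hl : φ.leadingCoeff ≠ 0 := right_ne_zero_of_mul_eq_one ha
  have ha0 : a ≠ 0 := left_ne_zero_of_mul_eq_one ha
  have hm : (affineConj φ a x₀).Monic :=
    monic_affineConj ha0 (by omega) (by rw [hφ]; simpa using ha)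
  have hn : (affineConj φ a x₀).natDegree = 2 := by rw [natDegree_affineConj ha0, hφ]
  have hq := eq_quadratic_of_degree_le_two (p := φ)
    (degree_le_of_natDegree_le hφ.le)
  have hl2 : φ.coeff 2 = φ.leadingCoeff := by rw [leadingCoeff, hφ]
  have h1 : (affineConj φ a x₀).coeff 1 = 0 := by
    rw [coeff_affineConj ha0 one_ne_zero, taylor_coeff_one]
    conv_lhs => rw [hq]
    rw [hl2, hx₀]
    simp only [derivative_add, derivative_mul, derivative_C, derivative_X_pow, derivative_X,
      eval_add, eval_mul, eval_C, eval_pow, eval_X, eval_zero, eval_one]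
    simp
    field_simp
    ring
  have h3 := eq_quadratic_of_degree_le_two (p := affineConj φ a x₀)
    (degree_le_of_natDegree_le hn.le)
  have h4 : (affineConj φ a x₀).coeff 2 = 1 := by
    have := hm.coeff_natDegree
    rwa [hn] at this
  rw [h1, h4] at h3
  conv_lhs => rw [h3]
  simp

theorem exists_splitsComplex {φ : ℂ[X]} {d : ℕ} (hφ : φ.natDegree = d) (hd : 2 ≤ d) :
    ∃ a x₀ : ℂ, a ^ (d - 1) * φ.leadingCoeff = 1 ∧ ∃ ρ : ℝ, 0 < ρ ∧ 1 ≤ archConst d * ρ ∧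
      Nonempty (Splitting (affineConj φ a x₀) d d 1 (archConst d * ρ)
        {z | FiniteOrbit (fun z => (affineConj φ a x₀).eval z) z}) ∧
      (splitThreshold d ≤ ρ ^ 2 →
        SplitsComplex (affineConj φ a x₀) d ρ (archConst d * ρ)) := by
  have hl : φ.leadingCoeff ≠ 0 := leadingCoeff_ne_zero.2 (by rintro rfl; simp at hφ; omega)
  rcases hd.eq_or_lt with rfl | hd3
  · refine ⟨φ.leadingCoeff⁻¹, -φ.coeff 1 / (2 * φ.leadingCoeff),
      by simp [hl], ?_⟩
    rw [affineConj_eq_X_sq_add_C two_ne_zero hφ (inv_mul_cancel₀ hl) rfl]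
    set c := (affineConj φ φ.leadingCoeff⁻¹ (-φ.coeff 1 / (2 * φ.leadingCoeff))).coeff 0
    have h1 := one_le_quadraticRadius c
    refine ⟨quadraticRadius c, by linarith, ?_, ?_, ?_⟩
    · simpa [archConst] using h1
    · rw [archConst, if_pos rfl, one_mul]
      exact nonempty_splitting_whole_quadratic c
    · intro h
      rw [splitThreshold, if_pos rfl] at h
      rw [archConst, if_pos rfl, one_mul]
      exact splitsComplex_quadratic (by nlinarith)
  · obtain ⟨a, ha⟩ := IsAlgClosed.exists_pow_nat_eq φ.leadingCoeff⁻¹ (n := d - 1) (by omega)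
    have ha1 : a ^ (d - 1) * φ.leadingCoeff = 1 := by rw [ha, inv_mul_cancel₀ hl]
    have ha0 : a ≠ 0 := by
      rintro rfl
      rw [zero_pow (by omega), zero_mul] at ha1
      exact zero_ne_one ha1
    have hm : (affineConj φ a 0).Monic := monic_affineConj ha0 (by omega) (by rwa [hφ])
    have hn : (affineConj φ a 0).natDegree = d := by rw [natDegree_affineConj ha0, hφ]
    have hd0 : (3 : ℝ) ≤ d := by exact_mod_cast hd3
    have hC : archConst d = (d : ℝ) ^ 2 := if_neg (by omega)
    have hT : splitThreshold d = 32 := if_neg (by omega)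
    -- The maximum with 1 keeps log δ nonnegative for small Julia sets. Above the threshold it is
    -- just the diameter.
    refine ⟨a, 0, ha1, max (Metric.diam (filledJulia (affineConj φ a 0))) 1 / d ^ 2,
      by positivity, ?_, ?_, ?_⟩
    · rw [hC, mul_div_cancel₀ _ (by positivity)]
      exact le_max_right _ _
    · rw [hC, mul_div_cancel₀ _ (by positivity)]
      exact nonempty_splitting_whole hn hd (le_max_left _ _)
    · intro h
      rw [hT, div_pow, le_div_iff₀ (by positivity), ← pow_mul] at h
      rw [hC, mul_div_cancel₀ _ (by positivity)]
      have hmax : max (Metric.diam (filledJulia (affineConj φ a 0))) 1 =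
          Metric.diam (filledJulia (affineConj φ a 0)) := by
        refine max_eq_left ?_
        by_contra! hlt
        rw [max_eq_right hlt.le] at h
        have : (1 : ℝ) ≤ (d : ℝ) ^ (2 * 2) := one_le_pow₀ (by linarith)
        linarith
      rw [hmax] at h ⊢
      refine splitsComplex_of_three_le hm hn hd3 rfl ?_ (by simpa using h)
      rcases (Metric.diam_nonneg (s := filledJulia (affineConj φ a 0))).eq_or_lt with h0 | h0
      · rw [← h0] at hmax
        norm_num at hmax
      · exact h0

/-- Compared with a non-archimedean place there are two losses, N log N from Hadamard's inequality
and log (`archConst d`) from the ratio of diameter to separation. The splitting is available only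
when ρ² reaches the threshold. -/
theorem arch_bound {φ : ℂ[X]} {d : ℕ} (hφ : φ.natDegree = d) (hd : 2 ≤ d) :
    ∃ ρ : ℝ, 0 < ρ ∧
      (∀ {N : ℕ} (x : Fin N → ℂ), Function.Injective x →
        (∀ i, FiniteOrbit (fun z => φ.eval z) (x i)) →
        2 * normPairLog (fun z : ℂ => ‖z‖) (Real.log ‖φ.leadingCoeff‖ / (d - 1)) x ≤
          N * Real.log N +
            (Real.log ρ + Real.log (archConst d)) * ((d - 1) * (N * Real.logb d N))) ∧
      (splitThreshold d ≤ ρ ^ 2 →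
        ∃ (m : ℕ) (W : Set ℂ), 0 < m ∧ m < d ∧ ∀ {N : ℕ} (x : Fin N → ℂ), Function.Injective x →
        (∀ i, FiniteOrbit (fun z => φ.eval z) (x i)) →
        ((∀ i, x i ∈ W) →
          2 * normPairLog (fun z : ℂ => ‖z‖) (Real.log ‖φ.leadingCoeff‖ / (d - 1)) x ≤
          N * Real.log N +
            (Real.log ρ + Real.log (archConst d)) * ((d - 1) * (N * Real.logb d N)) -
            (d - m) / m * (N * (N - m)) * Real.log ρ) ∧
        ((∀ i, x i ∉ W) →
          2 * normPairLog (fun z : ℂ => ‖z‖) (Real.log ‖φ.leadingCoeff‖ / (d - 1)) x ≤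
          N * Real.log N +
            (Real.log ρ + Real.log (archConst d)) * ((d - 1) * (N * Real.logb d N)) -
            (d - (d - m : ℕ)) / (d - m : ℕ) * (N * (N - (d - m : ℕ))) * Real.log ρ)) := by
  obtain ⟨a, x₀, ha, ρ, hρ, hρ1, ⟨hwhole⟩, hsplit⟩ := exists_splitsComplex hφ hd
  have ha0 : a ≠ 0 := by
    rintro rfl
    rw [zero_pow (by omega), zero_mul] at ha
    exact zero_ne_one ha
  have hm : (affineConj φ a x₀).Monic := monic_affineConj ha0 (by omega) (by rwa [hφ])
  have hn : (affineConj φ a x₀).natDegree = d := by rw [natDegree_affineConj ha0, hφ]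
  have hC : 0 < archConst d := by
    rw [archConst]
    split_ifs
    · exact one_pos
    · have : (0 : ℝ) < d := by exact_mod_cast (by omega : 0 < d)
      positivity
  have hlog : Real.log (archConst d * ρ) = Real.log ρ + Real.log (archConst d) := by
    rw [Real.log_mul hC.ne' hρ.ne', add_comm]
  have key : ∀ {S : Set ℂ} {m : ℕ} {r : ℝ}, 1 ≤ r → 0 < m → m ≤ d →
      Splitting (affineConj φ a x₀) d m r (archConst d * ρ) S →
      ∀ {N : ℕ} (x : Fin N → ℂ), Function.Injective x → (∀ i, (x i - x₀) / a ∈ S) →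
        2 * normPairLog (fun z : ℂ => ‖z‖) (Real.log ‖φ.leadingCoeff‖ / (d - 1)) x ≤
          N * Real.log N +
            (Real.log ρ + Real.log (archConst d)) * ((d - 1) * (N * Real.logb d N)) -
            (d - m) / m * (N * (N - m)) * Real.log r := by
    intro S m r hr hm0 hmd sp N x hx hxS
    have hinj : Function.Injective fun i => (x i - x₀) / a := fun i j hij => by
      have : x i - x₀ = x j - x₀ := by
        have := congrArg (· * a) hij
        simpa [div_mul_cancel₀ _ ha0] using this
      exact hx (sub_left_injective this)
    rcases Nat.eq_zero_or_pos N with rfl | hN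
    · simp [normPairLog]
    have hNr : (0 : ℝ) < N := by exact_mod_cast hN
    have h1 := sp.pairLog_le hm hn hd hm0 hmd hr hρ1 hinj hxS
      (H := Real.sqrt ((N : ℝ) ^ N)) (by positivity)
      fun M ρ hρ hM => norm_det_le_of_complex hρ hM
    rw [normPairLog_eq_pairLog hd ha hx (x₀ := x₀)]
    have h2 : 2 * Real.log (Real.sqrt ((N : ℝ) ^ N)) = N * Real.log N := by
      rw [Real.log_sqrt (by positivity), Real.log_pow]
      ring
    rw [h2, hlog] at h1
    exact h1
  refine ⟨ρ, hρ, fun {N} x hx hfin => ?_, fun hT => ?_⟩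
  · have := key le_rfl (by omega) le_rfl hwhole x hx fun i => finiteOrbit_affineConj ha0 (hfin i)
    simpa using this
  · obtain ⟨m, W, hm0, hmd, ⟨s1⟩, ⟨s2⟩⟩ := hsplit hT
    have hρ1 : 1 ≤ ρ := by
      have : (1 : ℝ) ≤ splitThreshold d := by rw [splitThreshold]; split_ifs <;> norm_num
      by_contra! hlt
      nlinarith
    refine ⟨m, (fun z => (z - x₀) / a) ⁻¹' W, hm0, hmd, fun {N} x hx hfin => ⟨fun hW => ?_,
      fun hW => ?_⟩⟩
    · exact key hρ1 hm0 hmd.le s1 x hx fun i => ⟨finiteOrbit_affineConj ha0 (hfin i), hW i⟩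
    · exact key hρ1 (by omega) (Nat.sub_le _ _) s2 x hx
        fun i => ⟨finiteOrbit_affineConj ha0 (hfin i), hW i⟩
end

noncomputable section

/-! ### Partitions of filled Julia sets into small pieces -/

/-- The number of pieces of diameter less than `1` of a real filled Julia set. -/
def colorBase (d : ℕ) : ℕ := if d = 2 then 9 else max 11 (2 * d)

theorem colorBase_pos (d : ℕ) : 0 < colorBase d := by
  rw [colorBase]
  split_ifs
  · norm_num
  · exact lt_max_of_lt_left (by norm_num)

section Coloring

variable {S : Set ℂ} {k d : ℕ}

theorem exists_coloring_of_cells {ι : Type*} [Fintype ι] (hk0 : 0 < k) (hk : Fintype.card ι ≤ k)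
    (R : ℂ → ι → Prop) (h1 : ∀ z ∈ S, ∃ i, R z i)
    (h2 : ∀ z ∈ S, ∀ w ∈ S, ∀ i, R z i → R w i → ‖z - w‖ < 1) :
    ∃ f : ℂ → Fin k, ∀ z ∈ S, ∀ w ∈ S, f z = f w → ‖z - w‖ < 1 := by
  classical
  choose g hg using h1
  let e : ι → Fin k := fun i => Fin.castLE hk (Fintype.equivFin ι i)
  have he : Function.Injective e := (Fin.castLE_injective hk).comp (Fintype.equivFin ι).injective
  refine ⟨fun z => if h : z ∈ S then e (g z h) else ⟨0, hk0⟩, fun z hz w hw hzw => ?_⟩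
  simp only [dif_pos hz, dif_pos hw] at hzw
  have h3 := he hzw
  exact h2 z hz w hw (g z hz) (hg z hz) (h3 ▸ hg w hw)

theorem exists_cell {x x₀ h : ℝ} (hh : 0 < h) {n : ℕ} (h1 : x₀ ≤ x) (h2 : x < x₀ + n * h) :
    ∃ a : Fin n, x₀ + a * h ≤ x ∧ x < x₀ + (a + 1) * h := by
  have h3 : 0 ≤ (x - x₀) / h := div_nonneg (by linarith) hh.le
  have h4 : (x - x₀) / h < n := by rw [div_lt_iff₀ hh]; linarith
  refine ⟨⟨⌊(x - x₀) / h⌋₊, (Nat.floor_lt h3).2 h4⟩, ?_, ?_⟩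
  · have := Nat.floor_le h3
    rw [le_div_iff₀ hh] at this
    simp only
    linarith
  · have := Nat.lt_floor_add_one ((x - x₀) / h)
    rw [div_lt_iff₀ hh] at this
    simp only
    linarith

theorem norm_sub_lt_one {z w : ℂ} {h u v : ℝ} (hh : h ^ 2 = 1 / 2) (hz1 : u ≤ z.re)
    (hz2 : z.re < u + h) (hz3 : v ≤ z.im) (hz4 : z.im < v + h) (hw1 : u ≤ w.re)
    (hw2 : w.re < u + h) (hw3 : v ≤ w.im) (hw4 : w.im < v + h) : ‖z - w‖ < 1 := by
  have h1 : (z.re - w.re) ^ 2 < h ^ 2 := sq_lt_sq' (by linarith) (by linarith)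
  have h2 : (z.im - w.im) ^ 2 < h ^ 2 := sq_lt_sq' (by linarith) (by linarith)
  have h3 : ‖z - w‖ ^ 2 = (z.re - w.re) ^ 2 + (z.im - w.im) ^ 2 := by
    rw [← Complex.normSq_eq_norm_sq, Complex.normSq_apply, Complex.sub_re, Complex.sub_im]
    ring
  nlinarith [norm_nonneg (z - w)]

theorem norm_eq_abs_re {z w : ℂ} (hz : z.im = 0) (hw : w.im = 0) : ‖z - w‖ = |z.re - w.re| := by
  rw [← Complex.sub_re, ← Real.norm_eq_abs, ← Complex.norm_real]
  congr 1
  apply Complex.ext <;> simp [hz, hw]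

theorem half_sqrt_two : (Real.sqrt 2 / 2) ^ 2 = 1 / 2 := by
  rw [div_pow, Real.sq_sqrt (by norm_num)]
  norm_num

/-- Half-open squares of side √2/2 have diameter 1, and the value 1 is not attained. -/
theorem coloring_grid {n : ℕ} (hn : 0 < n) {x₀ y₀ : ℝ}
    (h : ∀ z ∈ S, x₀ ≤ z.re ∧ z.re < x₀ + n * (Real.sqrt 2 / 2) ∧ y₀ ≤ z.im ∧
      z.im < y₀ + n * (Real.sqrt 2 / 2)) :
    ∃ f : ℂ → Fin (n ^ 2), ∀ z ∈ S, ∀ w ∈ S, f z = f w → ‖z - w‖ < 1 := by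
  set η := Real.sqrt 2 / 2 with hη
  have hη0 : 0 < η := by positivity
  refine exists_coloring_of_cells (ι := Fin n × Fin n) (by positivity) (by simp [pow_two])
    (fun z i => x₀ + i.1 * η ≤ z.re ∧ z.re < x₀ + (i.1 + 1) * η ∧ y₀ + i.2 * η ≤ z.im ∧
      z.im < y₀ + (i.2 + 1) * η) (fun z hz => ?_) ?_
  · obtain ⟨h1, h2, h3, h4⟩ := h z hz
    obtain ⟨a, ha⟩ := exists_cell hη0 h1 h2
    obtain ⟨b, hb⟩ := exists_cell hη0 h3 h4
    exact ⟨(a, b), ha.1, ha.2, hb.1, hb.2⟩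
  · rintro z - w - ⟨a, b⟩ ⟨h1, h2, h3, h4⟩ ⟨h5, h6, h7, h8⟩
    exact norm_sub_lt_one (h := η) half_sqrt_two h1 (by linarith) h3 (by linarith) h5
      (by linarith) h7 (by linarith)

/-- An open disk of radius √2 is covered by 4 × 4 squares of side √2/2. -/
theorem coloring_centers (hd : 0 < d) {α : Fin d → ℂ} (hk : 16 * d ≤ k)
    (h : ∀ z ∈ S, ∃ i, ‖z - α i‖ < Real.sqrt 2) :
    ∃ f : ℂ → Fin k, ∀ z ∈ S, ∀ w ∈ S, f z = f w → ‖z - w‖ < 1 := by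
  set η := Real.sqrt 2 / 2 with hη
  have hη0 : 0 < η := by positivity
  have hη2 : Real.sqrt 2 = 2 * η := by rw [hη]; ring
  refine exists_coloring_of_cells (ι := Fin d × Fin 4 × Fin 4) (by omega)
    (by simp; omega)
    (fun z i => (α i.1).re - 2 * η + i.2.1 * η ≤ z.re ∧
      z.re < (α i.1).re - 2 * η + (i.2.1 + 1) * η ∧ (α i.1).im - 2 * η + i.2.2 * η ≤ z.im ∧
      z.im < (α i.1).im - 2 * η + (i.2.2 + 1) * η) (fun z hz => ?_) ?_
  · obtain ⟨i, hi⟩ := h z hz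
    have h1 := abs_lt.1 ((Complex.abs_re_le_norm _).trans_lt hi)
    have h2 := abs_lt.1 ((Complex.abs_im_le_norm _).trans_lt hi)
    rw [Complex.sub_re, hη2] at h1
    rw [Complex.sub_im, hη2] at h2
    obtain ⟨a, ha⟩ := exists_cell (n := 4) hη0 (x₀ := (α i).re - 2 * η) (x := z.re)
      (by linarith) (by push_cast; linarith)
    obtain ⟨b, hb⟩ := exists_cell (n := 4) hη0 (x₀ := (α i).im - 2 * η) (x := z.im)
      (by linarith) (by push_cast; linarith)
    exact ⟨(i, a, b), ha.1, ha.2, hb.1, hb.2⟩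
  · rintro z - w - ⟨i, a, b⟩ ⟨h1, h2, h3, h4⟩ ⟨h5, h6, h7, h8⟩
    exact norm_sub_lt_one (h := η) half_sqrt_two h1 (by linarith) h3 (by linarith) h5
      (by linarith) h7 (by linarith)

theorem coloring_interval {n : ℕ} (hn : 0 < n) (hS : ∀ z ∈ S, z.im = 0) {x₀ : ℝ}
    (h : ∀ z ∈ S, x₀ ≤ z.re ∧ z.re < x₀ + n) :
    ∃ f : ℂ → Fin n, ∀ z ∈ S, ∀ w ∈ S, f z = f w → ‖z - w‖ < 1 := by
  refine exists_coloring_of_cells (ι := Fin n) hn (by simp)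
    (fun z i => x₀ + i * 1 ≤ z.re ∧ z.re < x₀ + (i + 1) * 1) (fun z hz => ?_) ?_
  · exact exists_cell one_pos (h z hz).1 (by linarith [(h z hz).2])
  · rintro z hz w hw i ⟨h1, h2⟩ ⟨h3, h4⟩
    rw [norm_eq_abs_re (hS z hz) (hS w hw), abs_lt]
    constructor <;> linarith

theorem coloring_real_centers (hd : 0 < d) {α : Fin d → ℂ} (hk : 2 * d ≤ k)
    (hS : ∀ z ∈ S, z.im = 0) (h : ∀ z ∈ S, ∃ i, ‖z - α i‖ < 1) :
    ∃ f : ℂ → Fin k, ∀ z ∈ S, ∀ w ∈ S, f z = f w → ‖z - w‖ < 1 := by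
  refine exists_coloring_of_cells (ι := Fin d × Fin 2) (by omega) (by simp; omega)
    (fun z i => (α i.1).re - 1 + i.2 * 1 ≤ z.re ∧ z.re < (α i.1).re - 1 + (i.2 + 1) * 1)
    (fun z hz => ?_) ?_
  · obtain ⟨i, hi⟩ := h z hz
    have h1 := abs_lt.1 ((Complex.abs_re_le_norm _).trans_lt hi)
    rw [Complex.sub_re] at h1
    obtain ⟨a, ha⟩ := exists_cell (n := 2) one_pos (x₀ := (α i).re - 1) (x := z.re)
      (by linarith) (by push_cast; linarith)
    exact ⟨(i, a), ha⟩
  · rintro z hz w hw i ⟨h1, h2⟩ ⟨h3, h4⟩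
    rw [norm_eq_abs_re (hS z hz) (hS w hw), abs_lt]
    constructor <;> linarith

/-- For u, v ≥ η one has uv ≥ η(u + v - η). As d ≥ 3, there is at least one further factor, and all
further factors together are at least η. -/
theorem le_prod_norm_sub (hd : 3 ≤ d) {α : Fin d → ℂ} {z : ℂ} {η : ℝ} (hη : 1 ≤ η)
    (h : ∀ i, η ≤ ‖z - α i‖) {i j : Fin d} (hij : i ≠ j) :
    η * (η * (‖z - α i‖ + ‖z - α j‖ - η)) ≤ ∏ i, ‖z - α i‖ := by
  have h1 : ∏ l, ‖z - α l‖ =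
      (∏ l ∈ ({i, j} : Finset (Fin d))ᶜ, ‖z - α l‖) * (‖z - α i‖ * ‖z - α j‖) := by
    rw [← Finset.prod_pair (f := fun l => ‖z - α l‖) hij, Finset.prod_compl_mul_prod]
  have h2 : η ≤ ∏ l ∈ ({i, j} : Finset (Fin d))ᶜ, ‖z - α l‖ := by
    have hcard : ({i, j} : Finset (Fin d))ᶜ.card = d - 2 := by
      rw [Finset.card_compl, Finset.card_pair hij, Fintype.card_fin]
    calc η ≤ η ^ (d - 2) := le_self_pow₀ hη (by omega)
      _ = ∏ l ∈ ({i, j} : Finset (Fin d))ᶜ, η := by rw [Finset.prod_const, hcard]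
      _ ≤ _ := Finset.prod_le_prod (fun _ _ => by linarith) fun l _ => h l
  have h3 : η * (‖z - α i‖ + ‖z - α j‖ - η) ≤ ‖z - α i‖ * ‖z - α j‖ := by
    nlinarith [mul_nonneg (sub_nonneg.2 (h i)) (sub_nonneg.2 (h j))]
  rw [h1]
  have h4 : 0 ≤ η * (‖z - α i‖ + ‖z - α j‖ - η) :=
    mul_nonneg (by linarith) (by linarith [h i, h j])
  exact mul_le_mul h2 h3 h4 (by linarith)

/-- In a set of large extent the points A and B are within q = τ^(1/d) of different roots. A point
at distance at least η from every root has total distance at least ℓ - 2q from those two, which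
makes the product of its distances exceed τ. -/
theorem exists_norm_sub_lt_of_prod_le (hd : 3 ≤ d) {α : Fin d → ℂ} {τ η ℓ : ℝ} (hτ : 1 ≤ τ)
    (hη : 1 ≤ η) (hprod : ∀ z ∈ S, ∏ i, ‖z - α i‖ ≤ τ) {A B : ℂ} (hA : A ∈ S) (hB : B ∈ S)
    (hAB : ℓ ≤ ‖A - B‖) (hnum : ∀ q : ℝ, 0 < q → q ^ 3 ≤ τ → τ < η * (η * (ℓ - 2 * q - η))) :
    ∀ z ∈ S, ∃ i, ‖z - α i‖ < η := by
  intro z hz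
  by_contra! hge
  obtain ⟨q, hq, hqd⟩ := exists_pow_eq_of_pos (d := d) (by omega) (by linarith : 0 < τ)
  have hn := hnum q hq (cube_le_of_pow_eq hd hq hqd hτ)
  obtain ⟨i, hi⟩ := exists_norm_sub_le (by omega) hq ((hprod A hA).trans_eq hqd.symm)
  obtain ⟨j, hj⟩ := exists_norm_sub_le (by omega) hq ((hprod B hB).trans_eq hqd.symm)
  have hη0 : 0 < η := by linarith
  have hpos : 0 < ℓ - 2 * q - η :=
    pos_of_mul_pos_right (pos_of_mul_pos_right (by linarith : 0 < η * (η * (ℓ - 2 * q - η)))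
      hη0.le) hη0.le
  have hij : i ≠ j := by
    rintro rfl
    have := norm_sub_le_norm_sub_add_norm_sub A (α i) B
    rw [norm_sub_rev (α i) B] at this
    linarith
  have h1 := (le_prod_norm_sub hd hη hge hij).trans (hprod z hz)
  have h2 : ℓ - 2 * q ≤ ‖z - α i‖ + ‖z - α j‖ := by
    have e1 := norm_sub_le_norm_sub_add_norm_sub A (α i) B
    have e2 := norm_sub_le_norm_sub_add_norm_sub (α i) z B
    have e3 := norm_sub_le_norm_sub_add_norm_sub z (α j) B
    rw [norm_sub_rev (α i) z] at e2
    rw [norm_sub_rev (α j) B] at e3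
    linarith
  have h3 : η * (η * (ℓ - 2 * q - η)) ≤ η * (η * (‖z - α i‖ + ‖z - α j‖ - η)) := by gcongr
  linarith

/-- Either S fits into a grid of β × β small squares, or it is so wide that every point is within √2
of one of the d preimages of the centre of its bounding box. In the second case 16d squares suffice,
and 16d ≤ β². -/
theorem coloring_complex_of_three_le (hd : 3 ≤ d) (hS : IsCompact S) (hne : S.Nonempty)
    (hroots : ∀ c, ∃ α : Fin d → ℂ, ∀ z ∈ S, ∃ w ∈ S, ∏ i, ‖z - α i‖ = ‖w - c‖) :
    ∃ f : ℂ → Fin (colorBase d ^ 2), ∀ z ∈ S, ∀ w ∈ S, f z = f w → ‖z - w‖ < 1 := by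
  obtain ⟨x₀, hx₀, hx₀m⟩ := hS.exists_isMinOn hne Complex.continuous_re.continuousOn
  obtain ⟨x₁, hx₁, hx₁m⟩ := hS.exists_isMaxOn hne Complex.continuous_re.continuousOn
  obtain ⟨y₀, hy₀, hy₀m⟩ := hS.exists_isMinOn hne Complex.continuous_im.continuousOn
  obtain ⟨y₁, hy₁, hy₁m⟩ := hS.exists_isMaxOn hne Complex.continuous_im.continuousOn
  replace hx₀m : ∀ z ∈ S, x₀.re ≤ z.re := fun z hz => hx₀m hz
  replace hx₁m : ∀ z ∈ S, z.re ≤ x₁.re := fun z hz => hx₁m hz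
  replace hy₀m : ∀ z ∈ S, y₀.im ≤ z.im := fun z hz => hy₀m hz
  replace hy₁m : ∀ z ∈ S, z.im ≤ y₁.im := fun z hz => hy₁m hz
  set β := colorBase d with hβ
  have hβ' : β = max 11 (2 * d) := if_neg (by omega)
  set η := Real.sqrt 2 / 2 with hη
  have hη2 : η ^ 2 = 1 / 2 := half_sqrt_two
  have hη0 : 0 < η := by positivity
  set w := max (x₁.re - x₀.re) (y₁.im - y₀.im) with hw
  by_cases hsmall : w < β * η
  · refine coloring_grid (n := β) (colorBase_pos d) (x₀ := x₀.re) (y₀ := y₀.im) fun z hz =>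
      ⟨hx₀m z hz, ?_, hy₀m z hz, ?_⟩
    · rw [← hη]
      linarith [hx₁m z hz, le_max_left (x₁.re - x₀.re) (y₁.im - y₀.im)]
    · rw [← hη]
      linarith [hy₁m z hz, le_max_right (x₁.re - x₀.re) (y₁.im - y₀.im)]
  push Not at hsmall
  have h11 : (11 : ℝ) ≤ β := by rw [hβ']; exact_mod_cast le_max_left _ _
  have hτ : 11 / 2 ≤ w * η := by nlinarith
  obtain ⟨A, hA, B, hB, hAB⟩ : ∃ A ∈ S, ∃ B ∈ S, w ≤ ‖A - B‖ := by
    rcases le_total (x₁.re - x₀.re) (y₁.im - y₀.im) with h | h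
    · refine ⟨y₁, hy₁, y₀, hy₀, ?_⟩
      rw [hw, max_eq_right h, ← Complex.sub_im]
      exact (le_abs_self _).trans (Complex.abs_im_le_norm _)
    · refine ⟨x₁, hx₁, x₀, hx₀, ?_⟩
      rw [hw, max_eq_left h, ← Complex.sub_re]
      exact Complex.re_le_norm _
  set c : ℂ := ⟨(x₀.re + x₁.re) / 2, (y₀.im + y₁.im) / 2⟩ with hc
  -- S lies within half the diagonal of a square of side w, that is w √2/2, of the centre of the
  -- bounding box.
  have hcw : ∀ z ∈ S, ‖z - c‖ ≤ w * η := fun z hz => by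
    have h3 : ‖z - c‖ ^ 2 = (z.re - c.re) ^ 2 + (z.im - c.im) ^ 2 := by
      rw [← Complex.normSq_eq_norm_sq, Complex.normSq_apply, Complex.sub_re, Complex.sub_im]
      ring
    have e1 : (z.re - c.re) ^ 2 ≤ (w / 2) ^ 2 := by
      have := le_max_left (x₁.re - x₀.re) (y₁.im - y₀.im)
      refine sq_le_sq' ?_ ?_ <;> simp only [hc] <;> linarith [hx₀m z hz, hx₁m z hz]
    have e2 : (z.im - c.im) ^ 2 ≤ (w / 2) ^ 2 := by
      have := le_max_right (x₁.re - x₀.re) (y₁.im - y₀.im)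
      refine sq_le_sq' ?_ ?_ <;> simp only [hc] <;> linarith [hy₀m z hz, hy₁m z hz]
    refine le_of_sq_le_sq ?_ (by linarith)
    rw [h3, mul_pow, hη2]
    linarith
  obtain ⟨α, hα⟩ := hroots c
  refine coloring_centers (d := d) (by omega) (α := α) ?_ ?_
  · rw [hβ']
    rcases Nat.lt_or_ge d 4 with h | h
    · have h5 : 11 ^ 2 ≤ max 11 (2 * d) ^ 2 := Nat.pow_le_pow_left (le_max_left _ _) 2
      omega
    · have h5 : (2 * d) ^ 2 ≤ max 11 (2 * d) ^ 2 := Nat.pow_le_pow_left (le_max_right _ _) 2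
      nlinarith
  · refine exists_norm_sub_lt_of_prod_le hd (τ := w * η) (by linarith)
      (Real.one_le_sqrt.2 one_le_two) (fun z hz => ?_) hA hB hAB fun q hq hq3 => ?_
    · obtain ⟨v, hv, e⟩ := hα z hz
      rw [e]
      exact hcw v hv
    · have hs : Real.sqrt 2 = 2 * η := by rw [hη]; ring
      set τ := w * η with hτd
      have hs1 : (1.414 : ℝ) ≤ Real.sqrt 2 := Real.le_sqrt_of_sq_le (by norm_num)
      have hwτ : w = 2 * η * τ := by
        rw [hτd]
        linear_combination (-2 * w) * hη2
      rw [hs, hwτ]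
      have e : 2 * η * (2 * η * (2 * η * τ - 2 * q - 2 * η)) =
          2 * η * (2 * τ - 2) - 4 * q := by
        linear_combination (4 * η * 2 * τ - 8 * q - 8 * η) * hη2
      rw [e, ← hs]
      -- A failure would give q of size at least 1.8, hence q³ ≥ 3.24 q; with q³ ≤ τ and τ ≥ 11/2
      -- this is contradictory.
      by_contra! hle
      have h6 : 1.828 * τ - 2.828 ≤ 4 * q := by nlinarith
      have h7 : 1.8 ≤ q := by linarith
      have h8 : 3.24 * q ≤ q ^ 3 := by
        have : 3.24 ≤ q ^ 2 := by nlinarith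
        nlinarith
      linarith

theorem coloring_real_of_three_le (hd : 3 ≤ d) (hS : IsCompact S) (hne : S.Nonempty)
    (hSr : ∀ z ∈ S, z.im = 0)
    (hroots : ∀ c, ∃ α : Fin d → ℂ, ∀ z ∈ S, ∃ w ∈ S, ∏ i, ‖z - α i‖ = ‖w - c‖) :
    ∃ f : ℂ → Fin (colorBase d), ∀ z ∈ S, ∀ w ∈ S, f z = f w → ‖z - w‖ < 1 := by
  obtain ⟨x₀, hx₀, hx₀m⟩ := hS.exists_isMinOn hne Complex.continuous_re.continuousOn
  obtain ⟨x₁, hx₁, hx₁m⟩ := hS.exists_isMaxOn hne Complex.continuous_re.continuousOn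
  replace hx₀m : ∀ z ∈ S, x₀.re ≤ z.re := fun z hz => hx₀m hz
  replace hx₁m : ∀ z ∈ S, z.re ≤ x₁.re := fun z hz => hx₁m hz
  set β := colorBase d with hβ
  have hβ' : β = max 11 (2 * d) := if_neg (by omega)
  by_cases hsmall : x₁.re - x₀.re < β
  · exact coloring_interval (colorBase_pos d) hSr (x₀ := x₀.re) fun z hz =>
      ⟨hx₀m z hz, by linarith [hx₁m z hz]⟩
  push Not at hsmall
  have h11 : (11 : ℝ) ≤ β := by rw [hβ']; exact_mod_cast le_max_left _ _
  set τ := (x₁.re - x₀.re) / 2 with hτ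
  obtain ⟨α, hα⟩ := hroots (((x₀.re + x₁.re) / 2 : ℝ) : ℂ)
  refine coloring_real_centers (d := d) (by omega) (α := α) (by rw [hβ']; exact le_max_right _ _)
    hSr ?_
  refine exists_norm_sub_lt_of_prod_le hd (τ := τ) (ℓ := 2 * τ) (by linarith) le_rfl
    (fun z hz => ?_) hx₁ hx₀ ?_ fun q hq hq3 => ?_
  · obtain ⟨v, hv, e⟩ := hα z hz
    rw [e, norm_eq_abs_re (hSr v hv) (Complex.ofReal_im _), Complex.ofReal_re, abs_le]
    constructor <;> linarith [hx₀m v hv, hx₁m v hv]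
  · have := Complex.re_le_norm (x₁ - x₀)
    rw [Complex.sub_re] at this
    linarith
  · by_contra! hle
    have h7 : 2.25 ≤ q := by linarith
    have h8 : 5 * q ≤ q ^ 3 := by
      have : 5 ≤ q ^ 2 := by nlinarith
      nlinarith
    linarith

/-- If both factors were at least 1, then 2|α| - 1 ≤ b. Squaring and using |α|² = b(b - 1) gives 3b²
- 6b - 1 ≤ 0, false for b ≥ 3. -/
theorem norm_sub_lt_one_or {b : ℝ} (hb : 3 ≤ b) {α z : ℂ} (hα : ‖α‖ ^ 2 = b * (b - 1))
    (hz : ‖z - α‖ * ‖z + α‖ ≤ b) : ‖z - α‖ < 1 ∨ ‖z + α‖ < 1 := by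
  by_contra! h
  have h1 : 2 * ‖α‖ ≤ ‖z - α‖ + ‖z + α‖ := by
    have := norm_sub_le (z + α) (z - α)
    rw [add_sub_sub_cancel, ← two_mul, norm_mul] at this
    simp only [Complex.norm_ofNat] at this
    linarith
  have h2 : 2 * ‖α‖ ≤ b + 1 := by nlinarith [mul_nonneg (sub_nonneg.2 h.1) (sub_nonneg.2 h.2)]
  nlinarith [norm_nonneg α]

theorem coloring_complex_of_two {b : ℝ} {α : ℂ} (hα : ‖α‖ ^ 2 = b * (b - 1))
    (hS : ∀ z ∈ S, ‖z‖ ≤ b ∧ ‖z - α‖ * ‖z + α‖ ≤ b) :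
    ∃ f : ℂ → Fin (colorBase 2 ^ 2), ∀ z ∈ S, ∀ w ∈ S, f z = f w → ‖z - w‖ < 1 := by
  have h9 : colorBase 2 = 9 := if_pos rfl
  rw [h9]
  have hs1 : (1.414 : ℝ) ≤ Real.sqrt 2 := Real.le_sqrt_of_sq_le (by norm_num)
  by_cases hb : 2 * b < 9 * (Real.sqrt 2 / 2)
  · refine coloring_grid (n := 9) (by norm_num) (x₀ := -b) (y₀ := -b) fun z hz => ?_
    have h1 := abs_le.1 ((Complex.abs_re_le_norm z).trans (hS z hz).1)
    have h2 := abs_le.1 ((Complex.abs_im_le_norm z).trans (hS z hz).1)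
    push_cast
    refine ⟨h1.1, ?_, h2.1, ?_⟩ <;> linarith
  · refine coloring_centers (d := 2) two_pos (α := ![α, -α]) (by norm_num) fun z hz => ?_
    have hlt : (1 : ℝ) < Real.sqrt 2 := by linarith
    rcases norm_sub_lt_one_or (by linarith) hα (hS z hz).2 with h | h
    · exact ⟨0, by simpa using h.trans hlt⟩
    · exact ⟨1, by simpa using h.trans hlt⟩

theorem coloring_real_of_two {b : ℝ} {α : ℂ} (hα : ‖α‖ ^ 2 = b * (b - 1))
    (hSr : ∀ z ∈ S, z.im = 0) (hS : ∀ z ∈ S, ‖z‖ ≤ b ∧ ‖z - α‖ * ‖z + α‖ ≤ b) :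
    ∃ f : ℂ → Fin (colorBase 2), ∀ z ∈ S, ∀ w ∈ S, f z = f w → ‖z - w‖ < 1 := by
  have h9 : colorBase 2 = 9 := if_pos rfl
  rw [h9]
  by_cases hb : 2 * b < 9
  · refine coloring_interval (by norm_num) hSr (x₀ := -b) fun z hz => ?_
    have h1 := abs_le.1 ((Complex.abs_re_le_norm z).trans (hS z hz).1)
    push_cast
    refine ⟨h1.1, ?_⟩
    linarith
  · refine coloring_real_centers (d := 2) two_pos (α := ![α, -α]) (by norm_num) hSr fun z hz => ?_
    rcases norm_sub_lt_one_or (by linarith) hα (hS z hz).2 with h | h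
    · exact ⟨0, by simpa using h⟩
    · exact ⟨1, by simpa using h⟩

end Coloring

theorem exists_norm_eval_sub_eq {ψ : ℂ[X]} {d : ℕ} (hl : ‖ψ.leadingCoeff‖ = 1)
    (hd : ψ.natDegree = d) (hd0 : 0 < d) (c : ℂ) :
    ∃ α : Fin d → ℂ, ∀ z, ∏ i, ‖z - α i‖ = ‖ψ.eval z - c‖ := by
  have hl0 : ψ.leadingCoeff ≠ 0 := by
    intro h
    rw [h, norm_zero] at hl
    exact zero_ne_one hl
  have hm : (C ψ.leadingCoeff⁻¹ * ψ).Monic := by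
    rw [Monic, leadingCoeff_mul, leadingCoeff_C, inv_mul_cancel₀ hl0]
  obtain ⟨α, hα⟩ := exists_forall_eval_eq hm
    (by rw [natDegree_C_mul (inv_ne_zero hl0), hd]) hd0 (ψ.leadingCoeff⁻¹ * c)
  refine ⟨α, fun z => ?_⟩
  rw [← norm_prod, ← hα, eval_mul, eval_C, ← mul_sub, norm_mul, norm_inv, hl, inv_one, one_mul]

theorem quadratic_coloring_data (c : ℂ) : ∃ α : ℂ,
    ‖α‖ ^ 2 = quadraticRadius c * (quadraticRadius c - 1) ∧
    ∀ z, FiniteOrbit (fun z => (X ^ 2 + C c : ℂ[X]).eval z) z →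
      ‖z‖ ≤ quadraticRadius c ∧ ‖z - α‖ * ‖z + α‖ ≤ quadraticRadius c := by
  obtain ⟨α, hα⟩ := IsAlgClosed.exists_pow_nat_eq (-c) (n := 2) (by norm_num)
  refine ⟨α, ?_, fun z hz => ⟨hz.norm_le_quadraticRadius, ?_⟩⟩
  · rw [← norm_pow, hα, norm_neg]
    linear_combination -quadraticRadius_sq c
  · have := (hz.iterate 1).norm_le_quadraticRadius
    simp only [Function.iterate_one, eval_add, eval_pow, eval_X, eval_C] at this
    rw [← norm_mul]
    have e : (z - α) * (z + α) = z ^ 2 + c := by linear_combination -hα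
    rwa [e]

theorem pow_mul_lt_one_of_div_lt_one {L : Type*} [NormedField L] {d : ℕ} (hd : 2 ≤ d) {a x₀ l : L}
    (ha : ‖a‖ ^ (d - 1) * ‖l‖ = 1) {x y : L} (h : ‖(x - x₀) / a - (y - x₀) / a‖ < 1) :
    ‖x - y‖ ^ (d - 1) * ‖l‖ < 1 := by
  have ha0 : 0 < ‖a‖ := by
    rcases (norm_nonneg a).eq_or_lt with h0 | h0
    · rw [← h0, zero_pow (by omega), zero_mul] at ha
      exact absurd ha zero_ne_one
    · exact h0
  rw [← sub_div, sub_sub_sub_cancel_right, norm_div, div_lt_one ha0] at h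
  rw [← ha]
  have hl : 0 < ‖l‖ := by
    rcases (norm_nonneg l).eq_or_lt with h0 | h0
    · rw [← h0, mul_zero] at ha
      exact absurd ha zero_ne_one
    · exact h0
  exact mul_lt_mul_of_pos_right (pow_lt_pow_left₀ h (norm_nonneg _) (by omega)) hl

theorem complex_coloring {φ : ℂ[X]} {d : ℕ} (hφ : φ.natDegree = d) (hd : 2 ≤ d) :
    ∃ f : ℂ → Fin (colorBase d ^ 2), ∀ x y, FiniteOrbit (fun z => φ.eval z) x →
      FiniteOrbit (fun z => φ.eval z) y → f x = f y →
      ‖x - y‖ ^ (d - 1) * ‖φ.leadingCoeff‖ < 1 := by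
  have hl : φ.leadingCoeff ≠ 0 := leadingCoeff_ne_zero.2 (by rintro rfl; simp at hφ; omega)
  suffices h : ∃ a x₀ : ℂ, a ^ (d - 1) * φ.leadingCoeff = 1 ∧
      ∃ f : ℂ → Fin (colorBase d ^ 2),
        ∀ z ∈ {z | FiniteOrbit (fun z => (affineConj φ a x₀).eval z) z},
        ∀ w ∈ {z | FiniteOrbit (fun z => (affineConj φ a x₀).eval z) z},
          f z = f w → ‖z - w‖ < 1 by
    obtain ⟨a, x₀, ha, f, hf⟩ := h
    have ha0 : a ≠ 0 := by
      rintro rfl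
      rw [zero_pow (by omega), zero_mul] at ha
      exact zero_ne_one ha
    refine ⟨fun x => f ((x - x₀) / a), fun x y hx hy hxy => ?_⟩
    exact pow_mul_lt_one_of_div_lt_one hd (by rw [← norm_pow, ← norm_mul, ha, norm_one])
      (hf _ (finiteOrbit_affineConj ha0 hx) _ (finiteOrbit_affineConj ha0 hy) hxy)
  rcases hd.eq_or_lt with rfl | hd3
  · refine ⟨φ.leadingCoeff⁻¹, -φ.coeff 1 / (2 * φ.leadingCoeff), by simp [hl], ?_⟩
    rw [affineConj_eq_X_sq_add_C two_ne_zero hφ (inv_mul_cancel₀ hl) rfl]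
    obtain ⟨α, hα, hS⟩ := quadratic_coloring_data
      ((affineConj φ φ.leadingCoeff⁻¹ (-φ.coeff 1 / (2 * φ.leadingCoeff))).coeff 0)
    exact coloring_complex_of_two hα hS
  · obtain ⟨a, ha⟩ := IsAlgClosed.exists_pow_nat_eq φ.leadingCoeff⁻¹ (n := d - 1) (by omega)
    have ha1 : a ^ (d - 1) * φ.leadingCoeff = 1 := by rw [ha, inv_mul_cancel₀ hl]
    have ha0 : a ≠ 0 := by
      rintro rfl
      rw [zero_pow (by omega), zero_mul] at ha1
      exact zero_ne_one ha1
    have hm : (affineConj φ a 0).Monic := monic_affineConj ha0 (by omega) (by rwa [hφ])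
    have hn : (affineConj φ a 0).natDegree = d := by rw [natDegree_affineConj ha0, hφ]
    obtain ⟨f, hf⟩ := coloring_complex_of_three_le hd3
      (isCompact_filledJulia (ψ := affineConj φ a 0) (by omega)) (nonempty_filledJulia (by omega))
      fun c => by
        obtain ⟨α, hα⟩ := exists_norm_eval_sub_eq (by rw [hm.leadingCoeff, norm_one]) hn
          (by omega) c
        exact ⟨α, fun z hz => ⟨_, eval_mem_filledJulia hz, hα z⟩⟩
    exact ⟨a, 0, ha1, f, fun z hz w hw => hf z (FiniteOrbit.mem_filledJulia hz) w
      (FiniteOrbit.mem_filledJulia hw)⟩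

theorem real_coloring {φ : ℝ[X]} {d : ℕ} (hφ : φ.natDegree = d) (hd : 2 ≤ d) :
    ∃ f : ℝ → Fin (colorBase d), ∀ x y, FiniteOrbit (fun z => φ.eval z) x →
      FiniteOrbit (fun z => φ.eval z) y → f x = f y →
      |x - y| ^ (d - 1) * |φ.leadingCoeff| < 1 := by
  have hl : φ.leadingCoeff ≠ 0 := leadingCoeff_ne_zero.2 (by rintro rfl; simp at hφ; omega)
  suffices h : ∃ a x₀ : ℝ, ‖a‖ ^ (d - 1) * ‖φ.leadingCoeff‖ = 1 ∧
      ∃ f : ℂ → Fin (colorBase d),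
        ∀ x y : ℝ, FiniteOrbit (fun z => (affineConj φ a x₀).eval z) x →
        FiniteOrbit (fun z => (affineConj φ a x₀).eval z) y →
          f x = f y → ‖(x : ℂ) - y‖ < 1 by
    obtain ⟨a, x₀, ha, f, hf⟩ := h
    have ha0 : a ≠ 0 := by
      rintro rfl
      rw [norm_zero, zero_pow (by omega), zero_mul] at ha
      exact zero_ne_one ha
    refine ⟨fun x => f (((x - x₀) / a : ℝ) : ℂ), fun x y hx hy hxy => ?_⟩
    refine pow_mul_lt_one_of_div_lt_one (L := ℝ) hd (x₀ := x₀) ha ?_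
    have := hf _ _ (finiteOrbit_affineConj ha0 hx) (finiteOrbit_affineConj ha0 hy) hxy
    rwa [← Complex.ofReal_sub, Complex.norm_real] at this
  rcases hd.eq_or_lt with rfl | hd3
  · refine ⟨φ.leadingCoeff⁻¹, -φ.coeff 1 / (2 * φ.leadingCoeff), by simp [hl], ?_⟩
    rw [affineConj_eq_X_sq_add_C two_ne_zero hφ (inv_mul_cancel₀ hl) rfl]
    set c := (affineConj φ φ.leadingCoeff⁻¹ (-φ.coeff 1 / (2 * φ.leadingCoeff))).coeff 0
    obtain ⟨α, hα, hS⟩ := quadratic_coloring_data (c : ℂ)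
    obtain ⟨f, hf⟩ := coloring_real_of_two
      (S := {z | FiniteOrbit (fun z => (X ^ 2 + C (c : ℂ) : ℂ[X]).eval z) z ∧ z.im = 0}) hα
      (fun z hz => hz.2) fun z hz => hS z hz.1
    have hmap : ∀ x : ℝ, FiniteOrbit (fun z => (X ^ 2 + C c : ℝ[X]).eval z) x →
        FiniteOrbit (fun z => (X ^ 2 + C (c : ℂ) : ℂ[X]).eval z) (x : ℂ) := fun x hx => by
      refine hx.map (σ := fun x : ℝ => (x : ℂ)) fun y => ?_
      simp
    exact ⟨f, fun x y hx hy => hf _ ⟨hmap x hx, Complex.ofReal_im _⟩ _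
      ⟨hmap y hy, Complex.ofReal_im _⟩⟩
  -- Over ℝ a root of order d - 1 need not exist for negative numbers, so the leading coefficient is
  -- only brought to ±1. The estimates need nothing but its norm.
  · obtain ⟨a, ha0, ha⟩ := exists_pow_eq_of_pos (d := d - 1) (δ := ‖φ.leadingCoeff‖⁻¹) (by omega)
      (inv_pos.2 (norm_pos_iff.2 hl))
    have ha1 : ‖a‖ ^ (d - 1) * ‖φ.leadingCoeff‖ = 1 := by
      rw [Real.norm_of_nonneg ha0.le, ha, inv_mul_cancel₀ (norm_ne_zero_iff.2 hl)]
    refine ⟨a, 0, ha1, ?_⟩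
    have hn : (affineConj φ a 0).natDegree = d := by rw [natDegree_affineConj ha0.ne', hφ]
    have hlc : ‖(affineConj φ a 0).leadingCoeff‖ = 1 := by
      rw [leadingCoeff, hn, coeff_affineConj ha0.ne' (by omega), ← hφ, coeff_taylor_natDegree,
        norm_mul, norm_pow, hφ, ha1]
    set ψ := affineConj φ a 0
    set Ψ := ψ.map Complex.ofRealHom with hΨ
    have hnΨ : Ψ.natDegree = d := by rw [hΨ, natDegree_map, hn]
    have hlΨ : ‖Ψ.leadingCoeff‖ = 1 := by
      rw [hΨ, leadingCoeff_map, Complex.ofRealHom_eq_coe, Complex.norm_real, hlc]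
    have hreal : ∀ z : ℂ, z.im = 0 → (Ψ.eval z).im = 0 := fun z hz => by
      have e : z = Complex.ofRealHom z.re := by
        apply Complex.ext <;> simp [hz]
      rw [e, hΨ, eval_map_apply]
      exact Complex.ofReal_im _
    have hmap : ∀ x : ℝ, FiniteOrbit (fun z => ψ.eval z) x →
        FiniteOrbit (fun z => Ψ.eval z) (x : ℂ) := fun x hx =>
      hx.map_ringHom Complex.ofRealHom
    by_cases hne : (filledJulia Ψ ∩ {z | z.im = 0}).Nonempty
    · obtain ⟨f, hf⟩ := coloring_real_of_three_le hd3
        ((isCompact_filledJulia (ψ := Ψ) (by omega)).inter_right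
          (isClosed_eq Complex.continuous_im continuous_const)) hne (fun z hz => hz.2)
        fun c => by
          obtain ⟨α, hα⟩ := exists_norm_eval_sub_eq hlΨ hnΨ (by omega) c
          exact ⟨α, fun z hz => ⟨_, ⟨eval_mem_filledJulia hz.1, hreal z hz.2⟩, hα z⟩⟩
      exact ⟨f, fun x y hx hy => hf _ ⟨(hmap x hx).mem_filledJulia, Complex.ofReal_im _⟩ _
        ⟨(hmap y hy).mem_filledJulia, Complex.ofReal_im _⟩⟩
    · exact ⟨fun _ => ⟨0, colorBase_pos d⟩, fun x y hx _ _ =>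
        absurd ⟨_, (hmap x hx).mem_filledJulia, Complex.ofReal_im _⟩ hne⟩
end

noncomputable section

/-! ### Standard absolute values from Dedekind domains -/

/-- The condition that a non-archimedean absolute value is normalized. -/
def NonarchAbs.IsStandard {K : Type*} [Field K] (w : NonarchAbs K) : Prop :=
  IsGreatest {r : ℝ | ∃ x : K, w.abs x = r ∧ r < 1} (1 / (w.residueCard : ℝ))

section Standard

variable {K : Type*} [Field K]

theorem NonarchAbs.ext_abs {w w' : NonarchAbs K} (h : w.abs = w'.abs) : w = w' := by
  cases w; cases w'; simp_all

theorem mem_standardAbs_iff {v : AbsoluteValue K ℝ} : v ∈ standardAbs K ↔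
    (∀ n : ℕ, v n = n) ∨ ∃ w : NonarchAbs K, w.abs = v ∧ w.IsStandard := by
  rw [standardAbs, Set.mem_ofPred_eq]
  refine or_congr_right (exists_congr fun w => and_congr_right fun h => ?_)
  subst h
  rfl

theorem not_isNonarchimedean_of_natCast {v : AbsoluteValue K ℝ} (h : ∀ n : ℕ, v n = n) :
    ¬ IsNonarchimedean v := fun hv => by
  have h1 := hv.apply_natCast_le_one (n := 2)
  rw [h 2] at h1
  norm_num at h1

theorem NonarchAbs.mem_standardAbs_iff (w : NonarchAbs K) : w.abs ∈ standardAbs K ↔ w.IsStandard := by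
  rw [_root_.mem_standardAbs_iff]
  refine ⟨?_, fun h => Or.inr ⟨w, rfl, h⟩⟩
  rintro (h | ⟨w', h, hw'⟩)
  · exact absurd w.nonarch (not_isNonarchimedean_of_natCast h)
  · rwa [← NonarchAbs.ext_abs h]

theorem mem_archPrimes_iff {v : AbsoluteValue K ℝ} : v ∈ archPrimes K ↔ ∀ n : ℕ, v n = n := by
  constructor
  · rintro ⟨h1, h2⟩
    refine (_root_.mem_standardAbs_iff.1 h1).resolve_right ?_
    rintro ⟨w, rfl, -⟩
    exact h2 w.nonarch
  · intro h
    exact ⟨_root_.mem_standardAbs_iff.2 (Or.inl h), not_isNonarchimedean_of_natCast h⟩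

namespace NonarchAbs

variable {w : NonarchAbs K}

theorem IsStandard.two_le_residueCard (h : w.IsStandard) : 2 ≤ w.residueCard := by
  obtain ⟨x, hx0, hx1⟩ := w.nontrivial
  obtain ⟨y, hy0, hy1⟩ : ∃ y, y ≠ 0 ∧ w.abs y < 1 := by
    rcases lt_or_gt_of_ne hx1 with h | h
    · exact ⟨x, hx0, h⟩
    · exact ⟨x⁻¹, inv_ne_zero hx0, by rw [map_inv₀]; exact inv_lt_one_of_one_lt₀ h⟩
  have h1 := h.2 ⟨y, rfl, hy1⟩
  have h2 : 0 < w.abs y := w.abs.pos hy0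
  obtain ⟨z, -, hz⟩ := h.1
  rcases Nat.lt_or_ge w.residueCard 2 with hlt | hge
  -- An infinite residue field has cardinality 0 by convention, and then 1/0 = 0 would be the
  -- largest value below 1; the nonzero y excludes this.
  · interval_cases hc : w.residueCard
    · rw [Nat.cast_zero, div_zero] at h1; linarith
    · norm_num at hz
  · exact hge

theorem IsStandard.le_of_one_lt (h : w.IsStandard) {x : K} (hx : 1 < w.abs x) :
    (w.residueCard : ℝ) ≤ w.abs x := by
  have h2 := h.two_le_residueCard
  have hq : (0 : ℝ) < w.residueCard := by exact_mod_cast (by omega : 0 < w.residueCard)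
  have h1 := h.2 ⟨x⁻¹, rfl, by rw [map_inv₀]; exact inv_lt_one_of_one_lt₀ hx⟩
  rw [map_inv₀, one_div] at h1
  exact (inv_le_inv₀ (by linarith) hq).1 h1

/-- Equivalent absolute values are powers of one another, and the exponent is 1 since both have the
same largest value below 1. -/
theorem IsStandard.eq_of_isEquiv {w' : NonarchAbs K} (h : w.IsStandard) (h' : w'.IsStandard)
    (he : w.abs.IsEquiv w'.abs) (hq : w.residueCard = w'.residueCard) : w.abs = w'.abs := by
  obtain ⟨c, hc, hcw⟩ := AbsoluteValue.isEquiv_iff_exists_rpow_eq.1 he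
  have hcw' : ∀ x, w.abs x ^ c = w'.abs x := fun x => congrFun hcw x
  set q : ℝ := 1 / (w.residueCard : ℝ) with hqd
  have h2 := h.two_le_residueCard
  have hq0 : 0 < q := by
    have : (0 : ℝ) < w.residueCard := by exact_mod_cast (by omega : 0 < w.residueCard)
    positivity
  obtain ⟨x, hx, hx1⟩ := h.1
  have hg' : IsGreatest {r : ℝ | ∃ x : K, w'.abs x = r ∧ r < 1} q := by
    rw [hqd, hq]; exact h'
  obtain ⟨y, hy, hy1⟩ := hg'.1
  have e1 : q ^ c ≤ q := by
    refine hg'.2 ⟨x, ?_, ?_⟩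
    · rw [← hcw', hx]
    · exact Real.rpow_lt_one hq0.le hx1 hc
  have e2 : q ≤ q ^ c := by
    have h3 : w.abs y < 1 := he.lt_one_iff.2 (by rw [hy]; exact hy1)
    have h4 : w.abs y ≤ q := h.2 ⟨y, rfl, h3⟩
    calc q = w.abs y ^ c := by rw [hcw', hy]
      _ ≤ q ^ c := Real.rpow_le_rpow (w.abs.nonneg _) h4 hc.le
  have e3 : c = 1 := by
    have := congrArg Real.log (le_antisymm e1 e2)
    rw [Real.log_rpow hq0] at this
    have hl : Real.log q ≠ 0 := (Real.log_neg hq0 hx1).ne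
    exact mul_right_cancel₀ hl (by rw [this, one_mul])
  ext x
  rw [← hcw', e3, Real.rpow_one]

/-- The map from O to the residue field has kernel I by `h2` and is onto by `h3`. -/
theorem residueCard_eq_card_quotient {O : Type*} [CommRing O] (f : O →+* K) (I : Ideal O)
    (h1 : ∀ a, w.abs (f a) ≤ 1) (h2 : ∀ a, w.abs (f a) < 1 ↔ a ∈ I)
    (h3 : ∀ x, w.abs x ≤ 1 → ∃ a, w.abs (f a - x) < 1) :
    w.residueCard = Nat.card (O ⧸ I) := by
  let V := (NormedField.valuation (K := WithAbs w.abs)).valuationSubring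
  let e : K →+* WithAbs w.abs := (WithAbs.equiv w.abs).symm.toRingHom
  have hn : ∀ x, ‖e x‖ = w.abs x := fun x => rfl
  let g : O →+* V := (e.comp f).codRestrict V.toSubring fun a =>
    mem_valuationSubring_iff_norm_le_one.2 (h1 a)
  have hg : ∀ a, ((g a : V) : WithAbs w.abs) = e (f a) := fun a => rfl
  let ρ : O →+* IsLocalRing.ResidueField V := (IsLocalRing.residue V).comp g
  have hρ : Function.Surjective ρ := by
    intro y
    obtain ⟨⟨x, hx⟩, rfl⟩ := IsLocalRing.residue_surjective y
    obtain ⟨z, rfl⟩ : ∃ z, e z = x := (WithAbs.equiv w.abs).symm.surjective x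
    obtain ⟨a, ha⟩ := h3 z (mem_valuationSubring_iff_norm_le_one.1 hx)
    refine ⟨a, ?_⟩
    rw [← sub_eq_zero, RingHom.comp_apply, ← map_sub, residue_eq_zero_iff_norm_lt_one]
    change ‖e (f a) - e z‖ < 1
    rw [← map_sub, hn]
    exact ha
  have hker : RingHom.ker ρ = I := by
    ext a
    rw [RingHom.mem_ker, RingHom.comp_apply, residue_eq_zero_iff_norm_lt_one, hg, hn, h2]
  rw [← hker]
  exact (Nat.card_congr (RingHom.quotientKerEquivOfSurjective hρ).toEquiv).symm

end NonarchAbs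

end Standard

section Dedekind

open IsDedekindDomain

theorem one_lt_card_quotient {O : Type*} [CommRing O] (P : HeightOneSpectrum O)
    [Finite (O ⧸ P.asIdeal)] :
    (1 : NNReal) < (Nat.card (O ⧸ P.asIdeal) : NNReal) := by
  have : Nontrivial (O ⧸ P.asIdeal) := Ideal.Quotient.nontrivial_iff.2 P.isPrime.ne_top
  exact_mod_cast Finite.one_lt_card

variable (K : Type*) [Field K] {O : Type*} [CommRing O] [IsDedekindDomain O] [Algebra O K]
  [IsFractionRing O K]

theorem residueCard_of_forall_iff (P : HeightOneSpectrum O) (w : NonarchAbs K)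
    (h : ∀ x, w.abs x < 1 ↔ P.valuation K x < 1) (h' : ∀ x, w.abs x ≤ 1 ↔ P.valuation K x ≤ 1) :
    w.residueCard = Nat.card (O ⧸ P.asIdeal) := by
  refine NonarchAbs.residueCard_eq_card_quotient (algebraMap O K) P.asIdeal (fun a => ?_)
    (fun a => ?_) fun x hx => ?_
  · rw [h']; exact P.valuation_le_one a
  · rw [h]; exact P.valuation_lt_one_iff_mem a
  · obtain ⟨a, ha⟩ := P.exists_valuation_sub_lt_of_integer ((h' x).1 hx) 1
    exact ⟨a, (h _).2 (by simpa using ha)⟩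

variable [hfin : ∀ P : HeightOneSpectrum O, Finite (O ⧸ P.asIdeal)]

/-- The normalized absolute value of a maximal ideal of a Dedekind domain. -/
def primeAbs (P : HeightOneSpectrum O) : NonarchAbs K where
  abs := P.adicAbv (one_lt_card_quotient P)
  nontrivial := by
    obtain ⟨π, hπ⟩ := P.valuation_exists_uniformizer K
    refine ⟨π, ?_, ?_⟩
    · rintro rfl
      rw [map_zero] at hπ
      exact WithZero.exp_ne_zero hπ.symm
    · change ((WithZeroMulInt.toNNReal (ne_zero_of_lt (one_lt_card_quotient P))
        (P.valuation K π) : NNReal) : ℝ) ≠ 1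
      intro h
      have h1 := (WithZeroMulInt.toNNReal_eq_one_iff _ _ (one_lt_card_quotient P).ne').1
        (NNReal.coe_eq_one.1 h)
      rw [hπ] at h1
      exact absurd (WithZero.exp_eq_one.1 h1) (by norm_num)
  nonarch := P.isNonarchimedean_adicAbv _

variable (P : HeightOneSpectrum O)

theorem primeAbs_apply (x : K) : (primeAbs K P).abs x =
    (WithZeroMulInt.toNNReal (ne_zero_of_lt (one_lt_card_quotient P)) (P.valuation K x) : NNReal) :=
  rfl

theorem primeAbs_le_one_iff (x : K) : (primeAbs K P).abs x ≤ 1 ↔ P.valuation K x ≤ 1 := by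
  rw [primeAbs_apply, ← WithZeroMulInt.toNNReal_le_one_iff (one_lt_card_quotient P),
    ← NNReal.coe_one, NNReal.coe_le_coe]

theorem primeAbs_lt_one_iff (x : K) : (primeAbs K P).abs x < 1 ↔ P.valuation K x < 1 := by
  rw [primeAbs_apply, ← WithZeroMulInt.toNNReal_lt_one_iff (one_lt_card_quotient P),
    ← NNReal.coe_one, NNReal.coe_lt_coe]

theorem primeAbs_algebraMap_le_one (a : O) : (primeAbs K P).abs (algebraMap O K a) ≤ 1 :=
  P.adicAbv_coe_le_one _ _

theorem primeAbs_algebraMap_lt_one_iff (a : O) :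
    (primeAbs K P).abs (algebraMap O K a) < 1 ↔ a ∈ P.asIdeal :=
  P.adicAbv_coe_lt_one_iff _ _

theorem residueCard_primeAbs : (primeAbs K P).residueCard = Nat.card (O ⧸ P.asIdeal) :=
  residueCard_of_forall_iff K P _ (primeAbs_lt_one_iff K P) (primeAbs_le_one_iff K P)

theorem primeAbs_isStandard : (primeAbs K P).IsStandard := by
  rw [NonarchAbs.IsStandard, residueCard_primeAbs]
  have hb := one_lt_card_quotient P
  have hval : (WithZeroMulInt.toNNReal (ne_zero_of_lt hb) (WithZero.exp (-1 : ℤ)) : ℝ) =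
      1 / (Nat.card (O ⧸ P.asIdeal) : ℝ) := by
    rw [WithZeroMulInt.toNNReal_neg_apply _ WithZero.exp_ne_zero]
    change (((Nat.card (O ⧸ P.asIdeal) : NNReal) ^ (-1 : ℤ) : NNReal) : ℝ) = _
    simp
  constructor
  · obtain ⟨π, hπ⟩ := P.valuation_exists_uniformizer K
    refine ⟨π, ?_, ?_⟩
    · rw [primeAbs_apply, hπ, hval]
    · rw [one_div]
      exact inv_lt_one_of_one_lt₀ (by exact_mod_cast hb)
  · rintro _ ⟨x, rfl, hx⟩
    rw [primeAbs_lt_one_iff] at hx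
    rw [primeAbs_apply, ← hval, NNReal.coe_le_coe]
    refine (WithZeroMulInt.toNNReal_strictMono hb).monotone ?_
    rw [show (1 : WithZero (Multiplicative ℤ)) = WithZero.exp 0 from rfl] at hx
    by_cases h0 : P.valuation K x = 0
    · rw [h0]; exact zero_le
    · obtain ⟨n, hn⟩ : ∃ n : ℤ, P.valuation K x = WithZero.exp n :=
        ⟨WithZero.log (P.valuation K x), (WithZero.exp_log h0).symm⟩
      rw [hn] at hx ⊢
      rw [WithZero.exp_lt_exp] at hx
      rw [WithZero.exp_le_exp]
      omega

theorem primeAbs_injective :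
    Function.Injective fun P : HeightOneSpectrum O => (primeAbs K P).abs := by
  intro P Q h
  ext a
  rw [← primeAbs_algebraMap_lt_one_iff K P, ← primeAbs_algebraMap_lt_one_iff K Q]
  exact iff_of_eq (congrArg (fun v : AbsoluteValue K ℝ => v (algebraMap O K a) < 1) h)

/-- The elements of O of absolute value below 1 form a nonzero prime ideal. Fractions over its
complement show that both valuation rings coincide, and the normalization does the rest. -/
theorem exists_eq_primeAbs {w : NonarchAbs K} (hw : w.IsStandard)
    (hle : ∀ a : O, w.abs (algebraMap O K a) ≤ 1) :
    ∃ P : HeightOneSpectrum O, w.abs = (primeAbs K P).abs := by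
  let I : Ideal O :=
    { carrier := {a | w.abs (algebraMap O K a) < 1}
      add_mem' := fun {a b} ha hb => by
        change w.abs _ < 1
        rw [map_add]
        exact (w.nonarch _ _).trans_lt (max_lt ha hb)
      zero_mem' := by change w.abs _ < 1; simp
      smul_mem' := fun c {a} ha => by
        change w.abs _ < 1
        rw [smul_eq_mul, map_mul, map_mul]
        exact mul_lt_one_of_nonneg_of_lt_one_right (hle c) (w.abs.nonneg _) ha }
  have hI : ∀ a, a ∈ I ↔ w.abs (algebraMap O K a) < 1 := fun a => Iff.rfl
  have hnI : ∀ a, a ∉ I → w.abs (algebraMap O K a) = 1 := fun a ha =>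
    le_antisymm (hle a) (not_lt.1 ha)
  have hprime : I.IsPrime := by
    refine Ideal.isPrime_iff.2 ⟨?_, fun {a b} hab => ?_⟩
    · rw [Ideal.ne_top_iff_one, hI]; simp
    · by_contra! h
      rw [hI, map_mul, map_mul, hnI a h.1, hnI b h.2] at hab
      norm_num at hab
  have hbot : I ≠ ⊥ := by
    intro h
    have h1 : ∀ a : O, a ≠ 0 → w.abs (algebraMap O K a) = 1 := fun a ha =>
      hnI a (by rw [h]; exact ha)
    obtain ⟨x, hx0, hx1⟩ := w.nontrivial
    obtain ⟨a, b, hb, rfl⟩ := IsFractionRing.div_surjective (A := O) x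
    have ha : a ≠ 0 := by rintro rfl; simp at hx0
    rw [map_div₀, h1 a ha, h1 b (nonZeroDivisors.ne_zero hb)] at hx1
    norm_num at hx1
  let P : HeightOneSpectrum O := ⟨I, hprime, hbot⟩
  have hval : ∀ x, P.valuation K x ≤ 1 → w.abs x ≤ 1 := fun x hx => by
    obtain ⟨a, ⟨s, hs⟩, h⟩ := P.exists_primeCompl_mul_eq_of_integer x hx
    have h2 := congrArg w.abs h
    rw [map_mul, hnI s hs, mul_one] at h2
    rw [h2]; exact hle a
  have hval2 : ∀ x, P.valuation K x < 1 → w.abs x < 1 := fun x hx => by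
    obtain ⟨a, ⟨s, hs⟩, h⟩ := P.exists_primeCompl_mul_eq_of_integer x hx.le
    have h2 := congrArg w.abs h
    rw [map_mul, hnI s hs, mul_one] at h2
    rw [h2, ← hI]
    change a ∈ P.asIdeal
    rw [← P.valuation_lt_one_iff_mem (K := K)]
    change P.valuation K (algebraMap O K a) < 1
    rw [← h, map_mul]
    have hs1 : P.valuation K (algebraMap O K s) = 1 := P.valuation_eq_one_iff_notMem.2 hs
    rwa [hs1, mul_one]
  have h' : ∀ x, w.abs x ≤ 1 ↔ P.valuation K x ≤ 1 := fun x => by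
    refine ⟨fun h => ?_, hval x⟩
    by_contra! hlt
    have hx0 : x ≠ 0 := by rintro rfl; simp at hlt
    have h3 := hval2 x⁻¹ (by rw [map_inv₀]; exact inv_lt_one_of_one_lt₀ hlt)
    rw [map_inv₀, inv_lt_one₀ (w.abs.pos hx0)] at h3
    linarith
  have h : ∀ x, w.abs x < 1 ↔ P.valuation K x < 1 := fun x => by
    refine ⟨fun h => ?_, hval2 x⟩
    by_contra! hlt
    have hx0 : x ≠ 0 := by rintro rfl; simp at hlt
    have h3 := hval x⁻¹ (by rw [map_inv₀]; exact inv_le_one_of_one_le₀ hlt)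
    rw [map_inv₀, inv_le_one₀ (w.abs.pos hx0)] at h3
    linarith
  refine ⟨P, hw.eq_of_isEquiv (primeAbs_isStandard K P) ?_ ?_⟩
  · rw [AbsoluteValue.isEquiv_iff_lt_one_iff]
    intro x
    rw [h, primeAbs_lt_one_iff]
  · rw [residueCard_primeAbs, residueCard_of_forall_iff K P w h h']

end Dedekind
end

noncomputable section

/-! ### The product formula for number fields -/

/-- The product formula for a global field, with the information on its archimedean places. -/
structure ProductFormula (K : Type*) [Field K] where
  /-- the exponents in the product formula -/
  mult : AbsoluteValue K ℝ → ℕ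
  mult_nonarch : ∀ w : NonarchAbs K, mult w.abs = 1
  finite_ne_one : ∀ x : K, x ≠ 0 → {v ∈ standardAbs K | v x ≠ 1}.Finite
  sum_log : ∀ x : K, x ≠ 0 → ∑ᶠ v ∈ standardAbs K, (mult v : ℝ) * Real.log (v x) = 0
  sum_mult : ∑ᶠ v ∈ archPrimes K, mult v = degQ K
  arch : ∀ v ∈ archPrimes K, (mult v = 1 ∧ ∃ σ : K →+* ℝ, ∀ x, v x = |σ x|) ∨
    (mult v = 2 ∧ ∃ σ : K →+* ℂ, ∀ x, v x = ‖σ x‖)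

section Arch

open NumberField

variable {K : Type*} [Field K]

theorem absoluteValue_ratCast [CharZero K] {v : AbsoluteValue K ℝ} (h : ∀ n : ℕ, v n = n) (q : ℚ) :
    v q = ‖q‖ := by
  have hi : ∀ n : ℤ, v n = |(n : ℝ)| := fun n => by
    obtain ⟨m, rfl | rfl⟩ := n.eq_nat_or_neg <;> simp [h]
  rw [Rat.cast_def, map_div₀, hi, h, ← Rat.norm_cast_real, Real.norm_eq_abs]
  conv_rhs => rw [Rat.cast_def, abs_div, Nat.abs_cast]

theorem eq_of_isEquiv_of_natCast {v v' : AbsoluteValue K ℝ} (h : ∀ n : ℕ, v n = n)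
    (h' : ∀ n : ℕ, v' n = n) (he : v.IsEquiv v') : v = v' := by
  obtain ⟨c, hc, hcw⟩ := AbsoluteValue.isEquiv_iff_exists_rpow_eq.1 he
  have hcw' : ∀ x, v x ^ c = v' x := fun x => congrFun hcw x
  have h2 := hcw' ((2 : ℕ) : K)
  rw [h, h'] at h2
  have h3 := congrArg Real.log h2
  rw [Real.log_rpow (by norm_num)] at h3
  have hc1 : c = 1 := mul_right_cancel₀ (Real.log_pos (by norm_num)).ne' (h3.trans (one_mul _).symm)
  ext x
  rw [← hcw', hc1, Real.rpow_one]

theorem isNontrivial_of_natCast {v : AbsoluteValue K ℝ} (h : ∀ n : ℕ, v n = n) :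
    v.IsNontrivial := by
  refine ⟨((2 : ℕ) : K), ?_, by rw [h]; norm_num⟩
  intro h0
  have := h 2
  rw [h0, map_zero] at this
  norm_num at this

theorem infinitePlace_natCast (w : InfinitePlace K) (n : ℕ) : w.1 n = n := by
  rw [← InfinitePlace.coe_apply, ← InfinitePlace.norm_embedding_eq]
  simp

theorem infinitePlace_val_injective (K : Type*) [Field K] :
    Function.Injective fun w : InfinitePlace K => w.1 := fun _ _ h => Subtype.ext h

/-- Bounded conjugates bound the coefficients of the minimal polynomial, and the equation then
bounds x for every v extending the usual absolute value of ℚ. The bound depends on the degree only,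
hence also holds for powers of x. -/
theorem absoluteValue_le_of_norm_le_one [NumberField K] {v : AbsoluteValue K ℝ}
    (h : ∀ n : ℕ, v n = n) {x : K} (hx : ∀ σ : K →+* ℂ, ‖σ x‖ ≤ 1) :
    v x ≤ max 1 (Module.finrank ℚ K *
      ((Module.finrank ℚ K).choose (Module.finrank ℚ K / 2) : ℝ)) := by
  rcases le_total (v x) 1 with hle | hge
  · exact le_max_of_le_left hle
  refine le_max_of_le_right ?_
  set B : ℝ := ((Module.finrank ℚ K).choose (Module.finrank ℚ K / 2) : ℝ) with hB
  have hint : IsIntegral ℚ x := Algebra.IsIntegral.isIntegral x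
  have hcoeff : ∀ i, ‖(minpoly ℚ x).coeff i‖ ≤ B := fun i => by
    have := NumberField.Embeddings.coeff_bdd_of_norm_le (A := ℂ) hx i
    simpa using this
  have hm := minpoly.monic hint
  have hdeg : (minpoly ℚ x).natDegree ≤ Module.finrank ℚ K := minpoly.natDegree_le x
  have hpos : 0 < (minpoly ℚ x).natDegree := minpoly.natDegree_pos hint
  have hroot := minpoly.aeval ℚ x
  rw [hm.as_sum] at hroot
  simp only [map_add, map_pow, aeval_X, map_sum, map_mul, aeval_C] at hroot
  have h1 : x ^ (minpoly ℚ x).natDegree = -∑ i ∈ Finset.range (minpoly ℚ x).natDegree,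
      algebraMap ℚ K ((minpoly ℚ x).coeff i) * x ^ i := eq_neg_of_add_eq_zero_left hroot
  set e := (minpoly ℚ x).natDegree with he
  have h2 : v x ^ e ≤ e * B * v x ^ (e - 1) := by
    rw [← map_pow, h1, AbsoluteValue.map_neg]
    refine (v.sum_le _ _).trans ?_
    calc ∑ i ∈ Finset.range e, v (algebraMap ℚ K ((minpoly ℚ x).coeff i) * x ^ i)
        ≤ ∑ _i ∈ Finset.range e, B * v x ^ (e - 1) := by
          refine Finset.sum_le_sum fun i hi => ?_
          rw [map_mul, map_pow, eq_ratCast, absoluteValue_ratCast h]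
          have hi' := Finset.mem_range.1 hi
          exact mul_le_mul (hcoeff i) (pow_le_pow_right₀ hge (by omega)) (by positivity)
            (by positivity)
      _ = e * B * v x ^ (e - 1) := by simp [mul_assoc]
  have h3 : v x ^ e = v x * v x ^ (e - 1) := by
    rw [← pow_succ', Nat.sub_add_cancel hpos]
  rw [h3] at h2
  have h4 : v x ≤ e * B := le_of_mul_le_mul_right h2 (by positivity)
  refine h4.trans ?_
  gcongr

/-- Were v different from all infinite places, weak approximation would provide a with v(a) > 1 that
is small at every infinite place. Its powers contradict the uniform bound. -/
theorem exists_infinitePlace_of_natCast [NumberField K] {v : AbsoluteValue K ℝ}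
    (h : ∀ n : ℕ, v n = n) : ∃ w : InfinitePlace K, w.1 = v := by
  by_contra! hne
  let u : Option (InfinitePlace K) → AbsoluteValue K ℝ := fun o => o.elim v fun w => w.1
  have hu : ∀ o, ∀ n : ℕ, u o n = n := fun o => by
    cases o with
    | none => exact h
    | some w => exact infinitePlace_natCast w
  have hpair : Pairwise fun i j => ¬ (u i).IsEquiv (u j) := by
    intro i j hij he
    have := eq_of_isEquiv_of_natCast (hu i) (hu j) he
    rcases i with _ | w <;> rcases j with _ | w'
    · exact hij rfl
    · exact hne w' this.symm
    · exact hne w this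
    · exact hij (congrArg some (Subtype.ext this))
  obtain ⟨a, ha, ha'⟩ := AbsoluteValue.exists_one_lt_lt_one_pi_of_not_isEquiv
    (fun i => isNontrivial_of_natCast (hu i)) hpair none
  have hσ : ∀ σ : K →+* ℂ, ‖σ a‖ ≤ 1 := fun σ => by
    have := ha' (some (InfinitePlace.mk σ)) (by simp)
    exact this.le
  set B := max 1 (Module.finrank ℚ K *
      ((Module.finrank ℚ K).choose (Module.finrank ℚ K / 2) : ℝ))
  obtain ⟨n, hn⟩ := pow_unbounded_of_one_lt B ha
  have h2 := absoluteValue_le_of_norm_le_one h (x := a ^ n) fun σ => by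
    rw [map_pow, norm_pow]
    exact pow_le_one₀ (norm_nonneg _) (hσ σ)
  rw [map_pow] at h2
  exact absurd h2 (not_le.2 hn)

theorem archPrimes_eq_range [NumberField K] :
    archPrimes K = Set.range fun w : InfinitePlace K => w.1 := by
  ext v
  rw [mem_archPrimes_iff]
  refine ⟨fun h => exists_infinitePlace_of_natCast h, ?_⟩
  rintro ⟨w, rfl⟩
  exact infinitePlace_natCast w

end Arch

/-- The non-archimedean standard absolute values. -/
def nonarchPrimes (K : Type*) [Field K] : Set (AbsoluteValue K ℝ) :=
  {v | ∃ w : NonarchAbs K, w.abs = v ∧ w.IsStandard}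

section

variable {K : Type*} [Field K]

theorem standardAbs_eq_union : standardAbs K = archPrimes K ∪ nonarchPrimes K := by
  ext v
  rw [mem_standardAbs_iff, Set.mem_union, mem_archPrimes_iff]
  rfl

theorem disjoint_archPrimes_nonarchPrimes : Disjoint (archPrimes K) (nonarchPrimes K) := by
  rw [Set.disjoint_left]
  rintro _ ⟨-, h⟩ ⟨w, rfl, -⟩
  exact h w.nonarch

theorem NonarchAbs.sum_le (w : NonarchAbs K) {ι : Type*} (s : Finset ι) {f : ι → K} {B : ℝ}
    (hB : 0 ≤ B) (h : ∀ i ∈ s, w.abs (f i) ≤ B) : w.abs (∑ i ∈ s, f i) ≤ B := by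
  classical
  induction s using Finset.induction_on with
  | empty => simpa using hB
  | insert a s ha ih =>
    rw [Finset.sum_insert ha]
    exact (w.nonarch _ _).trans (max_le (h a (Finset.mem_insert_self _ _))
      (ih fun i hi => h i (Finset.mem_insert_of_mem hi)))

theorem NonarchAbs.le_one_of_isIntegral (w : NonarchAbs K) {A : Type*} [CommRing A]
    [Algebra A K] (hA : ∀ a : A, w.abs (algebraMap A K a) ≤ 1) {x : K} (hx : IsIntegral A x) :
    w.abs x ≤ 1 := by
  obtain ⟨p, hm, hp⟩ := hx
  by_contra! hlt
  have h1 : eval₂ (algebraMap A K) x p = x ^ p.natDegree +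
      ∑ i ∈ Finset.range p.natDegree, algebraMap A K (p.coeff i) * x ^ i := by
    conv_lhs => rw [hm.as_sum]
    simp [eval₂_finsetSum]
  rw [h1] at hp
  have h2 : x ^ p.natDegree =
      -∑ i ∈ Finset.range p.natDegree, algebraMap A K (p.coeff i) * x ^ i :=
    eq_neg_of_add_eq_zero_left hp
  have hdeg : 0 < p.natDegree := by
    rcases Nat.eq_zero_or_pos p.natDegree with h0 | h0
    · rw [h0] at h2
      simp at h2
    · exact h0
  have h3 : w.abs (∑ i ∈ Finset.range p.natDegree, algebraMap A K (p.coeff i) * x ^ i) ≤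
      w.abs x ^ (p.natDegree - 1) := by
    refine w.sum_le _ (by positivity) ?_
    · intro i hi
      rw [map_mul, map_pow]
      have hi' := Finset.mem_range.1 hi
      calc w.abs (algebraMap A K (p.coeff i)) * w.abs x ^ i ≤ 1 * w.abs x ^ i :=
            mul_le_mul_of_nonneg_right (hA _) (by positivity)
        _ = w.abs x ^ i := one_mul _
        _ ≤ _ := pow_le_pow_right₀ hlt.le (by omega)
  have h4 := congrArg w.abs h2
  rw [map_pow, AbsoluteValue.map_neg] at h4
  have h5 : w.abs x ^ (p.natDegree - 1) < w.abs x ^ p.natDegree :=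
    pow_lt_pow_right₀ hlt (by omega)
  linarith

theorem nonarchPrimes_eq_range {O : Type*} [CommRing O] [IsDedekindDomain O] [Algebra O K]
    [IsFractionRing O K] [∀ P : IsDedekindDomain.HeightOneSpectrum O, Finite (O ⧸ P.asIdeal)] :
    {v ∈ nonarchPrimes K | ∀ a : O, v (algebraMap O K a) ≤ 1} =
      Set.range fun P : IsDedekindDomain.HeightOneSpectrum O => (primeAbs K P).abs := by
  ext v
  constructor
  · rintro ⟨⟨w, rfl, hw⟩, hle⟩
    obtain ⟨P, hP⟩ := exists_eq_primeAbs K hw hle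
    exact ⟨P, hP.symm⟩
  · rintro ⟨P, rfl⟩
    exact ⟨⟨_, rfl, primeAbs_isStandard K P⟩, primeAbs_algebraMap_le_one K P⟩

end

section NumberField

open NumberField

variable (K : Type*) [Field K] [NumberField K]

instance finite_quotient_heightOneSpectrum (P : IsDedekindDomain.HeightOneSpectrum (𝓞 K)) :
    Finite (𝓞 K ⧸ P.asIdeal) := Ideal.finiteQuotientOfFreeOfNeBot _ P.ne_bot

theorem nonarchPrimes_numberField : nonarchPrimes K =
    Set.range fun P : IsDedekindDomain.HeightOneSpectrum (𝓞 K) => (primeAbs K P).abs := by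
  rw [← nonarchPrimes_eq_range]
  ext v
  refine ⟨fun h => ⟨h, ?_⟩, fun h => h.1⟩
  obtain ⟨w, rfl, -⟩ := h
  intro a
  refine w.le_one_of_isIntegral (A := ℤ) (fun n => ?_) (RingOfIntegers.isIntegral_coe a)
  rw [eq_intCast]
  exact w.nonarch.apply_intCast_le_one

theorem primeAbs_eq_finitePlace (P : IsDedekindDomain.HeightOneSpectrum (𝓞 K)) (x : K) :
    (primeAbs K P).abs x = FinitePlace.mk P x := by
  rw [FinitePlace.mk_apply, FinitePlace.norm_embedding]
  rfl


theorem finite_ne_one_of_range {K ι : Type*} [Field K] {S : Set (AbsoluteValue K ℝ)}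
    {f : ι → AbsoluteValue K ℝ} (hS : S = Set.range f) {x : K} (h : {i | f i x ≠ 1}.Finite) :
    {v ∈ S | v x ≠ 1}.Finite := by
  refine (h.image f).subset ?_
  rintro v ⟨hv, hx⟩
  rw [hS] at hv
  obtain ⟨i, rfl⟩ := hv
  exact ⟨i, hx, rfl⟩

open Classical in
/-- The local degree of an archimedean absolute value (and `1` for the other ones). -/
def infiniteMult (v : AbsoluteValue K ℝ) : ℕ :=
  if h : ∃ w : InfinitePlace K, w.1 = v then h.choose.mult else 1

theorem infiniteMult_coe (w : InfinitePlace K) : infiniteMult K w.1 = w.mult := by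
  have h : ∃ w' : InfinitePlace K, w'.1 = w.1 := ⟨w, rfl⟩
  rw [infiniteMult, dif_pos h]
  congr 1
  exact Subtype.ext h.choose_spec

theorem infiniteMult_nonarch (w : NonarchAbs K) : infiniteMult K w.abs = 1 := by
  rw [infiniteMult, dif_neg]
  rintro ⟨u, hu⟩
  exact not_isNonarchimedean_of_natCast (infinitePlace_natCast u) (hu ▸ w.nonarch)

theorem finite_ne_one_numberField {x : K} (hx : x ≠ 0) :
    {v ∈ archPrimes K | v x ≠ 1}.Finite ∧ {v ∈ nonarchPrimes K | v x ≠ 1}.Finite := by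
  constructor
  · rw [archPrimes_eq_range]
    exact (Set.finite_range _).subset fun v hv => hv.1
  · refine finite_ne_one_of_range (nonarchPrimes_numberField K) ?_
    have h3 : (fun w : FinitePlace K => w x).HasFiniteMulSupport :=
      FinitePlace.hasFiniteMulSupport hx
    refine (Set.Finite.image FinitePlace.maximalIdeal h3).subset fun P hP => ?_
    refine ⟨FinitePlace.mk P, ?_, FinitePlace.maximalIdeal_mk P⟩
    rw [Function.mem_mulSupport, ← primeAbs_eq_finitePlace]
    exact hP

/-- The product formula for number fields. -/
def productFormulaNumberField : ProductFormula K where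
  mult := infiniteMult K
  mult_nonarch := infiniteMult_nonarch K
  finite_ne_one x hx := by
    obtain ⟨h1, h2⟩ := finite_ne_one_numberField K hx
    refine (h1.union h2).subset ?_
    rintro v ⟨hv, hx⟩
    rw [standardAbs_eq_union] at hv
    exact hv.imp (fun h => ⟨h, hx⟩) fun h => ⟨h, hx⟩
  sum_log x hx := by
    obtain ⟨h1, h2⟩ := finite_ne_one_numberField K hx
    have hsupp : ∀ S : Set (AbsoluteValue K ℝ), {v ∈ S | v x ≠ 1}.Finite →
        (S ∩ Function.support fun v => (infiniteMult K v : ℝ) * Real.log (v x)).Finite := by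
      refine fun S hS => hS.subset ?_
      rintro v ⟨hv, hv1⟩
      refine ⟨hv, fun h => hv1 ?_⟩
      simp [h]
    rw [standardAbs_eq_union, finsum_mem_union' disjoint_archPrimes_nonarchPrimes (hsupp _ h1)
      (hsupp _ h2), archPrimes_eq_range, nonarchPrimes_numberField,
      finsum_mem_range (infinitePlace_val_injective K), finsum_mem_range (primeAbs_injective K),
      finsum_eq_sum_of_fintype]
    have h3 := congrArg Real.log (prod_abs_eq_one hx)
    have hpos : ∀ w : FinitePlace K, 0 < w x := fun w => FinitePlace.pos_iff.2 hx
    have hpos' : ∀ w : InfinitePlace K, 0 < w x := fun w => InfinitePlace.pos_iff.2 hx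
    have hprod : 0 < ∏ᶠ w : FinitePlace K, w x := finprod_induction (0 < ·) one_pos (fun _ _ => mul_pos) hpos
    rw [Real.log_one, Real.log_mul (Finset.prod_ne_zero_iff.2 fun w _ => by
      have := hpos' w; positivity) hprod.ne', Real.log_prod fun w _ => by
      have := hpos' w; positivity, Real.log_finprod hpos] at h3
    rw [← h3]
    congr 1
    · refine Finset.sum_congr rfl fun w _ => ?_
      rw [infiniteMult_coe, Real.log_pow]
      rfl
    · rw [← finsum_comp_equiv FinitePlace.equivHeightOneSpectrum.symm]
      refine finsum_congr fun P => ?_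
      rw [infiniteMult_nonarch, Nat.cast_one, one_mul, primeAbs_eq_finitePlace]
      rfl
  sum_mult := by
    rw [archPrimes_eq_range, finsum_mem_range (infinitePlace_val_injective K),
      finsum_eq_sum_of_fintype, degQ, dif_pos ‹_›, ← InfinitePlace.sum_mult_eq]
    exact Finset.sum_congr rfl fun w _ => infiniteMult_coe K w
  arch v hv := by
    rw [archPrimes_eq_range] at hv
    obtain ⟨w, rfl⟩ := hv
    rw [infiniteMult_coe]
    rcases w.isReal_or_isComplex with h | h
    · refine Or.inl ⟨h.mult_eq_one, InfinitePlace.embedding_of_isReal h, fun x => ?_⟩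
      rw [← Real.norm_eq_abs, InfinitePlace.norm_embedding_of_isReal, InfinitePlace.coe_apply]
    · refine Or.inr ⟨h.mult_eq_two, w.embedding, fun x => ?_⟩
      rw [InfinitePlace.norm_embedding_eq, InfinitePlace.coe_apply]

end NumberField
end

noncomputable section

/-! ### Separating elements of function fields -/

section Separating

open IntermediateField

/-- From y s(y^p) = r(y^p), transcendence gives an equality of polynomials, and the degrees 1 + p
deg s and p deg r are incongruent modulo p. -/
theorem notMem_adjoin_pow {k K : Type*} [Field k] [Field K] [Algebra k K] {y : K}
    (hy : Transcendental k y) {p : ℕ} (hp : 2 ≤ p) : y ∉ k⟮y ^ p⟯ := by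
  intro h
  obtain ⟨r, s, h⟩ := (mem_adjoin_simple_iff k y).1 h
  rw [← expand_aeval p r y, ← expand_aeval p s y] at h
  have hp0 : 0 < p := by omega
  have hs : aeval y (expand k p s) ≠ 0 := fun h0 => by
    rw [h0, div_zero] at h
    exact hy (h ▸ isAlgebraic_zero)
  have h1 : aeval y (X * expand k p s - expand k p r) = 0 := by
    rw [map_sub, map_mul, aeval_X, sub_eq_zero]
    exact (eq_div_iff hs).1 h
  have h2 := sub_eq_zero.1 ((transcendental_iff.1 hy) _ h1)
  have hs0 : s ≠ 0 := by rintro rfl; simp at hs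
  have h3 := congrArg natDegree h2
  rw [natDegree_X_mul ((expand_ne_zero hp0).2 hs0), natDegree_expand, natDegree_expand] at h3
  have h4 : p ∣ 1 := (Nat.dvd_add_right (Nat.dvd_mul_left p s.natDegree)).1 ⟨r.natDegree, by
    rw [h3, mul_comm]⟩
  have := Nat.le_of_dvd one_pos h4
  omega

variable {p : ℕ} [hp : Fact p.Prime] {K : Type*} [Field K]

section

variable [CharP K p]

/-- The hypothesis says K = K^p(y). Applied to the preimage of L under the m-th power of Frobenius,
it shows that a subfield containing y and all p^(m+1)-th powers also contains all p^m-th powers. -/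
theorem eq_top_of_frobenius_mem {y : K} (h : ∀ L : Subfield K, y ∈ L → (∀ z, z ^ p ∈ L) → L = ⊤)
    (m : ℕ) (L : Subfield K) (hy : y ∈ L) (hL : ∀ z, z ^ p ^ m ∈ L) : L = ⊤ := by
  induction m with
  | zero => exact eq_top_iff.2 fun z _ => by simpa using hL z
  | succ m ih =>
    refine ih fun z => ?_
    have h1 := h (L.comap (iterateFrobenius K p m)) (by
      rw [Subfield.mem_comap, iterateFrobenius_def]
      exact pow_mem hy _) fun z => by
        rw [Subfield.mem_comap, iterateFrobenius_def, ← pow_mul, ← pow_succ']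
        exact hL z
    have h2 : z ∈ L.comap (iterateFrobenius K p m) := h1 ▸ Subfield.mem_top z
    rwa [Subfield.mem_comap, iterateFrobenius_def] at h2

theorem finrank_adjoin_frobenius {y : K} (hy : ∀ z, z ^ p ≠ y) :
    Module.finrank (frobenius K p).fieldRange
      (IntermediateField.adjoin (frobenius K p).fieldRange {y}) = p := by
  set C := (frobenius K p).fieldRange with hC
  let a : C := ⟨y ^ p, ⟨y, rfl⟩⟩
  have hirr : Irreducible (X ^ p - Polynomial.C a : C[X]) := by
    refine X_pow_sub_C_irreducible_of_prime hp.out ?_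
    rintro ⟨_, c, rfl⟩ hb
    have h1 := congrArg Subtype.val hb
    exact hy c (frobenius_inj K p h1)
  have hm : minpoly C y = X ^ p - Polynomial.C a := by
    refine (minpoly.eq_of_irreducible_of_monic hirr ?_ (monic_X_pow_sub_C _ hp.out.ne_zero)).symm
    rw [map_sub, map_pow, aeval_X, aeval_C, sub_eq_zero]
    rfl
  have hint : IsIntegral C y := ⟨_, monic_X_pow_sub_C a hp.out.ne_zero, by
    rw [eval₂_sub, eval₂_X_pow, eval₂_C, sub_eq_zero]; rfl⟩
  rw [adjoin.finrank hint, hm, natDegree_X_pow_sub_C]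

end

variable [Algebra (ZMod p) K]

/-- Extracting p-th roots terminates because each root strictly lowers the degree of K over the
field generated. -/
theorem exists_pow_eq_of_transcendental
    (hfin : ∀ y : K, Transcendental (ZMod p) y → FiniteDimensional (ZMod p)⟮y⟯ K)
    {x : K} (hx : Transcendental (ZMod p) x) :
    ∃ (y : K) (j : ℕ), x = y ^ p ^ j ∧ ∀ z, z ^ p ≠ y := by
  induction hn : Module.finrank (ZMod p)⟮x⟯ K using Nat.strong_induction_on generalizing x with
  | _ n ih =>
    by_cases h : ∃ z, z ^ p = x
    · obtain ⟨z, rfl⟩ := h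
      have hz : Transcendental (ZMod p) z := fun h => hx (h.pow p)
      have hle : (ZMod p)⟮z ^ p⟯ ≤ (ZMod p)⟮z⟯ := by
        rw [adjoin_simple_le_iff]
        exact pow_mem (mem_adjoin_simple_self _ z) p
      have := hfin _ hx
      have := hfin _ hz
      have hlt : Module.finrank (ZMod p)⟮z⟯ K < n := by
        refine lt_of_le_of_ne ?_ fun he => ?_
        · rw [← hn]
          exact finrank_le_of_le_left hle
        · have := eq_of_le_of_finrank_eq' hle (hn.trans he.symm)
          exact notMem_adjoin_pow hz hp.out.two_le (this ▸ mem_adjoin_simple_self _ z)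
      obtain ⟨y, j, rfl, hy⟩ := ih _ hlt hz rfl
      exact ⟨y, j + 1, by rw [pow_succ, pow_mul], hy⟩
    · exact ⟨x, 0, by simp, fun z hz => h ⟨z, hz⟩⟩

theorem exists_isSeparable_adjoin
    (hfin : ∀ y : K, Transcendental (ZMod p) y → FiniteDimensional (ZMod p)⟮y⟯ K)
    {x : K} (hx : Transcendental (ZMod p) x) :
    ∃ T : K, Transcendental (ZMod p) T ∧ Algebra.IsSeparable (ZMod p)⟮T⟯ K := by
  have := hfin x hx
  have : Algebra.EssFiniteType (ZMod p) K := by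
    have : Algebra.EssFiniteType (ZMod p) (ZMod p)⟮x⟯ :=
      essFiniteType_iff.2 ⟨{x}, by simp⟩
    exact Algebra.EssFiniteType.comp (ZMod p) (ZMod p)⟮x⟯ K
  obtain ⟨s, hs, hsep⟩ :=
    exists_isTranscendenceBasis_and_isSeparable_of_perfectField (k := ZMod p) (K := K)
  have hb : IsTranscendenceBasis (ZMod p) ![x] := by
    rw [isTranscendenceBasis_iff_algebraicIndependent_isAlgebraic]
    refine ⟨(algebraicIndependent_singleton_iff 0).2 hx, ?_⟩
    have : Algebra.IsAlgebraic (ZMod p)⟮x⟯ K := inferInstance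
    rw [isAlgebraic_adjoin_iff_top] at this
    rw [show Set.range ![x] = {x} by simp]
    exact this
  have hc := hs.lift_cardinalMk_eq hb
  have hcard : s.card = 1 := by
    simpa using hc
  obtain ⟨T, rfl⟩ := Finset.card_eq_one.1 hcard
  rw [Finset.coe_singleton] at hsep
  refine ⟨T, ?_, hsep⟩
  exact hs.1.transcendental ⟨T, by simp⟩

variable [CharP K p]

/-- Separability over 𝔽_p(T) gives K = K^p(T), so K has degree p over K^p. Any y outside K^p already
generates an extension of degree p. -/
theorem adjoin_frobenius_eq_top {T y : K} [Algebra.IsSeparable (ZMod p)⟮T⟯ K]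
    (hy : ∀ z, z ^ p ≠ y) :
    IntermediateField.adjoin (frobenius K p).fieldRange {y} = ⊤ := by
  set C := (frobenius K p).fieldRange with hC
  have hCmem : ∀ z : K, z ^ p ∈ C := fun z => ⟨z, rfl⟩
  have hT : IntermediateField.adjoin C {T} = ⊤ := by
    have : ExpChar (ZMod p)⟮T⟯ p := by
      have := expChar_of_injective_algebraMap (algebraMap (ZMod p) (ZMod p)⟮T⟯).injective p
      exact this
    have h1 := adjoin_eq_adjoin_pow_expChar_of_isSeparable' (ZMod p)⟮T⟯ K Set.univ p
    rw [adjoin_univ] at h1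
    rw [eq_top_iff]
    intro z _
    have hz : z ∈ adjoin (ZMod p)⟮T⟯ ((· ^ p) '' (Set.univ : Set K)) := h1 ▸ mem_top
    induction hz using adjoin_induction with
    | mem x hx =>
      obtain ⟨w, -, rfl⟩ := hx
      exact (adjoin C {T}).algebraMap_mem ⟨w ^ p, hCmem w⟩
    | algebraMap x =>
      obtain ⟨x, hx⟩ := x
      change x ∈ _
      induction hx using adjoin_induction with
      | mem x hx => exact subset_adjoin _ _ hx
      | algebraMap x =>
        rw [← ZMod.pow_card x, map_pow]
        exact (adjoin C {T}).algebraMap_mem ⟨_, hCmem _⟩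
      | add _ _ _ _ h1 h2 => exact add_mem (h1 trivial) (h2 trivial)
      | mul _ _ _ _ h1 h2 => exact mul_mem (h1 trivial) (h2 trivial)
      | inv _ _ h1 => exact inv_mem (h1 trivial)
    | add _ _ _ _ h1 h2 => exact add_mem (h1 trivial) (h2 trivial)
    | mul _ _ _ _ h1 h2 => exact mul_mem (h1 trivial) (h2 trivial)
    | inv _ _ h1 => exact inv_mem (h1 trivial)
  have hT' : ∀ z, z ^ p ≠ T := by
    rintro z rfl
    have h2 : (⊥ : IntermediateField C K) = ⊤ := by
      rw [← hT, eq_comm, eq_bot_iff, adjoin_simple_le_iff]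
      exact (⊥ : IntermediateField C K).algebraMap_mem ⟨_, hCmem z⟩
    have h3 : y ∈ (⊥ : IntermediateField C K) := h2 ▸ mem_top
    obtain ⟨⟨_, w, rfl⟩, hw⟩ := mem_bot.1 h3
    exact hy w hw
  have h1 := finrank_adjoin_frobenius hT'
  rw [← hC, hT, finrank_top'] at h1
  have : FiniteDimensional C K := Module.finite_of_finrank_pos (h1 ▸ hp.out.pos)
  exact eq_of_le_of_finrank_eq le_top
    (by rw [finrank_top', h1]; exact finrank_adjoin_frobenius hy)

/-- The separable closure of 𝔽_p(y) in K contains y and, the remaining extension being finite and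
purely inseparable, all p^m-th powers for some m. As K = K^p(y), it is everything. Separability
makes the integral closure of 𝔽_p[y] finite over 𝔽_p[y]. -/
theorem isSeparable_adjoin_of_not_pow
    (hfin : ∀ y : K, Transcendental (ZMod p) y → FiniteDimensional (ZMod p)⟮y⟯ K)
    {y : K} (hy : Transcendental (ZMod p) y) (hyp : ∀ z, z ^ p ≠ y) :
    Algebra.IsSeparable (ZMod p)⟮y⟯ K := by
  obtain ⟨T, hT, hsep⟩ := exists_isSeparable_adjoin hfin hy
  have htop := adjoin_frobenius_eq_top (T := T) hyp
  have hfd := hfin y hy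
  rw [← separableClosure.eq_top_iff]
  set S := separableClosure (ZMod p)⟮y⟯ K
  have : ExpChar S p := expChar_of_injective_algebraMap (algebraMap (ZMod p) S).injective p
  obtain ⟨m, hm⟩ := (IsPurelyInseparable.hasExponent_iff' S K p).1 inferInstance
  have h1 : S.toSubfield = ⊤ := by
    refine eq_top_of_frobenius_mem (p := p) (y := y) (fun L hyL hL => ?_) m _ ?_ fun z => ?_
    · rw [eq_top_iff]
      intro z _
      have hz : z ∈ IntermediateField.adjoin (frobenius K p).fieldRange {y} := htop ▸ mem_top
      induction hz using adjoin_induction with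
      | mem x hx => rw [Set.mem_singleton_iff.1 hx]; exact hyL
      | algebraMap x => obtain ⟨_, w, rfl⟩ := x; exact hL w
      | add _ _ _ _ h1 h2 => exact add_mem (h1 trivial) (h2 trivial)
      | mul _ _ _ _ h1 h2 => exact mul_mem (h1 trivial) (h2 trivial)
      | inv _ _ h1 => exact inv_mem (h1 trivial)
    · exact S.algebraMap_mem ⟨y, mem_adjoin_simple_self _ y⟩
    · obtain ⟨s, hs⟩ := hm z
      rw [← hs]
      exact s.2
  rw [eq_top_iff]
  intro z _
  have : z ∈ S.toSubfield := h1 ▸ Subfield.mem_top z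
  exact this

end Separating
end

noncomputable section

/-! ### The product formula for function fields -/

/-! ### Sizes of residue rings as products over primes. -/

section CardQuot

open IsDedekindDomain

variable (K : Type*) [Field K] {O : Type*} [CommRing O] [IsDedekindDomain O] [Algebra O K]
  [IsFractionRing O K] [∀ P : HeightOneSpectrum O, Finite (O ⧸ P.asIdeal)]

/-- The cardinality of the quotient as a multiplicative function of ideals. -/
def cardQuotHom (O : Type*) [CommRing O] [IsDedekindDomain O] [Infinite O] : Ideal O →* ℕ where
  toFun := Submodule.cardQuot
  map_one' := by rw [Ideal.one_eq_top, Submodule.cardQuot_top]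
  map_mul' I J := UniqueFactorizationMonoid.multiplicative_of_coprime Submodule.cardQuot I J
    (Submodule.cardQuot_bot _ _)
    (fun {I J} hI => by simp [Ideal.isUnit_iff.mp hI, Ideal.mul_top])
    (fun {I} i hI => by
      have : Ideal.IsPrime I := Ideal.isPrime_of_prime hI
      exact cardQuot_pow_of_prime hI.ne_zero)
    (fun {I J} hIJ => cardQuot_mul_of_coprime <| Ideal.isCoprime_iff_sup_eq.mpr
      (Ideal.isUnit_iff.mp (hIJ (Ideal.dvd_iff_le.mpr le_sup_left)
        (Ideal.dvd_iff_le.mpr le_sup_right))))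

theorem primeAbs_algebraMap (P : HeightOneSpectrum O) {x : O} (hx : x ≠ 0) :
    (primeAbs K P).abs (algebraMap O K x) =
      ((Nat.card (O ⧸ P.asIdeal) : ℝ) ^
        (Associates.mk P.asIdeal).count (Associates.mk (Ideal.span {x})).factors)⁻¹ := by
  rw [primeAbs_apply, P.valuation_of_algebraMap, P.intValuation_if_neg hx,
    WithZeroMulInt.toNNReal_neg_apply _ WithZero.exp_ne_zero]
  change (((Nat.card (O ⧸ P.asIdeal) : NNReal) ^
    (-((Associates.mk P.asIdeal).count (Associates.mk (Ideal.span {x})).factors : ℤ)) : NNReal) : ℝ) = _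
  simp

theorem finite_primeAbs_ne_one {x : O} (hx : x ≠ 0) :
    {P : HeightOneSpectrum O | (primeAbs K P).abs (algebraMap O K x) ≠ 1}.Finite := by
  refine (Ideal.finite_factors (I := Ideal.span {x}) (by simpa using hx)).subset fun P hP => ?_
  have h1 := lt_of_le_of_ne (primeAbs_algebraMap_le_one K P x) hP
  rw [primeAbs_algebraMap_lt_one_iff] at h1
  exact Ideal.dvd_span_singleton.2 h1

/-- The cardinality of the quotient is multiplicative in the ideal; it is applied to the
factorization of the principal ideal into prime powers. -/
theorem log_card_quotient_span [Infinite O] {x : O} (hx : x ≠ 0) :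
    Real.log (Nat.card (O ⧸ Ideal.span {x})) =
      ∑ᶠ P : HeightOneSpectrum O, -Real.log ((primeAbs K P).abs (algebraMap O K x)) := by
  have hI : Ideal.span {x} ≠ 0 := by simpa using hx
  have h1 := congrArg (fun I => ((cardQuotHom O I : ℕ) : ℝ))
    (Ideal.finprod_heightOneSpectrum_factorization hI)
  have hpos : ∀ P : HeightOneSpectrum O, (0 : ℝ) < Nat.card (O ⧸ P.asIdeal) := fun P => by
    have := one_lt_card_quotient P
    exact_mod_cast zero_lt_one.trans this
  have h2 : ((cardQuotHom O (∏ᶠ P : HeightOneSpectrum O, P.maxPowDividing (Ideal.span {x})) : ℕ) : ℝ)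
      = ∏ᶠ P : HeightOneSpectrum O, (Nat.card (O ⧸ P.asIdeal) : ℝ) ^
        (Associates.mk P.asIdeal).count (Associates.mk (Ideal.span {x})).factors := by
    rw [MonoidHom.map_finprod _ (Ideal.hasFiniteMulSupport hI)]
    refine (MonoidHom.map_finprod (Nat.castRingHom ℝ : ℕ →* ℝ) ?_).trans ?_
    rotate_left
    · refine finprod_congr fun P => ?_
      rw [HeightOneSpectrum.maxPowDividing, map_pow, map_pow]
      rfl
    · refine (Ideal.hasFiniteMulSupport hI).subset fun P hP => ?_
      rw [Function.mem_mulSupport] at hP ⊢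
      exact fun h => hP (by rw [h, map_one])
  have h3 : (Nat.card (O ⧸ Ideal.span {x}) : ℝ) = ∏ᶠ P : HeightOneSpectrum O,
      (Nat.card (O ⧸ P.asIdeal) : ℝ) ^
        (Associates.mk P.asIdeal).count (Associates.mk (Ideal.span {x})).factors := by
    rw [← h2, h1]
    rfl
  rw [h3, Real.log_finprod fun P => pow_pos (hpos P) _]
  refine finsum_congr fun P => ?_
  rw [primeAbs_algebraMap K P hx, Real.log_inv, neg_neg]

end CardQuot

/-! ### Counting the zeros of X in a finite separable extension of k(X). -/

section Zeros

variable (k : Type*) [Field k]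

theorem hasFiniteQuotients_polynomial [Finite k] : Ring.HasFiniteQuotients k[X] := by
  refine ⟨fun {I} hI => ?_⟩
  obtain ⟨f, rfl⟩ : ∃ f, I = Ideal.span {f} := (IsPrincipalIdealRing.principal I).principal
  have hf : f ≠ 0 := by rintro rfl; simp at hI
  have : Module.Finite k (k[X] ⧸ Ideal.span {f}) := (AdjoinRoot.powerBasis hf).finite
  exact Module.finite_of_finite k

variable (F K : Type*) [Field F] [Field K] [Algebra k[X] F] [IsFractionRing k[X] F] [Algebra F K] [Algebra k[X] K] [IsScalarTower k[X] F K]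
  [FiniteDimensional F K] [Algebra.IsSeparable F K]

/-- The quotient has dimension over k equal to the degree of the norm of X, and that norm is X to
the degree of the extension. -/
theorem natCard_quotient_X (O : Type*) [CommRing O] [IsDomain O] [Algebra k[X] O] [Algebra O K]
    [IsScalarTower k[X] O K] [IsIntegralClosure O k[X] K] [Algebra k O] [IsScalarTower k k[X] O]
    [Module.IsTorsionFree k[X] K] [Module.Finite k[X] O] [Module.Free k[X] O] (hx0 : algebraMap k[X] O X ≠ 0)
    [Finite (O ⧸ Ideal.span {algebraMap k[X] O X})] :
    Nat.card (O ⧸ Ideal.span {algebraMap k[X] O X}) = Nat.card k ^ Module.finrank F K := by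
  have hfr := finrank_quotient_span_eq_natDegree_norm (F := k)
    (Module.Free.chooseBasis k[X] O) hx0
  rw [Algebra.norm_algebraMap, natDegree_X_pow, IsIntegralClosure.rank k[X] F K O] at hfr
  have : Module.Finite k (O ⧸ Ideal.span {algebraMap k[X] O X}) := Module.Finite.of_finite
  rw [Module.natCard_eq_pow_finrank (K := k), hfr]

theorem NonarchAbs.apply_algebraMap_le_one {k K : Type*} [Field k] [Finite k] [Field K]
    [Algebra k[X] K] (w : NonarchAbs K) (h : w.abs (algebraMap k[X] K X) ≤ 1) (f : k[X]) :
    w.abs (algebraMap k[X] K f) ≤ 1 := by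
  rw [f.as_sum_range_C_mul_X_pow, map_sum]
  refine w.sum_le _ zero_le_one fun i _ => ?_
  rw [map_mul, map_pow, map_mul, map_pow]
  refine mul_le_one₀ ?_ (by positivity) (pow_le_one₀ (w.abs.nonneg _) h)
  by_cases h0 : f.coeff i = 0
  · simp [h0]
  · obtain ⟨m, hm, hm1⟩ := (isOfFinOrder_of_finite (Units.mk0 _ h0)).exists_pow_eq_one
    have h1 : f.coeff i ^ m = 1 := by
      have := congrArg Units.val hm1
      simpa using this
    have h2 : w.abs (algebraMap k[X] K (C (f.coeff i))) ^ m = 1 := by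
      rw [← map_pow, ← map_pow, ← C_pow, h1]; simp
    exact ((pow_eq_one_iff_of_nonneg (w.abs.nonneg _) hm.ne').1 h2).le

/-- The places with v(X) ≤ 1 are exactly the primes of the integral closure O of k[X], so the sum is
the logarithm of the size of O/(X). -/
theorem sum_log_zeros_of_isIntegralClosure [Finite k] (O : Type*) [CommRing O] [IsDomain O]
    [Algebra k[X] O] [Algebra O K] [IsScalarTower k[X] O K] [IsIntegralClosure O k[X] K]
    [Algebra k O] [IsScalarTower k k[X] O] :
    {v ∈ nonarchPrimes K | v (algebraMap k[X] K X) < 1}.Finite ∧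
    ∑ᶠ v ∈ {v ∈ nonarchPrimes K | v (algebraMap k[X] K X) ≤ 1},
      -Real.log (v (algebraMap k[X] K X)) = Module.finrank F K * Real.log (Nat.card k) := by
  have : IsDedekindDomain O := IsIntegralClosure.isDedekindDomain k[X] F K O
  have : IsFractionRing O K := IsIntegralClosure.isFractionRing_of_finite_extension k[X] F K O
  have hinjK : Function.Injective (algebraMap k[X] K) := by
    rw [IsScalarTower.algebraMap_eq k[X] F K]
    exact (algebraMap F K).injective.comp (IsFractionRing.injective k[X] F)
  have : Module.IsTorsionFree k[X] K :=
    (Module.isTorsionFree_iff_algebraMap_injective).2 hinjK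
  have hfm : Module.Finite k[X] O := IsIntegralClosure.finite k[X] F K O
  have : Module.Free k[X] O := IsIntegralClosure.module_free k[X] F K O
  have hinj : Function.Injective (algebraMap k[X] O) := fun a b h => hinjK (by
    rw [IsScalarTower.algebraMap_apply k[X] O K, h, ← IsScalarTower.algebraMap_apply])
  have := hasFiniteQuotients_polynomial k
  have : Ring.HasFiniteQuotients O := Ring.HasFiniteQuotients.of_module_finite k[X] O
  have : ∀ P : IsDedekindDomain.HeightOneSpectrum O, Finite (O ⧸ P.asIdeal) := fun P =>
    Ring.HasFiniteQuotients.finiteQuotient P.ne_bot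
  have : Infinite O := Infinite.of_injective _ hinj
  have hx0 : algebraMap k[X] O X ≠ 0 := (map_ne_zero_iff _ hinj).2 X_ne_zero
  have hset : {v ∈ nonarchPrimes K | v (algebraMap k[X] K X) ≤ 1} =
      Set.range fun P : IsDedekindDomain.HeightOneSpectrum O => (primeAbs K P).abs := by
    rw [← nonarchPrimes_eq_range]
    ext v
    refine and_congr_right fun hv => ⟨fun h => ?_, fun h => ?_⟩
    · obtain ⟨w, rfl, -⟩ := hv
      exact fun a => w.le_one_of_isIntegral (A := k[X]) (w.apply_algebraMap_le_one h)
        ((IsIntegralClosure.isIntegral k[X] K a).algebraMap)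
    · rw [IsScalarTower.algebraMap_apply k[X] O K]
      exact h _
  have hfq : Finite (O ⧸ Ideal.span {algebraMap k[X] O X}) :=
    Ring.HasFiniteQuotients.finiteQuotient (by simp [hx0])
  constructor
  · refine (finite_ne_one_of_range hset (x := algebraMap k[X] K X) ?_).subset fun v hv =>
      ⟨⟨hv.1, hv.2.le⟩, hv.2.ne⟩
    rw [IsScalarTower.algebraMap_apply k[X] O K]
    exact finite_primeAbs_ne_one K hx0
  · rw [hset, finsum_mem_range (primeAbs_injective K), IsScalarTower.algebraMap_apply k[X] O K,
      ← log_card_quotient_span K hx0, natCard_quotient_X k F K O hx0, Nat.cast_pow, Real.log_pow]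

theorem sum_log_zeros [Finite k] [Algebra k K] [IsScalarTower k k[X] K] :
    {v ∈ nonarchPrimes K | v (algebraMap k[X] K X) < 1}.Finite ∧
    ∑ᶠ v ∈ {v ∈ nonarchPrimes K | v (algebraMap k[X] K X) ≤ 1},
      -Real.log (v (algebraMap k[X] K X)) = Module.finrank F K * Real.log (Nat.card k) :=
  sum_log_zeros_of_isIntegralClosure k F K (integralClosure k[X] K)

end Zeros

/-! ### Zeros against poles of an element of a function field. -/

section FunctionField

open IntermediateField

variable {p : ℕ} [hp : Fact p.Prime] {K : Type*} [Field K] [Algebra (ZMod p) K]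

theorem sum_log_zeros_of_transcendental {y : K} (hy : Transcendental (ZMod p) y)
    (hfd : FiniteDimensional (ZMod p)⟮y⟯ K) (hsep : Algebra.IsSeparable (ZMod p)⟮y⟯ K) :
    {v ∈ nonarchPrimes K | v y < 1}.Finite ∧
    ∑ᶠ v ∈ {v ∈ nonarchPrimes K | v y ≤ 1}, -Real.log (v y) =
      Module.finrank (ZMod p)⟮y⟯ K * Real.log p := by
  let : Algebra (ZMod p)[X] (ZMod p)⟮y⟯ := (aeval (AdjoinSimple.gen (ZMod p) y)).toAlgebra
  let : Algebra (ZMod p)[X] K := (aeval y).toAlgebra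
  have hK : ∀ f, algebraMap (ZMod p)[X] K f = aeval y f := fun f => rfl
  have : IsScalarTower (ZMod p)[X] (ZMod p)⟮y⟯ K := IsScalarTower.of_algebraMap_eq fun f => by
    rw [hK]
    change _ = algebraMap (ZMod p)⟮y⟯ K (aeval (AdjoinSimple.gen (ZMod p) y) f)
    rw [← aeval_algebraMap_apply, AdjoinSimple.algebraMap_gen]
  have : IsScalarTower (ZMod p) (ZMod p)[X] K := IsScalarTower.of_algebraMap_eq fun a => by
    rw [hK, ← C_eq_algebraMap, aeval_C]
  have hinj : Function.Injective (algebraMap (ZMod p)[X] (ZMod p)⟮y⟯) := by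
    have h1 : Function.Injective (algebraMap (ZMod p)[X] K) :=
      transcendental_iff_injective.1 hy
    rw [IsScalarTower.algebraMap_eq (ZMod p)[X] (ZMod p)⟮y⟯ K] at h1
    exact Function.Injective.of_comp (f := algebraMap (ZMod p)⟮y⟯ K) h1
  have : FaithfulSMul (ZMod p)[X] (ZMod p)⟮y⟯ := (faithfulSMul_iff_algebraMap_injective _ _).2 hinj
  have : IsFractionRing (ZMod p)[X] (ZMod p)⟮y⟯ := by
    refine IsFractionRing.of_field _ _ fun z => ?_
    obtain ⟨r, s, h⟩ := (mem_adjoin_simple_iff (ZMod p) z.1).1 z.2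
    refine ⟨r, s, (algebraMap (ZMod p)⟮y⟯ K).injective ?_⟩
    rw [map_div₀, ← IsScalarTower.algebraMap_apply, ← IsScalarTower.algebraMap_apply]
    exact h
  have h := sum_log_zeros (ZMod p) (ZMod p)⟮y⟯ K
  rwa [hK, aeval_X, Nat.card_zmod] at h

theorem adjoin_simple_inv (y : K) : (ZMod p)⟮y⁻¹⟯ = (ZMod p)⟮y⟯ := by
  apply le_antisymm
  · rw [adjoin_simple_le_iff]
    exact inv_mem (mem_adjoin_simple_self _ y)
  · rw [adjoin_simple_le_iff]
    simpa using inv_mem (mem_adjoin_simple_self (ZMod p) y⁻¹)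

/-- The zeros of y and those of 1/y have the same weighted count, the degree over the common field
generated by y or 1/y times log p. That this count is positive also shows that there are places at
all. -/
theorem sum_log_nonarch_of_transcendental {y : K} (hy : Transcendental (ZMod p) y)
    (hfd : FiniteDimensional (ZMod p)⟮y⟯ K) (hsep : Algebra.IsSeparable (ZMod p)⟮y⟯ K) :
    {v ∈ nonarchPrimes K | v y ≠ 1}.Finite ∧ ∑ᶠ v ∈ nonarchPrimes K, Real.log (v y) = 0 ∧
      (nonarchPrimes K).Nonempty := by
  have hyinv : Transcendental (ZMod p) y⁻¹ := fun h => hy (by simpa using h.inv)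
  obtain ⟨f1, h1⟩ := sum_log_zeros_of_transcendental hy hfd hsep
  obtain ⟨f2, h2⟩ := sum_log_zeros_of_transcendental hyinv (by rwa [adjoin_simple_inv])
    (by rwa [adjoin_simple_inv])
  rw [adjoin_simple_inv] at h2
  have hy0 : y ≠ 0 := fun h => hy (h ▸ isAlgebraic_zero)
  have hpos : ∀ v : AbsoluteValue K ℝ, 0 < v y := fun v => v.pos hy0
  have e2 : {v ∈ nonarchPrimes K | v y⁻¹ < 1} = {v ∈ nonarchPrimes K | 1 < v y} := by
    ext v
    exact and_congr_right fun _ => by rw [map_inv₀, inv_lt_one₀ (hpos v)]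
  rw [e2] at f2
  have hfin : {v ∈ nonarchPrimes K | v y ≠ 1}.Finite := by
    refine (f1.union f2).subset fun v hv => ?_
    rcases lt_or_gt_of_ne hv.2 with h | h
    · exact Or.inl ⟨hv.1, h⟩
    · exact Or.inr ⟨hv.1, h⟩
  have g1 : ∑ᶠ v ∈ {v ∈ nonarchPrimes K | v y ≤ 1}, -Real.log (v y) =
      ∑ᶠ v ∈ {v ∈ nonarchPrimes K | v y < 1}, -Real.log (v y) := by
    refine finsum_mem_inter_support_eq _ _ _ (Set.ext fun v => ?_)
    refine ⟨fun ⟨⟨a, b⟩, c⟩ => ⟨⟨a, lt_of_le_of_ne b fun h => c ?_⟩, c⟩,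
      fun ⟨⟨a, b⟩, c⟩ => ⟨⟨a, b.le⟩, c⟩⟩
    simp [h]
  have g2 : ∑ᶠ v ∈ {v ∈ nonarchPrimes K | v y⁻¹ ≤ 1}, -Real.log (v y⁻¹) =
      ∑ᶠ v ∈ {v ∈ nonarchPrimes K | 1 < v y}, Real.log (v y) := by
    have : ∀ v : AbsoluteValue K ℝ, -Real.log (v y⁻¹) = Real.log (v y) := fun v => by
      rw [map_inv₀, Real.log_inv, neg_neg]
    simp_rw [this]
    refine finsum_mem_inter_support_eq _ _ _ (Set.ext fun v => ?_)
    refine ⟨fun ⟨⟨a, b⟩, c⟩ => ⟨⟨a, lt_of_le_of_ne ?_ fun h => c ?_⟩, c⟩,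
      fun ⟨⟨a, b⟩, c⟩ => ⟨⟨a, ?_⟩, c⟩⟩
    · rwa [map_inv₀, inv_le_one₀ (hpos v)] at b
    · simp [← h]
    · rw [map_inv₀]; exact inv_le_one_of_one_le₀ b.le
  refine ⟨hfin, ?_, ?_⟩
  · have h3 : ∑ᶠ v ∈ nonarchPrimes K, Real.log (v y) =
        ∑ᶠ v ∈ {v ∈ nonarchPrimes K | v y < 1} ∪ {v ∈ nonarchPrimes K | 1 < v y},
          Real.log (v y) := by
      refine finsum_mem_inter_support_eq _ _ _ (Set.ext fun v => ?_)
      refine ⟨fun ⟨a, c⟩ => ⟨?_, c⟩, fun ⟨a, c⟩ => ⟨a.elim (·.1) (·.1), c⟩⟩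
      rcases lt_trichotomy (v y) 1 with h | h | h
      · exact Or.inl ⟨a, h⟩
      · exact absurd (by simp [h]) c
      · exact Or.inr ⟨a, h⟩
    rw [h3, finsum_mem_union (Set.disjoint_left.2 fun v hv hv' => lt_asymm hv.2 hv'.2) f1 f2,
      ← g2, h2, ← h1, g1, ← finsum_mem_add_distrib f1]
    simp
  · by_contra hne
    rw [Set.not_nonempty_iff_eq_empty] at hne
    have hs : {v ∈ nonarchPrimes K | v y ≤ 1} = ∅ := by rw [hne]; simp
    rw [hs, finsum_mem_empty] at h1
    have hn : 0 < Module.finrank (ZMod p)⟮y⟯ K := Module.finrank_pos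
    have hl : 0 < Real.log p := Real.log_pos (by exact_mod_cast hp.out.one_lt)
    have : (0 : ℝ) < Module.finrank (ZMod p)⟮y⟯ K * Real.log p := by positivity
    linarith

theorem AbsoluteValue.eq_one_of_isAlgebraic {x : K} (hx0 : x ≠ 0) (hx : IsAlgebraic (ZMod p) x)
    (v : AbsoluteValue K ℝ) : v x = 1 := by
  have : FiniteDimensional (ZMod p) (ZMod p)⟮x⟯ := adjoin.finiteDimensional hx.isIntegral
  have : Finite (ZMod p)⟮x⟯ := Module.finite_of_finite (ZMod p)
  have h0 : AdjoinSimple.gen (ZMod p) x ≠ 0 := fun h =>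
    hx0 (by rw [← AdjoinSimple.coe_gen (ZMod p) x, h]; rfl)
  obtain ⟨m, hm, hm1⟩ := (isOfFinOrder_of_finite (Units.mk0 _ h0)).exists_pow_eq_one
  have h1 : x ^ m = 1 := by
    have := congrArg (fun u => ((u.val : (ZMod p)⟮x⟯) : K)) hm1
    simpa using this
  have h2 : v x ^ m = 1 := by rw [← map_pow, h1, map_one]
  exact (pow_eq_one_iff_of_nonneg (v.nonneg _) hm.ne').1 h2

theorem archPrimes_eq_empty {K : Type*} [Field K] [CharP K p] : archPrimes K = ∅ := by
  rw [Set.eq_empty_iff_forall_notMem]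
  intro v hv
  have := mem_archPrimes_iff.1 hv p
  rw [CharP.cast_eq_zero, map_zero] at this
  exact hp.out.ne_zero (by exact_mod_cast this.symm)

theorem not_numberField_of_charP {K : Type*} [Field K] [CharP K p] : ¬ NumberField K := fun h =>
  hp.out.ne_zero (CharP.eq K ‹CharP K p› (CharP.ofCharZero K))

variable [CharP K p]

/-- Algebraic elements are roots of unity and have absolute value 1. Other elements are p-power
powers of an element that is not a p-th power, to which the separable case applies. -/
theorem sum_log_nonarch (hfin : ∀ y : K, Transcendental (ZMod p) y →
    FiniteDimensional (ZMod p)⟮y⟯ K) {x : K} (hx0 : x ≠ 0) :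
    {v ∈ nonarchPrimes K | v x ≠ 1}.Finite ∧ ∑ᶠ v ∈ nonarchPrimes K, Real.log (v x) = 0 := by
  by_cases hx : IsAlgebraic (ZMod p) x
  · have h := AbsoluteValue.eq_one_of_isAlgebraic hx0 hx
    simp [h]
  · obtain ⟨y, j, rfl, hy⟩ := exists_pow_eq_of_transcendental hfin hx
    have hyt : Transcendental (ZMod p) y := fun h => hx (h.pow _)
    obtain ⟨h1, h2, -⟩ := sum_log_nonarch_of_transcendental hyt (hfin y hyt)
      (isSeparable_adjoin_of_not_pow hfin hyt hy)
    refine ⟨h1.subset fun v hv => ⟨hv.1, fun h => hv.2 (by rw [map_pow, h, one_pow])⟩, ?_⟩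
    simp_rw [map_pow, Real.log_pow]
    rw [← mul_finsum_mem, h2, mul_zero]

/-- The product formula for function fields. -/
def productFormulaFunctionField (hfin : ∀ y : K, Transcendental (ZMod p) y →
    FiniteDimensional (ZMod p)⟮y⟯ K) : ProductFormula K where
  mult := fun _ => 1
  mult_nonarch := fun _ => rfl
  finite_ne_one x hx := by
    rw [standardAbs_eq_union, archPrimes_eq_empty (p := p), Set.empty_union]
    exact (sum_log_nonarch hfin hx).1
  sum_log x hx := by
    rw [standardAbs_eq_union, archPrimes_eq_empty (p := p), Set.empty_union]
    simpa using (sum_log_nonarch hfin hx).2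
  sum_mult := by
    rw [archPrimes_eq_empty (p := p), finsum_mem_empty, degQ,
      dif_neg (not_numberField_of_charP (p := p))]
  arch := by
    rw [archPrimes_eq_empty (p := p)]
    exact fun v hv => hv.elim

theorem nonarchPrimes_nonempty (hfin : ∀ y : K, Transcendental (ZMod p) y →
    FiniteDimensional (ZMod p)⟮y⟯ K) {x : K} (hx : Transcendental (ZMod p) x) :
    (nonarchPrimes K).Nonempty := by
  obtain ⟨y, j, rfl, hy⟩ := exists_pow_eq_of_transcendental hfin hx
  have hyt : Transcendental (ZMod p) y := fun h => hx (h.pow _)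
  exact (sum_log_nonarch_of_transcendental hyt (hfin y hyt)
      (isSeparable_adjoin_of_not_pow hfin hyt hy)).2.2

end FunctionField

theorem IsGlobalField.cases {K : Type*} [Field K] (hK : IsGlobalField K) :
    NumberField K ∨ (¬ NumberField K ∧ archPrimes K = ∅ ∧ (nonarchPrimes K).Nonempty ∧
      Nonempty (ProductFormula K)) := by
  rcases hK with h | ⟨p, hp, alg, hF⟩
  · exact Or.inl h
  · refine Or.inr ?_
    let : Algebra (ZMod p) K :=
      ((algebraMap (RatFunc (ZMod p)) K).comp (algebraMap (ZMod p) (RatFunc (ZMod p)))).toAlgebra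
    have : IsScalarTower (ZMod p) (RatFunc (ZMod p)) K := IsScalarTower.of_algebraMap_eq fun _ => rfl
    have : CharP K p := charP_of_injective_algebraMap (algebraMap (ZMod p) K).injective p
    have hfin : ∀ y : K, Transcendental (ZMod p) y →
        FiniteDimensional (IntermediateField.adjoin (ZMod p) {y}) K := fun y hy =>
      FunctionField.finiteDimensional_of_adjoin_transcendental hy
    have hT : Transcendental (ZMod p) (algebraMap (RatFunc (ZMod p)) K RatFunc.X) :=
      (transcendental_algebraMap_iff (algebraMap (RatFunc (ZMod p)) K).injective).2
        RatFunc.transcendental_X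
    exact ⟨not_numberField_of_charP (p := p), archPrimes_eq_empty (p := p),
      nonarchPrimes_nonempty hfin hT, ⟨productFormulaFunctionField hfin⟩⟩
end

noncomputable section

/-! ### Bounds for sets of points with finite orbit -/

/-! ### From inequalities for tuples to cardinalities. -/

section Counting

/-- Only tuples of points are ever estimated; finiteness of the set is part of the conclusion. -/
theorem finite_of_forall_fin_le {α : Type*} {Y : Set α} {B : ℝ}
    (h : ∀ (N : ℕ) (x : Fin N → α), Function.Injective x → (∀ i, x i ∈ Y) → (N : ℝ) ≤ B) :
    Y.Finite ∧ (Y.ncard : ℝ) ≤ B := by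
  have key : ∀ s : Finset α, (s : Set α) ⊆ Y → (s.card : ℝ) ≤ B := fun s hs =>
    h s.card (fun i => (s.equivFin.symm i : α))
      (fun i j hij => s.equivFin.symm.injective (Subtype.ext hij))
      fun i => hs (s.equivFin.symm i).2
  have hfin : Y.Finite := by
    by_contra hinf
    obtain ⟨s, hs, hc⟩ := Set.Infinite.exists_subset_card_eq hinf (⌊B⌋₊ + 1)
    have h1 := key s hs
    rw [hc] at h1
    push_cast at h1
    exact absurd h1 (not_le.2 (Nat.lt_floor_add_one B))
  refine ⟨hfin, ?_⟩
  have := key hfin.toFinset (by simp)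
  rwa [← Set.ncard_eq_toFinset_card Y hfin] at this

theorem finite_of_forall_color {α : Type*} {X : Set α} {n : ℕ} {B : ℝ} (f : α → Fin n)
    (h : ∀ c, {x ∈ X | f x = c}.Finite ∧ ({x ∈ X | f x = c}.ncard : ℝ) ≤ B) :
    X.Finite ∧ (X.ncard : ℝ) ≤ n * B := by
  have hX : X = ⋃ c : Fin n, {x ∈ X | f x = c} := by
    ext x; simp
  have hfin : X.Finite := by
    rw [hX]
    exact Set.finite_iUnion fun c => (h c).1
  refine ⟨hfin, ?_⟩
  have h1 : X.ncard ≤ ∑ c : Fin n, {x ∈ X | f x = c}.ncard := by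
    conv_lhs => rw [hX]
    exact Set.ncard_iUnion_le_of_fintype _
  calc (X.ncard : ℝ) ≤ ∑ c : Fin n, ({x ∈ X | f x = c}.ncard : ℝ) := by exact_mod_cast h1
    _ ≤ ∑ _c : Fin n, B := Finset.sum_le_sum fun c _ => (h c).2
    _ = n * B := by simp

theorem le_add_kappa_of_le {d m N : ℕ} {t L : ℝ} (hm : 0 < m) (hmd : m < d) (hL : 0 < L)
    (h : (d - m) / m * (N * (N - m)) * L ≤ L * (t * ((d - 1) * (N * Real.logb d N)))) :
    (N : ℝ) ≤ m + kappa d m * t * Real.logb d N := by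
  have hm' : (0 : ℝ) < m := by exact_mod_cast hm
  rcases Nat.eq_zero_or_pos N with rfl | hN
  · simp
  have hN' : (0 : ℝ) < N := by exact_mod_cast hN
  have h3 : (0 : ℝ) < d - m := by
    have : (m : ℝ) < d := by exact_mod_cast hmd
    linarith
  have h1 : (d - m) / m * (N - m) ≤ t * ((d - 1) * Real.logb d N) := by
    refine le_of_mul_le_mul_right ?_ (mul_pos hN' hL)
    calc (d - m) / m * (N - m) * (N * L) = (d - m) / m * (N * (N - m)) * L := by ring
      _ ≤ _ := h
      _ = _ := by ring
  rw [kappa]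
  have h2 : (N : ℝ) - m ≤ m / (d - m) * (t * ((d - 1) * Real.logb d N)) := by
    calc (N : ℝ) - m = m / (d - m) * ((d - m) / m * (N - m)) := by field_simp
      _ ≤ _ := mul_le_mul_of_nonneg_left h1 (by positivity)
  calc (N : ℝ) ≤ m + m / (d - m) * (t * ((d - 1) * Real.logb d N)) := by linarith
    _ = _ := by ring

/-- Bookkeeping of the product formula: every place has g at most L, the value at the dominant
place, so the whole sum is at most L t E - Q, where Q is the gain at v₀. The slack t - |S| pays for
the corrections c. -/
theorem le_of_sum_nonneg {ι : Type*} {S : Finset ι} {v₀ : ι} (hv₀ : v₀ ∈ S) {f g c : ι → ℝ}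
    {E Q t L : ℝ} (hE : 0 ≤ E) (h0 : 0 ≤ ∑ v ∈ S, f v) (hf : ∀ v ∈ S, f v ≤ (g v + c v) * E)
    (hf0 : f v₀ ≤ (g v₀ + c v₀) * E - Q) (hg : ∀ v ∈ S, g v ≤ L)
    (hc : ∑ v ∈ S, c v ≤ (t - S.card) * L) : Q ≤ L * (t * E) := by
  classical
  have h1 : ∑ v ∈ S, f v ≤ ∑ v ∈ S, (g v + c v) * E - Q := by
    rw [← Finset.add_sum_erase S _ hv₀, ← Finset.add_sum_erase S (fun v => (g v + c v) * E) hv₀]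
    have := Finset.sum_le_sum fun v (hv : v ∈ S.erase v₀) => hf v (Finset.mem_of_mem_erase hv)
    linarith
  have h2 : ∑ v ∈ S, (g v + c v) ≤ t * L := by
    rw [Finset.sum_add_distrib]
    have h3 : ∑ v ∈ S, g v ≤ S.card * L := by
      refine (Finset.sum_le_sum hg).trans ?_
      simp
    linarith
  rw [← Finset.sum_mul] at h1
  have := mul_le_mul_of_nonneg_right h2 hE
  linarith

end Counting

/-! ### Combining the local bounds. -/

section Places

variable {K : Type*} [Field K]

/-- The points of `K` with finite orbit under `φ`. -/
def finiteOrbitPts (φ : K[X]) : Set K := {x | FiniteOrbit (fun z => φ.eval z) x}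

/-- A bound for the product of the differences of points at a place. -/
def PlaceBound (φ : K[X]) (v : AbsoluteValue K ℝ) (n : ℕ) (g c : ℝ) : Prop :=
  ∀ (N : ℕ) (x : Fin N → K), Function.Injective x → (∀ i, x i ∈ finiteOrbitPts φ) →
    2 * (n * normPairLog v (Real.log (v φ.leadingCoeff) / (φ.natDegree - 1)) x) ≤
      (g + c) * ((φ.natDegree - 1) * (N * Real.logb φ.natDegree N))

/-- The existence of a partition into two sets for which there is a better bound for the product
of the differences of points at a place. -/
def PlaceSplit (φ : K[X]) (v : AbsoluteValue K ℝ) (n : ℕ) (g c : ℝ) : Prop :=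
  ∃ (m : ℕ) (W : Set K), 0 < m ∧ m < φ.natDegree ∧
    ∀ (N : ℕ) (x : Fin N → K), Function.Injective x → (∀ i, x i ∈ finiteOrbitPts φ) →
    ((∀ i, x i ∈ W) →
      2 * (n * normPairLog v (Real.log (v φ.leadingCoeff) / (φ.natDegree - 1)) x) ≤
        (g + c) * ((φ.natDegree - 1) * (N * Real.logb φ.natDegree N)) -
          (φ.natDegree - m) / m * (N * (N - m)) * g) ∧
    ((∀ i, x i ∉ W) →
      2 * (n * normPairLog v (Real.log (v φ.leadingCoeff) / (φ.natDegree - 1)) x) ≤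
        (g + c) * ((φ.natDegree - 1) * (N * Real.logb φ.natDegree N)) -
          (φ.natDegree - (φ.natDegree - m : ℕ)) / (φ.natDegree - m : ℕ) *
            (N * (N - (φ.natDegree - m : ℕ))) * g)

/-- The two parts at v₀ are counted separately, each leading to N ≤ m + κ t log_d N with its own m;
the two constants κ are then added. -/
theorem ncard_le_of_placeSplit {φ : K[X]} (hd : 2 ≤ φ.natDegree) {X : Set K}
    (hX : X ⊆ finiteOrbitPts φ) {S : Finset (AbsoluteValue K ℝ)} {n : AbsoluteValue K ℝ → ℕ}
    {g c : AbsoluteValue K ℝ → ℝ} {t : ℝ}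
    (hS : ∀ (N : ℕ) (x : Fin N → K), Function.Injective x → (∀ i, x i ∈ X) →
      0 ≤ ∑ v ∈ S, n v * normPairLog v (Real.log (v φ.leadingCoeff) / (φ.natDegree - 1)) x)
    (hb : ∀ v ∈ S, PlaceBound φ v (n v) (g v) (c v)) {v₀ : AbsoluteValue K ℝ} (hv₀ : v₀ ∈ S)
    (hs : PlaceSplit φ v₀ (n v₀) (g v₀) (c v₀)) (hg0 : 0 < g v₀) (hg : ∀ v ∈ S, g v ≤ g v₀)
    (hc : ∑ v ∈ S, c v ≤ (t - S.card) * g v₀) (ht : t = 1 ∨ 2 ≤ t) :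
    X.Finite ∧ (X.ncard : ℝ) ≤
      ((φ.natDegree : ℝ) ^ 2 - 2 * φ.natDegree + 2) * pointBound φ.natDegree t := by
  obtain ⟨m, W, hm, hmd, hW⟩ := hs
  set d := φ.natDegree with hdd
  have hm' : 0 < d - m := by omega
  have hmd' : d - m < d := by omega
  have hd1 : (1 : ℝ) < d := by exact_mod_cast (by omega : 1 < d)
  have hE : ∀ N : ℕ, 0 ≤ (d - 1) * (N * Real.logb d N) := fun N => by
    rcases Nat.eq_zero_or_pos N with rfl | hN
    · simp
    have : 0 ≤ Real.logb d N := Real.logb_nonneg hd1 (by exact_mod_cast hN)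
    have : (0 : ℝ) ≤ d - 1 := by linarith
    positivity
  have h0 : ∀ (N : ℕ) (x : Fin N → K), Function.Injective x → (∀ i, x i ∈ X) →
      0 ≤ ∑ v ∈ S, 2 * (n v * normPairLog v (Real.log (v φ.leadingCoeff) / (d - 1)) x) := by
    intro N x hx hxX
    rw [← Finset.mul_sum]
    have := hS N x hx hxX
    positivity
  obtain ⟨f1, c1⟩ : (X ∩ W).Finite ∧ ((X ∩ W).ncard : ℝ) ≤ kappa d m * pointBound d t := by
    refine finite_of_forall_fin_le fun N x hx hxX => ?_
    refine le_kappa_mul_pointBound hm hmd ht (le_add_kappa_of_le hm hmd hg0 ?_)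
    have hxf : ∀ i, x i ∈ finiteOrbitPts φ := fun i => hX (hxX i).1
    exact le_of_sum_nonneg hv₀ (hE N) (h0 N x hx fun i => (hxX i).1)
      (fun v hv => hb v hv N x hx hxf) ((hW N x hx hxf).1 fun i => (hxX i).2) hg hc
  obtain ⟨f2, c2⟩ : (X \ W).Finite ∧ ((X \ W).ncard : ℝ) ≤ kappa d (d - m) * pointBound d t := by
    refine finite_of_forall_fin_le fun N x hx hxX => ?_
    refine le_kappa_mul_pointBound hm' hmd' ht (le_add_kappa_of_le hm' hmd' hg0 ?_)
    have hxf : ∀ i, x i ∈ finiteOrbitPts φ := fun i => hX (hxX i).1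
    exact le_of_sum_nonneg hv₀ (hE N) (h0 N x hx fun i => (hxX i).1)
      (fun v hv => hb v hv N x hx hxf) ((hW N x hx hxf).2 fun i => (hxX i).2) hg hc
  have hX' : X = X ∩ W ∪ X \ W := (Set.inter_union_sdiff X W).symm
  refine ⟨by rw [hX']; exact f1.union f2, ?_⟩
  have h1 : X.ncard ≤ (X ∩ W).ncard + (X \ W).ncard := by
    conv_lhs => rw [hX']
    exact Set.ncard_union_le _ _
  have h2 : (X.ncard : ℝ) ≤ (X ∩ W).ncard + (X \ W).ncard := by exact_mod_cast h1
  have hpb : 0 ≤ pointBound d t := by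
    have hk := kappa_pos hm hmd
    have := (Nat.cast_nonneg _).trans c1
    exact nonneg_of_mul_nonneg_right this hk
  have := mul_le_mul_of_nonneg_right (kappa_add_kappa_le hm hmd) hpb
  linarith

/-- The sum of the local contributions over a set of places outside of which they are not
positive. -/
theorem ProductFormula.sum_normPairLog_nonneg (pf : ProductFormula K) {a : K} (ha : a ≠ 0) (e : ℝ)
    {S : Finset (AbsoluteValue K ℝ)} (hS : ↑S ⊆ standardAbs K) {N : ℕ} {x : Fin N → K}
    (hx : Function.Injective x)
    (h : ∀ v ∈ standardAbs K, v ∉ S → normPairLog v (Real.log (v a) / e) x ≤ 0) :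
    0 ≤ ∑ v ∈ S, pf.mult v * normPairLog v (Real.log (v a) / e) x := by
  classical
  have hfin : (S ∪ {v ∈ standardAbs K | v a ≠ 1} ∪ ⋃ i, ⋃ j,
      {v ∈ standardAbs K | x j - x i ≠ 0 ∧ v (x j - x i) ≠ 1} : Set (AbsoluteValue K ℝ)).Finite := by
    refine (S.finite_toSet.union (pf.finite_ne_one a ha)).union
      (Set.finite_iUnion fun i => Set.finite_iUnion fun j => ?_)
    by_cases hij : x j - x i = 0
    · simp [hij]
    · exact (pf.finite_ne_one _ hij).subset fun v hv => ⟨hv.1, hv.2.2⟩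
  set T := hfin.toFinset with hT
  have hST : S ⊆ T := fun v hv => by
    rw [hT, Set.Finite.mem_toFinset]; exact Or.inl (Or.inl hv)
  have hTs : ∀ v ∈ T, v ∈ standardAbs K := fun v hv => by
    rw [hT, Set.Finite.mem_toFinset] at hv
    rcases hv with (hv | hv) | hv
    · exact hS hv
    · exact hv.1
    · obtain ⟨i, hv⟩ := Set.mem_iUnion.1 hv
      obtain ⟨j, hv⟩ := Set.mem_iUnion.1 hv
      exact hv.1
  have hsum : ∀ z : K, z ≠ 0 → (∀ v ∈ standardAbs K, v z ≠ 1 → v ∈ T) →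
      ∑ v ∈ T, (pf.mult v : ℝ) * Real.log (v z) = 0 := by
    intro z hz hzT
    rw [← pf.sum_log z hz]
    refine (finsum_mem_eq_sum_of_inter_support_eq _ ?_).symm
    ext v
    refine ⟨fun ⟨h1, h2⟩ => ⟨hzT v h1 fun h3 => h2 (by simp [h3]), h2⟩,
      fun ⟨h1, h2⟩ => ⟨hTs v h1, h2⟩⟩
  -- The finite set T contains all places where a or some difference is not a unit, so the product
  -- formula applies on T to each of these elements.
  have hzero : ∑ v ∈ T, pf.mult v * normPairLog v (Real.log (v a) / e) x = 0 := by
    simp only [normPairLog, Finset.mul_sum]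
    rw [Finset.sum_comm]
    refine Finset.sum_eq_zero fun i _ => ?_
    rw [Finset.sum_comm]
    refine Finset.sum_eq_zero fun j hj => ?_
    have hij : x j - x i ≠ 0 := sub_ne_zero.2 fun h => (Finset.mem_Ioi.1 hj).ne (hx h).symm
    have h1 := hsum a ha fun v hv h => by
      rw [hT, Set.Finite.mem_toFinset]; exact Or.inl (Or.inr ⟨hv, h⟩)
    have h2 := hsum _ hij fun v hv h => by
      rw [hT, Set.Finite.mem_toFinset]
      exact Or.inr (Set.mem_iUnion.2 ⟨i, Set.mem_iUnion.2 ⟨j, hv, hij, h⟩⟩)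
    calc ∑ v ∈ T, (pf.mult v : ℝ) * (Real.log (v (x j - x i)) + Real.log (v a) / e)
        = ∑ v ∈ T, (pf.mult v : ℝ) * Real.log (v (x j - x i)) +
          (∑ v ∈ T, (pf.mult v : ℝ) * Real.log (v a)) / e := by
          rw [Finset.sum_div, ← Finset.sum_add_distrib]
          exact Finset.sum_congr rfl fun v _ => by ring
      _ = 0 := by rw [h1, h2, zero_div, add_zero]
  rw [← Finset.sum_sdiff hST] at hzero
  have hneg : ∑ v ∈ T \ S, pf.mult v * normPairLog v (Real.log (v a) / e) x ≤ 0 := by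
    refine Finset.sum_nonpos fun v hv => ?_
    rw [Finset.mem_sdiff] at hv
    exact mul_nonpos_of_nonneg_of_nonpos (Nat.cast_nonneg _) (h v (hTs v hv.1) hv.2)
  linarith

theorem log_add_log_div_nonpos {v : AbsoluteValue K ℝ} {x y a : K} (hxy : x ≠ y) (ha : a ≠ 0)
    {d : ℕ} (hd : 2 ≤ d) (h : v (x - y) ^ (d - 1) * v a ≤ 1) :
    Real.log (v (x - y)) + Real.log (v a) / (d - 1) ≤ 0 := by
  have h1 : 0 < v (x - y) := v.pos (sub_ne_zero.2 hxy)
  have h2 : 0 < v a := v.pos ha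
  have h3 := Real.log_nonpos (by positivity) h
  rw [Real.log_mul (by positivity) h2.ne', Real.log_pow, Nat.cast_sub (by omega),
    Nat.cast_one] at h3
  have hd1 : (0 : ℝ) < d - 1 := by
    have : (2 : ℝ) ≤ d := by exact_mod_cast hd
    linarith
  have h4 : (d - 1) * (Real.log (v (x - y)) + Real.log (v a) / (d - 1)) ≤ 0 := by
    rw [mul_add, mul_div_cancel₀ _ hd1.ne']
    exact h3
  exact nonpos_of_mul_nonpos_right h4 hd1

theorem log_add_log_div_neg {v : AbsoluteValue K ℝ} {x y a : K} (hxy : x ≠ y) (ha : a ≠ 0)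
    {d : ℕ} (hd : 2 ≤ d) (h : v (x - y) ^ (d - 1) * v a < 1) :
    Real.log (v (x - y)) + Real.log (v a) / (d - 1) < 0 := by
  have h1 : 0 < v (x - y) := v.pos (sub_ne_zero.2 hxy)
  have h2 : 0 < v a := v.pos ha
  have h3 := Real.log_neg (by positivity) h
  rw [Real.log_mul (by positivity) h2.ne', Real.log_pow, Nat.cast_sub (by omega),
    Nat.cast_one] at h3
  have hd1 : (0 : ℝ) < d - 1 := by
    have : (2 : ℝ) ≤ d := by exact_mod_cast hd
    linarith
  have h4 : (d - 1) * (Real.log (v (x - y)) + Real.log (v a) / (d - 1)) < 0 := by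
    rw [mul_add, mul_div_cancel₀ _ hd1.ne']
    exact h3
  exact neg_of_mul_neg_right h4 hd1.le

theorem normPairLog_nonpos {φ : K[X]} (hd : 2 ≤ φ.natDegree) {v : AbsoluteValue K ℝ} {N : ℕ}
    {x : Fin N → K} (hx : Function.Injective x)
    (h : ∀ i j, v (x j - x i) ^ (φ.natDegree - 1) * v φ.leadingCoeff ≤ 1) :
    normPairLog v (Real.log (v φ.leadingCoeff) / (φ.natDegree - 1)) x ≤ 0 := by
  refine Finset.sum_nonpos fun i _ => Finset.sum_nonpos fun j hj => ?_
  refine log_add_log_div_nonpos (fun h => (Finset.mem_Ioi.1 hj).ne (hx h).symm) ?_ hd (h i j)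
  exact leadingCoeff_ne_zero.2 (by rintro rfl; simp at hd)

end Places
end

noncomputable section

/-! ### Bad primes and preperiodic points -/

section Preperiodic

variable {K : Type*} [Field K]

theorem finiteOrbit_iff {α : Type*} {f : α → α} {x : α} :
    FiniteOrbit f x ↔ ∃ m, f^[m] x ∈ Function.periodicPts f := by
  constructor
  · intro h
    have hni : ¬ Function.Injective fun n : ℕ => f^[n] x := fun hinj =>
      Set.infinite_range_of_injective hinj h
    obtain ⟨a, b, hab, hne⟩ := Function.not_injective_iff.1 hni
    wlog hlt : a < b generalizing a b
    · exact this b a hab.symm hne.symm (by omega)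
    refine ⟨a, b - a, by omega, ?_⟩
    rw [Function.IsPeriodicPt, Function.IsFixedPt, ← Function.iterate_add_apply,
      Nat.sub_add_cancel hlt.le]
    exact hab.symm
  · rintro ⟨m, k, hk, hper⟩
    refine (Set.toFinite ((fun n : ℕ => f^[n] x) '' (Finset.range (m + k)))).subset ?_
    rintro _ ⟨n, rfl⟩
    rcases lt_or_ge n (m + k) with h | h
    · exact ⟨n, by simpa using h, rfl⟩
    · refine ⟨(n - m) % k + m, by
        have := Nat.mod_lt (n - m) hk
        simp only [Finset.coe_range, Set.mem_Iio]; omega, ?_⟩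
      change f^[(n - m) % k + m] x = f^[n] x
      rw [Function.iterate_add_apply, hper.iterate_mod_apply, ← Function.iterate_add_apply,
        Nat.sub_add_cancel (by omega)]

theorem polyMap_iterate_coe (φ : K[X]) (n : ℕ) (x : K) :
    (polyMap φ)^[n] (x : OnePoint K) = ((fun z => φ.eval z)^[n] x : K) := by
  induction n generalizing x with
  | zero => rfl
  | succ n ih =>
    rw [Function.iterate_succ_apply, Function.iterate_succ_apply, ← ih]
    rfl

theorem coe_mem_periodicPts_iff (φ : K[X]) (x : K) :
    (x : OnePoint K) ∈ Function.periodicPts (polyMap φ) ↔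
      x ∈ Function.periodicPts fun z => φ.eval z := by
  refine exists_congr fun n => and_congr_right fun _ => ?_
  rw [Function.IsPeriodicPt, Function.IsFixedPt, polyMap_iterate_coe, OnePoint.coe_eq_coe]
  rfl

theorem preperiodicPts_eq (φ : K[X]) :
    preperiodicPts φ = insert OnePoint.infty ((fun x : K => (x : OnePoint K)) '' finiteOrbitPts φ) := by
  ext x
  induction x using OnePoint.rec with
  | infty =>
    refine ⟨fun _ => Set.mem_insert _ _, fun _ => ⟨0, 1, one_pos, ?_⟩⟩
    rfl
  | coe x =>
    rw [Set.mem_insert_iff, or_iff_right (OnePoint.coe_ne_infty x)]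
    have h1 : (x : OnePoint K) ∈ (fun x : K => (x : OnePoint K)) '' finiteOrbitPts φ ↔
        FiniteOrbit (fun z => φ.eval z) x :=
      OnePoint.coe_injective.mem_set_image
    rw [h1, finiteOrbit_iff]
    exact exists_congr fun m => by rw [polyMap_iterate_coe, coe_mem_periodicPts_iff]

theorem preperiodicPts_finite {φ : K[X]} (h : (finiteOrbitPts φ).Finite) :
    (preperiodicPts φ).Finite ∧ (preperiodicPts φ).ncard = (finiteOrbitPts φ).ncard + 1 := by
  rw [preperiodicPts_eq]
  refine ⟨(h.image _).insert _, ?_⟩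
  rw [Set.ncard_insert_of_notMem (by simp) (h.image _),
    Set.ncard_image_of_injective _ OnePoint.coe_injective]

end Preperiodic

/-! ### Finiteness of the bad primes, and colours at archimedean places. -/

section Bad

variable {K : Type*} [Field K]

/-- The non-archimedean bad primes. -/
def nonarchBad (φ : K[X]) : Set (AbsoluteValue K ℝ) :=
  {v | ∃ w : NonarchAbs K, w.abs = v ∧ w.IsStandard ∧ ¬ PotentiallyGoodReduction (φ.map w.toCv)}

theorem badPrimes_eq_union (φ : K[X]) : badPrimes φ = archPrimes K ∪ nonarchBad φ := by
  ext v
  constructor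
  · rintro ⟨hv, hbad⟩
    rw [standardAbs_eq_union] at hv
    rcases hv with hv | ⟨w, rfl, hw⟩
    · exact Or.inl hv
    · exact Or.inr ⟨w, rfl, hw, fun h => hbad ⟨w, rfl, h⟩⟩
  · rintro (hv | ⟨w, rfl, hw, hbad⟩)
    · refine ⟨hv.1, ?_⟩
      rintro ⟨w, rfl, -⟩
      exact hv.2 w.nonarch
    · refine ⟨w.mem_standardAbs_iff.2 hw, ?_⟩
      rintro ⟨w', h, hg⟩
      rw [NonarchAbs.ext_abs h] at hg
      exact hbad hg

theorem disjoint_archPrimes_nonarchBad (φ : K[X]) : Disjoint (archPrimes K) (nonarchBad φ) :=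
  disjoint_archPrimes_nonarchPrimes.mono_right (by
    rintro _ ⟨w, h, hw, -⟩
    exact ⟨w, h, hw⟩)

theorem nonarchBad_subset_standardAbs (φ : K[X]) : nonarchBad φ ⊆ standardAbs K := by
  rintro _ ⟨w, rfl, hw, -⟩
  exact w.mem_standardAbs_iff.2 hw

theorem ProductFormula.finite_archPrimes (pf : ProductFormula K) : (archPrimes K).Finite := by
  by_cases h2 : (2 : K) = 0
  · convert! Set.finite_empty
    rw [Set.eq_empty_iff_forall_notMem]
    intro v hv
    have := mem_archPrimes_iff.1 hv 2
    rw [Nat.cast_ofNat, h2, map_zero] at this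
    norm_num at this
  · refine (pf.finite_ne_one 2 h2).subset fun v hv => ⟨hv.1, ?_⟩
    have := mem_archPrimes_iff.1 hv 2
    rw [Nat.cast_ofNat] at this
    rw [this]
    norm_num

/-- At all but finitely many places the nonzero coefficients are units, and φ itself has good
reduction there. -/
theorem ProductFormula.finite_nonarchBad (pf : ProductFormula K) {φ : K[X]}
    (hφ : 0 < φ.natDegree) : (nonarchBad φ).Finite := by
  have hfin : (⋃ i ∈ φ.support, {v ∈ standardAbs K | v (φ.coeff i) ≠ 1}).Finite :=
    φ.support.finite_toSet.biUnion fun i hi => pf.finite_ne_one _ (mem_support_iff.1 hi)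
  refine hfin.subset ?_
  rintro _ ⟨w, rfl, hw, hbad⟩
  by_contra hnot
  simp only [Set.mem_iUnion, not_exists] at hnot
  have h1 : ∀ i ∈ φ.support, w.abs (φ.coeff i) = 1 := fun i hi => by
    by_contra h
    exact hnot i hi ⟨w.mem_standardAbs_iff.2 hw, h⟩
  refine hbad (potentiallyGoodReduction_of_integral w hφ (fun i => ?_) ?_)
  · by_cases hi : i ∈ φ.support
    · exact (h1 i hi).le
    · rw [notMem_support_iff.1 hi, map_zero]; exact zero_le_one
  · refine h1 _ (natDegree_mem_support_of_nonzero ?_)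
    rintro rfl
    simp at hφ

theorem ProductFormula.badPrimes_finite (pf : ProductFormula K) {φ : K[X]}
    (hφ : 0 < φ.natDegree) : (badPrimes φ).Finite := by
  rw [badPrimes_eq_union]
  exact pf.finite_archPrimes.union (pf.finite_nonarchBad hφ)

theorem ProductFormula.ncard_badPrimes (pf : ProductFormula K) {φ : K[X]}
    (hφ : 0 < φ.natDegree) :
    (badPrimes φ).ncard = (archPrimes K).ncard + (nonarchBad φ).ncard := by
  rw [badPrimes_eq_union, Set.ncard_union_eq (disjoint_archPrimes_nonarchBad φ)
    pf.finite_archPrimes (pf.finite_nonarchBad hφ)]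

theorem pow_mul_le_one_of_notMem_badPrimes {φ : K[X]} (hd : 2 ≤ φ.natDegree)
    {v : AbsoluteValue K ℝ} (hv : v ∈ standardAbs K) (hb : v ∉ badPrimes φ) {x y : K}
    (hx : x ∈ finiteOrbitPts φ) (hy : y ∈ finiteOrbitPts φ) :
    v (x - y) ^ (φ.natDegree - 1) * v φ.leadingCoeff ≤ 1 := by
  have : ∃ w : NonarchAbs K, w.abs = v ∧ PotentiallyGoodReduction (φ.map w.toCv) := by
    by_contra h
    exact hb ⟨hv, h⟩
  obtain ⟨w, rfl, hw⟩ := this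
  exact nonarch_place_good w rfl hd hw hx hy

theorem ProductFormula.mult_eq (pf : ProductFormula K) {v : AbsoluteValue K ℝ}
    (hv : v ∈ archPrimes K) : (pf.mult v = 1 ∨ pf.mult v = 2) ∧
      ∃ σ : K →+* ℂ, ∀ x, ‖σ x‖ = v x := by
  rcases pf.arch v hv with ⟨h, σ, hσ⟩ | ⟨h, σ, hσ⟩
  · exact ⟨Or.inl h, Complex.ofRealHom.comp σ, fun x => by simp [hσ]⟩
  · exact ⟨Or.inr h, σ, fun x => (hσ x).symm⟩

theorem ProductFormula.sum_arch_mult (pf : ProductFormula K) :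
    ∑ v ∈ pf.finite_archPrimes.toFinset, pf.mult v = degQ K := by
  rw [← pf.sum_mult, finsum_mem_eq_finite_toFinset_sum _ pf.finite_archPrimes]

theorem ProductFormula.ncard_archPrimes_le (pf : ProductFormula K) :
    (archPrimes K).ncard ≤ degQ K := by
  rw [← pf.sum_arch_mult, Set.ncard_eq_toFinset_card _ pf.finite_archPrimes, Finset.card_eq_sum_ones]
  refine Finset.sum_le_sum fun v hv => ?_
  rcases (pf.mult_eq ((Set.Finite.mem_toFinset _).1 hv)).1 with h | h <;> omega

theorem ProductFormula.mult_pos (pf : ProductFormula K) {v : AbsoluteValue K ℝ}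
    (hv : v ∈ archPrimes K) : 0 < pf.mult v := by
  rcases (pf.mult_eq hv).1 with h | h <;> omega

/-- Colours for the points with finite orbit such that points of the same colour are close to
each other at all archimedean places. -/
theorem ProductFormula.exists_coloring (pf : ProductFormula K) {φ : K[X]}
    (hd : 2 ≤ φ.natDegree) : ∃ f : K → Fin (colorBase φ.natDegree ^ degQ K),
      ∀ x ∈ finiteOrbitPts φ, ∀ y ∈ finiteOrbitPts φ, f x = f y → ∀ v ∈ archPrimes K,
        v (x - y) ^ (φ.natDegree - 1) * v φ.leadingCoeff < 1 := by
  classical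
  set A := pf.finite_archPrimes.toFinset with hA
  have hmem : ∀ v : A, v.1 ∈ archPrimes K := fun v => (Set.Finite.mem_toFinset _).1 v.2
  have h : ∀ v : A, ∃ f : K → Fin (colorBase φ.natDegree ^ pf.mult v.1),
      ∀ x ∈ finiteOrbitPts φ, ∀ y ∈ finiteOrbitPts φ, f x = f y →
        v.1 (x - y) ^ (φ.natDegree - 1) * v.1 φ.leadingCoeff < 1 := by
    intro v
    rcases pf.arch v.1 (hmem v) with ⟨hm, σ, hσ⟩ | ⟨hm, σ, hσ⟩
    · obtain ⟨f, hf⟩ := real_coloring (φ := φ.map σ) (natDegree_map σ) hd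
      rw [hm, pow_one]
      refine ⟨fun x => f (σ x), fun x hx y hy hxy => ?_⟩
      have := hf _ _ (FiniteOrbit.map_ringHom σ hx) (FiniteOrbit.map_ringHom σ hy) hxy
      rwa [← map_sub, ← hσ, leadingCoeff_map, ← hσ] at this
    · obtain ⟨f, hf⟩ := complex_coloring (φ := φ.map σ) (natDegree_map σ) hd
      rw [hm]
      refine ⟨fun x => f (σ x), fun x hx y hy hxy => ?_⟩
      have := hf _ _ (FiniteOrbit.map_ringHom σ hx) (FiniteOrbit.map_ringHom σ hy) hxy
      rwa [← map_sub, ← hσ, leadingCoeff_map, ← hσ] at this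
  choose f hf using h
  -- Real places have β colours and complex ones β², so the local degrees add up to the exponent [K
  -- : ℚ].
  have hcard : Fintype.card ((v : A) → Fin (colorBase φ.natDegree ^ pf.mult v.1)) =
      colorBase φ.natDegree ^ degQ K := by
    rw [Fintype.card_pi]
    simp only [Fintype.card_fin]
    rw [Finset.prod_pow_eq_pow_sum, ← pf.sum_arch_mult, ← hA]
    congr 1
    exact Finset.sum_coe_sort A pf.mult
  refine ⟨fun x => Fintype.equivFinOfCardEq hcard fun v => f v x, fun x hx y hy hxy v hv => ?_⟩
  have h1 := (Fintype.equivFinOfCardEq hcard).injective hxy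
  have hvA : v ∈ A := (Set.Finite.mem_toFinset _).2 hv
  exact hf ⟨v, hvA⟩ x hx y hy (congrFun h1 ⟨v, hvA⟩)

end Bad

/-! ### Local data at the bad places. -/

section LocalData

variable {K : Type*} [Field K]

theorem nonarch_place_data (pf : ProductFormula K) {φ : K[X]} (hd : 2 ≤ φ.natDegree)
    {x₀ : K} (hx₀ : x₀ ∈ finiteOrbitPts φ) {v : AbsoluteValue K ℝ} (hv : v ∈ nonarchBad φ) :
    ∃ g : ℝ, 0 < g ∧ PlaceBound φ v (pf.mult v) g 0 ∧ PlaceSplit φ v (pf.mult v) g 0 ∧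
      ∃ i, 1 ≤ i ∧ i < φ.natDegree ∧
        Real.exp g ^ ((φ.natDegree - 1) * (φ.natDegree - i)) * v φ.leadingCoeff ^ (i - 1) =
          v ((taylor x₀ φ).coeff i) ^ (φ.natDegree - 1) := by
  obtain ⟨w, rfl, -, hbad⟩ := hv
  obtain ⟨r, hr, hi, m, W, hm, hmd, hW⟩ := nonarch_place_bad w rfl hd hbad hx₀
  rw [pf.mult_nonarch]
  refine ⟨Real.log r, Real.log_pos hr, ?_, ⟨m, W, hm, hmd, ?_⟩, ?_⟩
  · intro N x hx hxf
    rw [Nat.cast_one, one_mul, add_zero]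
    exact (hW x hx hxf).1
  · intro N x hx hxf
    rw [Nat.cast_one, one_mul, add_zero]
    exact (hW x hx hxf).2
  · rwa [Real.exp_log (by linarith)]

/-- Here g is the local degree times log ρ, and N log N is rewritten as log d/(d - 1) times (d - 1)
N log_d N to fit the common shape. -/
theorem arch_place_data (pf : ProductFormula K) {φ : K[X]} (hd : 2 ≤ φ.natDegree)
    {v : AbsoluteValue K ℝ} (hv : v ∈ archPrimes K) :
    ∃ g : ℝ, PlaceBound φ v (pf.mult v) g
        (pf.mult v * (Real.log φ.natDegree / (φ.natDegree - 1) +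
          Real.log (archConst φ.natDegree))) ∧
      (Real.log (splitThreshold φ.natDegree) ≤ g → PlaceSplit φ v (pf.mult v) g
        (pf.mult v * (Real.log φ.natDegree / (φ.natDegree - 1) +
          Real.log (archConst φ.natDegree)))) := by
  obtain ⟨hn, σ, hσ⟩ := pf.mult_eq hv
  have hdeg : (φ.map σ).natDegree = φ.natDegree := natDegree_map σ
  obtain ⟨ρ, hρ, hb, hs⟩ := arch_bound hdeg hd
  set d := φ.natDegree with hdd
  set n := pf.mult v with hnn
  have hd1 : (0 : ℝ) < d - 1 := by
    have : (2 : ℝ) ≤ d := by exact_mod_cast hd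
    linarith
  have hld : 0 < Real.log d := Real.log_pos (by linarith)
  have hlc : ‖(φ.map σ).leadingCoeff‖ = v φ.leadingCoeff := by rw [leadingCoeff_map, hσ]
  have hinj : ∀ {N : ℕ} {x : Fin N → K}, Function.Injective x →
      Function.Injective fun i => σ (x i) := fun hx => σ.injective.comp hx
  have hcomp : ∀ {N : ℕ} (x : Fin N → K) (A : ℝ),
      normPairLog (fun z : ℂ => ‖z‖) A (fun i => σ (x i)) = normPairLog v A x := fun x A =>
    normPairLog_comp σ hσ A x
  have key : ∀ (N : ℕ) (P Q : ℝ), 2 * P ≤ N * Real.log N +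
      (Real.log ρ + Real.log (archConst d)) * ((d - 1) * (N * Real.logb d N)) - Q →
      2 * (n * P) ≤ (n * Real.log ρ + n * (Real.log d / (d - 1) + Real.log (archConst d))) *
        ((d - 1) * (N * Real.logb d N)) - n * Q := by
    intro N P Q h
    have e : (N : ℝ) * Real.log N = Real.log d / (d - 1) * ((d - 1) * (N * Real.logb d N)) := by
      rw [Real.logb]
      field_simp
    rw [e] at h
    have := mul_le_mul_of_nonneg_left h (Nat.cast_nonneg n)
    calc 2 * (n * P) = n * (2 * P) := by ring
      _ ≤ _ := this
      _ = _ := by ring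
  refine ⟨n * Real.log ρ, fun N x hx hxf => ?_, fun hthr => ?_⟩
  · have := hb (fun i => σ (x i)) (hinj hx) fun i => FiniteOrbit.map_ringHom σ (hxf i)
    rw [hcomp, hlc] at this
    have h2 := key N _ 0 (by rwa [sub_zero])
    rwa [mul_zero, sub_zero] at h2
  · have hT : 1 ≤ splitThreshold d := by rw [splitThreshold]; split_ifs <;> norm_num
    -- The local degree is at most 2, so g ≥ log T guarantees only ρ² ≥ T. This is why the threshold
    -- refers to the square.
    have hthr' : splitThreshold d ≤ ρ ^ 2 := by
      have h2 : n * Real.log ρ ≤ Real.log (ρ ^ 2) := by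
        rw [Real.log_pow]
        have hρ1 : 0 ≤ Real.log ρ := by
          by_contra! hneg
          have h3 := (Real.log_nonneg hT).trans hthr
          have h4 : 0 < (n : ℝ) := by exact_mod_cast pf.mult_pos hv
          nlinarith
        refine mul_le_mul_of_nonneg_right ?_ hρ1
        rcases hn with h | h <;> norm_num [h]
      exact (Real.log_le_log_iff (by linarith) (by positivity)).1 (hthr.trans h2)
    obtain ⟨m, W, hm, hmd, hW⟩ := hs hthr'
    refine ⟨m, σ ⁻¹' W, hm, hmd, fun N x hx hxf => ?_⟩
    have := hW (fun i => σ (x i)) (hinj hx) fun i => FiniteOrbit.map_ringHom σ (hxf i)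
    rw [hcomp, hlc] at this
    refine ⟨fun h => ?_, fun h => ?_⟩
    · have h2 := key N _ _ (this.1 h)
      refine h2.trans (le_of_eq ?_)
      ring
    · have h2 := key N _ _ (this.2 h)
      refine h2.trans (le_of_eq ?_)
      ring

end LocalData
end

noncomputable section

/-! ### Few bad primes -/

section Few

variable {K : Type*} [Field K]

theorem pointBound_nonneg {d : ℕ} (hd : 2 ≤ d) {t : ℝ} (ht : 1 ≤ t) : 0 ≤ pointBound d t := by
  have hd1 : (1 : ℝ) < d := by exact_mod_cast (by omega : 1 < d)
  have h1 : 0 ≤ Real.logb d t := Real.logb_nonneg hd1 ht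
  rw [pointBound]
  split_ifs with h
  · positivity
  · have h2 : 1 ≤ Real.logb d t := by
      rw [← Real.logb_self_eq_one hd1]
      exact Real.logb_le_logb_of_le hd1 (by linarith) (not_lt.1 h)
    have h3 : 0 ≤ Real.logb d (Real.logb d t) := Real.logb_nonneg hd1 h2
    positivity

theorem one_or_two_le_natCast {n : ℕ} (hn : n ≠ 0) : (n : ℝ) = 1 ∨ 2 ≤ (n : ℝ) := by
  rcases Nat.lt_or_ge n 2 with h | h
  · left; have : n = 1 := by omega
    simp [this]
  · right; exact_mod_cast h

/-- Within a colour class the archimedean contributions are not positive, so only the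
non-archimedean bad primes count, without corrections c. The number of colours multiplies the bound.
-/
theorem ProductFormula.ncard_finiteOrbitPts_le (pf : ProductFormula K) {φ : K[X]}
    (hd : 2 ≤ φ.natDegree) (hne : (nonarchBad φ).ncard ≠ 0) :
    (finiteOrbitPts φ).Finite ∧ ((finiteOrbitPts φ).ncard : ℝ) ≤
      (colorBase φ.natDegree ^ degQ K : ℕ) * (((φ.natDegree : ℝ) ^ 2 - 2 * φ.natDegree + 2) *
        pointBound φ.natDegree (nonarchBad φ).ncard) := by
  have ht := one_or_two_le_natCast hne
  have ht1 : (1 : ℝ) ≤ (nonarchBad φ).ncard := by rcases ht with h | h <;> linarith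
  rcases (finiteOrbitPts φ).eq_empty_or_nonempty with he | ⟨x₀, hx₀⟩
  · rw [he]
    refine ⟨Set.finite_empty, ?_⟩
    rw [Set.ncard_empty, Nat.cast_zero]
    have := pointBound_nonneg hd ht1
    have h2 : 0 ≤ (φ.natDegree : ℝ) ^ 2 - 2 * φ.natDegree + 2 := by
      nlinarith [sq_nonneg ((φ.natDegree : ℝ) - 1)]
    positivity
  obtain ⟨f, hf⟩ := pf.exists_coloring hd
  refine finite_of_forall_color f fun c => ?_
  have hfin := pf.finite_nonarchBad (φ := φ) (by omega)
  have hdata : ∀ v : AbsoluteValue K ℝ, ∃ g : ℝ, v ∈ nonarchBad φ → 0 < g ∧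
      PlaceBound φ v (pf.mult v) g 0 ∧ PlaceSplit φ v (pf.mult v) g 0 := fun v => by
    by_cases hv : v ∈ nonarchBad φ
    · obtain ⟨g, h1, h2, h3, -⟩ := nonarch_place_data pf hd hx₀ hv
      exact ⟨g, fun _ => ⟨h1, h2, h3⟩⟩
    · exact ⟨0, fun h => absurd h hv⟩
  choose g hg using hdata
  set S := hfin.toFinset with hS
  have hmem : ∀ v, v ∈ S ↔ v ∈ nonarchBad φ := fun v => Set.Finite.mem_toFinset _
  have hcard : S.card = (nonarchBad φ).ncard := (Set.ncard_eq_toFinset_card _ hfin).symm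
  have hSne : S.Nonempty := by rw [← Finset.card_pos, hcard]; omega
  obtain ⟨v₀, hv₀, hmax⟩ := Finset.exists_max_image S g hSne
  have hv₀' := hg v₀ ((hmem v₀).1 hv₀)
  refine ncard_le_of_placeSplit (S := S) (n := pf.mult) (g := g) (c := fun _ => 0) hd
    (fun x hx => hx.1) (fun N x hx hxX => ?_) (fun v hv => (hg v ((hmem v).1 hv)).2.1) hv₀
    hv₀'.2.2 hv₀'.1 hmax (by simp [hcard]) ht
  refine pf.sum_normPairLog_nonneg (leadingCoeff_ne_zero.2 (by rintro rfl; simp at hd)) _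
    (fun v hv => nonarchBad_subset_standardAbs φ ((hmem v).1 hv)) hx fun v hv hvS => ?_
  refine normPairLog_nonpos hd hx fun i j => ?_
  by_cases hva : v ∈ archPrimes K
  · exact (hf _ (hxX j).1 _ (hxX i).1 ((hxX j).2.trans (hxX i).2.symm) v hva).le
  · refine pow_mul_le_one_of_notMem_badPrimes hd hv ?_ (hxX j).1 (hxX i).1
    rw [badPrimes_eq_union]
    rintro (h | h)
    · exact hva h
    · exact hvS ((hmem v).2 h)

theorem injective_pair {α : Type*} {x y : α} (h : x ≠ y) : Function.Injective ![x, y] := by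
  intro i j hij
  fin_cases i <;> fin_cases j <;> simp_all

theorem normPairLog_pair {v : K → ℝ} {A : ℝ} (x y : K) :
    normPairLog v A ![x, y] = Real.log (v (y - x)) + A := by
  rw [normPairLog, Fin.sum_univ_two]
  have h0 : Finset.Ioi (0 : Fin 2) = {1} := rfl
  have h1 : Finset.Ioi (1 : Fin 2) = ∅ := rfl
  rw [h0, h1]
  simp

/-- Two points of one colour would have negative contributions at the archimedean places and none
positive elsewhere, against the product formula. -/
theorem ProductFormula.ncard_finiteOrbitPts_le_of_good (pf : ProductFormula K) {φ : K[X]}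
    (hd : 2 ≤ φ.natDegree) (h0 : (nonarchBad φ).ncard = 0) (harch : (archPrimes K).Nonempty) :
    (finiteOrbitPts φ).Finite ∧ ((finiteOrbitPts φ).ncard : ℝ) ≤
      (colorBase φ.natDegree ^ degQ K : ℕ) := by
  have hl : φ.leadingCoeff ≠ 0 := leadingCoeff_ne_zero.2 (by rintro rfl; simp at hd)
  have hempty : nonarchBad φ = ∅ :=
    (Set.ncard_eq_zero (pf.finite_nonarchBad (φ := φ) (by omega))).1 h0
  obtain ⟨f, hf⟩ := pf.exists_coloring hd
  suffices h : ∀ c, {x ∈ finiteOrbitPts φ | f x = c}.Subsingleton by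
    have := finite_of_forall_color (B := 1) f fun c =>
      ⟨(h c).finite, by exact_mod_cast (Set.ncard_le_one (h c).finite).2 (h c)⟩
    rwa [mul_one] at this
  rintro c x ⟨hx, rfl⟩ y ⟨hy, hxy⟩
  by_contra hne
  have hpair := pf.sum_normPairLog_nonneg hl (φ.natDegree - 1)
    (S := pf.finite_archPrimes.toFinset) (fun v hv => ((Set.Finite.mem_toFinset _).1 hv).1)
    (injective_pair hne) fun v hv hvS => by
      rw [normPairLog_pair]
      refine log_add_log_div_nonpos (Ne.symm hne) hl hd
        (pow_mul_le_one_of_notMem_badPrimes hd hv ?_ hy hx)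
      rw [badPrimes_eq_union, hempty, Set.union_empty]
      exact fun h => hvS ((Set.Finite.mem_toFinset _).2 h)
  refine absurd hpair (not_le.2 (Finset.sum_neg (fun v hv => ?_) ?_))
  · have hva := (Set.Finite.mem_toFinset _).1 hv
    rw [normPairLog_pair]
    refine mul_neg_of_pos_of_neg (by exact_mod_cast pf.mult_pos hva) ?_
    exact log_add_log_div_neg (Ne.symm hne) hl hd (hf y hy x hx hxy v hva)
  · obtain ⟨v, hv⟩ := harch
    exact ⟨v, (Set.Finite.mem_toFinset _).2 hv⟩

end Few

/-! ### Function fields without bad primes -/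

section Good

variable {K : Type*} [Field K]

theorem NonarchAbs.IsStandard.le_residueCard_of_injective {w : NonarchAbs K} (hw : w.IsStandard)
    {N : ℕ} (x : Fin N → K) (h1 : ∀ i, w.abs (x i) ≤ 1)
    (h2 : ∀ i j, i ≠ j → w.abs (x i - x j) = 1) : N ≤ w.residueCard := by
  let V := (NormedField.valuation (K := WithAbs w.abs)).valuationSubring
  have hfin : Finite (IsLocalRing.ResidueField V) :=
    Nat.finite_of_card_ne_zero (by
      have := hw.two_le_residueCard
      rw [NonarchAbs.residueCard] at this
      change 2 ≤ Nat.card (IsLocalRing.ResidueField V) at this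
      omega)
  let y : Fin N → V := fun i => ⟨(WithAbs.equiv w.abs).symm (x i),
    mem_valuationSubring_iff_norm_le_one.2 (h1 i)⟩
  have hinj : Function.Injective fun i => IsLocalRing.residue V (y i) := by
    intro i j hij
    by_contra hne
    have h3 : IsLocalRing.residue V (y i - y j) = 0 := by rw [map_sub, sub_eq_zero]; exact hij
    rw [residue_eq_zero_iff_norm_lt_one] at h3
    have h4 : w.abs (x i - x j) < 1 := h3
    rw [h2 i j hne] at h4
    exact lt_irrefl _ h4
  have := Nat.card_le_card_of_injective _ hinj
  rwa [Nat.card_eq_fintype_card, Fintype.card_fin] at this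

/-- For two points all local contributions are nonpositive with sum zero, hence all vanish. At the
place with smallest residue field all differences then have equal size, and after an affine change
the points have distinct residues. -/
theorem ProductFormula.ncard_finiteOrbitPts_le_minResidueCard (pf : ProductFormula K) {φ : K[X]}
    (hd : 2 ≤ φ.natDegree) (h0 : badPrimes φ = ∅) (hne : (nonarchPrimes K).Nonempty) :
    (finiteOrbitPts φ).Finite ∧ ((finiteOrbitPts φ).ncard : ℝ) ≤ minResidueCard K := by
  have hl : φ.leadingCoeff ≠ 0 := leadingCoeff_ne_zero.2 (by rintro rfl; simp at hd)
  have hd1 : (0 : ℝ) < φ.natDegree - 1 := by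
    have : (2 : ℝ) ≤ φ.natDegree := by exact_mod_cast hd
    linarith
  obtain ⟨w, hw, hq⟩ : minResidueCard K ∈
      {q : ℕ | ∃ w : NonarchAbs K, w.abs ∈ standardAbs K ∧ w.residueCard = q} := by
    refine Nat.sInf_mem ?_
    obtain ⟨_, w, rfl, hw⟩ := hne
    exact ⟨_, w, w.mem_standardAbs_iff.2 hw, rfl⟩
  have hws := w.mem_standardAbs_iff.1 hw
  have hgood : ∀ v ∈ standardAbs K, ∀ x ∈ finiteOrbitPts φ, ∀ y ∈ finiteOrbitPts φ,
      v (x - y) ^ (φ.natDegree - 1) * v φ.leadingCoeff ≤ 1 := fun v hv x hx y hy =>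
    pow_mul_le_one_of_notMem_badPrimes hd hv (by rw [h0]; exact fun h => h) hx hy
  have hone : ∀ x ∈ finiteOrbitPts φ, ∀ y ∈ finiteOrbitPts φ, x ≠ y →
      Real.log (w.abs (y - x)) = -(Real.log (w.abs φ.leadingCoeff) / (φ.natDegree - 1)) := by
    intro x hx y hy hxy
    have h1 := pf.sum_normPairLog_nonneg hl (φ.natDegree - 1) (S := {w.abs}) (by simpa using hw)
      (injective_pair hxy) fun v hv _ => by
        rw [normPairLog_pair]
        exact log_add_log_div_nonpos hxy.symm hl hd (hgood v hv y hy x hx)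
    rw [Finset.sum_singleton, pf.mult_nonarch, Nat.cast_one, one_mul, normPairLog_pair] at h1
    have h2 := log_add_log_div_nonpos hxy.symm hl hd (hgood _ hw y hy x hx)
    linarith
  refine finite_of_forall_fin_le fun N x hx hxf => ?_
  rw [← hq]
  have h2q := hws.two_le_residueCard
  rcases Nat.lt_or_ge N 2 with hN | hN
  · exact_mod_cast (by omega : N ≤ w.residueCard)
  · let a : Fin N := ⟨0, by omega⟩
    let b : Fin N := ⟨1, by omega⟩
    have hab : x a ≠ x b := fun h => by simpa [a, b] using hx h
    have hba : x b - x a ≠ 0 := sub_ne_zero.2 hab.symm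
    have hdiff : ∀ i j, i ≠ j → w.abs (x i - x j) = w.abs (x b - x a) := by
      intro i j hij
      have hij' : x j ≠ x i := fun h => hij (hx h).symm
      refine Real.log_injOn_pos (w.abs.pos (sub_ne_zero.2 hij'.symm)) (w.abs.pos hba) ?_
      rw [hone _ (hxf j) _ (hxf i) hij', hone _ (hxf a) _ (hxf b) hab]
    have hpos := w.abs.pos hba
    have := hws.le_residueCard_of_injective (fun i => (x i - x a) / (x b - x a)) (fun i => ?_)
      fun i j hij => ?_
    · exact_mod_cast this
    · by_cases hi : i = a
      · rw [hi, sub_self, zero_div, map_zero]; exact zero_le_one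
      · rw [map_div₀, hdiff i a hi, div_self hpos.ne']
    · rw [← sub_div, sub_sub_sub_cancel_right, map_div₀, hdiff i j hij, div_self hpos.ne']

end Good
end

noncomputable section

/-! ### Many bad primes -/

/-! ### Counting places with small residue field. -/

section ResidueChar

variable {K : Type*} [Field K]

theorem NonarchAbs.IsStandard.exists_prime {w : NonarchAbs K} (hw : w.IsStandard) :
    ∃ p : ℕ, p.Prime ∧ w.abs p < 1 := by
  let V := (NormedField.valuation (K := WithAbs w.abs)).valuationSubring
  have hfin : Finite (IsLocalRing.ResidueField V) :=
    Nat.finite_of_card_ne_zero (by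
      have := hw.two_le_residueCard
      rw [NonarchAbs.residueCard] at this
      change 2 ≤ Nat.card (IsLocalRing.ResidueField V) at this
      omega)
  obtain ⟨p, hp⟩ := CharP.exists (IsLocalRing.ResidueField V)
  have hprime : p.Prime := (CharP.char_is_prime_or_zero (IsLocalRing.ResidueField V) p).resolve_right
    (CharP.char_ne_zero_of_finite (IsLocalRing.ResidueField V) p)
  refine ⟨p, hprime, ?_⟩
  have h1 : IsLocalRing.residue V (p : V) = 0 := by
    rw [map_natCast, CharP.cast_eq_zero]
  rw [residue_eq_zero_iff_norm_lt_one] at h1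
  have h2 : ‖((p : V) : WithAbs w.abs)‖ = w.abs p := by
    have : ((p : V) : WithAbs w.abs) = (WithAbs.equiv w.abs).symm (p : K) := by
      rw [map_natCast]; rfl
    rw [this]; rfl
  rwa [h2] at h1

/-- The numbers 0, …, p - 1 have distinct residues: their differences are prime to p, hence units by
Bézout. -/
theorem NonarchAbs.IsStandard.le_residueCard {w : NonarchAbs K} (hw : w.IsStandard) {p : ℕ}
    (hp : p.Prime) (h : w.abs p < 1) : p ≤ w.residueCard := by
  refine hw.le_residueCard_of_injective (fun i : Fin p => ((i : ℕ) : K)) (fun i => ?_) ?_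
  · exact w.nonarch.apply_natCast_le_one
  · have key : ∀ a b : ℕ, a < b → b < p → w.abs ((b : K) - a) = 1 := by
      intro a b hab hb
      have hc : IsCoprime ((b - a : ℕ) : ℤ) p := by
        rw [Nat.isCoprime_iff_coprime]
        exact (Nat.coprime_of_lt_prime (by omega) (by omega : b - a < p) hp).symm
      obtain ⟨u, t, hut⟩ := hc
      rw [← Nat.cast_sub hab.le]
      refine le_antisymm w.nonarch.apply_natCast_le_one ?_
      by_contra! hlt
      have h1 : (u : K) * ((b - a : ℕ) : K) + t * p = 1 := by exact_mod_cast congrArg (Int.cast : ℤ → K) hut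
      have h2 := congrArg w.abs h1
      rw [map_one] at h2
      have h3 := w.nonarch ((u : K) * ((b - a : ℕ) : K)) (t * p)
      rw [h2, map_mul, map_mul] at h3
      have hu : w.abs u ≤ 1 := w.nonarch.apply_intCast_le_one
      have ht : w.abs t ≤ 1 := w.nonarch.apply_intCast_le_one
      have h4 : w.abs u * w.abs ((b - a : ℕ) : K) < 1 :=
        mul_lt_one_of_nonneg_of_lt_one_right hu (w.abs.nonneg _) hlt
      have h5 : w.abs t * w.abs p < 1 :=
        mul_lt_one_of_nonneg_of_lt_one_right ht (w.abs.nonneg _) h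
      exact absurd h3 (not_le.2 (max_lt h4 h5))
    intro i j hij
    rcases lt_or_gt_of_ne hij with h | h
    · rw [w.abs.map_sub]; exact key i j h j.2
    · exact key j i h i.2

/-- In the product formula for p each place above p contributes at most -log p, while the
archimedean places contribute [K : ℚ] log p. -/
theorem ProductFormula.ncard_over_prime_le (pf : ProductFormula K) [CharZero K] {p : ℕ}
    (hp : p.Prime) :
    {v ∈ nonarchPrimes K | v p < 1}.Finite ∧ {v ∈ nonarchPrimes K | v p < 1}.ncard ≤ degQ K := by
  classical
  have hp0 : (p : K) ≠ 0 := by exact_mod_cast hp.ne_zero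
  have hsub : nonarchPrimes K ⊆ standardAbs K := by
    rw [standardAbs_eq_union]; exact Set.subset_union_right
  have hfin : {v ∈ nonarchPrimes K | v p < 1}.Finite :=
    (pf.finite_ne_one _ hp0).subset fun v hv => ⟨hsub hv.1, hv.2.ne⟩
  refine ⟨hfin, ?_⟩
  have hlp : 0 < Real.log p := Real.log_pos (by exact_mod_cast hp.one_lt)
  set S := hfin.toFinset with hS
  have hmem : ∀ v, v ∈ S ↔ v ∈ nonarchPrimes K ∧ v p < 1 := fun v => Set.Finite.mem_toFinset _
  set A := pf.finite_archPrimes.toFinset with hA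
  have hmemA : ∀ v, v ∈ A ↔ v ∈ archPrimes K := fun v => Set.Finite.mem_toFinset _
  have h1 := pf.sum_log p hp0
  have hdisj : Disjoint A S := by
    rw [Finset.disjoint_left]
    intro v hv hv'
    exact Set.disjoint_left.1 disjoint_archPrimes_nonarchPrimes ((hmemA v).1 hv) ((hmem v).1 hv').1
  have h2 : ∑ᶠ v ∈ standardAbs K, (pf.mult v : ℝ) * Real.log (v p) =
      ∑ v ∈ A ∪ S, (pf.mult v : ℝ) * Real.log (v p) := by
    refine finsum_mem_eq_sum_of_inter_support_eq _ ?_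
    ext v
    simp only [Set.mem_inter_iff, Finset.coe_union, Set.mem_union, Finset.mem_coe, hmemA, hmem]
    refine and_congr_left fun hsupp => ⟨fun hv => ?_, fun hv => ?_⟩
    · rw [standardAbs_eq_union] at hv
      refine hv.imp id fun hv => ⟨hv, ?_⟩
      obtain ⟨w, rfl, -⟩ := id hv
      refine lt_of_le_of_ne w.nonarch.apply_natCast_le_one fun h => hsupp ?_
      simp [h]
    · rcases hv with hv | hv
      · exact hv.1
      · exact hsub hv.1
  rw [h2, Finset.sum_union hdisj] at h1
  have h3 : ∑ v ∈ A, (pf.mult v : ℝ) * Real.log (v p) = degQ K * Real.log p := by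
    rw [← pf.sum_arch_mult, Nat.cast_sum, Finset.sum_mul]
    refine Finset.sum_congr rfl fun v hv => ?_
    rw [mem_archPrimes_iff.1 ((hmemA v).1 hv)]
  have h4 : ∑ v ∈ S, (pf.mult v : ℝ) * Real.log (v p) ≤ ∑ _v ∈ S, -Real.log p := by
    refine Finset.sum_le_sum fun v hv => ?_
    obtain ⟨⟨w, rfl, hw⟩, hlt⟩ := (hmem v).1 hv
    rw [pf.mult_nonarch, Nat.cast_one, one_mul, ← Real.log_inv]
    have hpos : 0 < w.abs p := w.abs.pos hp0
    refine Real.log_le_log hpos ?_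
    have h5 := hw.le_of_one_lt (x := (p : K)⁻¹) (by
      rw [map_inv₀]; exact (one_lt_inv₀ hpos).2 hlt)
    rw [map_inv₀] at h5
    have h6 : (p : ℝ) ≤ w.residueCard := by exact_mod_cast hw.le_residueCard hp hlt
    rw [le_inv_comm₀ hpos (by exact_mod_cast hp.pos)]
    linarith
  rw [Finset.sum_const, nsmul_eq_mul] at h4
  rw [Set.ncard_eq_toFinset_card _ hfin, ← hS]
  have h7 : (S.card : ℝ) * Real.log p ≤ degQ K * Real.log p := by linarith
  exact_mod_cast le_of_mul_le_mul_right h7 hlp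

theorem ProductFormula.ncard_residueCard_le (pf : ProductFormula K) [CharZero K] (n : ℕ)
    {S : Set (AbsoluteValue K ℝ)}
    (hS : ∀ v ∈ S, ∃ w : NonarchAbs K, w.abs = v ∧ w.IsStandard ∧ w.residueCard ≤ n) :
    S.ncard ≤ degQ K * n.primeCounting := by
  have hsub : S ⊆ ⋃ p ∈ (Finset.range (n + 1)).filter Nat.Prime,
      {v ∈ nonarchPrimes K | v p < 1} := by
    intro v hv
    obtain ⟨w, rfl, hw, hn⟩ := hS v hv
    obtain ⟨p, hp, hlt⟩ := hw.exists_prime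
    have := hw.le_residueCard hp hlt
    refine Set.mem_biUnion (x := p) ?_ ⟨⟨w, rfl, hw⟩, hlt⟩
    simp only [Finset.coe_filter, Finset.mem_range, Set.mem_ofPred_eq]
    exact ⟨by omega, hp⟩
  have hfin : ∀ p ∈ (Finset.range (n + 1)).filter Nat.Prime,
      {v ∈ nonarchPrimes K | v p < 1}.Finite := fun p hp =>
    (pf.ncard_over_prime_le (Finset.mem_filter.1 hp).2).1
  calc S.ncard ≤ (⋃ p ∈ (Finset.range (n + 1)).filter Nat.Prime,
        {v ∈ nonarchPrimes K | v p < 1}).ncard :=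
        Set.ncard_le_ncard hsub (Set.Finite.biUnion (Finset.finite_toSet _) hfin)
    _ ≤ ∑ p ∈ (Finset.range (n + 1)).filter Nat.Prime,
        {v ∈ nonarchPrimes K | v p < 1}.ncard := Finset.set_ncard_biUnion_le _ _
    _ ≤ ∑ _p ∈ (Finset.range (n + 1)).filter Nat.Prime, degQ K :=
        Finset.sum_le_sum fun p hp => (pf.ncard_over_prime_le (Finset.mem_filter.1 hp).2).2
    _ = degQ K * n.primeCounting := by
        rw [Finset.sum_const, smul_eq_mul, mul_comm, Nat.primeCounting, Nat.primeCounting',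
          Nat.count_eq_card_filter_range]

end ResidueChar

/-! ### The numerical thresholds. -/

section Threshold

/-- The size of a residue field from which on the place dominates. -/
def residueThreshold (d : ℕ) : ℕ := if d = 2 then 17 else 32 ^ ((d - 1) * (d - 2))

/-- For d = 2 this is π(16) = 6. For d ≥ 3 and x = 32^k, a Chebyshev bound has main term (4/5) x/k,
and √x + 1 ≤ (6/5) x/k covers the rest; the passage from 32 to 33 is spare room. -/
theorem primeCounting_residueThreshold {d : ℕ} (hd : 2 ≤ d) :
    (((residueThreshold d - 1).primeCounting : ℕ) : ℝ) + 1 ≤ sigmaConst d := by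
  rcases Nat.eq_or_lt_of_le hd with rfl | h3
  · have : Nat.primeCounting 16 = 6 := by decide
    rw [residueThreshold, sigmaConst, if_pos rfl, if_pos rfl]
    norm_num [this]
  · have hd3 : 3 ≤ d := h3
    set k := (d - 1) * (d - 2) with hk
    have hk2 : 2 ≤ k := by
      have : 2 * 1 ≤ (d - 1) * (d - 2) := Nat.mul_le_mul (by omega) (by omega)
      simpa using this
    have hkr : (((d : ℝ) - 1) * ((d : ℝ) - 2)) = k := by
      rw [hk, Nat.cast_mul, Nat.cast_sub (by omega), Nat.cast_sub (by omega)]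
      simp
    rw [residueThreshold, sigmaConst, if_neg (by omega), if_neg (by omega), hkr, ← hk]
    set x : ℝ := 32 ^ k with hx
    have hk0 : (2 : ℝ) ≤ k := by exact_mod_cast hk2
    have hx1 : 1 < x := one_lt_pow₀ (by norm_num) (by omega)
    have h1 := Chebyshev.pi_le_log4_mul_div hx1
    have hfl : ⌊x⌋₊ = 32 ^ k := by
      rw [hx, show (32 : ℝ) ^ k = ((32 ^ k : ℕ) : ℝ) by push_cast; rfl, Nat.floor_natCast]
    rw [hfl] at h1
    have hmono : ((32 ^ k - 1).primeCounting : ℝ) ≤ ((32 ^ k).primeCounting : ℝ) := by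
      exact_mod_cast Nat.monotone_primeCounting (Nat.sub_le _ _)
    have hl2 := Real.log_pos one_lt_two
    have hlog : Real.log 4 * x / Real.log √x = 4 / 5 * (x / k) := by
      rw [Real.log_sqrt (by positivity), hx, Real.log_pow,
        show Real.log 4 = 2 * Real.log 2 by
          rw [show (4 : ℝ) = 2 ^ 2 by norm_num, Real.log_pow]; norm_num,
        show Real.log 32 = 5 * Real.log 2 by
          rw [show (32 : ℝ) = 2 ^ 5 by norm_num, Real.log_pow]; norm_num]
      field_simp
      norm_num
    have hsqrt : √x + 1 ≤ 6 / 5 * (x / k) := by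
      have hs1 : 1 ≤ √x := Real.one_le_sqrt.2 hx1.le
      have hks : (k : ℝ) ≤ √x / 2 := by
        have hb : (2 * (k : ℝ)) ^ 2 ≤ x := by
          rw [hx]
          have : ∀ n : ℕ, 2 ≤ n → (2 * n) ^ 2 ≤ 32 ^ n := by
            intro n hn
            induction n, hn using Nat.le_induction with
            | base => norm_num
            | succ n hn ih => rw [pow_succ 32 n]; nlinarith
          exact_mod_cast this k hk2
        have := Real.le_sqrt_of_sq_le hb
        linarith
      have hss : √x * √x = x := Real.mul_self_sqrt (by linarith)
      have : 2 * √x ≤ x / k := by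
        rw [le_div_iff₀ (by linarith)]
        nlinarith
      linarith
    have h33 : x ≤ 33 ^ k := by
      rw [hx]; exact pow_le_pow_left₀ (by norm_num) (by norm_num) k
    have hfinal : 2 * (x / k) ≤ 2 * 33 ^ k / k := by
      rw [← mul_div_assoc]
      gcongr
    rw [hlog] at h1
    linarith

/-- Some power of exp g is the absolute value of an element of `K`, and a value above 1 is at least
the size of the residue field. The exponent is (d - 1)(d - i) for i ≥ 2 and, after a root, d - 1 for
i = 1; both are at most (d - 1)(d - 2) when d ≥ 3. -/
theorem log_splitThreshold_le {K : Type*} [Field K] {w : NonarchAbs K} (hw : w.IsStandard)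
    {d : ℕ} (hd : 2 ≤ d) (hq : residueThreshold d ≤ w.residueCard) {g : ℝ} (hg : 0 < g) {a t : K}
    (ha : a ≠ 0) {i : ℕ} (hi : 1 ≤ i) (hid : i < d)
    (h : Real.exp g ^ ((d - 1) * (d - i)) * w.abs a ^ (i - 1) = w.abs t ^ (d - 1)) :
    Real.log (splitThreshold d) ≤ g := by
  have he : 1 < Real.exp g := Real.one_lt_exp_iff.2 hg
  have hq' : (residueThreshold d : ℝ) ≤ w.residueCard := by exact_mod_cast hq
  have hapos : 0 < w.abs a := w.abs.pos ha
  suffices hs : splitThreshold d ≤ Real.exp g by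
    rw [← Real.log_exp g]
    refine Real.log_le_log ?_ hs
    rw [splitThreshold]; split_ifs <;> norm_num
  rcases Nat.eq_or_lt_of_le hd with rfl | h3
  · have : i = 1 := by omega
    subst this
    have h' : Real.exp g = w.abs t := by simpa using h
    have := hw.le_of_one_lt (x := t) (by rw [← h']; exact he)
    rw [residueThreshold, if_pos rfl] at hq'
    rw [splitThreshold, if_pos rfl, h']
    push_cast at hq'
    linarith
  · rw [residueThreshold, if_neg (by omega)] at hq'
    push_cast at hq'
    rw [splitThreshold, if_neg (by omega)]
    have hfin : ∀ e : ℕ, e ≤ (d - 1) * (d - 2) → (w.residueCard : ℝ) ≤ Real.exp g ^ e →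
        32 ≤ Real.exp g := by
      intro e hle hres
      have hk : (d - 1) * (d - 2) ≠ 0 := Nat.mul_ne_zero (by omega) (by omega)
      refine (pow_le_pow_iff_left₀ (by norm_num) (Real.exp_pos g).le hk).1 ?_
      exact hq'.trans (hres.trans (pow_le_pow_right₀ he.le hle))
    rcases Nat.eq_or_lt_of_le hi with rfl | hi2
    · have h' : Real.exp g ^ (d - 1) = w.abs t := by
        rw [Nat.sub_self, pow_zero, mul_one, pow_mul] at h
        exact (pow_left_inj₀ (by positivity) (w.abs.nonneg _) (by omega)).1 h
      refine hfin (d - 1) (Nat.le_mul_of_pos_right _ (by omega)) ?_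
      rw [h']
      exact hw.le_of_one_lt (by rw [← h']; exact one_lt_pow₀ he (by omega))
    · have h' : Real.exp g ^ ((d - 1) * (d - i)) = w.abs (t ^ (d - 1) / a ^ (i - 1)) := by
        rw [map_div₀, map_pow, map_pow, ← h, mul_div_cancel_right₀ _ (by positivity)]
      refine hfin ((d - 1) * (d - i)) (Nat.mul_le_mul_left _ (by omega)) ?_
      rw [h']
      refine hw.le_of_one_lt ?_
      rw [← h']
      exact one_lt_pow₀ he (Nat.mul_ne_zero (by omega) (by omega))

/-- The archimedean loss per unit of degree, measured against g, is at most log d/(2 log 2), the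
coefficient of D in t. For d ≥ 3 the loss is at most (5/2) log d, which the threshold 32 = 2⁵
matches exactly. -/
theorem log_archConst_add_le {d : ℕ} (hd : 2 ≤ d) {g : ℝ}
    (hg : Real.log (splitThreshold d) ≤ g) :
    Real.log d / (d - 1) + Real.log (archConst d) ≤ Real.log d / (2 * Real.log 2) * g := by
  have hl2 := Real.log_pos one_lt_two
  have hd' : (2 : ℝ) ≤ d := by exact_mod_cast hd
  have hld : 0 < Real.log d := Real.log_pos (by linarith)
  refine le_trans ?_ (mul_le_mul_of_nonneg_left hg (by positivity))
  rcases Nat.eq_or_lt_of_le hd with rfl | h3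
  · rw [archConst, splitThreshold, if_pos rfl, if_pos rfl, Real.log_one, add_zero,
      show (16 : ℝ) = 2 ^ 4 by norm_num, Real.log_pow]
    have : Real.log ((2 : ℕ) : ℝ) = Real.log 2 := by norm_num
    rw [this]
    push_cast
    field_simp
    norm_num
  · rw [archConst, splitThreshold, if_neg (by omega), if_neg (by omega),
      show (32 : ℝ) = 2 ^ 5 by norm_num, Real.log_pow, Real.log_pow]
    have hd3 : (3 : ℝ) ≤ d := by exact_mod_cast h3
    have h1 : Real.log d / (d - 1) ≤ Real.log d / 2 := by
      gcongr; linarith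
    have h2 : Real.log d / (2 * Real.log 2) * ((5 : ℕ) * Real.log 2) = 5 / 2 * Real.log d := by
      push_cast
      field_simp
    rw [h2]
    push_cast
    linarith

end Threshold

/-! ### The dominant place in the presence of many bad primes. -/

section Many

variable {K : Type*} [Field K]

/-- The place `w` forces the largest g to reach the splitting threshold. Hence the dominant place
splits even if it is archimedean, and the corrections c of all archimedean places fit into t - s. -/
theorem ProductFormula.ncard_finiteOrbitPts_le_of_large (pf : ProductFormula K) {φ : K[X]}
    (hd : 2 ≤ φ.natDegree) {w : NonarchAbs K} (hw : w.IsStandard) (hwb : w.abs ∈ nonarchBad φ)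
    (hq : residueThreshold φ.natDegree ≤ w.residueCard) {t : ℝ}
    (ht : t = (badPrimes φ).ncard + degQ K * Real.log φ.natDegree / (2 * Real.log 2))
    (ht2 : 2 ≤ t) :
    (finiteOrbitPts φ).Finite ∧ ((finiteOrbitPts φ).ncard : ℝ) ≤
      ((φ.natDegree : ℝ) ^ 2 - 2 * φ.natDegree + 2) * pointBound φ.natDegree t := by
  classical
  rcases (finiteOrbitPts φ).eq_empty_or_nonempty with he | ⟨x₀, hx₀⟩
  · rw [he]
    refine ⟨Set.finite_empty, ?_⟩
    rw [Set.ncard_empty, Nat.cast_zero]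
    have := pointBound_nonneg hd (by linarith : 1 ≤ t)
    have h2 : 0 ≤ (φ.natDegree : ℝ) ^ 2 - 2 * φ.natDegree + 2 := by
      nlinarith [sq_nonneg ((φ.natDegree : ℝ) - 1)]
    positivity
  have hl : φ.leadingCoeff ≠ 0 := leadingCoeff_ne_zero.2 (by rintro rfl; simp at hd)
  set κ := Real.log φ.natDegree / (φ.natDegree - 1) + Real.log (archConst φ.natDegree) with hκ
  let c : AbsoluteValue K ℝ → ℝ := fun v => if v ∈ archPrimes K then pf.mult v * κ else 0
  have hdata : ∀ v : AbsoluteValue K ℝ, ∃ g : ℝ, v ∈ badPrimes φ →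
      PlaceBound φ v (pf.mult v) g (c v) ∧
      (Real.log (splitThreshold φ.natDegree) ≤ g → PlaceSplit φ v (pf.mult v) g (c v)) ∧
      (v = w.abs → Real.log (splitThreshold φ.natDegree) ≤ g) := by
    intro v
    by_cases hv : v ∈ archPrimes K
    · obtain ⟨g, h1, h2⟩ := arch_place_data pf hd hv
      have hc : c v = pf.mult v * κ := if_pos hv
      refine ⟨g, fun _ => ⟨by rw [hc]; exact h1, by rw [hc]; exact h2, ?_⟩⟩
      rintro rfl
      exact absurd w.nonarch hv.2
    · by_cases hvb : v ∈ nonarchBad φ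
      · obtain ⟨g, h0, h1, h2, i, hi, hid, h⟩ := nonarch_place_data pf hd hx₀ hvb
        have hc : c v = 0 := if_neg hv
        refine ⟨g, fun _ => ⟨by rw [hc]; exact h1, fun _ => by rw [hc]; exact h2, ?_⟩⟩
        rintro rfl
        exact log_splitThreshold_le hw hd hq h0 hl hi hid h
      · refine ⟨0, fun h => ?_⟩
        rw [badPrimes_eq_union] at h
        exact absurd h (by rintro (h | h); exacts [hv h, hvb h])
  choose g hg using hdata
  have hfin := pf.badPrimes_finite (φ := φ) (by omega)
  set S := hfin.toFinset with hS
  have hmem : ∀ v, v ∈ S ↔ v ∈ badPrimes φ := fun v => Set.Finite.mem_toFinset _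
  have hcard : S.card = (badPrimes φ).ncard := (Set.ncard_eq_toFinset_card _ hfin).symm
  have hwS : w.abs ∈ S := by
    rw [hmem, badPrimes_eq_union]; exact Or.inr hwb
  obtain ⟨v₀, hv₀, hmax⟩ := Finset.exists_max_image S g ⟨_, hwS⟩
  have hthr : Real.log (splitThreshold φ.natDegree) ≤ g v₀ :=
    ((hg w.abs ((hmem _).1 hwS)).2.2 rfl).trans (hmax _ hwS)
  have hg0 : 0 < g v₀ := by
    refine lt_of_lt_of_le (Real.log_pos ?_) hthr
    rw [splitThreshold]; split_ifs <;> norm_num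
  refine ncard_le_of_placeSplit (S := S) (n := pf.mult) (g := g) (c := c) hd
    subset_rfl (fun N x hx hxX => ?_) (fun v hv => (hg v ((hmem v).1 hv)).1) hv₀
    ((hg v₀ ((hmem v₀).1 hv₀)).2.1 hthr) hg0 hmax ?_ (Or.inr ht2)
  · refine pf.sum_normPairLog_nonneg hl _ (fun v hv => ((hmem v).1 hv).1) hx fun v hv hvS => ?_
    refine normPairLog_nonpos hd hx fun i j => ?_
    exact pow_mul_le_one_of_notMem_badPrimes hd hv (fun h => hvS ((hmem v).2 h)) (hxX j) (hxX i)
  · have hsum : ∑ v ∈ S, c v = degQ K * κ := by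
      rw [Finset.sum_ite, Finset.sum_const_zero, add_zero, ← Finset.sum_mul, ← pf.sum_arch_mult,
        Nat.cast_sum]
      congr 1
      refine Finset.sum_congr ?_ fun _ _ => rfl
      ext v
      rw [Finset.mem_filter, hmem, Set.Finite.mem_toFinset, badPrimes_eq_union]
      exact ⟨fun h => h.2, fun h => ⟨Or.inl h, h⟩⟩
    rw [hsum, hcard, ht, add_sub_cancel_left]
    have := mul_le_mul_of_nonneg_left (log_archConst_add_le hd hthr)
      (Nat.cast_nonneg (α := ℝ) (degQ K))
    calc (degQ K : ℝ) * κ ≤ _ := this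
      _ = _ := by ring

/-- Otherwise all bad primes would be archimedean, at most D in number, or lie above primes below
the threshold, at most D over each; together at most σD. -/
theorem ProductFormula.exists_large (pf : ProductFormula K) [CharZero K] {φ : K[X]}
    (hd : 2 ≤ φ.natDegree)
    (hs : sigmaConst φ.natDegree * degQ K < (badPrimes φ).ncard) :
    ∃ w : NonarchAbs K, w.IsStandard ∧ w.abs ∈ nonarchBad φ ∧
      residueThreshold φ.natDegree ≤ w.residueCard := by
  by_contra! hcon
  have h1 := pf.ncard_residueCard_le (residueThreshold φ.natDegree - 1) (S := nonarchBad φ) (by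
    rintro _ ⟨w, rfl, hw, hbad⟩
    have := hcon w hw ⟨w, rfl, hw, hbad⟩
    exact ⟨w, rfl, hw, by omega⟩)
  have h2 := pf.ncard_archPrimes_le
  have h3 := pf.ncard_badPrimes (φ := φ) (by omega)
  have h4 := mul_le_mul_of_nonneg_right (primeCounting_residueThreshold hd)
    (Nat.cast_nonneg (α := ℝ) (degQ K))
  have h5 : ((badPrimes φ).ncard : ℝ) ≤ degQ K + degQ K *
      ((residueThreshold φ.natDegree - 1).primeCounting : ℕ) := by
    rw [h3]; exact_mod_cast Nat.add_le_add h2 h1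
  linarith

end Many
end

noncomputable section

/-! ### The main theorem -/

section Main

variable {K : Type*} [Field K]

theorem one_le_sigmaConst {d : ℕ} (hd : 2 ≤ d) : 1 ≤ sigmaConst d := by
  have := primeCounting_residueThreshold hd
  have h2 : (0 : ℝ) ≤ ((residueThreshold d - 1).primeCounting : ℕ) := Nat.cast_nonneg _
  linarith

theorem boundM_eq_pointBound {d s : ℕ} (h1 : ¬(¬ NumberField K ∧ s = 0))
    (h2 : ¬(NumberField K ∧ s = (archPrimes K).ncard)) (ht : 0 < tParam K d s) :
    boundM K d s = betaParam K d s ^ degQ K *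
      (((d : ℝ) ^ 2 - 2 * d + 2) * pointBound d (tParam K d s)) := by
  rw [boundM, if_neg h1, if_neg h2, pointBound, ← mul_assoc]
  by_cases h : tParam K d s < d
  · rw [if_pos ⟨ht, h⟩, if_pos h]
  · rw [if_neg fun h' => h h'.2, if_neg h]

theorem betaParam_of_le [hK : NumberField K] {d s : ℕ} (hs : (s : ℝ) ≤ sigmaConst d * degQ K) :
    betaParam K d s = colorBase d := by
  rw [betaParam, if_pos ⟨hK, hs⟩, colorBase]
  split_ifs <;> simp

theorem badPrimes_bound_numberField [hK : NumberField K] {φ : K[X]} (hd : 2 ≤ φ.natDegree) :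
    (finiteOrbitPts φ).Finite ∧
      ((finiteOrbitPts φ).ncard : ℝ) ≤ boundM K φ.natDegree (badPrimes φ).ncard := by
  set pf := productFormulaNumberField K
  have hs := pf.ncard_badPrimes (φ := φ) (by omega)
  have hle := pf.ncard_archPrimes_le
  have hσ := one_le_sigmaConst hd
  have hFF : ¬(¬ NumberField K ∧ (badPrimes φ).ncard = 0) := fun h => h.1 hK
  by_cases hsσ : ((badPrimes φ).ncard : ℝ) ≤ sigmaConst φ.natDegree * degQ K
  · by_cases hb : (nonarchBad φ).ncard = 0
    · have harch : (archPrimes K).Nonempty := by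
        rw [archPrimes_eq_range]; exact Set.range_nonempty _
      have hsa : (badPrimes φ).ncard = (archPrimes K).ncard := by omega
      have h := pf.ncard_finiteOrbitPts_le_of_good hd hb harch
      rw [boundM, if_neg hFF, if_pos ⟨hK, hsa⟩, betaParam_of_le hsσ]
      exact_mod_cast h
    · have hsa : ¬(NumberField K ∧ (badPrimes φ).ncard = (archPrimes K).ncard) := by
        rintro ⟨-, h⟩; omega
      have ht : tParam K φ.natDegree (badPrimes φ).ncard = (nonarchBad φ).ncard := by
        rw [tParam, if_pos hK, if_pos hsσ, hs]
        push_cast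
        ring
      have h := pf.ncard_finiteOrbitPts_le hd hb
      rw [boundM_eq_pointBound hFF hsa (by rw [ht]; exact_mod_cast Nat.pos_of_ne_zero hb), ht,
        betaParam_of_le hsσ]
      exact_mod_cast h
  · have hlt := not_le.1 hsσ
    have hD : (0 : ℝ) < degQ K := by
      rw [degQ, dif_pos hK]
      exact_mod_cast Module.finrank_pos
    have hsa : ¬(NumberField K ∧ (badPrimes φ).ncard = (archPrimes K).ncard) := by
      rintro ⟨-, h⟩
      rw [h] at hlt
      have h2 : ((archPrimes K).ncard : ℝ) ≤ degQ K := by exact_mod_cast hle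
      nlinarith
    obtain ⟨w, hw, hwb, hq⟩ := pf.exists_large hd hlt
    have ht : tParam K φ.natDegree (badPrimes φ).ncard =
        (badPrimes φ).ncard + degQ K * Real.log φ.natDegree / (2 * Real.log 2) := by
      rw [tParam, if_pos hK, if_neg hsσ]
    have ht2 : 2 ≤ tParam K φ.natDegree (badPrimes φ).ncard := by
      have h1 : (1 : ℝ) ≤ degQ K := by exact_mod_cast (by exact_mod_cast hD : 0 < degQ K)
      have h2 : 1 < ((badPrimes φ).ncard : ℝ) := by nlinarith
      have h3 : (2 : ℝ) ≤ (badPrimes φ).ncard := by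
        exact_mod_cast (by exact_mod_cast h2 : 1 < (badPrimes φ).ncard)
      have h4 : 0 ≤ degQ K * Real.log φ.natDegree / (2 * Real.log 2) := by
        have := Real.log_pos one_lt_two
        have := Real.log_natCast_nonneg φ.natDegree
        positivity
      rw [ht]
      linarith
    have h := pf.ncard_finiteOrbitPts_le_of_large hd hw hwb hq ht ht2
    rw [boundM_eq_pointBound hFF hsa (by linarith), betaParam, if_neg fun h => hsσ h.2, one_pow,
      one_mul]
    exact h

theorem badPrimes_bound_functionField (hK : ¬ NumberField K) (harch : archPrimes K = ∅)
    (hne : (nonarchPrimes K).Nonempty) (pf : ProductFormula K) {φ : K[X]}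
    (hd : 2 ≤ φ.natDegree) :
    (finiteOrbitPts φ).Finite ∧
      ((finiteOrbitPts φ).ncard : ℝ) ≤ boundM K φ.natDegree (badPrimes φ).ncard := by
  have hs := pf.ncard_badPrimes (φ := φ) (by omega)
  rw [harch, Set.ncard_empty, zero_add] at hs
  have hD : degQ K = 0 := dif_neg hK
  by_cases h0 : (badPrimes φ).ncard = 0
  · rw [boundM, if_pos ⟨hK, h0⟩]
    exact pf.ncard_finiteOrbitPts_le_minResidueCard hd
      ((Set.ncard_eq_zero (pf.badPrimes_finite (φ := φ) (by omega))).1 h0) hne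
  · have ht : tParam K φ.natDegree (badPrimes φ).ncard = (badPrimes φ).ncard := if_neg hK
    have h := pf.ncard_finiteOrbitPts_le hd (by rwa [← hs])
    rw [boundM_eq_pointBound (fun h => h0 h.2) (fun h => hK h.1)
      (by rw [ht]; exact_mod_cast Nat.pos_of_ne_zero h0), ht, hD, pow_zero]
    rw [hD, pow_zero, Nat.cast_one, ← hs] at h
    exact h

theorem IsGlobalField.preperiodicPts_bound (hK : IsGlobalField K) {φ : K[X]}
    (hd : 2 ≤ φ.natDegree) : (badPrimes φ).Finite ∧ (preperiodicPts φ).Finite ∧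
      ((preperiodicPts φ).ncard : ℝ) ≤ boundM K φ.natDegree (badPrimes φ).ncard + 1 := by
  obtain ⟨hbad, hfin, hle⟩ : (badPrimes φ).Finite ∧ (finiteOrbitPts φ).Finite ∧
      ((finiteOrbitPts φ).ncard : ℝ) ≤ boundM K φ.natDegree (badPrimes φ).ncard := by
    rcases hK.cases with hN | ⟨hN, harch, hne, ⟨pf⟩⟩
    · exact ⟨(productFormulaNumberField K).badPrimes_finite (by omega),
        badPrimes_bound_numberField hd⟩
    · exact ⟨pf.badPrimes_finite (by omega), badPrimes_bound_functionField hN harch hne pf hd⟩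
  obtain ⟨h1, h2⟩ := preperiodicPts_finite hfin
  refine ⟨hbad, h1, ?_⟩
  rw [h2]
  push_cast
  linarith

open Filter Asymptotics

/-- For large s the second form of the bound applies; log (s + c) ≤ 2 log s, and the iterated
logarithm is estimated by the logarithm. -/
theorem pointBound_isBigO {d : ℕ} (hd : 2 ≤ d) {c : ℝ} (hc : 0 ≤ c) :
    (fun s : ℕ => pointBound d (s + c)) =O[atTop] fun s : ℕ => (s : ℝ) * Real.log s := by
  have hd2 : (2 : ℝ) ≤ d := by exact_mod_cast hd
  set L := Real.log d with hL
  have hLpos : 0 < L := Real.log_pos (by linarith)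
  have hlarge : ∀ᶠ s : ℕ in atTop, max (max (d : ℝ) c) 3 ≤ s :=
    tendsto_natCast_atTop_atTop.eventually_ge_atTop _
  refine IsBigO.of_bound (4 * (1 / L + 1 / L ^ 2 + 3)) ?_
  filter_upwards [hlarge] with s hs
  have hsd : (d : ℝ) ≤ s := (le_max_left _ _).trans ((le_max_left _ _).trans hs)
  have hsc : c ≤ s := (le_max_right _ _).trans ((le_max_left _ _).trans hs)
  have hs3 : 3 ≤ (s : ℝ) := (le_max_right _ _).trans hs
  set t : ℝ := s + c with ht
  have hts : (s : ℝ) ≤ t := by linarith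
  have ht1 : 1 ≤ Real.log t := by
    rw [Real.le_log_iff_exp_le (by linarith)]
    linarith [Real.exp_one_lt_d9]
  have hls : 0 ≤ Real.log s := Real.log_nonneg (by linarith)
  rw [Real.norm_of_nonneg (pointBound_nonneg hd (by linarith)),
    Real.norm_of_nonneg (by positivity), pointBound, if_neg (by linarith)]
  have e1 : Real.logb d t = Real.log t / L := rfl
  have e2 : Real.logb d (Real.logb d t) ≤ Real.log t / L ^ 2 := by
    rw [e1, Real.logb, ← hL, div_le_iff₀ hLpos]
    have h := Real.log_le_self (x := Real.log t / L) (by positivity)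
    calc _ ≤ Real.log t / L := h
      _ = Real.log t / L ^ 2 * L := by field_simp
  have hlt : Real.log t ≤ 2 * Real.log s := by
    calc Real.log t ≤ Real.log ((s : ℝ) ^ 2) := Real.log_le_log (by linarith) (by nlinarith)
      _ = 2 * Real.log s := by rw [Real.log_pow]; norm_num
  have ht0 : 0 ≤ t := by linarith
  calc t * Real.logb d t + t * Real.logb d (Real.logb d t) + 3 * t
      ≤ t * (Real.log t / L) + t * (Real.log t / L ^ 2) + 3 * (t * Real.log t) := by
        rw [e1] at e2 ⊢
        gcongr
        exact le_mul_of_one_le_right ht0 ht1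
    _ = (1 / L + 1 / L ^ 2 + 3) * (t * Real.log t) := by ring
    _ ≤ (1 / L + 1 / L ^ 2 + 3) * ((2 * s) * (2 * Real.log s)) := by
        gcongr
        linarith
    _ = _ := by ring

theorem exists_boundM_eventually_eq (K : Type*) [Field K] (d : ℕ) : ∃ c : ℝ, 0 ≤ c ∧
    ∀ᶠ s : ℕ in atTop,
      boundM K d s = ((d : ℝ) ^ 2 - 2 * d + 2) * pointBound d ((s : ℝ) + c) := by
  by_cases hK : NumberField K
  · refine ⟨degQ K * Real.log d / (2 * Real.log 2), ?_, ?_⟩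
    · have := Real.log_pos one_lt_two
      have := Real.log_natCast_nonneg d
      positivity
    have h1 : ∀ᶠ s : ℕ in atTop, sigmaConst d * degQ K < s :=
      tendsto_natCast_atTop_atTop.eventually_gt_atTop _
    filter_upwards [h1, eventually_gt_atTop (archPrimes K).ncard] with s hs hsa
    have hsσ : ¬ (s : ℝ) ≤ sigmaConst d * degQ K := not_le.2 hs
    have ht : tParam K d s = s + degQ K * Real.log d / (2 * Real.log 2) := by
      rw [tParam, if_pos hK, if_neg hsσ]
    have hpos : 0 < tParam K d s := by
      rw [ht]
      have := Real.log_pos one_lt_two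
      have := Real.log_natCast_nonneg d
      have : (0 : ℝ) < s := by exact_mod_cast (by omega : 0 < s)
      positivity
    rw [boundM_eq_pointBound (fun h => h.1 hK) (fun h => by omega) hpos, betaParam,
      if_neg fun h => hsσ h.2, one_pow, one_mul, ht]
  · refine ⟨0, le_rfl, ?_⟩
    filter_upwards [eventually_gt_atTop 0] with s hs
    have ht : tParam K d s = s := if_neg hK
    rw [boundM_eq_pointBound (fun h => by omega) (fun h => hK h.1)
      (by rw [ht]; exact_mod_cast hs), ht, show degQ K = 0 from dif_neg hK, pow_zero, one_mul,
      add_zero]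

/-- The eventual estimate extends to all s ≥ 2 because s log s does not vanish there. The point at
infinity is absorbed by s log s ≥ 1. -/
theorem exists_boundM_le (K : Type*) [Field K] {d : ℕ} (hd : 2 ≤ d) :
    ∃ C : ℝ, ∀ s : ℕ, 2 ≤ s → boundM K d s + 1 ≤ C * (s * Real.log s) := by
  obtain ⟨c, hc, heq⟩ := exists_boundM_eventually_eq K d
  have h1 : (fun s : ℕ => boundM K d s) =O[atTop] fun s : ℕ => (s : ℝ) * Real.log s :=
    IsBigO.congr' ((pointBound_isBigO hd hc).const_mul_left _)
      (heq.mono fun s hs => hs.symm) EventuallyEq.rfl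
  obtain ⟨C, hC, hb⟩ := bound_of_isBigO_nat_atTop h1
  refine ⟨C + 1, fun s hs => ?_⟩
  have hs2 : (2 : ℝ) ≤ s := by exact_mod_cast hs
  have hlog : Real.log 2 ≤ Real.log s := Real.log_le_log (by norm_num) hs2
  have hl2 := Real.log_two_gt_d9
  have hg : 1 ≤ (s : ℝ) * Real.log s := by nlinarith
  have h2 := hb (x := s) (by linarith : (s : ℝ) * Real.log s ≠ 0)
  rw [Real.norm_of_nonneg (by linarith : 0 ≤ (s : ℝ) * Real.log s)] at h2
  have h3 := (Real.le_norm_self _).trans h2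
  linarith

end Main
end

theorem mainTheorem1 {K : Type*} [Field K] (hK : IsGlobalField K) (d : ℕ) (hd : 2 ≤ d) :
    (∀ φ : Polynomial K, φ.natDegree = d →
      (badPrimes φ).Finite ∧ (preperiodicPts φ).Finite ∧
        ((preperiodicPts φ).ncard : ℝ) ≤ boundM K d (badPrimes φ).ncard + 1) ∧
    ∃ C : ℝ, ∀ φ : Polynomial K, φ.natDegree = d → 2 ≤ (badPrimes φ).ncard →
      ((preperiodicPts φ).ncard : ℝ) ≤
        C * ((badPrimes φ).ncard * Real.log (badPrimes φ).ncard) := by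
  have h1 : ∀ φ : Polynomial K, φ.natDegree = d →
      (badPrimes φ).Finite ∧ (preperiodicPts φ).Finite ∧
        ((preperiodicPts φ).ncard : ℝ) ≤ boundM K d (badPrimes φ).ncard + 1 := by
    rintro φ rfl
    exact hK.preperiodicPts_bound hd
  obtain ⟨C, hC⟩ := exists_boundM_le K hd
  exact ⟨h1, C, fun φ hφ hs => (h1 φ hφ).2.2.trans (hC _ hs)⟩
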